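/- **Codes.** Let $\ell\ge 3$ be odd. A CSS code is described by its Tanner square complex $T$ ($X$-checks, qubits and $Z$-checks are the vertices of degree $0,1,2$; squares are cycles $(x,q,z,q')$) and by the cochain complex $C^0\xrightarrow{\delta^0}C^1\xrightarrow{\delta^1}C^2$ over $\mathbb F_2$ spanned by these vertices; $B^{m+1}=\delta^m C^m$, and $|\cdot|$ is the Hamming weight. $C_{(0)}$ is the $[[5,1,2]]$ surface code. $C_{(i+1)}=\mathcal R_X(C_{(i)})$ for even $i$ and $C_{(i+1)}=\mathcal R_Z(C_{(i)})$ for odd $i$. Here $\mathcal R_X$ attaches to each vertex $v$ of $T_{(i)}$ the complex $Y_v=(X'_v\times\{0\})\cup(X'_v\times\{1\})\cup(\partial X'_v\times[0,1])$: $X_v$ is the union of the squares at $v$ if $v$ is an $X$-check, of the edges from $v$ to $Z$-checks if $v$ is a qubit, and the point $v$ if $v$ is a $Z$-check; $\partial X_v$ is the part of $X_v$ formed by the closed cells that do not contain $v$; the prime means subdividing each edge into $(\ell-1)/2$ edges. $C_{(i+1)}$ is the sum over $v$ of the cellular cochain complexes of the $Y_v$, shifted by $\deg v$; its coboundary is the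 sum of the local ones and of the restriction maps of the inclusions $Y_q\hookrightarrow Y_x$ and $Y_z\hookrightarrow Y_q$ for adjacent $x,q$ and $q,z$. $\mathcal R_Z$ is the same construction on the dual complex, dualized back. The vertices of $T_{(i+1)}$ are thus the cells of the $Y_{(i+1),v}:=Y_v$, $v\in T_{(i)}(0)$. Let $\mathcal F_i:C_{(i)}\to C_{(i+1)}$ be the cochain map sending $v$ to the sum of the $0$-cells of $Y_v$ (for $\mathcal R_X$), respectively subdivision into layer $0$ (for $\mathcal R_Z$). **Decoder.** A decoder maps $\sigma_i\in B^2(C_{(i)})$, $i\ge3$, to $f_i=\sum_v f_{i,v}\in C^1_{(i)}$ and $\sigma_{i-1}\in C^2_{(i-1)}$, where $f_{i,v}$ is supported on $Y_{(i),v}$, as follows. ($\mathcal R_X$-steps, $i$ odd.) For each $X$-check $x$, $f_{i,x}$ is a function of $\sigma_i|_{Y_x}$ whose coboundary equals $\sigma_i|_{Y_x}$ on $Y_x$ and has weight at most $|\sigma_i|_{Y_x}|$ outside $Y_x$; then, for each qubit $q$, $f_{i,q}$ is chosen in the same way on $Y_q$ for the updated syndrome $\sigma_i+\delta\sum_x f_{i,x}$;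 and $\sigma_{i-1}=\mathcal F_{i-1}^{-1}(\sigma_i+\delta f_i)$. ($\mathcal R_Z$-steps, $i$ even.) $\sigma_{i-1}(z)$ is the parity of $\sigma_i$ on $Y_z$, and $f_{i,z}$ is a function of $\sigma_i|_{Y_z}$ with $\delta f_{i,z}=(\sigma_i+\mathcal F_{i-1}(\sigma_{i-1}))|_{Y_z}$. (The requirements on $f_{i,v}$ are imposed whenever they can be met.) At level $2$ the decoder outputs $f_2$ with $\delta f_2=\sigma_2$, sets $f_{2,v}=f_2|_{Y_v}$, $\sigma_1=\sigma_0=0$, $f_1=f_0=0$, and corrects small errors: if $e\in C^1_{(2)}$ is supported on the qubits adjacent to one $X$-check, then $f_2(\delta e)+e\in B^1$. The global correction is $f(\sigma_{2k})=f_{2k}+\mathcal F_{2k-1}(f_{2k-1})+\mathcal F_{2k-1}\mathcal F_{2k-2}(f_{2k-2})+\cdots$. A syndrome $\sigma_{2k}\in B^2(C_{(2k)})$ is *unstable* if, for some $e\in C^1_{(2k)}$ with $|e|=1$, $f(\sigma_{2k})+f(\sigma_{2k}+\delta e)+e$ represents a nontrivial class in $H^1(C_{(2k)})$. **Decoding graph.**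 $G$ has a root $v^{(0)}$ and, for $1\le i\le 2k$, a copy $G_i$ of the $1$-skeleton of $T_{(i-1)}$; $V_i$ is the node set of $G_i$. The root is joined to all of $V_1$, and $v\in V_{i-1}$ to those $v'\in V_i$ that are cells of $Y_{(i-1),v}$. $\Delta$ is the maximum degree of $G$. The subgraph $G_{\sigma_{2k}}$ is induced by the following nodes: all $v\in V_i$, $2\le i\le 2k$, such that $\sigma_i|_{Y_v}\ne0$, or $f_{i,v}\ne0$, or $(\delta f_{i,v'})|_{Y_v}\neq0$ for some $v'$; the nodes of $V_1$ joined to such nodes of $V_2$; and the root if any node of $V_1$ is included. The *witness subgraph* $G_\tau$ is the connected component of $G_{\sigma_{2k}}$ containing $v^{(0)}$ (possibly empty). The witness syndrome $\tau_i$ is $\sigma_i$ restricted to the union of the $Y_{(i),v}$ over the nodes $v$ of $G_\tau$ in $G_i$ (for $i=0$, $\tau_0=\sigma_0=0$). **Statement.** Such decoders exist for all sufficiently large odd $\ell$. For every odd $\ell\ge3$, every such decoder and every $k\ge1$: 1. if $\sigma_{2k}\in B^2(C_{(2k)})$ is unstable, its witness subgraph has at least $2^{k-1}$ nodes; 2.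 for every $m$, the number of subgraphs of $G$ with $m$ nodes that are witness subgraphs of some $\sigma_{2k}\in B^2(C_{(2k)})$ is at most $|V_2|(\Delta+1)^{2m}$; 3. for every $\sigma_{2k}\in B^2(C_{(2k)})$, $\sum_{i=0}^{2k}|\tau_i|\le 4|\tau_{2k}|$. -/

import Mathlib

open scoped Classical

noncomputable section

/-- The Tanner graph of a CSS code. `deg v = 0, 1, 2` says that `v` is an `X`-check, a qubit, a
`Z`-check; `inc u v` says that `u, v` are adjacent and `deg v = deg u + 1`. The squares of the Tanner
square complex are the cycles `(x, q, z, q')`. In the codes `tannerLevel` built below every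
`X`-check and every `Z`-check share either no qubit or exactly two, so that the squares are the
pairs `(x, z)` with a common qubit, and the square complex is determined by its 1-skeleton. -/
structure Tanner where
  V : Type
  fin : Fintype V
  deg : V → ℕ
  inc : V → V → Prop

instance (T : Tanner) : Fintype T.V := T.fin

namespace Tanner

/-- Binary cochains of all degrees together. -/
abbrev Cochain (T : Tanner) : Type := T.V → ZMod 2

/-- The space `C^m` of cochains of degree `m`. -/
def cochains (T : Tanner) (m : ℕ) : Submodule (ZMod 2) T.Cochain where
  carrier := {c | ∀ v, c v ≠ 0 → T.deg v = m}
  zero_mem' := fun v h => absurd rfl h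
  add_mem' := by
    intro a b ha hb v hv
    by_cases h : a v = 0
    · refine hb v fun h' => hv ?_
      simp [h, h']
    · exact ha v h
  smul_mem' := by
    intro r a ha v hv
    refine ha v fun h => hv ?_
    simp [h]

/-- The coboundary map. -/
def cobdry (T : Tanner) : T.Cochain →ₗ[ZMod 2] T.Cochain where
  toFun c := fun v => ∑ u : T.V, if T.inc u v then c u else 0
  map_add' := by
    intro a b
    funext v
    simp only [Pi.add_apply, ← Finset.sum_add_distrib]
    exact Finset.sum_congr rfl fun u _ => by split_ifs <;> simp
  map_smul' := by
    intro r a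
    funext v
    simp only [Pi.smul_apply, smul_eq_mul, Finset.mul_sum, RingHom.id_apply]
    exact Finset.sum_congr rfl fun u _ => by split_ifs <;> simp

/-- `T.coboundaries m` is the space `B^(m+1)` of coboundaries of cochains of degree `m`. -/
def coboundaries (T : Tanner) (m : ℕ) : Submodule (ZMod 2) T.Cochain :=
  (T.cochains m).map T.cobdry

/-- The Hamming weight. -/
def weight {T : Tanner} (c : T.Cochain) : ℕ := (Finset.univ.filter fun v => c v ≠ 0).card

/-- The restriction `c|_S`, extended by zero. -/
def restrict {T : Tanner} (S : Set T.V) (c : T.Cochain) : T.Cochain :=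
  fun v => if v ∈ S then c v else 0

/-! ### The seed code -/

/-- Degrees on the `3 × 3` grid: corners and centre are qubits, `(0,1), (2,1)` are `X`-checks and
`(1,0), (1,2)` are `Z`-checks. -/
def seedDeg (p : Fin 3 × Fin 3) : ℕ :=
  if (p.1.val + p.2.val) % 2 = 0 then 1 else if p.1.val % 2 = 0 then 0 else 2

/-- The `[[5,1,2]]` surface code. -/
def seed : Tanner where
  V := Fin 3 × Fin 3
  fin := inferInstance
  deg := seedDeg
  inc p q := Nat.dist p.1.val q.1.val + Nat.dist p.2.val q.2.val = 1 ∧ seedDeg q = seedDeg p + 1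

/-! ### The replacement steps

`b = true` stands for the `X`-iteration, `b = false` for the `Z`-iteration. The latter is the former
applied to the dual complex (exchange of `X`- and `Z`-checks), followed by dualizing back. -/

/-- The incidence relation of `T` (`b = true`) or of its dual (`b = false`). -/
def up (T : Tanner) (b : Bool) (u v : T.V) : Prop := if b then T.inc u v else T.inc v u

/-- `v` is `u`, or lies above `u` on an edge or on a square. -/
def le (T : Tanner) (b : Bool) (u v : T.V) : Prop :=
  u = v ∨ T.up b u v ∨ ∃ w, T.up b u w ∧ T.up b w v

/-- `(t, a, h)`: the label `t` of an open cell of the star of a vertex `v`, coordinates `a` in that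
cell, and a height `h`. Each edge of the star, and the height interval, is subdivided; an even
coordinate stands for a vertex of the subdivision and an odd one for an open edge. -/
abbrev RawCell (T : Tanner) (ℓ : ℕ) : Type := T.V × (T.V → Fin ℓ) × Fin 3

/-- The cells of the local complex `Y_v`. The open cells of the star `X_v` (`v` itself, the edges
from `v` upwards and the squares at `v` that continue them) are labelled by the vertices `t ≥ v`; the
cell `t` has one coordinate for each edge `(v, w)` of its closure. Every such edge is subdivided into
`(ℓ-1)/2` edges, so coordinates run over `0, …, ℓ-1`, and they are nonzero inside the cell `t`. The
boundary `∂X_v` is the set of cells with a coordinate equal to `ℓ-1`. `Y_v` consists of two copies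
of the subdivided star (`h = 0` and `h = 2`) and of the cylinder `∂X_v × [0,1]` (`h = 1`). -/
def IsCell (T : Tanner) (ℓ : ℕ) (b : Bool) (v : T.V) (c : T.RawCell ℓ) : Prop :=
  T.le b v c.1 ∧ (∀ w, (c.2.1 w).val ≠ 0 ↔ T.up b v w ∧ T.le b w c.1) ∧
    (c.2.2 = 1 → ∃ w, (c.2.1 w).val + 1 = ℓ)

/-- The dimension of a cell: the number of its odd coordinates, height included. -/
def cellDim {T : Tanner} {ℓ : ℕ} (c : T.RawCell ℓ) : ℕ :=
  (Finset.univ.filter fun w => (c.2.1 w).val % 2 = 1).card + c.2.2.val % 2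

/-- `c` is a facet of `c'` inside one local complex `Y_v`. -/
def IsFacet {T : Tanner} {ℓ : ℕ} (b : Bool) (c c' : T.RawCell ℓ) : Prop :=
  cellDim c' = cellDim c + 1 ∧ T.le b c.1 c'.1 ∧
    (∀ w, c.2.1 w = c'.2.1 w ∨
      ((c'.2.1 w).val % 2 = 1 ∧ Nat.dist (c.2.1 w).val (c'.2.1 w).val = 1)) ∧
    (c.2.2 = c'.2.2 ∨ c'.2.2 = 1)

/-- For adjacent `v, v'` the inclusion `Y_{v'} ↪ Y_v` sends `c'` to `c`. The star of `v'` lies in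
`∂X_v`: the coordinate of `c` along `(v, v')` is maximal and, if `c` is not over the edge `(v, v')`,
its other coordinate, on the square with vertices `v, v', t`, is the distance from `v'` towards
`t`. -/
def IsInclusion {T : Tanner} {ℓ : ℕ} (b : Bool) (v v' : T.V) (c c' : T.RawCell ℓ) : Prop :=
  c.1 = c'.1 ∧ c.2.2 = c'.2.2 ∧ (c.2.1 v').val + 1 = ℓ ∧
    ∀ w, T.up b v w → w ≠ v' → T.le b w c.1 → c.2.1 w = c'.2.1 c.1

/-- The replacement `R_X` (`b = true`) or `R_Z` (`b = false`). The new cochain complex is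
`⨁_v C_v`, with `C_v` the cochain complex of `Y_v` shifted by `deg v` (for `R_Z`: its dual), and the
coboundary map is the sum of the local coboundary maps and of the maps induced by the inclusions
`Y_{v'} ↪ Y_v`. -/
def replace (ℓ : ℕ) (b : Bool) (T : Tanner) : Tanner where
  V := Σ v : T.V, {c : T.RawCell ℓ // T.IsCell ℓ b v c}
  fin := inferInstance
  deg p := if b then T.deg p.1 + cellDim p.2.1 else T.deg p.1 - cellDim p.2.1
  inc p p' :=
    if b then
      (p.1 = p'.1 ∧ IsFacet b p.2.1 p'.2.1) ∨
        (T.up b p.1 p'.1 ∧ IsInclusion b p.1 p'.1 p.2.1 p'.2.1)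
    else
      (p'.1 = p.1 ∧ IsFacet b p'.2.1 p.2.1) ∨
        (T.up b p'.1 p.1 ∧ IsInclusion b p'.1 p.1 p'.2.1 p.2.1)

/-- The restriction `σ|_{Y_v}`. -/
def loc {ℓ : ℕ} {b : Bool} {T : Tanner} (v : T.V) (σ : (replace ℓ b T).Cochain) :
    (replace ℓ b T).Cochain :=
  restrict {p | p.1 = v} σ

/-- The cochain map `F` from the old to the new complex. For `R_X` it sends a vertex `v` to the sum
of all 0-cells of `Y_v`, the generator of the lowest cohomology of `C_v`. For `R_Z` it is the
subdivision map into the layer `h = 0`: it sends a qubit or a `Z`-check `v` to the centre of `Y_v`,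
a generator of the cohomology of `C_v`, and adds the straight strings and the quadrants which the
homological perturbation lemma adds to it. -/
def lift {ℓ : ℕ} {b : Bool} {T : Tanner} (c : T.Cochain) : (replace ℓ b T).Cochain := fun p =>
  if b then (if cellDim p.2.1 = 0 then c p.1 else 0)
  else if p.2.1.2.2 = 0 ∧ (replace ℓ b T).deg p = T.deg p.2.1.1 then c p.2.1.1 else 0

/-- The parity on each `Y_v`, `v` a `Z`-check, of a cochain of degree two. -/
def parity {ℓ : ℕ} {b : Bool} {T : Tanner} (σ : (replace ℓ b T).Cochain) : T.Cochain := fun v =>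
  if T.deg v = 2 then ∑ p : (replace ℓ b T).V, loc v σ p else 0

/-! ### The coarse-graining steps -/

/-- Admissible local corrections for the local syndrome `s` on `Y_v` in an `R_X`-step: `f` lives on
`C_v^1`, removes `s`, and creates on the other local complexes a syndrome of weight at most
`|s|`. -/
def IsCorrectionX {ℓ : ℕ} {b : Bool} {T : Tanner} (v : T.V) (s f : (replace ℓ b T).Cochain) :
    Prop :=
  f ∈ (replace ℓ b T).cochains 1 ∧ loc v f = f ∧ loc v ((replace ℓ b T).cobdry f) = s ∧
    ∑ w : T.V, (if w = v then 0 else weight (loc w ((replace ℓ b T).cobdry f))) ≤ weight s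

/-- Admissible local corrections for the local syndrome `s` on `Y_v` in an `R_Z`-step: `f` lives on
`C_v^1` and moves `s` to the part on `Y_v` of the image under `F` of the coarse-grained syndrome. -/
def IsCorrectionZ {ℓ : ℕ} {b : Bool} {T : Tanner} (v : T.V) (s f : (replace ℓ b T).Cochain) :
    Prop :=
  f ∈ (replace ℓ b T).cochains 1 ∧ loc v f = f ∧
    loc v ((replace ℓ b T).cobdry f) = s + loc v (lift (parity s))

/-- The admissible local corrections of an `R_X`-step (`b = true`) or an `R_Z`-step. -/
def IsCorrection {ℓ : ℕ} {b : Bool} {T : Tanner} (v : T.V) (s f : (replace ℓ b T).Cochain) :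
    Prop :=
  if b then IsCorrectionX v s f else IsCorrectionZ v s f

/-- The local components `f_v` of the correction for the syndrome `σ`, when `corr v s` is the local
correction chosen for the local syndrome `s` on `Y_v`. In an `R_X`-step the syndrome is first cleaned
from the `Y_x`, and what results is cleaned from the `Y_q`; in an `R_Z`-step only the `Y_z` carry
corrections. -/
def stepLocal {ℓ : ℕ} {b : Bool} {T : Tanner}
    (corr : T.V → (replace ℓ b T).Cochain → (replace ℓ b T).Cochain)
    (σ : (replace ℓ b T).Cochain) (v : T.V) : (replace ℓ b T).Cochain :=
  if b then
    if T.deg v = 0 then corr v (loc v σ)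
    else if T.deg v = 1 then
      corr v (loc v (σ + (replace ℓ b T).cobdry
        (∑ x : T.V, if T.deg x = 0 then corr x (loc x σ) else 0)))
    else 0
  else if T.deg v = 2 then corr v (loc v σ) else 0

/-- The coarse-grained syndrome: `F⁻¹(σ + δf)` in an `R_X`-step, and the local cohomology classes
(the parities) of `σ` in an `R_Z`-step. -/
def stepCoarse {ℓ : ℕ} {b : Bool} {T : Tanner}
    (corr : T.V → (replace ℓ b T).Cochain → (replace ℓ b T).Cochain)
    (σ : (replace ℓ b T).Cochain) : T.Cochain :=
  if b then
    Function.invFun (lift (ℓ := ℓ) (b := b) (T := T))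
      (σ + (replace ℓ b T).cobdry (∑ v : T.V, stepLocal corr σ v))
  else parity σ

end Tanner

open Tanner

/-- Iterations alternate, starting with an `R_X`. -/
def isX (i : ℕ) : Bool := decide (i % 2 = 0)

/-- The level-`i` code `C_(i)`, with its Tanner graph `T_(i)`. -/
def tannerLevel (ℓ : ℕ) : ℕ → Tanner
  | 0 => seed
  | i + 1 => replace ℓ (isX i) (tannerLevel ℓ i)

/-- The cochain map `F_i : C_(i) → C_(i+1)`. -/
def levelLift (ℓ i : ℕ) (c : (tannerLevel ℓ i).Cochain) : (tannerLevel ℓ (i + 1)).Cochain :=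
  lift (ℓ := ℓ) (b := isX i) c

/-- The restriction of a level-`(i+1)` cochain to the local complex `Y_v`. -/
def levelLoc (ℓ i : ℕ) (v : (tannerLevel ℓ i).V) (c : (tannerLevel ℓ (i + 1)).Cochain) :
    (tannerLevel ℓ (i + 1)).Cochain :=
  loc (ℓ := ℓ) (b := isX i) v c

/-- A decoder: the choices left open by the coarse-graining procedure. At the levels `i + 1 ≥ 3` it
picks, for every local syndrome that has an admissible local correction, such a correction. At level
two it outputs a correction with the given syndrome, and it corrects small errors: those supported on
the qubits adjacent to one `X`-check. -/
structure Decoder (ℓ : ℕ) where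
  corr : (i : ℕ) → (tannerLevel ℓ i).V →
    (replace ℓ (isX i) (tannerLevel ℓ i)).Cochain → (replace ℓ (isX i) (tannerLevel ℓ i)).Cochain
  base : (tannerLevel ℓ 2).Cochain → (tannerLevel ℓ 2).Cochain
  corr_spec : ∀ i, 2 ≤ i → ∀ v s, (∃ f, IsCorrection v s f) → IsCorrection v s (corr i v s)
  base_spec : ∀ σ ∈ (tannerLevel ℓ 2).coboundaries 1,
    base σ ∈ (tannerLevel ℓ 2).cochains 1 ∧ (tannerLevel ℓ 2).cobdry (base σ) = σ
  base_small : ∀ x, (tannerLevel ℓ 2).deg x = 0 → ∀ e ∈ (tannerLevel ℓ 2).cochains 1,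
    (∀ q, e q ≠ 0 → (tannerLevel ℓ 2).inc x q) →
      base ((tannerLevel ℓ 2).cobdry e) + e ∈ (tannerLevel ℓ 2).coboundaries 0

namespace Decoder

variable {ℓ : ℕ} (D : Decoder ℓ)

/-- The local component `f_{i+1, v}` of the level-`(i+1)` correction for the level-`(i+1)` syndrome
`σ`. There are no corrections below level two. -/
def localCorr : (i : ℕ) → (tannerLevel ℓ (i + 1)).Cochain → (tannerLevel ℓ i).V →
    (tannerLevel ℓ (i + 1)).Cochain
  | 0 => fun _ _ => 0
  | 1 => fun σ v => levelLoc ℓ 1 v (D.base σ)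
  | i + 2 => fun σ v => stepLocal (D.corr (i + 2)) σ v

/-- The level-`(i+1)` correction `f_{i+1}`. -/
def levelCorr (i : ℕ) (σ : (tannerLevel ℓ (i + 1)).Cochain) : (tannerLevel ℓ (i + 1)).Cochain :=
  ∑ v : (tannerLevel ℓ i).V, D.localCorr i σ v

/-- The coarse-grained syndrome `σ_i` of the level-`(i+1)` syndrome `σ`. Since the level-two
correction removes the whole syndrome, it vanishes at the levels one and zero. -/
def coarse : (i : ℕ) → (tannerLevel ℓ (i + 1)).Cochain → (tannerLevel ℓ i).Cochain
  | 0 => fun _ => 0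
  | 1 => fun _ => 0
  | i + 2 => fun σ => stepCoarse (D.corr (i + 2)) σ

/-- The global correction `f(σ)` for a level-`n` syndrome:
`f = f_n + F(f_(n-1)) + F(F(f_(n-2))) + …`. -/
def total : (n : ℕ) → (tannerLevel ℓ n).Cochain → (tannerLevel ℓ n).Cochain
  | 0 => fun _ => 0
  | n + 1 => fun σ => D.levelCorr n σ + levelLift ℓ n (total n (D.coarse n σ))

/-- The history `σ_j`, `j ≤ n`, of a level-`n` syndrome `σ = σ_n` under coarse-graining. -/
def syndrome : (n : ℕ) → (tannerLevel ℓ n).Cochain → (j : ℕ) → (tannerLevel ℓ j).Cochain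
  | 0 => fun σ => Function.update (fun _ => 0) 0 σ
  | n + 1 => fun σ => Function.update (syndrome n (D.coarse n σ)) (n + 1) σ

/-- `σ` is unstable: some single-qubit flip `e` makes `f(σ) + f(σ + δe) + e` a cocycle that
represents a nontrivial class in `H^1`. -/
def Unstable (n : ℕ) (σ : (tannerLevel ℓ n).Cochain) : Prop :=
  ∃ e ∈ (tannerLevel ℓ n).cochains 1, weight e = 1 ∧
    (tannerLevel ℓ n).cobdry (D.total n σ + D.total n (σ + (tannerLevel ℓ n).cobdry e) + e) = 0 ∧
    D.total n σ + D.total n (σ + (tannerLevel ℓ n).cobdry e) + e ∉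
      (tannerLevel ℓ n).coboundaries 0

end Decoder

/-! ### The decoding graph -/

/-- The nodes of the decoding graph for the level-`n` code: the root (`none`), which is the only node
of `G_0`, and for `i < n` the nodes of `G_(i+1)`, labelled by the vertices of `T_(i)`. -/
abbrev DNode (ℓ n : ℕ) : Type := Option (Σ i : Fin n, (tannerLevel ℓ i).V)

/-- The node of `G_(i+1)` with label `v`. -/
def dnode {ℓ n : ℕ} (i : ℕ) (h : i < n) (v : (tannerLevel ℓ i).V) : DNode ℓ n :=
  some ⟨⟨i, h⟩, v⟩

/-- The edges of the decoding graph: those of the 1-skeletons, those from `v` to the vertices of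
`Y_v`, and those from the root to `G_1`. -/
inductive DAdj {ℓ n : ℕ} : DNode ℓ n → DNode ℓ n → Prop
  | level (i : ℕ) (h : i < n) (u v : (tannerLevel ℓ i).V) (huv : (tannerLevel ℓ i).inc u v) :
      DAdj (dnode i h u) (dnode i h v)
  | child (i : ℕ) (h : i + 1 < n) (w : (tannerLevel ℓ (i + 1)).V) :
      DAdj (dnode i (Nat.lt_of_succ_lt h) w.1) (dnode (i + 1) h w)
  | root (h : 0 < n) (v : (tannerLevel ℓ 0).V) : DAdj none (dnode 0 h v)

/-- The decoding graph `G`. -/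
def decodingGraph (ℓ n : ℕ) : SimpleGraph (DNode ℓ n) := SimpleGraph.fromRel DAdj

namespace Decoder

variable {ℓ : ℕ} (D : Decoder ℓ)

/-- The vertices of the subgraph `G_σ` induced by a level-`n` syndrome `σ`. -/
inductive Marked (n : ℕ) (σ : (tannerLevel ℓ n).Cochain) : DNode ℓ n → Prop
  | syndrome (i : ℕ) (h : i < n) (hi : 1 ≤ i) (v : (tannerLevel ℓ i).V)
      (hv : levelLoc ℓ i v (D.syndrome n σ (i + 1)) ≠ 0) : Marked n σ (dnode i h v)
  | correction (i : ℕ) (h : i < n) (hi : 1 ≤ i) (v : (tannerLevel ℓ i).V)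
      (hv : D.localCorr i (D.syndrome n σ (i + 1)) v ≠ 0) : Marked n σ (dnode i h v)
  | boundary (i : ℕ) (h : i < n) (hi : 1 ≤ i) (v v' : (tannerLevel ℓ i).V)
      (hv : levelLoc ℓ i v ((tannerLevel ℓ (i + 1)).cobdry
        (D.localCorr i (D.syndrome n σ (i + 1)) v')) ≠ 0) : Marked n σ (dnode i h v)
  | parent (h : 1 < n) (w : (tannerLevel ℓ 1).V) (hw : Marked n σ (dnode 1 h w)) :
      Marked n σ (dnode 0 (Nat.lt_of_succ_lt h) w.1)
  | root (h : 0 < n) (v : (tannerLevel ℓ 0).V) (hv : Marked n σ (dnode 0 h v)) :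
      Marked n σ none

/-- The subgraph `G_σ` induced by a level-`n` syndrome `σ`. -/
def inducedSubgraph (n : ℕ) (σ : (tannerLevel ℓ n).Cochain) : (decodingGraph ℓ n).Subgraph :=
  (⊤ : (decodingGraph ℓ n).Subgraph).induce {u | D.Marked n σ u}

/-- The witness subgraph of `σ`: the connected component of `G_σ` that contains the root, empty if
the root does not belong to `G_σ`. -/
def witness (n : ℕ) (σ : (tannerLevel ℓ n).Cochain) : (decodingGraph ℓ n).Subgraph :=
  (D.inducedSubgraph n σ).induce
    {u | none ∈ (D.inducedSubgraph n σ).verts ∧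
      (D.inducedSubgraph n σ).spanningCoe.Reachable none u}

/-- The witness syndrome `τ_j` at level `j`: `σ_j` restricted to the regions `Y_v`, `v` a node of the
witness subgraph in `G_j`. The region of the root is the whole level-zero complex. -/
def witnessSyndrome (n : ℕ) (σ : (tannerLevel ℓ n).Cochain) :
    (j : ℕ) → (tannerLevel ℓ j).Cochain
  | 0 => restrict {_p | none ∈ (D.witness n σ).verts} (D.syndrome n σ 0)
  | j + 1 => restrict {p | ∃ h : j < n, dnode j h p.1 ∈ (D.witness n σ).verts}
      (D.syndrome n σ (j + 1))

end Decoder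

end

/-! An `X`-step replaces each `X`-check `x` by a complex `Y_x` that is connected and has no first
cohomology (`Nice.star_const`, `Nice.star_exact`): it consists of two copies of a cone over a
connected link, joined along their boundaries by a cylinder. Each `Y_q` is connected too
(`Nice.qubit_const`). Hence a one-cochain of the new complex whose coboundary is a lift can be moved
off the `Y_x` by a coboundary, is then constant on every `Y_q`, and so is the lift of an old
one-cochain (`Nice.exists_eq_lift_true`). A `Z`-step is the transpose of an `X`-step of the dual
complex; there `fiberSum`, the transpose of the dual lift, inverts the lift up to coboundaries
(`Nice.add_lift_fiberSum_mem`). All this needs square complexes that are regular in the sense of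
`Nice`, a property that every step preserves (`Nice.replace`).

Locality. Call an error small if it lives on the qubits adjacent to one `X`-check. Adding a small
error to a syndrome changes the corrections of a step in such a way that, up to a coboundary, the
lift of another small error is passed on (`Nice.step_local`). If the history of a syndrome vanishes
at level two, a single flipped qubit therefore arrives there as a small error on top of the zero
syndrome and is decoded correctly. So an unstable syndrome has a nonzero level-two syndrome
(`Decoder.Unstable.syndrome_two_ne_zero`), and its witness subgraph contains the root and carries
syndrome weight at level two.

Weight. In an `X`-step the weight handed on from the `Y_x` to the `Y_q` and from there to the `Y_z`
does not grow, while each `Z`-check of the coarse syndrome fills both points of its `Y_z`; the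
coarse weight is at most half of the fine one. In a `Z`-step the coarse syndrome is a parity and not
heavier than the fine one (`Nice.step_weight`). A connected component of the marked nodes is closed
under the interactions of a step, so the same bounds hold for the witness syndromes. Read upwards,
the weight doubles every two levels; this gives the lower bound `2 ^ (k - 1)` and, through a
geometric series, the constant `4`.

Counting. A nonempty witness subgraph is induced, connected and contains the root, so it is the
support of a closed walk of length `2 * (m - 1)` from the root.

Existence. The local problems are solvable at the allowed cost by `Nice.exists_correction_check` and
`Nice.exists_correction_qubit`. At level two, small errors with equal syndromes are equivalent,
because two `X`-checks cannot block all the parallel copies of a row of the seed code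
(`small_pair`). -/

namespace Tanner

/-! ### Basic facts on cochains -/

theorem zmod_two_cases (a : ZMod 2) : a = 0 ∨ a = 1 := by
  revert a; decide

theorem zmod_two_eq_of_add {a b : ZMod 2} (h : a + b = 0) : a = b := by
  revert a b; decide

theorem zmod_two_ne_zero {a : ZMod 2} : a ≠ 0 ↔ a = 1 := by
  revert a; decide

section Basic

variable {T : Tanner}

theorem cobdry_apply (c : T.Cochain) (v : T.V) :
    T.cobdry c v = ∑ u : T.V, if T.inc u v then c u else 0 := rfl

theorem cochain_add_self (c : T.Cochain) : c + c = 0 := by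
  funext v; exact CharTwo.add_self_eq_zero (c v)

theorem cochain_eq_of_add {a b : T.Cochain} (h : a + b = 0) : a = b := by
  funext v; exact zmod_two_eq_of_add (congrFun h v)

theorem cochain_add_cancel (a b : T.Cochain) : a + b + b = a := by
  rw [add_assoc, cochain_add_self, add_zero]

theorem cobdry_ne_zero {c : T.Cochain} {v : T.V} (h : T.cobdry c v ≠ 0) :
    ∃ u, T.inc u v ∧ c u ≠ 0 := by
  rw [cobdry_apply] at h
  obtain ⟨u, -, hu⟩ := Finset.exists_ne_zero_of_sum_ne_zero h
  by_cases hi : T.inc u v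
  · exact ⟨u, hi, by simpa [hi] using hu⟩
  · simp [hi] at hu

theorem restrict_apply (S : Set T.V) (c : T.Cochain) (v : T.V) :
    restrict S c v = if v ∈ S then c v else 0 := rfl

theorem restrict_mem_cochains {m : ℕ} {c : T.Cochain} (S : Set T.V) (h : c ∈ T.cochains m) :
    restrict S c ∈ T.cochains m := by
  intro v hv
  refine h v fun h0 => hv ?_
  simp [restrict_apply, h0]

/-! ### Regular square complexes -/

/-- The conditions on a Tanner graph which are preserved by the replacement steps: degrees are at
most two, checks that share a qubit share exactly two, there are no isolated vertices, and links of
checks are connected. -/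
structure Nice (T : Tanner) : Prop where
  deg_le : ∀ v, T.deg v ≤ 2
  inc_deg : ∀ {u v}, T.inc u v → T.deg v = T.deg u + 1
  diamond : ∀ {x q z}, T.inc x q → T.inc q z → ∃ q', q' ≠ q ∧ T.inc x q' ∧ T.inc q' z ∧
    ∀ w, T.inc x w → T.inc w z → w = q ∨ w = q'
  above : ∀ v, T.deg v ≤ 1 → ∃ w, T.inc v w
  below : ∀ v, 1 ≤ T.deg v → ∃ w, T.inc w v
  linkUp : ∀ x, T.deg x = 0 → ∀ φ : T.V → ZMod 2,
    (∀ a b z, T.inc x a → T.inc x b → T.inc a z → T.inc b z → φ a = φ b) →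
    ∀ q q', T.inc x q → T.inc x q' → φ q = φ q'
  linkDown : ∀ z, T.deg z = 2 → ∀ φ : T.V → ZMod 2,
    (∀ a b x, T.inc a z → T.inc b z → T.inc x a → T.inc x b → φ a = φ b) →
    ∀ q q', T.inc q z → T.inc q' z → φ q = φ q'

/-- The dual complex: exchange of `X`- and `Z`-checks. -/
def dual (T : Tanner) : Tanner where
  V := T.V
  fin := T.fin
  deg v := 2 - T.deg v
  inc u v := T.inc v u

/-- Regularity is self-dual: exchanging the two kinds of checks swaps `above` with `below` and
`linkUp` with `linkDown`. This is what lets the `Z`-steps inherit everything from the `X`-steps. -/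
theorem Nice.dual (hT : T.Nice) : T.dual.Nice where
  deg_le v := Nat.sub_le _ _
  inc_deg {u v} h := by
    have h1 : T.deg u = T.deg v + 1 := hT.inc_deg h
    have h2 := hT.deg_le u
    change 2 - T.deg v = 2 - T.deg u + 1
    omega
  diamond {x q z} h1 h2 := by
    obtain ⟨q', hne, ha, hb, hu⟩ := hT.diamond (x := z) (q := q) (z := x) h2 h1
    exact ⟨q', hne, hb, ha, fun w hw hw' => hu w hw' hw⟩
  above v hv := by
    refine hT.below v ?_
    have hv' : 2 - T.deg v ≤ 1 := hv
    omega
  below v hv := by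
    refine hT.above v ?_
    have hv' : 1 ≤ 2 - T.deg v := hv
    omega
  linkUp x hx φ hφ q q' hq hq' := by
    have hx' : 2 - T.deg x = 0 := hx
    have := hT.deg_le x
    exact hT.linkDown x (by omega) φ (fun a b z ha hb hza hzb => hφ a b z ha hb hza hzb) q q' hq hq'
  linkDown z hz φ hφ q q' hq hq' := by
    have hz' : 2 - T.deg z = 2 := hz
    have := hT.deg_le z
    exact hT.linkUp z (by omega) φ (fun a b x ha hb hxa hxb => hφ a b x ha hb hxa hxb) q q' hq hq'

/-- Each pair `(x, z)` contributes one term for every common neighbour, and `diamond` makes the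
number of these zero or two. -/
theorem Nice.cobdry_cobdry (hT : T.Nice) (c : T.Cochain) : T.cobdry (T.cobdry c) = 0 := by
  funext z
  have h1 : T.cobdry (T.cobdry c) z
      = ∑ x : T.V, ∑ q : T.V, if T.inc x q ∧ T.inc q z then c x else 0 := by
    rw [cobdry_apply, Finset.sum_comm]
    refine Finset.sum_congr rfl fun q _ => ?_
    by_cases hq : T.inc q z
    · simp [hq, cobdry_apply]
    · simp [hq]
  rw [h1]
  refine Finset.sum_eq_zero fun x _ => ?_
  by_cases hex : ∃ q, T.inc x q ∧ T.inc q z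
  · obtain ⟨q, hxq, hqz⟩ := hex
    obtain ⟨q', hne, ha, hb, hu⟩ := hT.diamond hxq hqz
    rw [Finset.sum_eq_add q q' hne.symm]
    · simp [hxq, hqz, ha, hb, CharTwo.add_self_eq_zero]
    · intro w _ hw
      rw [if_neg]
      rintro ⟨h3, h4⟩
      rcases hu w h3 h4 with h | h
      · exact hw.1 h
      · exact hw.2 h
    · simp
    · simp
  · push Not at hex
    refine Finset.sum_eq_zero fun q _ => ?_
    rw [if_neg]
    rintro ⟨h3, h4⟩
    exact hex q h3 h4

theorem Nice.cobdry_mem (hT : T.Nice) {m : ℕ} {c : T.Cochain} (hc : c ∈ T.cochains m) :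
    T.cobdry c ∈ T.cochains (m + 1) := by
  intro v hv
  obtain ⟨u, hu, hcu⟩ := cobdry_ne_zero hv
  rw [hT.inc_deg hu, hc u hcu]

theorem mem_coboundaries {m : ℕ} {c : T.Cochain} :
    c ∈ T.coboundaries m ↔ ∃ d ∈ T.cochains m, T.cobdry d = c := Iff.rfl

theorem Nice.coboundaries_le (hT : T.Nice) {m : ℕ} {c : T.Cochain} (hc : c ∈ T.coboundaries m) :
    c ∈ T.cochains (m + 1) := by
  obtain ⟨d, hd, rfl⟩ := hc
  exact hT.cobdry_mem hd

end Basic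

/-! ### The seed code -/

theorem seed_inc_iff (p q : Fin 3 × Fin 3) : seed.inc p q ↔
    Nat.dist p.1.val q.1.val + Nat.dist p.2.val q.2.val = 1 ∧ seedDeg q = seedDeg p + 1 := Iff.rfl

/-- The incidence relation of the seed code, as a decidable relation. -/
abbrev seedInc (p q : Fin 3 × Fin 3) : Prop :=
  Nat.dist p.1.val q.1.val + Nat.dist p.2.val q.2.val = 1 ∧ seedDeg q = seedDeg p + 1

set_option maxRecDepth 20000 in
theorem seed_nice : seed.Nice where
  deg_le := by
    change ∀ v : Fin 3 × Fin 3, seedDeg v ≤ 2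
    decide
  inc_deg {u v} h := h.2
  diamond {x q z} := by
    have h : ∀ x q z : Fin 3 × Fin 3, seedInc x q → seedInc q z → ∃ q', q' ≠ q ∧ seedInc x q' ∧
      seedInc q' z ∧ ∀ w, seedInc x w → seedInc w z → w = q ∨ w = q' := by decide
    exact h x q z
  above := by
    change ∀ v : Fin 3 × Fin 3, seedDeg v ≤ 1 → ∃ w, seedInc v w
    decide
  below := by
    change ∀ v : Fin 3 × Fin 3, 1 ≤ seedDeg v → ∃ w, seedInc w v
    decide
  linkUp x hx φ hφ q q' hq hq' := by
    -- Every qubit at an `X`-check shares a `Z`-check with the central qubit, so all values are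
    -- compared with the central one.
    have h : ∀ x q : Fin 3 × Fin 3, seedInc x q → seedDeg x = 0 → seedInc x (1, 1) ∧
        ∃ z, seedInc q z ∧ seedInc (1, 1) z := by decide
    obtain ⟨hr, z, h1, h2⟩ := h x q hq hx
    obtain ⟨-, z', h3, h4⟩ := h x q' hq' hx
    exact (hφ q (1, 1) z hq hr h1 h2).trans (hφ q' (1, 1) z' hq' hr h3 h4).symm
  linkDown z hz φ hφ q q' hq hq' := by
    have h : ∀ z q : Fin 3 × Fin 3, seedInc q z → seedDeg z = 2 → seedInc (1, 1) z ∧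
        ∃ x, seedInc x q ∧ seedInc x (1, 1) := by decide
    obtain ⟨hr, x, h1, h2⟩ := h z q hq hz
    obtain ⟨-, x', h3, h4⟩ := h z q' hq' hz
    exact (hφ q (1, 1) x hq hr h1 h2).trans (hφ q' (1, 1) x' hq' hr h3 h4).symm

end Tanner

namespace Tanner

/-! ### Coordinates on the local complexes -/

/-- The coordinate `n` of a subdivided interval. -/
def fc (ℓ : ℕ) [NeZero ℓ] (n : ℕ) : Fin ℓ := Fin.ofNat ℓ n

theorem fc_val {ℓ : ℕ} [NeZero ℓ] {n : ℕ} (h : n < ℓ) : (fc ℓ n).val = n := by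
  simp [fc, Nat.mod_eq_of_lt h]

theorem fc_of_val {ℓ : ℕ} [NeZero ℓ] (a : Fin ℓ) : fc ℓ a.val = a := by
  apply Fin.ext; rw [fc_val a.isLt]

theorem fc_zero_val {ℓ : ℕ} [NeZero ℓ] : (fc ℓ 0).val = 0 := fc_val (Nat.pos_of_ne_zero (NeZero.ne ℓ))

/-- The cell over the point `v` at height `η`. -/
def pt {T : Tanner} {ℓ : ℕ} [NeZero ℓ] (v : T.V) (η : ℕ) : T.RawCell ℓ :=
  (v, fun _ => fc ℓ 0, fc 3 η)

/-- The cell with coordinate `α` on the edge from `v` to `w`, at height `η`. -/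
noncomputable def line {T : Tanner} {ℓ : ℕ} [NeZero ℓ] (v w : T.V) (α η : ℕ) : T.RawCell ℓ :=
  (if α = 0 then v else w, fun u => if u = w then fc ℓ α else fc ℓ 0, fc 3 η)

/-- The cell with coordinates `(α, β)` on the square `(x, q, z, q')`, at height `η`. -/
noncomputable def sqr {T : Tanner} {ℓ : ℕ} [NeZero ℓ] (x q q' z : T.V) (α β η : ℕ) : T.RawCell ℓ :=
  (if α = 0 then (if β = 0 then x else q') else if β = 0 then q else z,
    fun u => if u = q then fc ℓ α else if u = q' then fc ℓ β else fc ℓ 0, fc 3 η)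

/-- `(x, q, z, q')` is a square. -/
structure Sq (T : Tanner) (x q q' z : T.V) : Prop where
  xq : T.inc x q
  xq' : T.inc x q'
  qz : T.inc q z
  q'z : T.inc q' z
  ne : q ≠ q'
  only : ∀ w, T.inc x w → T.inc w z → w = q ∨ w = q'

theorem Sq.symm {T : Tanner} {x q q' z : T.V} (s : Sq T x q q' z) : Sq T x q' q z :=
  ⟨s.xq', s.xq, s.q'z, s.qz, s.ne.symm, fun w h h' => (s.only w h h').symm⟩

theorem Nice.exists_sq {T : Tanner} (hT : T.Nice) {x q z : T.V} (h : T.inc x q) (h' : T.inc q z) :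
    ∃ q', Sq T x q q' z := by
  obtain ⟨q', hne, ha, hb, hu⟩ := hT.diamond h h'
  exact ⟨q', h, ha, h', hb, hne.symm, hu⟩

/-- The other qubit of the square with vertices `x, q, z`. -/
noncomputable def oth (T : Tanner) (x q z : T.V) : T.V :=
  if h : ∃ q', Sq T x q q' z then h.choose else q

theorem Nice.sq_oth {T : Tanner} (hT : T.Nice) {x q z : T.V} (h : T.inc x q) (h' : T.inc q z) :
    Sq T x q (oth T x q z) z := by
  have hex := hT.exists_sq h h'
  rw [oth, dif_pos hex]
  exact hex.choose_spec

theorem Sq.oth_eq {T : Tanner} (hT : T.Nice) {x q q' z : T.V} (s : Sq T x q q' z) :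
    oth T x q z = q' := by
  have s' := hT.sq_oth s.xq s.qz
  rcases s.only _ s'.xq' s'.q'z with h | h
  · exact absurd h s'.ne.symm
  · exact h

/-- Admissible coordinates on a subdivided edge of a star. -/
def LineOK (ℓ α η : ℕ) : Prop := α < ℓ ∧ η < 3 ∧ (η = 1 → α + 1 = ℓ)

/-- Admissible coordinates on a subdivided square of a star. -/
def SqOK (ℓ α β η : ℕ) : Prop := α < ℓ ∧ β < ℓ ∧ η < 3 ∧ (η = 1 → α + 1 = ℓ ∨ β + 1 = ℓ)

/-- Facets in edge coordinates. -/
def Fac1 (α' η' α η : ℕ) : Prop :=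
  (α % 2 = 1 ∧ (α' + 1 = α ∨ α' = α + 1) ∧ η' = η) ∨
    (η % 2 = 1 ∧ α' = α ∧ (η' + 1 = η ∨ η' = η + 1))

/-- Facets in square coordinates. -/
def Fac2 (α' β' η' α β η : ℕ) : Prop :=
  (α % 2 = 1 ∧ (α' + 1 = α ∨ α' = α + 1) ∧ β' = β ∧ η' = η) ∨
    (β % 2 = 1 ∧ α' = α ∧ (β' + 1 = β ∨ β' = β + 1) ∧ η' = η) ∨
    (η % 2 = 1 ∧ α' = α ∧ β' = β ∧ (η' + 1 = η ∨ η' = η + 1))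

theorem SqOK.symm {ℓ α β η : ℕ} (h : SqOK ℓ α β η) : SqOK ℓ β α η := by
  unfold SqOK at *; omega

theorem Fac2.symm {α' β' η' α β η : ℕ} (h : Fac2 α' β' η' α β η) : Fac2 β' α' η' β α η := by
  unfold Fac2 at *; omega

theorem Fac2.ok {ℓ α' β' η' α β η : ℕ} (hodd : ℓ % 2 = 1) (hf : Fac2 α' β' η' α β η)
    (h : SqOK ℓ α β η) : SqOK ℓ α' β' η' := by
  unfold Fac2 SqOK at *; omega

theorem Fac1.ok {ℓ α' η' α η : ℕ} (hodd : ℓ % 2 = 1) (hf : Fac1 α' η' α η)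
    (h : LineOK ℓ α η) : LineOK ℓ α' η' := by
  unfold Fac1 LineOK at *; omega

theorem LineOK.sq {ℓ α η : ℕ} (h : LineOK ℓ α η) : SqOK ℓ (ℓ - 1) α η := by
  unfold SqOK LineOK at *; omega

variable {T : Tanner} {ℓ : ℕ}

theorem up_true (u v : T.V) : T.up true u v ↔ T.inc u v := by simp [up]

theorem le_true (u v : T.V) : T.le true u v ↔
    u = v ∨ T.inc u v ∨ ∃ w, T.inc u w ∧ T.inc w v := by simp [le, up]

theorem le_refl (u : T.V) : T.le true u u := Or.inl rfl

theorem inc_le {u v : T.V} (h : T.inc u v) : T.le true u v := by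
  rw [le_true]; exact Or.inr (Or.inl h)

theorem inc_inc_le {u w v : T.V} (h : T.inc u w) (h' : T.inc w v) : T.le true u v := by
  rw [le_true]; exact Or.inr (Or.inr ⟨w, h, h'⟩)

theorem Nice.le_deg (hT : T.Nice) {u v : T.V} (h : T.le true u v) :
    u = v ∨ (T.inc u v ∧ T.deg v = T.deg u + 1) ∨
      ((∃ w, T.inc u w ∧ T.inc w v) ∧ T.deg v = T.deg u + 2) := by
  rw [le_true] at h
  rcases h with h | h | ⟨w, h1, h2⟩
  · exact Or.inl h
  · exact Or.inr (Or.inl ⟨h, hT.inc_deg h⟩)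
  · refine Or.inr (Or.inr ⟨⟨w, h1, h2⟩, ?_⟩)
    rw [hT.inc_deg h2, hT.inc_deg h1]

theorem Nice.le_trans_deg (hT : T.Nice) {u v : T.V} (h : T.le true u v) : T.deg u ≤ T.deg v := by
  rcases hT.le_deg h with h | h | h
  · rw [h]
  · omega
  · omega

theorem Nice.eq_of_le (hT : T.Nice) {u v : T.V} (h : T.le true u v) (hd : T.deg v ≤ T.deg u) :
    u = v := by
  rcases hT.le_deg h with h | h | h
  · exact h
  · omega
  · omega

theorem Nice.inc_of_le (hT : T.Nice) {u v : T.V} (h : T.le true u v)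
    (hd : T.deg v = T.deg u + 1) : T.inc u v := by
  rcases hT.le_deg h with h | h | h
  · rw [h] at hd; omega
  · exact h.1
  · omega

theorem Nice.sq_deg (hT : T.Nice) {x q q' z : T.V} (s : Sq T x q q' z) :
    T.deg x = 0 ∧ T.deg q = 1 ∧ T.deg q' = 1 ∧ T.deg z = 2 := by
  have h1 := hT.inc_deg s.xq
  have h2 := hT.inc_deg s.xq'
  have h3 := hT.inc_deg s.qz
  have h4 := hT.deg_le z
  omega

section Cells

variable [NeZero ℓ]

/-- The two qubits of a square play the same role. Through this symmetry statements about one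
coordinate of a square transfer to the other. -/
theorem sqr_swap {x q q' z : T.V} (hne : q ≠ q') (α β η : ℕ) :
    (sqr x q q' z α β η : T.RawCell ℓ) = sqr x q' q z β α η := by
  unfold sqr
  refine Prod.ext ?_ (Prod.ext ?_ rfl)
  · simp only; split_ifs <;> rfl
  · funext u
    simp only
    by_cases h1 : u = q
    · subst h1; simp [hne]
    · simp [h1]

theorem sqr_zero_right (x q q' z : T.V) (α η : ℕ) :
    (sqr x q q' z α 0 η : T.RawCell ℓ) = line x q α η := by
  unfold sqr line
  refine Prod.ext ?_ (Prod.ext ?_ rfl)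
  · simp
  · funext u
    simp

theorem sqr_zero_left {x q q' z : T.V} (hne : q ≠ q') (β η : ℕ) :
    (sqr x q q' z 0 β η : T.RawCell ℓ) = line x q' β η := by
  rw [sqr_swap hne, sqr_zero_right]

theorem line_zero (v w : T.V) (η : ℕ) : (line v w 0 η : T.RawCell ℓ) = pt v η := by
  unfold line pt
  simp

theorem sqr_coord_left (x q q' z : T.V) {α : ℕ} (β η : ℕ) (h : α < ℓ) :
    ((sqr x q q' z α β η : T.RawCell ℓ).2.1 q).val = α := by
  simp [sqr, fc_val h]

theorem sqr_coord_right {x q q' z : T.V} (hne : q ≠ q') {β : ℕ} (α η : ℕ) (h : β < ℓ) :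
    ((sqr x q q' z α β η : T.RawCell ℓ).2.1 q').val = β := by
  simp [sqr, fc_val h, hne.symm]

theorem sqr_height (x q q' z : T.V) {η : ℕ} (α β : ℕ) (h : η < 3) :
    ((sqr x q q' z α β η : T.RawCell ℓ).2.2).val = η := by
  simp [sqr, fc_val h]

theorem sqr_inj {x q q' z : T.V} (hne : q ≠ q') {α β η α' β' η' : ℕ} (h : SqOK ℓ α β η)
    (h' : SqOK ℓ α' β' η')
    (he : (sqr x q q' z α β η : T.RawCell ℓ) = sqr x q q' z α' β' η') :
    α = α' ∧ β = β' ∧ η = η' := by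
  refine ⟨?_, ?_, ?_⟩
  · rw [← sqr_coord_left x q q' z β η h.1, he, sqr_coord_left x q q' z β' η' h'.1]
  · rw [← sqr_coord_right (x := x) (z := z) hne α η h.2.1, he,
      sqr_coord_right hne α' η' h'.2.1]
  · rw [← sqr_height (ℓ := ℓ) x q q' z α β h.2.2.1, he, sqr_height x q q' z α' β' h'.2.2.1]

theorem line_coord (v w : T.V) {α : ℕ} (η : ℕ) (h : α < ℓ) :
    ((line v w α η : T.RawCell ℓ).2.1 w).val = α := by
  simp [line, fc_val h]

theorem line_height (v w : T.V) {η : ℕ} (α : ℕ) (h : η < 3) :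
    ((line v w α η : T.RawCell ℓ).2.2).val = η := by
  simp [line, fc_val h]

theorem line_inj {v w : T.V} {α η α' η' : ℕ} (h : LineOK ℓ α η) (h' : LineOK ℓ α' η')
    (he : (line v w α η : T.RawCell ℓ) = line v w α' η') : α = α' ∧ η = η' := by
  refine ⟨?_, ?_⟩
  · rw [← line_coord v w η h.1, he, line_coord v w η' h'.1]
  · rw [← line_height (ℓ := ℓ) v w α h.2.1, he, line_height v w α' h'.2.1]

theorem pt_height (v : T.V) {η : ℕ} (h : η < 3) : ((pt v η : T.RawCell ℓ).2.2).val = η := by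
  simp [pt, fc_val h]

theorem cellDim_pt (v : T.V) {η : ℕ} (h : η < 3) : cellDim (pt v η : T.RawCell ℓ) = η % 2 := by
  simp [cellDim, pt, fc_val h, fc_zero_val]

theorem cellDim_line (v w : T.V) {α η : ℕ} (h : LineOK ℓ α η) :
    cellDim (line v w α η : T.RawCell ℓ) = α % 2 + η % 2 := by
  unfold cellDim
  rw [line_height v w α h.2.1]
  congr 1
  have : (Finset.univ.filter fun u => ((line v w α η : T.RawCell ℓ).2.1 u).val % 2 = 1)
      = if α % 2 = 1 then {w} else ∅ := by
    ext u
    rw [Finset.mem_filter]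
    by_cases hu : u = w
    · subst hu
      rw [line_coord v u η h.1]
      split_ifs with h1 <;> simp [h1]
    · simp only [line, if_neg hu, fc_zero_val]
      split_ifs <;> simp [hu]
  rw [this]
  split_ifs with h1
  · simp [h1]
  · simp; omega

theorem cellDim_sqr {x q q' z : T.V} (hne : q ≠ q') {α β η : ℕ} (h : SqOK ℓ α β η) :
    cellDim (sqr x q q' z α β η : T.RawCell ℓ) = α % 2 + β % 2 + η % 2 := by
  unfold cellDim
  rw [sqr_height x q q' z α β h.2.2.1]
  congr 1
  have : (Finset.univ.filter fun u => ((sqr x q q' z α β η : T.RawCell ℓ).2.1 u).val % 2 = 1)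
      = (if α % 2 = 1 then {q} else ∅) ∪ (if β % 2 = 1 then {q'} else ∅) := by
    ext u
    rw [Finset.mem_filter, Finset.mem_union]
    by_cases hu : u = q
    · subst hu
      rw [sqr_coord_left _ _ _ _ _ _ h.1]
      split_ifs with h1 h2 h2 <;> simp [h1, hne]
    · by_cases hu' : u = q'
      · subst hu'
        rw [sqr_coord_right hne _ _ h.2.1]
        split_ifs with h1 h2 h2 <;> simp [h2, hu]
      · simp only [sqr, if_neg hu, if_neg hu', fc_zero_val]
        split_ifs with h1 h2 h2 <;> simp [hu, hu']
  rw [this, Finset.card_union_of_disjoint]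
  · split_ifs with h1 h2 h2 <;> simp <;> omega
  · split_ifs <;> simp [hne]

theorem Nice.isCell_pt (hT : T.Nice) {z : T.V} (hz : T.deg z = 2) {η : ℕ} (h : η < 3) (h1 : η ≠ 1) :
    T.IsCell ℓ true z (pt z η) := by
  refine ⟨le_refl z, fun w => ?_, fun h2 => ?_⟩
  · simp only [pt, fc_zero_val, ne_eq, not_true_eq_false, false_iff, up_true]
    rintro ⟨h2, -⟩
    have := hT.inc_deg h2
    have := hT.deg_le w
    omega
  · exact absurd (by have := congrArg Fin.val h2; simpa [pt, fc_val h] using this) h1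

/-- The star of a `Z`-check is a point with empty boundary. A vertical cell would need a coordinate
`ℓ - 1`, which is nonzero, so `Y_z` is just two points, at heights `0` and `2`. -/
theorem Nice.eq_pt (hT : T.Nice) (h3 : 3 ≤ ℓ) {z : T.V} (hz : T.deg z = 2) {c : T.RawCell ℓ}
    (hc : T.IsCell ℓ true z c) : c = pt z c.2.2.val ∧ c.2.2.val ≠ 1 := by
  obtain ⟨h1, h2, h4⟩ := hc
  have hl : c.1 = z := (hT.eq_of_le h1 (by rw [hz]; exact hT.deg_le _)).symm
  have h0 : ∀ w, (c.2.1 w).val = 0 := by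
    intro w
    by_contra hw
    have := ((h2 w).1 hw).1
    rw [up_true] at this
    have := hT.inc_deg this
    have := hT.deg_le w
    omega
  constructor
  · refine Prod.ext hl (Prod.ext (funext fun w => Fin.ext ?_) ?_)
    · rw [h0 w]; simp [pt, fc_zero_val]
    · simp [pt, fc_of_val]
  · intro h5
    obtain ⟨w, hw⟩ := h4 (Fin.ext h5)
    rw [h0 w] at hw
    omega

theorem Nice.isCell_line (hT : T.Nice) {q z : T.V} (hqz : T.inc q z) (hq : T.deg q = 1) {α η : ℕ}
    (h : LineOK ℓ α η) : T.IsCell ℓ true q (line q z α η) := by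
  have hz := hT.inc_deg hqz
  refine ⟨?_, fun w => ?_, fun h2 => ⟨z, ?_⟩⟩
  · unfold line
    simp only
    split_ifs
    · exact le_refl q
    · exact inc_le hqz
  · rw [up_true]
    by_cases hw : w = z
    · subst hw
      rw [line_coord _ _ _ h.1]
      unfold line
      simp only
      split_ifs with h1
      · simp only [h1, ne_eq, not_true_eq_false, false_iff]
        rintro ⟨-, h5⟩
        have := hT.le_trans_deg h5
        omega
      · simp [h1, hqz, le_refl]
    · simp only [line, if_neg hw, fc_zero_val, ne_eq, not_true_eq_false, false_iff]
      rintro ⟨h5, h6⟩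
      have := hT.inc_deg h5
      split_ifs at h6 with h1
      · have := hT.le_trans_deg h6
        omega
      · exact hw (hT.eq_of_le h6 (by omega))
  · rw [line_coord _ _ _ h.1]
    refine h.2.2 ?_
    have := congrArg Fin.val h2
    rwa [line_height _ _ _ h.2.1] at this

/-- Coordinates are nonzero only along edges in the closure of the labelled cell, so the labels `q`
and `z` leave at most the coordinate towards `z`. -/
theorem Nice.eq_line (hT : T.Nice) (h3 : 3 ≤ ℓ) {q z : T.V} (hqz : T.inc q z) (hq : T.deg q = 1)
    {c : T.RawCell ℓ} (hc : T.IsCell ℓ true q c) (hl : c.1 = q ∨ c.1 = z) :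
    c = line q z (c.2.1 z).val c.2.2.val ∧ LineOK ℓ (c.2.1 z).val c.2.2.val := by
  obtain ⟨h1, h2, h4⟩ := hc
  have hz := hT.inc_deg hqz
  have h0 : ∀ w, w ≠ z → (c.2.1 w).val = 0 := by
    intro w hwz
    by_contra hw
    obtain ⟨h5, h6⟩ := (h2 w).1 hw
    rw [up_true] at h5
    have := hT.inc_deg h5
    rcases hl with hl | hl
    · rw [hl] at h6
      have := hT.le_trans_deg h6
      omega
    · rw [hl] at h6
      exact hwz (hT.eq_of_le h6 (by omega))
  have hz0 : (c.2.1 z).val ≠ 0 ↔ c.1 = z := by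
    rw [h2 z, up_true]
    constructor
    · rintro ⟨-, h6⟩
      rcases hl with hl | hl
      · rw [hl] at h6
        have := hT.le_trans_deg h6
        omega
      · exact hl
    · intro h
      exact ⟨hqz, by rw [h]; exact le_refl z⟩
  refine ⟨Prod.ext ?_ (Prod.ext (funext fun w => ?_) ?_), (c.2.1 z).isLt, c.2.2.isLt, fun h5 => ?_⟩
  · unfold line
    simp only
    split_ifs with h
    · rcases hl with hl | hl
      · exact hl
      · exact absurd h (hz0.2 hl)
    · exact hz0.1 h
  · by_cases hw : w = z
    · subst hw; simp [line, fc_of_val]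
    · simp only [line, if_neg hw]
      apply Fin.ext
      rw [h0 w hw, fc_zero_val]
  · simp [line, fc_of_val]
  · obtain ⟨w, hw⟩ := h4 (Fin.ext h5)
    by_cases hwz : w = z
    · rw [hwz] at hw; exact hw
    · rw [h0 w hwz] at hw; omega

theorem Nice.exists_line (hT : T.Nice) (h3 : 3 ≤ ℓ) {q : T.V} (hq : T.deg q = 1) {c : T.RawCell ℓ}
    (hc : T.IsCell ℓ true q c) :
    ∃ z α η, T.inc q z ∧ LineOK ℓ α η ∧ c = line q z α η := by
  have h1 := hc.1
  by_cases h : c.1 = q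
  · obtain ⟨z, hz⟩ := hT.above q (by omega)
    obtain ⟨he, hok⟩ := hT.eq_line h3 hz hq hc (Or.inl h)
    exact ⟨z, _, _, hz, hok, he⟩
  · rcases hT.le_deg h1 with h2 | h2 | h2
    · exact absurd h2.symm h
    · obtain ⟨he, hok⟩ := hT.eq_line h3 h2.1 hq hc (Or.inr rfl)
      exact ⟨_, _, _, h2.1, hok, he⟩
    · have := hT.deg_le c.1
      omega

theorem sqr_label_cases (x q q' z : T.V) (α β η : ℕ) :
    ((sqr x q q' z α β η : T.RawCell ℓ).1 = x ∧ α = 0 ∧ β = 0) ∨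
    ((sqr x q q' z α β η : T.RawCell ℓ).1 = q' ∧ α = 0 ∧ β ≠ 0) ∨
    ((sqr x q q' z α β η : T.RawCell ℓ).1 = q ∧ α ≠ 0 ∧ β = 0) ∨
    ((sqr x q q' z α β η : T.RawCell ℓ).1 = z ∧ α ≠ 0 ∧ β ≠ 0) := by
  unfold sqr
  simp only
  split_ifs with h1 h2 h2 <;> simp [h1, h2]

theorem Nice.isCell_sqr (hT : T.Nice) {x q q' z : T.V} (s : Sq T x q q' z) {α β η : ℕ}
    (h : SqOK ℓ α β η) : T.IsCell ℓ true x (sqr x q q' z α β η) := by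
  obtain ⟨hx, hq, hq', hz⟩ := hT.sq_deg s
  have hle : ∀ w t : T.V, T.inc x w → T.deg t = 1 → T.le true w t → w = t := by
    intro w t hw ht hl
    have := hT.inc_deg hw
    exact hT.eq_of_le hl (by omega)
  have hle0 : ∀ w t : T.V, T.inc x w → T.deg t = 0 → ¬ T.le true w t := by
    intro w t hw ht hl
    have := hT.inc_deg hw
    have := hT.le_trans_deg hl
    omega
  have hlz : ∀ w, T.inc x w → T.le true w z → w = q ∨ w = q' := by
    intro w hw hl
    have := hT.inc_deg hw
    exact s.only w hw (hT.inc_of_le hl (by omega))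
  refine ⟨?_, fun w => ?_, fun h2 => ?_⟩
  · rcases sqr_label_cases (ℓ := ℓ) x q q' z α β η with h1 | h1 | h1 | h1 <;> rw [h1.1]
    · exact le_refl x
    · exact inc_le s.xq'
    · exact inc_le s.xq
    · exact inc_inc_le s.xq s.qz
  · rw [up_true]
    by_cases hw : w = q
    · subst hw
      rw [sqr_coord_left _ _ _ _ _ _ h.1]
      rcases sqr_label_cases (ℓ := ℓ) x w q' z α β η with h1 | h1 | h1 | h1 <;> rw [h1.1]
      · simp only [h1.2.1, ne_eq, not_true_eq_false, false_iff]
        exact fun h5 => hle0 _ _ h5.1 hx h5.2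
      · simp only [h1.2.1, ne_eq, not_true_eq_false, false_iff]
        exact fun h5 => s.ne (hle _ _ h5.1 hq' h5.2)
      · simp [h1.2.1, s.xq, le_refl]
      · simp [h1.2.1, s.xq, inc_le s.qz]
    · by_cases hw' : w = q'
      · subst hw'
        rw [sqr_coord_right s.ne _ _ h.2.1]
        rcases sqr_label_cases (ℓ := ℓ) x q w z α β η with h1 | h1 | h1 | h1 <;> rw [h1.1]
        · simp only [h1.2.2, ne_eq, not_true_eq_false, false_iff]
          exact fun h5 => hle0 _ _ h5.1 hx h5.2
        · simp [h1.2.2, s.xq', le_refl]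
        · simp only [h1.2.2, ne_eq, not_true_eq_false, false_iff]
          exact fun h5 => s.ne.symm (hle _ _ h5.1 hq h5.2)
        · simp [h1.2.2, s.xq', inc_le s.q'z]
      · have h0 : ((sqr x q q' z α β η : T.RawCell ℓ).2.1 w).val = 0 := by
          simp [sqr, hw, hw', fc_zero_val]
        rw [h0]
        simp only [ne_eq, not_true_eq_false, false_iff]
        rintro ⟨h5, h6⟩
        rcases sqr_label_cases (ℓ := ℓ) x q q' z α β η with h1 | h1 | h1 | h1 <;> rw [h1.1] at h6
        · exact hle0 _ _ h5 hx h6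
        · exact hw' (hle _ _ h5 hq' h6)
        · exact hw (hle _ _ h5 hq h6)
        · rcases hlz w h5 h6 with h7 | h7
          · exact hw h7
          · exact hw' h7
  · have h5 := congrArg Fin.val h2
    rw [sqr_height _ _ _ _ _ _ h.2.2.1] at h5
    rcases h.2.2.2 h5 with h6 | h6
    · exact ⟨q, by rw [sqr_coord_left _ _ _ _ _ _ h.1]; exact h6⟩
    · exact ⟨q', by rw [sqr_coord_right s.ne _ _ h.2.1]; exact h6⟩

/-- Normal form of the cells on a closed square: a label below `z` is one of the four vertices of
the square, and by `Sq.only` no coordinate other than those along `q` and `q'` can be nonzero. -/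
theorem Nice.eq_sqr (hT : T.Nice) (h3 : 3 ≤ ℓ) {x q q' z : T.V} (s : Sq T x q q' z)
    {c : T.RawCell ℓ} (hc : T.IsCell ℓ true x c) (hle : T.le true c.1 z) :
    c = sqr x q q' z (c.2.1 q).val (c.2.1 q').val c.2.2.val ∧
      SqOK ℓ (c.2.1 q).val (c.2.1 q').val c.2.2.val := by
  obtain ⟨hx, hq, hq', hz⟩ := hT.sq_deg s
  obtain ⟨h1, h2, h4⟩ := hc
  simp only [up_true] at h2
  have hl : c.1 = x ∨ c.1 = q ∨ c.1 = q' ∨ c.1 = z := by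
    rcases hT.le_deg h1 with h | h | h
    · exact Or.inl h.symm
    · have := hT.inc_of_le hle (by omega)
      rcases s.only _ h.1 this with h | h <;> simp [h]
    · have := hT.eq_of_le hle (by omega)
      simp [this]
  have h0 : ∀ w, w ≠ q → w ≠ q' → (c.2.1 w).val = 0 := by
    intro w hw hw'
    by_contra hne
    obtain ⟨h5, h6⟩ := (h2 w).1 hne
    have := hT.inc_deg h5
    rcases hl with hl | hl | hl | hl <;> rw [hl] at h6
    · have := hT.le_trans_deg h6
      omega
    · exact hw (hT.eq_of_le h6 (by omega))
    · exact hw' (hT.eq_of_le h6 (by omega))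
    · rcases s.only w h5 (hT.inc_of_le h6 (by omega)) with h7 | h7
      · exact hw h7
      · exact hw' h7
  have hqx : ¬ T.le true q x := fun h => by have := hT.le_trans_deg h; omega
  have hq'x : ¬ T.le true q' x := fun h => by have := hT.le_trans_deg h; omega
  have hqq' : ¬ T.le true q q' := fun h => s.ne (hT.eq_of_le h (by omega))
  have hq'q : ¬ T.le true q' q := fun h => s.ne.symm (hT.eq_of_le h (by omega))
  have hcq := h2 q
  have hcq' := h2 q'
  refine ⟨Prod.ext ?_ (Prod.ext (funext fun w => ?_) ?_), (c.2.1 q).isLt, (c.2.1 q').isLt,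
    c.2.2.isLt, fun h5 => ?_⟩
  · rcases hl with hl | hl | hl | hl <;> rw [hl] at hcq hcq'
    · have e1 : (c.2.1 q).val = 0 := by by_contra h; exact hqx (hcq.1 h).2
      have e2 : (c.2.1 q').val = 0 := by by_contra h; exact hq'x (hcq'.1 h).2
      simp [sqr, e1, e2, hl]
    · have e1 : (c.2.1 q).val ≠ 0 := hcq.2 ⟨s.xq, le_refl q⟩
      have e2 : (c.2.1 q').val = 0 := by by_contra h; exact hq'q (hcq'.1 h).2
      simp only [sqr, if_neg e1, if_pos e2, hl]
    · have e1 : (c.2.1 q).val = 0 := by by_contra h; exact hqq' (hcq.1 h).2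
      have e2 : (c.2.1 q').val ≠ 0 := hcq'.2 ⟨s.xq', le_refl q'⟩
      simp only [sqr, if_pos e1, if_neg e2, hl]
    · have e1 : (c.2.1 q).val ≠ 0 := hcq.2 ⟨s.xq, inc_le s.qz⟩
      have e2 : (c.2.1 q').val ≠ 0 := hcq'.2 ⟨s.xq', inc_le s.q'z⟩
      simp only [sqr, if_neg e1, if_neg e2, hl]
  · by_cases hw : w = q
    · subst hw; simp [sqr, fc_of_val]
    · by_cases hw' : w = q'
      · subst hw'; simp [sqr, hw, fc_of_val]
      · simp only [sqr, if_neg hw, if_neg hw']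
        apply Fin.ext
        rw [h0 w hw hw', fc_zero_val]
  · simp [sqr, fc_of_val]
  · obtain ⟨w, hw⟩ := h4 (Fin.ext h5)
    by_cases hwq : w = q
    · rw [hwq] at hw; exact Or.inl hw
    · by_cases hwq' : w = q'
      · rw [hwq'] at hw; exact Or.inr hw
      · rw [h0 w hwq hwq'] at hw; omega

/-- The square is not unique for cells on an axis or at the centre. The last clause says that a cell
on an axis is written with this axis first; `Nice.string_indicator` relies on it. -/
theorem Nice.exists_sqr (hT : T.Nice) (h3 : 3 ≤ ℓ) {x : T.V} (hx : T.deg x = 0) {c : T.RawCell ℓ}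
    (hc : T.IsCell ℓ true x c) :
    ∃ q q' z α β η, Sq T x q q' z ∧ SqOK ℓ α β η ∧ c = sqr x q q' z α β η ∧
      (c.1 = z ∨ c.1 = q ∨ c.1 = x) := by
  have key : ∃ q z, T.inc x q ∧ T.inc q z ∧ T.le true c.1 z ∧ (c.1 = z ∨ c.1 = q ∨ c.1 = x) := by
    rcases hT.le_deg hc.1 with h | h | h
    · obtain ⟨q, hq⟩ := hT.above x (by omega)
      obtain ⟨z, hz⟩ := hT.above q (by rw [hT.inc_deg hq]; omega)
      exact ⟨q, z, hq, hz, by rw [← h]; exact inc_inc_le hq hz, by simp [h]⟩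
    · obtain ⟨z, hz⟩ := hT.above c.1 (by omega)
      exact ⟨c.1, z, h.1, hz, inc_le hz, by simp⟩
    · obtain ⟨⟨q, h1, h2⟩, -⟩ := h
      exact ⟨q, c.1, h1, h2, le_refl _, by simp⟩
  obtain ⟨q, z, hq, hz, hl, hlab⟩ := key
  obtain ⟨q', s⟩ := hT.exists_sq hq hz
  obtain ⟨he, hok⟩ := hT.eq_sqr h3 s hc hl
  exact ⟨q, q', z, _, _, _, s, hok, he, hlab⟩

end Cells

end Tanner

namespace Tanner

variable {T : Tanner} {ℓ : ℕ}

/-! ### Incidences in the replaced complex -/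

theorem Nice.le_trans (hT : T.Nice) {u v w : T.V} (h : T.le true u v) (h' : T.le true v w) :
    T.le true u w := by
  rcases hT.le_deg h with h1 | h1 | h1
  · rw [h1]; exact h'
  · rcases hT.le_deg h' with h2 | h2 | h2
    · rw [← h2]; exact h
    · exact inc_inc_le h1.1 h2.1
    · have := hT.deg_le w
      omega
  · have := hT.deg_le w
    have := hT.le_trans_deg h'
    rw [← hT.eq_of_le h' (by omega)]
    exact h

/-- The vertex and the raw cell of a vertex of the replaced complex. -/
def raw (p : (replace ℓ true T).V) : T.V × T.RawCell ℓ := (p.1, p.2.1)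

theorem raw_injective : Function.Injective (raw : (replace ℓ true T).V → _) := by
  rintro ⟨v, c, hc⟩ ⟨v', c', hc'⟩ h
  simp only [raw, Prod.mk.injEq] at h
  obtain ⟨rfl, rfl⟩ := h
  rfl

theorem exists_raw {v : T.V} {c : T.RawCell ℓ} (hc : T.IsCell ℓ true v c) :
    ∃ p : (replace ℓ true T).V, raw p = (v, c) := ⟨⟨v, c, hc⟩, rfl⟩

theorem raw_cell {p : (replace ℓ true T).V} {v : T.V} {c : T.RawCell ℓ} (h : raw p = (v, c)) :
    T.IsCell ℓ true v c := by
  obtain ⟨v', c', hc'⟩ := p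
  simp only [raw, Prod.mk.injEq] at h
  obtain ⟨rfl, rfl⟩ := h
  exact hc'

theorem raw_fst {p : (replace ℓ true T).V} {v : T.V} {c : T.RawCell ℓ} (h : raw p = (v, c)) :
    p.1 = v := congrArg Prod.fst h

theorem raw_snd {p : (replace ℓ true T).V} {v : T.V} {c : T.RawCell ℓ} (h : raw p = (v, c)) :
    p.2.1 = c := congrArg Prod.snd h

theorem replace_inc (p p' : (replace ℓ true T).V) : (replace ℓ true T).inc p p' ↔
    ((raw p).1 = (raw p').1 ∧ IsFacet true (raw p).2 (raw p').2) ∨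
      (T.inc (raw p).1 (raw p').1 ∧
        IsInclusion true (raw p).1 (raw p').1 (raw p).2 (raw p').2) := by
  simp [replace, up, raw]

theorem replace_deg {p : (replace ℓ true T).V} {v : T.V} {c : T.RawCell ℓ} (h : raw p = (v, c)) :
    (replace ℓ true T).deg p = T.deg v + cellDim c := by
  rw [← raw_fst h, ← raw_snd h]
  simp [replace]

theorem coord_cases {m n : ℕ} (h : m = n ∨ n % 2 = 1 ∧ Nat.dist m n = 1) :
    m = n ∨ n % 2 = 1 ∧ m % 2 = 0 ∧ (m + 1 = n ∨ m = n + 1) := by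
  unfold Nat.dist at h; omega

/-- A coordinate that changes goes from odd to even and costs one dimension, and the height behaves
in the same way. As the dimension drops by exactly one, exactly one of the three changes. -/
theorem Fac2.of_coord {α β η a b e : ℕ} (he : e < 3)
    (hd : α % 2 + β % 2 + η % 2 = a % 2 + b % 2 + e % 2 + 1)
    (h1 : a = α ∨ α % 2 = 1 ∧ Nat.dist a α = 1) (h2 : b = β ∨ β % 2 = 1 ∧ Nat.dist b β = 1)
    (h3 : e = η ∨ η = 1) : Fac2 a b e α β η := by
  unfold Fac2
  rcases coord_cases h1 with rfl | ⟨p1, p2, p3⟩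
  · rcases coord_cases h2 with rfl | ⟨r1, r2, r3⟩
    · right; right
      rcases h3 with rfl | rfl <;> omega
    · right; left
      refine ⟨r1, rfl, r3, ?_⟩
      omega
  · left
    refine ⟨p1, p3, ?_, ?_⟩
    · rcases coord_cases h2 with rfl | ⟨r1, r2, r3⟩
      · rfl
      · omega
    · rcases coord_cases h2 with rfl | ⟨r1, r2, r3⟩
      · omega
      · omega

theorem Fac1.of_coord {α η a e : ℕ} (he : e < 3)
    (hd : α % 2 + η % 2 = a % 2 + e % 2 + 1)
    (h1 : a = α ∨ α % 2 = 1 ∧ Nat.dist a α = 1) (h3 : e = η ∨ η = 1) : Fac1 a e α η := by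
  unfold Fac1
  rcases coord_cases h1 with rfl | ⟨p1, p2, p3⟩
  · right
    rcases h3 with rfl | rfl <;> omega
  · left
    refine ⟨p1, p3, ?_⟩
    omega

variable [NeZero ℓ]

theorem Nice.facet_sqr_iff (hT : T.Nice) (h3 : 3 ≤ ℓ) (hodd : ℓ % 2 = 1) {x q q' z : T.V}
    (s : Sq T x q q' z) {α β η : ℕ} (ok : SqOK ℓ α β η) {c : T.RawCell ℓ}
    (hc : T.IsCell ℓ true x c) :
    IsFacet true c (sqr x q q' z α β η) ↔
      ∃ α' β' η', Fac2 α' β' η' α β η ∧ c = sqr x q q' z α' β' η' := by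
  have hlz : ∀ α β η, T.le true (sqr x q q' z α β η : T.RawCell ℓ).1 z := by
    intro α β η
    rcases sqr_label_cases (ℓ := ℓ) x q q' z α β η with h1 | h1 | h1 | h1 <;> rw [h1.1]
    · exact inc_inc_le s.xq s.qz
    · exact inc_le s.q'z
    · exact inc_le s.qz
    · exact le_refl z
  constructor
  · rintro ⟨hd, hl, hcoord, hh⟩
    obtain ⟨he, hok⟩ := hT.eq_sqr h3 s hc (hT.le_trans hl (hlz α β η))
    have h1 := hcoord q
    have h2 := hcoord q'
    rw [Fin.ext_iff, sqr_coord_left _ _ _ _ _ _ ok.1] at h1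
    rw [Fin.ext_iff, sqr_coord_right s.ne _ _ ok.2.1] at h2
    rw [Fin.ext_iff, Fin.ext_iff, sqr_height _ _ _ _ _ _ ok.2.2.1, Fin.val_one] at hh
    rw [cellDim_sqr s.ne ok] at hd
    have hd' : cellDim c = _ := (congrArg cellDim he).trans (cellDim_sqr s.ne hok)
    rw [hd'] at hd
    exact ⟨_, _, _, Fac2.of_coord hok.2.2.1 hd h1 h2 hh, he⟩
  · rintro ⟨α', β', η', hf, rfl⟩
    have ok' := hf.ok hodd ok
    refine ⟨?_, ?_, fun w => ?_, ?_⟩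
    · rw [cellDim_sqr s.ne ok, cellDim_sqr s.ne ok']
      unfold Fac2 at hf
      omega
    · have hz0 : (α = 0 → α' = 0) ∧ (β = 0 → β' = 0) := by
        unfold Fac2 at hf; omega
      rcases sqr_label_cases (ℓ := ℓ) x q q' z α' β' η' with h1 | h1 | h1 | h1 <;>
      rcases sqr_label_cases (ℓ := ℓ) x q q' z α β η with h2 | h2 | h2 | h2 <;>
      rw [h1.1, h2.1] <;>
      first
        | exact le_refl _
        | exact inc_le s.xq
        | exact inc_le s.xq'
        | exact inc_le s.qz
        | exact inc_le s.q'z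
        | exact inc_inc_le s.xq s.qz
        | (exfalso; omega)
    · by_cases hw : w = q
      · subst hw
        rw [Fin.ext_iff, sqr_coord_left _ _ _ _ _ _ ok.1, sqr_coord_left _ _ _ _ _ _ ok'.1]
        unfold Nat.dist
        unfold Fac2 at hf
        omega
      · by_cases hw' : w = q'
        · subst hw'
          rw [Fin.ext_iff, sqr_coord_right s.ne _ _ ok.2.1, sqr_coord_right s.ne _ _ ok'.2.1]
          unfold Nat.dist
          unfold Fac2 at hf
          omega
        · left
          simp [sqr, hw, hw']
    · rw [Fin.ext_iff, Fin.ext_iff, sqr_height _ _ _ _ _ _ ok.2.2.1,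
        sqr_height _ _ _ _ _ _ ok'.2.2.1, Fin.val_one]
      unfold Fac2 at hf
      unfold SqOK at ok
      omega

theorem Nice.facet_line_iff (hT : T.Nice) (h3 : 3 ≤ ℓ) (hodd : ℓ % 2 = 1) {q z : T.V}
    (hqz : T.inc q z) (hq : T.deg q = 1) {α η : ℕ} (ok : LineOK ℓ α η) {c : T.RawCell ℓ}
    (hc : T.IsCell ℓ true q c) :
    IsFacet true c (line q z α η) ↔ ∃ α' η', Fac1 α' η' α η ∧ c = line q z α' η' := by
  have hz := hT.inc_deg hqz
  constructor
  · rintro ⟨hd, hl, hcoord, hh⟩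
    have hl' : c.1 = q ∨ c.1 = z := by
      have hlz : T.le true c.1 z := by
        refine hT.le_trans hl ?_
        unfold line
        simp only
        split_ifs
        · exact inc_le hqz
        · exact le_refl z
      rcases hT.le_deg hc.1 with h | h | h
      · exact Or.inl h.symm
      · exact Or.inr (hT.eq_of_le hlz (by omega))
      · have := hT.deg_le c.1
        omega
    obtain ⟨he, hok⟩ := hT.eq_line h3 hqz hq hc hl'
    have h1 := hcoord z
    rw [Fin.ext_iff, line_coord _ _ _ ok.1] at h1
    rw [Fin.ext_iff, Fin.ext_iff, line_height _ _ _ ok.2.1, Fin.val_one] at hh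
    rw [cellDim_line _ _ ok] at hd
    have hd' : cellDim c = _ := (congrArg cellDim he).trans (cellDim_line _ _ hok)
    rw [hd'] at hd
    exact ⟨_, _, Fac1.of_coord hok.2.1 hd h1 hh, he⟩
  · rintro ⟨α', η', hf, rfl⟩
    have ok' := hf.ok hodd ok
    refine ⟨?_, ?_, fun w => ?_, ?_⟩
    · rw [cellDim_line _ _ ok, cellDim_line _ _ ok']
      unfold Fac1 at hf
      omega
    · have hz0 : α = 0 → α' = 0 := by
        unfold Fac1 at hf; omega
      unfold line
      simp only
      split_ifs with h1 h2 h2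
      · exact le_refl q
      · exact inc_le hqz
      · exact absurd (hz0 h2) h1
      · exact le_refl z
    · by_cases hw : w = z
      · subst hw
        rw [Fin.ext_iff, line_coord _ _ _ ok.1, line_coord _ _ _ ok'.1]
        unfold Nat.dist
        unfold Fac1 at hf
        omega
      · left
        simp [line, hw]
    · rw [Fin.ext_iff, Fin.ext_iff, line_height _ _ _ ok.2.1, line_height _ _ _ ok'.2.1,
        Fin.val_one]
      unfold Fac1 at hf
      unfold LineOK at ok
      omega

/-- `Y_q` is the side of `Y_x` on which the coordinate along `(x, q)` is maximal; moving from `q`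
towards `z` is moving parallel to `(x, q')`. -/
theorem Nice.inclusion_line_iff (hT : T.Nice) (h3 : 3 ≤ ℓ) {x q q' z : T.V}
    (s : Sq T x q q' z) {β η : ℕ} (ok : LineOK ℓ β η) {c : T.RawCell ℓ}
    (hc : T.IsCell ℓ true x c) :
    IsInclusion true x q c (line q z β η) ↔ c = sqr x q q' z (ℓ - 1) β η := by
  obtain ⟨hx, hq, hq', hz⟩ := hT.sq_deg s
  have hlab : (sqr x q q' z (ℓ - 1) β η : T.RawCell ℓ).1 = (line q z β η : T.RawCell ℓ).1 := by
    have : ℓ - 1 ≠ 0 := by omega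
    simp [sqr, line, this]
  have okk := ok.sq
  constructor
  · rintro ⟨h1, h2, h4, h5⟩
    have hle : T.le true c.1 z := by
      rw [h1]
      unfold line
      simp only
      split_ifs
      · exact inc_le s.qz
      · exact le_refl z
    obtain ⟨he, hok⟩ := hT.eq_sqr h3 s hc hle
    have e1 : (c.2.1 q).val = ℓ - 1 := by omega
    have e2 : c.2.2.val = η := by rw [h2, line_height _ _ _ ok.2.1]
    -- For `β = 0` the cell lies over the edge `(x, q)` and the clause of `IsInclusion` on the other
    -- coordinate is void; there the label `q` forces the coordinate to be zero.
    have e3 : (c.2.1 q').val = β := by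
      by_cases hb : β = 0
      · by_contra hne
        have hl2 : c.1 = q := by rw [h1]; simp [line, hb]
        have h6 := ((hc.2.1 q').1 (by omega)).2
        rw [hl2] at h6
        exact s.ne.symm (hT.eq_of_le h6 (by omega))
      · have hl2 : c.1 = z := by rw [h1]; simp [line, hb]
        have h6 := h5 q' ((up_true _ _).2 s.xq') s.ne.symm (by rw [hl2]; exact inc_le s.q'z)
        rw [h6, hl2, line_coord _ _ _ ok.1]
    rw [e1, e2, e3] at he
    exact he
  · rintro rfl
    refine ⟨hlab, ?_, ?_, ?_⟩
    · rfl
    · rw [sqr_coord_left _ _ _ _ _ _ okk.1]; omega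
    · intro w hw hne hl
      rw [up_true] at hw
      have hw1 := hT.inc_deg hw
      have h0 : ℓ - 1 ≠ 0 := by omega
      by_cases hb : β = 0
      · exfalso
        have : (sqr x q q' z (ℓ - 1) β η : T.RawCell ℓ).1 = q := by simp [sqr, h0, hb]
        rw [this] at hl
        exact hne (hT.eq_of_le hl (by omega))
      · have : (sqr x q q' z (ℓ - 1) β η : T.RawCell ℓ).1 = z := by simp [sqr, h0, hb]
        rw [this] at hl ⊢
        rcases s.only w hw (hT.inc_of_le hl (by omega)) with h7 | h7
        · exact absurd h7 hne
        · rw [h7, Fin.ext_iff, sqr_coord_right s.ne _ _ okk.2.1, line_coord _ _ _ ok.1]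

theorem Nice.inclusion_pt_iff (hT : T.Nice) (h3 : 3 ≤ ℓ) {q z : T.V} (hqz : T.inc q z)
    (hq : T.deg q = 1) {η : ℕ} (h : η < 3) {c : T.RawCell ℓ} (hc : T.IsCell ℓ true q c) :
    IsInclusion true q z c (pt z η) ↔ c = line q z (ℓ - 1) η := by
  have hz := hT.inc_deg hqz
  constructor
  · rintro ⟨h1, h2, h4, -⟩
    obtain ⟨he, hok⟩ := hT.eq_line h3 hqz hq hc (Or.inr h1)
    have e1 : (c.2.1 z).val = ℓ - 1 := by omega
    have e2 : c.2.2.val = η := by rw [h2, pt_height _ h]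
    rwa [e1, e2] at he
  · rintro rfl
    have h0 : ℓ - 1 ≠ 0 := by omega
    refine ⟨?_, rfl, ?_, ?_⟩
    · simp [line, pt, h0]
    · rw [line_coord _ _ _ (by omega)]; omega
    · intro w hw hne hl
      exfalso
      rw [up_true] at hw
      have := hT.inc_deg hw
      have h6 : (line q z (ℓ - 1) η : T.RawCell ℓ).1 = z := by simp [line, h0]
      rw [h6] at hl
      exact hne (hT.eq_of_le hl (by omega))

/-- Nothing lies below an `X`-check, so no inclusion leads into a cell of `Y_x` and only its facets
count. -/
theorem Nice.inc_sqr_iff (hT : T.Nice) (h3 : 3 ≤ ℓ) (hodd : ℓ % 2 = 1) {x q q' z : T.V}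
    (s : Sq T x q q' z) {α β η : ℕ} (ok : SqOK ℓ α β η) {p p' : (replace ℓ true T).V}
    (hp' : raw p' = (x, sqr x q q' z α β η)) :
    (replace ℓ true T).inc p p' ↔
      ∃ α' β' η', Fac2 α' β' η' α β η ∧ raw p = (x, sqr x q q' z α' β' η') := by
  rw [replace_inc, hp']
  constructor
  · rintro (⟨h1, h2⟩ | ⟨h1, -⟩)
    · change p.1 = x at h1
      obtain ⟨a, b, e, hf, he⟩ := (hT.facet_sqr_iff h3 hodd s ok (h1 ▸ p.2.2)).1 h2
      exact ⟨a, b, e, hf, Prod.ext h1 he⟩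
    · have h4 : T.deg x = _ := hT.inc_deg h1
      have := hT.sq_deg s
      omega
  · rintro ⟨a, b, e, hf, he⟩
    refine Or.inl ?_
    rw [he]
    refine ⟨rfl, ?_⟩
    exact (hT.facet_sqr_iff h3 hodd s ok (raw_cell he)).2 ⟨a, b, e, hf, rfl⟩

theorem Nice.inc_line_iff (hT : T.Nice) (h3 : 3 ≤ ℓ) (hodd : ℓ % 2 = 1) {q z : T.V}
    (hqz : T.inc q z) (hq : T.deg q = 1) {α η : ℕ} (ok : LineOK ℓ α η)
    {p p' : (replace ℓ true T).V} (hp' : raw p' = (q, line q z α η)) :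
    (replace ℓ true T).inc p p' ↔
      (∃ α' η', Fac1 α' η' α η ∧ raw p = (q, line q z α' η')) ∨
      ∃ x, T.inc x q ∧ raw p = (x, sqr x q (oth T x q z) z (ℓ - 1) α η) := by
  rw [replace_inc, hp']
  constructor
  · rintro (⟨h1, h2⟩ | ⟨h1, h2⟩)
    · left
      change p.1 = q at h1
      obtain ⟨a, e, hf, he⟩ := (hT.facet_line_iff h3 hodd hqz hq ok (h1 ▸ p.2.2)).1 h2
      exact ⟨a, e, hf, Prod.ext h1 he⟩
    · right
      refine ⟨p.1, h1, Prod.ext rfl ?_⟩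
      exact (hT.inclusion_line_iff h3 (hT.sq_oth h1 hqz) ok p.2.2).1 h2
  · rintro (⟨a, e, hf, he⟩ | ⟨x, hx, he⟩)
    · rw [he]
      refine Or.inl ⟨rfl, ?_⟩
      exact (hT.facet_line_iff h3 hodd hqz hq ok (raw_cell he)).2 ⟨a, e, hf, rfl⟩
    · refine Or.inr ?_
      rw [he]
      exact ⟨hx, (hT.inclusion_line_iff h3 (hT.sq_oth hx hqz) ok (raw_cell he)).2 rfl⟩

theorem Nice.inc_pt_iff (hT : T.Nice) (h3 : 3 ≤ ℓ) {z : T.V} (hz : T.deg z = 2) {η : ℕ}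
    (h : η < 3) {p p' : (replace ℓ true T).V} (hp' : raw p' = (z, pt z η)) :
    (replace ℓ true T).inc p p' ↔ ∃ q, T.inc q z ∧ raw p = (q, line q z (ℓ - 1) η) := by
  rw [replace_inc, hp']
  constructor
  · rintro (⟨h1, h2⟩ | ⟨h1, h2⟩)
    · exfalso
      have hc : T.IsCell ℓ true z p.2.1 := by
        have h1' : p.1 = z := h1
        exact h1' ▸ p.2.2
      have e2 := (hT.eq_pt h3 hz hc).1
      have hd : cellDim (pt z η) = cellDim p.2.1 + 1 := h2.1
      rw [e2, cellDim_pt z h, cellDim_pt z p.2.1.2.2.isLt] at hd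
      have h4 := (hT.eq_pt h3 hz (raw_cell hp')).2
      rw [pt_height _ h] at h4
      omega
    · refine ⟨p.1, h1, Prod.ext rfl ?_⟩
      have h4 : T.deg z = T.deg p.1 + 1 := hT.inc_deg h1
      have h5 : T.deg p.1 = 1 := by omega
      exact (hT.inclusion_pt_iff h3 h1 h5 h p.2.2).1 h2
  · rintro ⟨q, hq, he⟩
    refine Or.inr ?_
    rw [he]
    have := hT.inc_deg hq
    exact ⟨hq, (hT.inclusion_pt_iff h3 hq (by omega) h (raw_cell he)).2 rfl⟩

/-- The three kinds of vertices of the replaced complex. -/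
theorem Nice.raw_cases (hT : T.Nice) (h3 : 3 ≤ ℓ) (p : (replace ℓ true T).V) :
    (∃ x q q' z α β η, Sq T x q q' z ∧ SqOK ℓ α β η ∧ raw p = (x, sqr x q q' z α β η) ∧
      (replace ℓ true T).deg p = α % 2 + β % 2 + η % 2) ∨
    (∃ q z α η, T.inc q z ∧ T.deg q = 1 ∧ LineOK ℓ α η ∧ raw p = (q, line q z α η) ∧
      (replace ℓ true T).deg p = 1 + (α % 2 + η % 2)) ∨
    (∃ z η, T.deg z = 2 ∧ η < 3 ∧ η ≠ 1 ∧ raw p = (z, pt z η) ∧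
      (replace ℓ true T).deg p = 2) := by
  have hd := hT.deg_le p.1
  have : T.deg p.1 = 0 ∨ T.deg p.1 = 1 ∨ T.deg p.1 = 2 := by omega
  rcases this with h | h | h
  · left
    obtain ⟨q, q', z, α, β, η, s, ok, he, -⟩ := hT.exists_sqr h3 h p.2.2
    refine ⟨p.1, q, q', z, α, β, η, s, ok, Prod.ext rfl he, ?_⟩
    rw [replace_deg (Prod.ext rfl he : raw p = (p.1, sqr p.1 q q' z α β η)), cellDim_sqr s.ne ok, h]
    omega
  · right; left
    obtain ⟨z, α, η, hz, ok, he⟩ := hT.exists_line h3 h p.2.2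
    refine ⟨p.1, z, α, η, hz, h, ok, Prod.ext rfl he, ?_⟩
    rw [replace_deg (Prod.ext rfl he : raw p = (p.1, line p.1 z α η)), cellDim_line _ _ ok, h]
  · right; right
    obtain ⟨he, hne⟩ := hT.eq_pt h3 h p.2.2
    refine ⟨p.1, _, h, p.2.1.2.2.isLt, hne, Prod.ext rfl he, ?_⟩
    rw [replace_deg (Prod.ext rfl he : raw p = (p.1, pt p.1 _)),
      cellDim_pt _ p.2.1.2.2.isLt, h]
    have := p.2.1.2.2.isLt
    omega

/-! ### Evaluation of cochains -/

/-- The value of a cochain at a raw cell, zero if there is no such cell. -/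
noncomputable def ev (g : (replace ℓ true T).Cochain) (v : T.V) (c : T.RawCell ℓ) : ZMod 2 :=
  if h : T.IsCell ℓ true v c then g ⟨v, c, h⟩ else 0

omit [NeZero ℓ] in
theorem ev_raw (g : (replace ℓ true T).Cochain) {p : (replace ℓ true T).V} {v : T.V}
    {c : T.RawCell ℓ} (h : raw p = (v, c)) : ev g v c = g p := by
  obtain ⟨v', c', hc'⟩ := p
  simp only [raw, Prod.mk.injEq] at h
  obtain ⟨rfl, rfl⟩ := h
  simp [ev, hc']

omit [NeZero ℓ] in
theorem ev_add (g g' : (replace ℓ true T).Cochain) (v : T.V) (c : T.RawCell ℓ) :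
    ev (g + g') v c = ev g v c + ev g' v c := by
  unfold ev; split_ifs <;> rfl

omit [NeZero ℓ] in
theorem sum_raw (g : (replace ℓ true T).Cochain) (v : T.V) (c : T.RawCell ℓ) :
    (∑ p, if raw p = (v, c) then g p else 0) = ev g v c := by
  unfold ev
  split_ifs with h
  · rw [Finset.sum_eq_single ⟨v, c, h⟩]
    · simp [raw]
    · intro p _ hp
      rw [if_neg]
      intro he
      exact hp (raw_injective he)
    · intro h'
      exact absurd (Finset.mem_univ _) h'
  · refine Finset.sum_eq_zero fun p _ => ?_
    rw [if_neg]
    intro he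
    exact h (raw_cell he)

end Tanner

namespace Tanner

variable {T : Tanner} {ℓ : ℕ}

/-! ### The coboundary map in coordinates -/

theorem cobdry_eq_sum {T : Tanner} (g : T.Cochain) (v : T.V) (S : Finset T.V)
    (h : ∀ p, T.inc p v ↔ p ∈ S) : T.cobdry g v = ∑ p ∈ S, g p := by
  rw [cobdry_apply, ← Finset.sum_filter]
  congr 1
  ext p
  simp [h p]

variable [NeZero ℓ]

theorem Nice.exists_sqr_raw (hT : T.Nice) {x q q' z : T.V} (s : Sq T x q q' z) {α β η : ℕ}
    (ok : SqOK ℓ α β η) : ∃ p : (replace ℓ true T).V, raw p = (x, sqr x q q' z α β η) :=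
  exists_raw (hT.isCell_sqr s ok)

theorem Nice.exists_line_raw (hT : T.Nice) {q z : T.V} (hqz : T.inc q z) (hq : T.deg q = 1)
    {α η : ℕ} (ok : LineOK ℓ α η) :
    ∃ p : (replace ℓ true T).V, raw p = (q, line q z α η) :=
  exists_raw (hT.isCell_line hqz hq ok)

theorem Nice.exists_pt_raw (hT : T.Nice) {z : T.V} (hz : T.deg z = 2) {η : ℕ} (h : η < 3)
    (h1 : η ≠ 1) : ∃ p : (replace ℓ true T).V, raw p = (z, pt z η) :=
  exists_raw (hT.isCell_pt hz h h1)

theorem sqr_raw_ne {x q q' z : T.V} (hne : q ≠ q') {α β η α' β' η' : ℕ} (h : SqOK ℓ α β η)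
    (h' : SqOK ℓ α' β' η') {p p' : (replace ℓ true T).V} (hp : raw p = (x, sqr x q q' z α β η))
    (hp' : raw p' = (x, sqr x q q' z α' β' η')) (hn : ¬ (α = α' ∧ β = β' ∧ η = η')) : p ≠ p' := by
  rintro rfl
  rw [hp] at hp'
  exact hn (sqr_inj hne h h' (congrArg Prod.snd hp'))

theorem line_raw_ne {q z : T.V} {α η α' η' : ℕ} (h : LineOK ℓ α η) (h' : LineOK ℓ α' η')
    {p p' : (replace ℓ true T).V} (hp : raw p = (q, line q z α η))
    (hp' : raw p' = (q, line q z α' η')) (hn : ¬ (α = α' ∧ η = η')) : p ≠ p' := by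
  rintro rfl
  rw [hp] at hp'
  exact hn (line_inj h h' (congrArg Prod.snd hp'))

/-- Facets are the solutions of the arithmetic relation `Fac2`; once they are listed, each
coboundary formula below comes down to `omega`. -/
theorem Nice.ev_cobdry_sqr_two (hT : T.Nice) (h3 : 3 ≤ ℓ) (hodd : ℓ % 2 = 1) {x q q' z : T.V}
    (s : Sq T x q q' z) {α β η : ℕ} (ok : SqOK ℓ α β η) (a1 b1 e1 a2 b2 e2 : ℕ)
    (hne : ¬ (a1 = a2 ∧ b1 = b2 ∧ e1 = e2))
    (hf : ∀ a b e, Fac2 a b e α β η ↔ (a = a1 ∧ b = b1 ∧ e = e1) ∨ (a = a2 ∧ b = b2 ∧ e = e2))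
    (g : (replace ℓ true T).Cochain) :
    ev ((replace ℓ true T).cobdry g) x (sqr x q q' z α β η) =
      ev g x (sqr x q q' z a1 b1 e1) + ev g x (sqr x q q' z a2 b2 e2) := by
  have ok1 : SqOK ℓ a1 b1 e1 := ((hf _ _ _).2 (by simp)).ok hodd ok
  have ok2 : SqOK ℓ a2 b2 e2 := ((hf _ _ _).2 (by simp)).ok hodd ok
  obtain ⟨p', hp'⟩ := hT.exists_sqr_raw s ok
  obtain ⟨p1, hp1⟩ := hT.exists_sqr_raw s ok1
  obtain ⟨p2, hp2⟩ := hT.exists_sqr_raw s ok2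
  rw [ev_raw _ hp', ev_raw _ hp1, ev_raw _ hp2, cobdry_eq_sum g p' {p1, p2}, Finset.sum_pair]
  · exact sqr_raw_ne s.ne ok1 ok2 hp1 hp2 hne
  · intro p
    rw [hT.inc_sqr_iff h3 hodd s ok hp']
    simp only [Finset.mem_insert, Finset.mem_singleton]
    constructor
    · rintro ⟨a, b, e, h, hp⟩
      rcases (hf a b e).1 h with ⟨rfl, rfl, rfl⟩ | ⟨rfl, rfl, rfl⟩
      · exact Or.inl (raw_injective (hp.trans hp1.symm))
      · exact Or.inr (raw_injective (hp.trans hp2.symm))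
    · rintro (rfl | rfl)
      · exact ⟨_, _, _, (hf _ _ _).2 (by simp), hp1⟩
      · exact ⟨_, _, _, (hf _ _ _).2 (by simp), hp2⟩

theorem Nice.ev_cobdry_edge (hT : T.Nice) (h3 : 3 ≤ ℓ) (hodd : ℓ % 2 = 1) {x q q' z : T.V}
    (s : Sq T x q q' z) {i β η : ℕ} (ok : SqOK ℓ (i + 1) β η) (hi : i % 2 = 0) (hβ : β % 2 = 0)
    (hη : η % 2 = 0) (g : (replace ℓ true T).Cochain) :
    ev ((replace ℓ true T).cobdry g) x (sqr x q q' z (i + 1) β η) =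
      ev g x (sqr x q q' z i β η) + ev g x (sqr x q q' z (i + 2) β η) := by
  refine hT.ev_cobdry_sqr_two h3 hodd s ok _ _ _ _ _ _ (by omega) (fun a b e => ?_) g
  unfold Fac2; omega

theorem Nice.ev_cobdry_edge' (hT : T.Nice) (h3 : 3 ≤ ℓ) (hodd : ℓ % 2 = 1) {x q q' z : T.V}
    (s : Sq T x q q' z) {α j η : ℕ} (ok : SqOK ℓ α (j + 1) η) (hα : α % 2 = 0) (hj : j % 2 = 0)
    (hη : η % 2 = 0) (g : (replace ℓ true T).Cochain) :
    ev ((replace ℓ true T).cobdry g) x (sqr x q q' z α (j + 1) η) =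
      ev g x (sqr x q q' z α j η) + ev g x (sqr x q q' z α (j + 2) η) := by
  refine hT.ev_cobdry_sqr_two h3 hodd s ok _ _ _ _ _ _ (by omega) (fun a b e => ?_) g
  unfold Fac2; omega

theorem Nice.ev_cobdry_vert (hT : T.Nice) (h3 : 3 ≤ ℓ) (hodd : ℓ % 2 = 1) {x q q' z : T.V}
    (s : Sq T x q q' z) {α β : ℕ} (ok : SqOK ℓ α β 1) (hα : α % 2 = 0) (hβ : β % 2 = 0)
    (g : (replace ℓ true T).Cochain) :
    ev ((replace ℓ true T).cobdry g) x (sqr x q q' z α β 1) =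
      ev g x (sqr x q q' z α β 0) + ev g x (sqr x q q' z α β 2) := by
  refine hT.ev_cobdry_sqr_two h3 hodd s ok _ _ _ _ _ _ (by omega) (fun a b e => ?_) g
  unfold Fac2; omega

theorem Nice.ev_cobdry_sqr_four (hT : T.Nice) (h3 : 3 ≤ ℓ) (hodd : ℓ % 2 = 1) {x q q' z : T.V}
    (s : Sq T x q q' z) {α β η : ℕ} (ok : SqOK ℓ α β η) (a1 b1 e1 a2 b2 e2 a3 b3 e3 a4 b4 e4 : ℕ)
    (h12 : ¬ (a1 = a2 ∧ b1 = b2 ∧ e1 = e2)) (h13 : ¬ (a1 = a3 ∧ b1 = b3 ∧ e1 = e3))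
    (h14 : ¬ (a1 = a4 ∧ b1 = b4 ∧ e1 = e4)) (h23 : ¬ (a2 = a3 ∧ b2 = b3 ∧ e2 = e3))
    (h24 : ¬ (a2 = a4 ∧ b2 = b4 ∧ e2 = e4)) (h34 : ¬ (a3 = a4 ∧ b3 = b4 ∧ e3 = e4))
    (hf : ∀ a b e, Fac2 a b e α β η ↔ (a = a1 ∧ b = b1 ∧ e = e1) ∨ (a = a2 ∧ b = b2 ∧ e = e2) ∨
      (a = a3 ∧ b = b3 ∧ e = e3) ∨ (a = a4 ∧ b = b4 ∧ e = e4))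
    (g : (replace ℓ true T).Cochain) :
    ev ((replace ℓ true T).cobdry g) x (sqr x q q' z α β η) =
      ev g x (sqr x q q' z a1 b1 e1) + (ev g x (sqr x q q' z a2 b2 e2) +
        (ev g x (sqr x q q' z a3 b3 e3) + ev g x (sqr x q q' z a4 b4 e4))) := by
  have f1 : Fac2 a1 b1 e1 α β η := (hf _ _ _).2 (by simp)
  have f2 : Fac2 a2 b2 e2 α β η := (hf _ _ _).2 (by simp)
  have f3 : Fac2 a3 b3 e3 α β η := (hf _ _ _).2 (by simp)
  have f4 : Fac2 a4 b4 e4 α β η := (hf _ _ _).2 (by simp)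
  have ok1 := f1.ok hodd ok
  have ok2 := f2.ok hodd ok
  have ok3 := f3.ok hodd ok
  have ok4 := f4.ok hodd ok
  obtain ⟨p', hp'⟩ := hT.exists_sqr_raw s ok
  obtain ⟨p1, hp1⟩ := hT.exists_sqr_raw s ok1
  obtain ⟨p2, hp2⟩ := hT.exists_sqr_raw s ok2
  obtain ⟨p3, hp3⟩ := hT.exists_sqr_raw s ok3
  obtain ⟨p4, hp4⟩ := hT.exists_sqr_raw s ok4
  have n12 := sqr_raw_ne s.ne ok1 ok2 hp1 hp2 h12
  have n13 := sqr_raw_ne s.ne ok1 ok3 hp1 hp3 h13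
  have n14 := sqr_raw_ne s.ne ok1 ok4 hp1 hp4 h14
  have n23 := sqr_raw_ne s.ne ok2 ok3 hp2 hp3 h23
  have n24 := sqr_raw_ne s.ne ok2 ok4 hp2 hp4 h24
  have n34 := sqr_raw_ne s.ne ok3 ok4 hp3 hp4 h34
  rw [ev_raw _ hp', ev_raw _ hp1, ev_raw _ hp2, ev_raw _ hp3, ev_raw _ hp4,
    cobdry_eq_sum g p' {p1, p2, p3, p4}, Finset.sum_insert (by simp [n12, n13, n14]),
    Finset.sum_insert (by simp [n23, n24]), Finset.sum_pair n34]
  intro p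
  rw [hT.inc_sqr_iff h3 hodd s ok hp']
  simp only [Finset.mem_insert, Finset.mem_singleton]
  constructor
  · rintro ⟨a, b, e, h, hp⟩
    rcases (hf a b e).1 h with ⟨rfl, rfl, rfl⟩ | ⟨rfl, rfl, rfl⟩ | ⟨rfl, rfl, rfl⟩ | ⟨rfl, rfl, rfl⟩
    · exact Or.inl (raw_injective (hp.trans hp1.symm))
    · exact Or.inr (Or.inl (raw_injective (hp.trans hp2.symm)))
    · exact Or.inr (Or.inr (Or.inl (raw_injective (hp.trans hp3.symm))))
    · exact Or.inr (Or.inr (Or.inr (raw_injective (hp.trans hp4.symm))))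
  · rintro (rfl | rfl | rfl | rfl)
    · exact ⟨_, _, _, f1, hp1⟩
    · exact ⟨_, _, _, f2, hp2⟩
    · exact ⟨_, _, _, f3, hp3⟩
    · exact ⟨_, _, _, f4, hp4⟩

theorem Nice.ev_cobdry_face (hT : T.Nice) (h3 : 3 ≤ ℓ) (hodd : ℓ % 2 = 1) {x q q' z : T.V}
    (s : Sq T x q q' z) {i j η : ℕ} (ok : SqOK ℓ (i + 1) (j + 1) η) (hi : i % 2 = 0)
    (hj : j % 2 = 0) (hη : η % 2 = 0) (g : (replace ℓ true T).Cochain) :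
    ev ((replace ℓ true T).cobdry g) x (sqr x q q' z (i + 1) (j + 1) η) =
      ev g x (sqr x q q' z i (j + 1) η) + (ev g x (sqr x q q' z (i + 2) (j + 1) η) +
        (ev g x (sqr x q q' z (i + 1) j η) + ev g x (sqr x q q' z (i + 1) (j + 2) η))) := by
  refine hT.ev_cobdry_sqr_four h3 hodd s ok _ _ _ _ _ _ _ _ _ _ _ _ (by omega) (by omega)
    (by omega) (by omega) (by omega) (by omega) (fun a b e => ?_) g
  unfold Fac2; omega

theorem Nice.ev_cobdry_cyl (hT : T.Nice) (h3 : 3 ≤ ℓ) (hodd : ℓ % 2 = 1) {x q q' z : T.V}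
    (s : Sq T x q q' z) {α j : ℕ} (ok : SqOK ℓ α (j + 1) 1) (hα : α % 2 = 0)
    (hj : j % 2 = 0) (g : (replace ℓ true T).Cochain) :
    ev ((replace ℓ true T).cobdry g) x (sqr x q q' z α (j + 1) 1) =
      ev g x (sqr x q q' z α j 1) + (ev g x (sqr x q q' z α (j + 2) 1) +
        (ev g x (sqr x q q' z α (j + 1) 0) + ev g x (sqr x q q' z α (j + 1) 2))) := by
  refine hT.ev_cobdry_sqr_four h3 hodd s ok _ _ _ _ _ _ _ _ _ _ _ _ (by omega) (by omega)
    (by omega) (by omega) (by omega) (by omega) (fun a b e => ?_) g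
  unfold Fac2; omega

/-- The sum over the `X`-checks `x` below `q` of the values on the images of the cell
`line q z α η` of `Y_q` in `Y_x`. -/
noncomputable def inclSum (g : (replace ℓ true T).Cochain) (q z : T.V) (α η : ℕ) : ZMod 2 :=
  ∑ x : T.V, if T.inc x q then ev g x (sqr x q (oth T x q z) z (ℓ - 1) α η) else 0

/-- A cell lies over a single vertex of `T`, so at most one `x` matches it and a sum over cells
becomes a sum over `X`-checks. -/
theorem sum_incl (g : (replace ℓ true T).Cochain) {q z : T.V} (α η : ℕ)
    (P : (replace ℓ true T).V → Prop)
    (hP : ∀ p, P p ↔ ∃ x, T.inc x q ∧ raw p = (x, sqr x q (oth T x q z) z (ℓ - 1) α η)) :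
    (∑ p, if P p then g p else 0) = inclSum g q z α η := by
  have h1 : ∀ p, (if P p then g p else 0) = ∑ x : T.V, if T.inc x q then
      (if raw p = (x, sqr x q (oth T x q z) z (ℓ - 1) α η) then g p else 0) else 0 := by
    intro p
    by_cases h : P p
    · obtain ⟨x, hx, he⟩ := (hP p).1 h
      rw [if_pos h, Finset.sum_eq_single x]
      · simp [hx, he]
      · intro y _ hy
        have : raw p ≠ (y, sqr y q (oth T y q z) z (ℓ - 1) α η) := by
          intro h5
          rw [he] at h5
          exact hy (congrArg Prod.fst h5).symm
        simp [this]
      · simp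
    · rw [if_neg h]
      symm
      refine Finset.sum_eq_zero fun x _ => ?_
      by_cases hx : T.inc x q
      · rw [if_pos hx, if_neg]
        intro he
        exact h ((hP p).2 ⟨x, hx, he⟩)
      · rw [if_neg hx]
  rw [Finset.sum_congr rfl fun p _ => h1 p, Finset.sum_comm]
  refine Finset.sum_congr rfl fun x _ => ?_
  split_ifs
  · exact sum_raw g x _
  · simp

theorem Nice.ev_cobdry_line_two (hT : T.Nice) (h3 : 3 ≤ ℓ) (hodd : ℓ % 2 = 1) {q z : T.V}
    (hqz : T.inc q z) (hq : T.deg q = 1) {α η : ℕ} (ok : LineOK ℓ α η) (a1 e1 a2 e2 : ℕ)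
    (hne : ¬ (a1 = a2 ∧ e1 = e2))
    (hf : ∀ a e, Fac1 a e α η ↔ (a = a1 ∧ e = e1) ∨ (a = a2 ∧ e = e2))
    (g : (replace ℓ true T).Cochain) :
    ev ((replace ℓ true T).cobdry g) q (line q z α η) =
      ev g q (line q z a1 e1) + ev g q (line q z a2 e2) + inclSum g q z α η := by
  have f1 : Fac1 a1 e1 α η := (hf _ _).2 (by simp)
  have f2 : Fac1 a2 e2 α η := (hf _ _).2 (by simp)
  obtain ⟨p', hp'⟩ := hT.exists_line_raw hqz hq ok
  obtain ⟨p1, hp1⟩ := hT.exists_line_raw hqz hq (f1.ok hodd ok)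
  obtain ⟨p2, hp2⟩ := hT.exists_line_raw hqz hq (f2.ok hodd ok)
  have n12 := line_raw_ne (f1.ok hodd ok) (f2.ok hodd ok) hp1 hp2 hne
  have hP : ∀ p, (replace ℓ true T).inc p p' ↔ (p = p1 ∨ p = p2) ∨
      ∃ x, T.inc x q ∧ raw p = (x, sqr x q (oth T x q z) z (ℓ - 1) α η) := by
    intro p
    rw [hT.inc_line_iff h3 hodd hqz hq ok hp']
    refine or_congr_left ?_
    constructor
    · rintro ⟨a, e, h, hp⟩
      rcases (hf a e).1 h with ⟨rfl, rfl⟩ | ⟨rfl, rfl⟩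
      · exact Or.inl (raw_injective (hp.trans hp1.symm))
      · exact Or.inr (raw_injective (hp.trans hp2.symm))
    · rintro (rfl | rfl)
      · exact ⟨_, _, f1, hp1⟩
      · exact ⟨_, _, f2, hp2⟩
  -- The two facets lie over `q`, the included cells over `X`-checks, so no cell is counted twice.
  have hdisj : ∀ p, (p = p1 ∨ p = p2) →
      ¬ ∃ x, T.inc x q ∧ raw p = (x, sqr x q (oth T x q z) z (ℓ - 1) α η) := by
    rintro p hp ⟨x, hx, he⟩
    have h5 : p.1 = q := by
      rcases hp with rfl | rfl
      · exact raw_fst hp1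
      · exact raw_fst hp2
    have h6 : p.1 = x := raw_fst he
    have := hT.inc_deg hx
    rw [← h5, ← h6] at this
    omega
  rw [ev_raw _ hp', ev_raw _ hp1, ev_raw _ hp2, ← sum_incl g α η _ (fun p => Iff.rfl),
    ← Finset.sum_pair n12, cobdry_apply]
  have h7 : ∑ p ∈ ({p1, p2} : Finset (replace ℓ true T).V), g p =
      ∑ p, if p = p1 ∨ p = p2 then g p else 0 := by
    rw [← Finset.sum_filter]
    congr 1
    ext p
    simp
  rw [h7, ← Finset.sum_add_distrib]
  refine Finset.sum_congr rfl fun p _ => ?_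
  have h8 := hdisj p
  have h9 := hP p
  by_cases ha : p = p1 ∨ p = p2
  · rw [if_pos (h9.2 (Or.inl ha)), if_pos ha, if_neg (h8 ha), add_zero]
  · rw [if_neg ha, zero_add]
    by_cases hb : ∃ x, T.inc x q ∧ raw p = (x, sqr x q (oth T x q z) z (ℓ - 1) α η)
    · rw [if_pos (h9.2 (Or.inr hb)), if_pos hb]
    · rw [if_neg hb, if_neg]
      rw [h9]
      exact not_or.2 ⟨ha, hb⟩

theorem Nice.ev_cobdry_line (hT : T.Nice) (h3 : 3 ≤ ℓ) (hodd : ℓ % 2 = 1) {q z : T.V}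
    (hqz : T.inc q z) (hq : T.deg q = 1) {i η : ℕ} (ok : LineOK ℓ (i + 1) η) (hi : i % 2 = 0)
    (hη : η % 2 = 0) (g : (replace ℓ true T).Cochain) :
    ev ((replace ℓ true T).cobdry g) q (line q z (i + 1) η) =
      ev g q (line q z i η) + ev g q (line q z (i + 2) η) + inclSum g q z (i + 1) η := by
  refine hT.ev_cobdry_line_two h3 hodd hqz hq ok _ _ _ _ (by omega) (fun a e => ?_) g
  unfold Fac1; omega

theorem Nice.ev_cobdry_line_vert (hT : T.Nice) (h3 : 3 ≤ ℓ) (hodd : ℓ % 2 = 1) {q z : T.V}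
    (hqz : T.inc q z) (hq : T.deg q = 1) {α : ℕ} (ok : LineOK ℓ α 1) (hα : α % 2 = 0)
    (g : (replace ℓ true T).Cochain) :
    ev ((replace ℓ true T).cobdry g) q (line q z α 1) =
      ev g q (line q z α 0) + ev g q (line q z α 2) + inclSum g q z α 1 := by
  refine hT.ev_cobdry_line_two h3 hodd hqz hq ok _ _ _ _ (by omega) (fun a e => ?_) g
  unfold Fac1; omega

theorem Nice.ev_cobdry_line_pt (hT : T.Nice) (h3 : 3 ≤ ℓ) (hodd : ℓ % 2 = 1) {q z : T.V}
    (hqz : T.inc q z) (hq : T.deg q = 1) {α η : ℕ} (ok : LineOK ℓ α η) (hα : α % 2 = 0)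
    (hη : η % 2 = 0) (g : (replace ℓ true T).Cochain) :
    ev ((replace ℓ true T).cobdry g) q (line q z α η) = inclSum g q z α η := by
  obtain ⟨p', hp'⟩ := hT.exists_line_raw hqz hq ok
  rw [ev_raw _ hp', cobdry_apply]
  refine sum_incl g α η _ fun p => ?_
  rw [hT.inc_line_iff h3 hodd hqz hq ok hp', or_iff_right]
  rintro ⟨a, e, h, -⟩
  unfold Fac1 at h
  omega

theorem Nice.ev_cobdry_pt (hT : T.Nice) (h3 : 3 ≤ ℓ) {z : T.V} (hz : T.deg z = 2) {η : ℕ}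
    (h : η < 3) (h1 : η ≠ 1) (g : (replace ℓ true T).Cochain) :
    ev ((replace ℓ true T).cobdry g) z (pt z η) =
      ∑ q : T.V, if T.inc q z then ev g q (line q z (ℓ - 1) η) else 0 := by
  obtain ⟨p', hp'⟩ := hT.exists_pt_raw (ℓ := ℓ) hz h h1
  rw [ev_raw _ hp', cobdry_apply]
  have h2 : ∀ p, (if (replace ℓ true T).inc p p' then g p else 0) = ∑ q : T.V, if T.inc q z then
      (if raw p = (q, line q z (ℓ - 1) η) then g p else 0) else 0 := by
    intro p
    by_cases hp : (replace ℓ true T).inc p p'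
    · obtain ⟨x, hx, he⟩ := (hT.inc_pt_iff h3 hz h hp').1 hp
      rw [if_pos hp, Finset.sum_eq_single x]
      · simp [hx, he]
      · intro y _ hy
        have : raw p ≠ (y, line y z (ℓ - 1) η) := by
          intro h5
          rw [he] at h5
          exact hy (congrArg Prod.fst h5).symm
        simp [this]
      · simp
    · rw [if_neg hp]
      symm
      refine Finset.sum_eq_zero fun x _ => ?_
      by_cases hx : T.inc x z
      · rw [if_pos hx, if_neg]
        intro he
        exact hp ((hT.inc_pt_iff h3 hz h hp').2 ⟨x, hx, he⟩)
      · rw [if_neg hx]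
  rw [Finset.sum_congr rfl fun p _ => h2 p, Finset.sum_comm]
  refine Finset.sum_congr rfl fun x _ => ?_
  split_ifs
  · exact sum_raw g x _
  · simp

end Tanner

namespace Tanner

variable {T : Tanner} {ℓ : ℕ}

/-! ### The replacement preserves regularity -/

/-- In a product of subdivided intervals, cells of codimension two differ in exactly two
coordinates, and an intermediate cell takes one of these from each end. This leaves two candidates.
-/
theorem Fac2.unique_mid {a b e α β η α' β' η' : ℕ} (h : Fac2 a b e α' β' η')
    (h' : Fac2 α' β' η' α β η) :
    (a ≠ α ∧ b ≠ β ∧ e = η ∧ η' = η ∧ ((α' = a ∧ β' = β) ∨ (α' = α ∧ β' = b))) ∨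
    (a ≠ α ∧ b = β ∧ e ≠ η ∧ β' = β ∧ ((α' = a ∧ η' = η) ∨ (α' = α ∧ η' = e))) ∨
    (a = α ∧ b ≠ β ∧ e ≠ η ∧ α' = α ∧ ((β' = b ∧ η' = η) ∨ (β' = β ∧ η' = e))) := by
  unfold Fac2 at h h'
  rcases h with h | h | h <;> rcases h' with h' | h' | h' <;> omega

theorem Fac2.diamond {a b e α β η α' β' η' : ℕ} (h : Fac2 a b e α' β' η')
    (h' : Fac2 α' β' η' α β η) :
    ∃ α'' β'' η'', ¬ (α'' = α' ∧ β'' = β' ∧ η'' = η') ∧ Fac2 a b e α'' β'' η'' ∧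
      Fac2 α'' β'' η'' α β η := by
  unfold Fac2 at *
  rcases h with h | h | h <;> rcases h' with h' | h' | h'
  · omega
  · exact ⟨a, β, η, by omega, by omega, by omega⟩
  · exact ⟨a, β, η, by omega, by omega, by omega⟩
  · exact ⟨α, b, η, by omega, by omega, by omega⟩
  · omega
  · exact ⟨α, b, η, by omega, by omega, by omega⟩
  · exact ⟨α, β, e, by omega, by omega, by omega⟩
  · exact ⟨α, β, e, by omega, by omega, by omega⟩
  · omega

theorem Fac2.mid_cases {a b e α β η α1 β1 η1 α2 β2 η2 α3 β3 η3 : ℕ} (h1 : Fac2 a b e α1 β1 η1)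
    (h1' : Fac2 α1 β1 η1 α β η) (h2 : Fac2 a b e α2 β2 η2)
    (h2' : Fac2 α2 β2 η2 α β η) (h3 : Fac2 a b e α3 β3 η3) (h3' : Fac2 α3 β3 η3 α β η)
    (hne : ¬ (α2 = α1 ∧ β2 = β1 ∧ η2 = η1)) :
    (α3 = α1 ∧ β3 = β1 ∧ η3 = η1) ∨ (α3 = α2 ∧ β3 = β2 ∧ η3 = η2) := by
  have k1 := h1.unique_mid h1'
  have k2 := h2.unique_mid h2'
  have k3 := h3.unique_mid h3'
  clear h1 h1' h2 h2' h3 h3'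
  rcases k1 with k1 | k1 | k1 <;> rcases k2 with k2 | k2 | k2 <;> rcases k3 with k3 | k3 | k3 <;>
    omega

variable [NeZero ℓ]

theorem deg_sqr {x q q' z : T.V} (hT : T.Nice) (s : Sq T x q q' z) {α β η : ℕ}
    (ok : SqOK ℓ α β η) {p : (replace ℓ true T).V} (hp : raw p = (x, sqr x q q' z α β η)) :
    (replace ℓ true T).deg p = α % 2 + β % 2 + η % 2 := by
  rw [replace_deg hp, cellDim_sqr s.ne ok, (hT.sq_deg s).1, zero_add]

theorem deg_line {q z : T.V} (hq : T.deg q = 1) {α η : ℕ}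
    (ok : LineOK ℓ α η) {p : (replace ℓ true T).V} (hp : raw p = (q, line q z α η)) :
    (replace ℓ true T).deg p = 1 + (α % 2 + η % 2) := by
  rw [replace_deg hp, cellDim_line _ _ ok, hq]

theorem Nice.replace_inc_deg (hT : T.Nice) {p p' : (replace ℓ true T).V}
    (h3 : 3 ≤ ℓ) (hodd : ℓ % 2 = 1)
    (h : (replace ℓ true T).inc p p') :
    (replace ℓ true T).deg p' = (replace ℓ true T).deg p + 1 := by
  rcases hT.raw_cases h3 p' with ⟨x, q, q', z, α, β, η, s, ok, hp', hd⟩ |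
    ⟨q, z, α, η, hqz, hq, ok, hp', hd⟩ | ⟨z, η, hz, hη, hne, hp', hd⟩
  · obtain ⟨a, b, e, hf, hp⟩ := (hT.inc_sqr_iff h3 hodd s ok hp').1 h
    rw [hd, deg_sqr hT s (hf.ok hodd ok) hp]
    unfold Fac2 at hf; omega
  · rcases (hT.inc_line_iff h3 hodd hqz hq ok hp').1 h with ⟨a, e, hf, hp⟩ | ⟨x, hx, hp⟩
    · rw [hd, deg_line hq (hf.ok hodd ok) hp]
      unfold Fac1 at hf; omega
    · rw [hd, deg_sqr hT (hT.sq_oth hx hqz) ok.sq hp]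
      omega
  · obtain ⟨q, hqz, hp⟩ := (hT.inc_pt_iff h3 hz hη hp').1 h
    have hq := hT.inc_deg hqz
    rw [hd, deg_line (by omega) (by unfold LineOK; omega) hp]
    omega

theorem Nice.replace_deg_le (hT : T.Nice) (h3 : 3 ≤ ℓ) (hodd : ℓ % 2 = 1)
    (p : (replace ℓ true T).V) : (replace ℓ true T).deg p ≤ 2 := by
  rcases hT.raw_cases h3 p with ⟨x, q, q', z, α, β, η, s, ok, hp', hd⟩ |
    ⟨q, z, α, η, hqz, hq, ok, hp', hd⟩ | ⟨z, η, hz, hη, hne, hp', hd⟩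
  · rw [hd]; unfold SqOK at ok; omega
  · rw [hd]; unfold LineOK at ok; omega
  · omega

theorem Nice.replace_above (hT : T.Nice) (h3 : 3 ≤ ℓ) (hodd : ℓ % 2 = 1)
    (p : (replace ℓ true T).V) (hp : (replace ℓ true T).deg p ≤ 1) :
    ∃ w, (replace ℓ true T).inc p w := by
  rcases hT.raw_cases h3 p with ⟨x, q, q', z, α, β, η, s, ok, hp', hd⟩ |
    ⟨q, z, α, η, hqz, hq, ok, hp', hd⟩ | ⟨z, η, hz, hη, hne, hp', hd⟩
  · have key : ∃ a b e, SqOK ℓ a b e ∧ Fac2 α β η a b e := by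
      unfold SqOK at ok
      -- The cell is thickened in an even coordinate, inwards or, from `0`, outwards. A vertical
      -- cell must keep a coordinate `ℓ - 1`, so in that case the other coordinate is the one to
      -- change.
      by_cases h : α % 2 = 0 ∧ (η = 1 → β + 1 = ℓ)
      · refine ⟨if α = 0 then 1 else α - 1, β, η, ?_, ?_⟩
        · unfold SqOK; split_ifs <;> omega
        · unfold Fac2; split_ifs <;> omega
      · refine ⟨α, if β = 0 then 1 else β - 1, η, ?_, ?_⟩
        · unfold SqOK; split_ifs <;> omega
        · unfold Fac2; split_ifs <;> omega
    obtain ⟨a, b, e, ok', hf⟩ := key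
    obtain ⟨w, hw⟩ := hT.exists_sqr_raw s ok'
    exact ⟨w, (hT.inc_sqr_iff h3 hodd s ok' hw).2 ⟨_, _, _, hf, hp'⟩⟩
  · have key : ∃ a e, LineOK ℓ a e ∧ Fac1 α η a e := by
      unfold LineOK at ok
      refine ⟨if α = 0 then 1 else α - 1, η, ?_, ?_⟩
      · unfold LineOK; split_ifs <;> omega
      · unfold Fac1; split_ifs <;> omega
    obtain ⟨a, e, ok', hf⟩ := key
    obtain ⟨w, hw⟩ := hT.exists_line_raw hqz hq ok'
    exact ⟨w, (hT.inc_line_iff h3 hodd hqz hq ok' hw).2 (Or.inl ⟨_, _, hf, hp'⟩)⟩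
  · omega

theorem Nice.replace_below (hT : T.Nice) (h3 : 3 ≤ ℓ) (hodd : ℓ % 2 = 1)
    (p : (replace ℓ true T).V) (hp : 1 ≤ (replace ℓ true T).deg p) :
    ∃ w, (replace ℓ true T).inc w p := by
  rcases hT.raw_cases h3 p with ⟨x, q, q', z, α, β, η, s, ok, hp', hd⟩ |
    ⟨q, z, α, η, hqz, hq, ok, hp', hd⟩ | ⟨z, η, hz, hη, hne, hp', hd⟩
  · have key : ∃ a b e, Fac2 a b e α β η := by
      by_cases h : α % 2 = 1
      · exact ⟨α - 1, β, η, by unfold Fac2; omega⟩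
      · by_cases h : β % 2 = 1
        · exact ⟨α, β - 1, η, by unfold Fac2; omega⟩
        · exact ⟨α, β, η - 1, by unfold Fac2; omega⟩
    obtain ⟨a, b, e, hf⟩ := key
    obtain ⟨w, hw⟩ := hT.exists_sqr_raw s (hf.ok hodd ok)
    exact ⟨w, (hT.inc_sqr_iff h3 hodd s ok hp').2 ⟨_, _, _, hf, hw⟩⟩
  · obtain ⟨x, hx⟩ := hT.below q (by omega)
    obtain ⟨w, hw⟩ := hT.exists_sqr_raw (hT.sq_oth hx hqz) ok.sq
    exact ⟨w, (hT.inc_line_iff h3 hodd hqz hq ok hp').2 (Or.inr ⟨_, hx, hw⟩)⟩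
  · obtain ⟨q, hq⟩ := hT.below z (by omega)
    have hq1 := hT.inc_deg hq
    obtain ⟨w, hw⟩ := hT.exists_line_raw (α := ℓ - 1) (η := η) (ℓ := ℓ) hq (by omega)
      (by unfold LineOK; omega)
    exact ⟨w, (hT.inc_pt_iff h3 hz hη hp').2 ⟨_, hq, hw⟩⟩

theorem Fac2.incl {β η ℓ : ℕ} (hodd : ℓ % 2 = 1) {a b e : ℕ} :
    Fac2 a b e (ℓ - 1) β η ↔ a = ℓ - 1 ∧ Fac1 b e β η := by
  unfold Fac2 Fac1; omega

/-- There are three sources of diamonds: inside `Y_x`, the two orders of changing two coordinates;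
at a cell of `Y_q`, the two orders of taking a facet and including into `Y_x`; at a point of `Y_z`,
the two qubits of a square of `T`. -/
theorem Nice.replace_diamond (hT : T.Nice) (h3 : 3 ≤ ℓ) (hodd : ℓ % 2 = 1)
    {p e r : (replace ℓ true T).V} (h1 : (replace ℓ true T).inc p e)
    (h2 : (replace ℓ true T).inc e r) :
    ∃ e', e' ≠ e ∧ (replace ℓ true T).inc p e' ∧ (replace ℓ true T).inc e' r ∧
      ∀ w, (replace ℓ true T).inc p w → (replace ℓ true T).inc w r → w = e ∨ w = e' := by
  rcases hT.raw_cases h3 r with ⟨x, q, q', z, α, β, η, s, ok, hr, hd⟩ |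
    ⟨q, z, α, η, hqz, hq, ok, hr, hd⟩ | ⟨z, η, hz, hη, hne, hr, hd⟩
  · obtain ⟨α', β', η', hf, he⟩ := (hT.inc_sqr_iff h3 hodd s ok hr).1 h2
    have ok' := hf.ok hodd ok
    obtain ⟨a, b, c, hf', hp⟩ := (hT.inc_sqr_iff h3 hodd s ok' he).1 h1
    have ok0 := hf'.ok hodd ok'
    obtain ⟨α'', β'', η'', hne, g1, g2⟩ := hf'.diamond hf
    have ok'' := g2.ok hodd ok
    obtain ⟨e', he'⟩ := hT.exists_sqr_raw s ok''
    refine ⟨e', sqr_raw_ne s.ne ok'' ok' he' he hne,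
      (hT.inc_sqr_iff h3 hodd s ok'' he').2 ⟨_, _, _, g1, hp⟩,
      (hT.inc_sqr_iff h3 hodd s ok hr).2 ⟨_, _, _, g2, he'⟩, fun w hw1 hw2 => ?_⟩
    obtain ⟨i, j, k, k1, hw⟩ := (hT.inc_sqr_iff h3 hodd s ok hr).1 hw2
    have okw := k1.ok hodd ok
    obtain ⟨i', j', k', k2, hp2⟩ := (hT.inc_sqr_iff h3 hodd s okw hw).1 hw1
    obtain ⟨rfl, rfl, rfl⟩ := sqr_inj s.ne (k2.ok hodd okw) ok0
      (congrArg Prod.snd (hp2.symm.trans hp))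
    rcases hf'.mid_cases hf g1 g2 k2 k1 hne with ⟨rfl, rfl, rfl⟩ | ⟨rfl, rfl, rfl⟩
    · exact Or.inl (raw_injective (hw.trans he.symm))
    · exact Or.inr (raw_injective (hw.trans he'.symm))
  · have hinc := fun w => hT.inc_line_iff (p := w) h3 hodd hqz hq ok hr
    -- the two intermediate vertices for given `x` and facet of the cell of `Y_q`
    have key : ∀ x a c, T.inc x q → Fac1 a c α η →
        ∀ p e e' : (replace ℓ true T).V, raw p = (x, sqr x q (oth T x q z) z (ℓ - 1) a c) →
        raw e = (q, line q z a c) → raw e' = (x, sqr x q (oth T x q z) z (ℓ - 1) α η) →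
        e ≠ e' ∧ (replace ℓ true T).inc p e ∧ (replace ℓ true T).inc e r ∧
        (replace ℓ true T).inc p e' ∧ (replace ℓ true T).inc e' r ∧
        ∀ w, (replace ℓ true T).inc p w → (replace ℓ true T).inc w r → w = e ∨ w = e' := by
      intro x a c hx hf p e e' hp he he'
      have s := hT.sq_oth hx hqz
      have hf2 : Fac2 (ℓ - 1) a c (ℓ - 1) α η := (Fac2.incl hodd).2 ⟨rfl, hf⟩
      have okf := hf.ok hodd ok
      refine ⟨?_, (hT.inc_line_iff h3 hodd hqz hq okf he).2 (Or.inr ⟨x, hx, hp⟩),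
        (hinc e).2 (Or.inl ⟨_, _, hf, he⟩),
        (hT.inc_sqr_iff h3 hodd s ok.sq he').2 ⟨_, _, _, hf2, hp⟩,
        (hinc e').2 (Or.inr ⟨x, hx, he'⟩), fun w hw1 hw2 => ?_⟩
      · rintro rfl
        rw [he] at he'
        have h5 : q = x := congrArg Prod.fst he'
        have := hT.inc_deg hx
        rw [h5] at this
        omega
      · rcases (hinc w).1 hw2 with ⟨i, k, hf3, hw⟩ | ⟨y, hy, hw⟩
        · left
          rcases (hT.inc_line_iff h3 hodd hqz hq (hf3.ok hodd ok) hw).1 hw1 with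
            ⟨_, _, _, hp2⟩ | ⟨y, hy, hp2⟩
          · have h5 : q = x := congrArg Prod.fst (hp2.symm.trans hp)
            have := hT.inc_deg hx
            rw [h5] at this
            omega
          · have h5 : y = x := congrArg Prod.fst (hp2.symm.trans hp)
            subst h5
            obtain ⟨-, rfl, rfl⟩ := sqr_inj s.ne (hf3.ok hodd ok).sq okf.sq
              (congrArg Prod.snd (hp2.symm.trans hp))
            exact raw_injective (hw.trans he.symm)
        · right
          obtain ⟨i, j, k, -, hp2⟩ := (hT.inc_sqr_iff h3 hodd (hT.sq_oth hy hqz) ok.sq hw).1 hw1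
          have h5 : y = x := congrArg Prod.fst (hp2.symm.trans hp)
          subst h5
          exact raw_injective (hw.trans he'.symm)
    rcases (hinc e).1 h2 with ⟨a, c, hf, he⟩ | ⟨x, hx, he⟩
    · have hdeg := hT.replace_inc_deg h3 hodd h1
      rcases (hT.inc_line_iff h3 hodd hqz hq (hf.ok hodd ok) he).1 h1 with
        ⟨a', c', hf', hp⟩ | ⟨x, hx, hp⟩
      -- Two facets in succession inside `Y_q` would need odd coordinate and odd height, but at
      -- height `1` the coordinate is `ℓ - 1`, which is even.
      · unfold Fac1 at hf hf'
        unfold LineOK at ok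
        omega
      · obtain ⟨e', he'⟩ := hT.exists_sqr_raw (hT.sq_oth hx hqz) ok.sq
        obtain ⟨k1, k2, k3, k4, k5, k6⟩ := key x a c hx hf p e e' hp he he'
        exact ⟨e', k1.symm, k4, k5, k6⟩
    · obtain ⟨i, j, k, hf, hp⟩ := (hT.inc_sqr_iff h3 hodd (hT.sq_oth hx hqz) ok.sq he).1 h1
      obtain ⟨rfl, hf1⟩ := (Fac2.incl hodd).1 hf
      obtain ⟨e', he'⟩ := hT.exists_line_raw hqz hq (hf1.ok hodd ok)
      obtain ⟨k1, k2, k3, k4, k5, k6⟩ := key x j k hx hf1 p e' e hp he' he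
      exact ⟨e', k1, k2, k3, fun w h h' => (k6 w h h').symm⟩
  · have hinc := fun w => hT.inc_pt_iff (p := w) h3 hz hη hr
    obtain ⟨q, hqz, he⟩ := (hinc e).1 h2
    have hq : T.deg q = 1 := by have := hT.inc_deg hqz; omega
    have ok : LineOK ℓ (ℓ - 1) η := by unfold LineOK; omega
    rcases (hT.inc_line_iff h3 hodd hqz hq ok he).1 h1 with ⟨a, c, hf, hp⟩ | ⟨x, hx, hp⟩
    · unfold Fac1 at hf
      omega
    · have s := hT.sq_oth hx hqz
      have hq' := (hT.sq_deg s).2.2.1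
      obtain ⟨e', he'⟩ := hT.exists_line_raw s.q'z hq' ok
      refine ⟨e', ?_, ?_, (hinc e').2 ⟨_, s.q'z, he'⟩, ?_⟩
      · rintro rfl
        rw [he] at he'
        exact s.ne (congrArg Prod.fst he')
      · refine (hT.inc_line_iff h3 hodd s.q'z hq' ok he').2 (Or.inr ⟨x, s.xq', ?_⟩)
        rw [hp, s.symm.oth_eq hT, sqr_swap s.ne]
      · intro w hw1 hw2
        obtain ⟨q2, hq2z, hw⟩ := (hinc w).1 hw2
        have hq2 : T.deg q2 = 1 := by have := hT.inc_deg hq2z; omega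
        rcases (hT.inc_line_iff h3 hodd hq2z hq2 ok hw).1 hw1 with ⟨a, c, hf, -⟩ | ⟨y, hy, hp2⟩
        · unfold Fac1 at hf
          omega
        · have h5 : y = x := congrArg Prod.fst (hp2.symm.trans hp)
          subst h5
          rcases s.only q2 hy hq2z with rfl | rfl
          · exact Or.inl (raw_injective (hw.trans he.symm))
          · exact Or.inr (raw_injective (hw.trans he'.symm))

end Tanner

/-! ### Connectedness of the links in the replaced complex. -/

namespace Tanner

variable {T : Tanner} {ℓ : ℕ} [NeZero ℓ]

/-- Two facets that differ from the given cell in different coordinates. -/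
def Transversal (a b c a' b' c' α β η : ℕ) : Prop :=
  (a ≠ α ∧ a' = α) ∨ (b ≠ β ∧ b' = β) ∨ (c ≠ η ∧ c' = η)

/-- Making both changes at once gives the corner in which the two facets meet. -/
theorem Fac2.common_facet {a b c a' b' c' α β η : ℕ} (h1 : Fac2 a b c α β η)
    (h2 : Fac2 a' b' c' α β η) (h : Transversal a b c a' b' c' α β η) :
    ∃ i j k, Fac2 i j k a b c ∧ Fac2 i j k a' b' c' := by
  unfold Fac2 Transversal at *
  rcases h1 with h1 | h1 | h1 <;> rcases h2 with h2 | h2 | h2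
  · omega
  · exact ⟨a, b', η, by omega, by omega⟩
  · exact ⟨a, β, c', by omega, by omega⟩
  · exact ⟨a', b, η, by omega, by omega⟩
  · omega
  · exact ⟨α, b, c', by omega, by omega⟩
  · exact ⟨a', β, c, by omega, by omega⟩
  · exact ⟨α, b', c, by omega, by omega⟩
  · omega

/-- Opposite facets of a face do not meet, but both meet a facet in the other odd coordinate, which
exists because the face has dimension two. -/
theorem Fac2.exists_transversal {a b c a' b' c' α β η : ℕ} (h1 : Fac2 a b c α β η)
    (h2 : Fac2 a' b' c' α β η) (hd : α % 2 + β % 2 + η % 2 = 2) :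
    Transversal a b c a' b' c' α β η ∨ ∃ i j k, Fac2 i j k α β η ∧
      Transversal a b c i j k α β η ∧ Transversal a' b' c' i j k α β η := by
  unfold Fac2 at h1 h2
  unfold Fac2 Transversal
  rcases h1 with h1 | h1 | h1 <;> rcases h2 with h2 | h2 | h2
  · by_cases h : β % 2 = 1
    · exact Or.inr ⟨α, β - 1, η,
        Or.inr (Or.inl ⟨by omega, by omega, by omega, by omega⟩), Or.inl ⟨by omega, by omega⟩, Or.inl ⟨by omega, by omega⟩⟩
    · exact Or.inr ⟨α, β, η - 1,
        Or.inr (Or.inr ⟨by omega, by omega, by omega, by omega⟩), Or.inl ⟨by omega, by omega⟩, Or.inl ⟨by omega, by omega⟩⟩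
  · exact Or.inl (Or.inl ⟨by omega, by omega⟩)
  · exact Or.inl (Or.inl ⟨by omega, by omega⟩)
  · exact Or.inl (Or.inr (Or.inl ⟨by omega, by omega⟩))
  · by_cases h : α % 2 = 1
    · exact Or.inr ⟨α - 1, β, η,
        Or.inl ⟨by omega, by omega, by omega, by omega⟩, Or.inr (Or.inl ⟨by omega, by omega⟩), Or.inr (Or.inl ⟨by omega, by omega⟩)⟩
    · exact Or.inr ⟨α, β, η - 1,
        Or.inr (Or.inr ⟨by omega, by omega, by omega, by omega⟩), Or.inr (Or.inl ⟨by omega, by omega⟩), Or.inr (Or.inl ⟨by omega, by omega⟩)⟩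
  · exact Or.inl (Or.inr (Or.inl ⟨by omega, by omega⟩))
  · exact Or.inl (Or.inr (Or.inr ⟨by omega, by omega⟩))
  · exact Or.inl (Or.inr (Or.inr ⟨by omega, by omega⟩))
  · by_cases h : α % 2 = 1
    · exact Or.inr ⟨α - 1, β, η,
        Or.inl ⟨by omega, by omega, by omega, by omega⟩, Or.inr (Or.inr ⟨by omega, by omega⟩), Or.inr (Or.inr ⟨by omega, by omega⟩)⟩
    · exact Or.inr ⟨α, β - 1, η,
        Or.inr (Or.inl ⟨by omega, by omega, by omega, by omega⟩), Or.inr (Or.inr ⟨by omega, by omega⟩), Or.inr (Or.inr ⟨by omega, by omega⟩)⟩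

/-- `φ` takes the same value on any two qubits that lie above `p` and below a common check. -/
def UpInvariant {T : Tanner} (p : T.V) (φ : T.V → ZMod 2) : Prop :=
  ∀ a b z, T.inc p a → T.inc p b → T.inc a z → T.inc b z → φ a = φ b

theorem Nice.upInvariant_sqr (hT : T.Nice) (h3 : 3 ≤ ℓ) (hodd : ℓ % 2 = 1) {x q q' z : T.V}
    (s : Sq T x q q' z) {α β η : ℕ} {p : (replace ℓ true T).V}
    (hp : raw p = (x, sqr x q q' z α β η)) {φ : (replace ℓ true T).V → ZMod 2}
    (hφ : UpInvariant p φ) (a b c a' b' c' i j k : ℕ) (ok : SqOK ℓ i j k)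
    (h1 : Fac2 α β η a b c) (h2 : Fac2 a b c i j k) (h1' : Fac2 α β η a' b' c')
    (h2' : Fac2 a' b' c' i j k) :
    ev φ x (sqr x q q' z a b c) = ev φ x (sqr x q q' z a' b' c') := by
  obtain ⟨r, hr⟩ := hT.exists_sqr_raw s ok
  obtain ⟨e, he⟩ := hT.exists_sqr_raw s (h2.ok hodd ok)
  obtain ⟨e', he'⟩ := hT.exists_sqr_raw s (h2'.ok hodd ok)
  rw [ev_raw _ he, ev_raw _ he']
  exact hφ e e' r ((hT.inc_sqr_iff h3 hodd s (h2.ok hodd ok) he).2 ⟨_, _, _, h1, hp⟩)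
    ((hT.inc_sqr_iff h3 hodd s (h2'.ok hodd ok) he').2 ⟨_, _, _, h1', hp⟩)
    ((hT.inc_sqr_iff h3 hodd s ok hr).2 ⟨_, _, _, h2, he⟩)
    ((hT.inc_sqr_iff h3 hodd s ok hr).2 ⟨_, _, _, h2', he'⟩)

/-- The common check is the cell `(b, c)` of `Y_q`: it lies above the copy of `p` in `Y_q` and above
its own image in `Y_x`. -/
theorem Nice.upInvariant_line (hT : T.Nice) (h3 : 3 ≤ ℓ) (hodd : ℓ % 2 = 1) {x q q' z : T.V}
    (s : Sq T x q q' z) {β η : ℕ} {p : (replace ℓ true T).V}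
    (hp : raw p = (x, sqr x q q' z (ℓ - 1) β η)) (ok : LineOK ℓ β η)
    {φ : (replace ℓ true T).V → ZMod 2}
    (hφ : UpInvariant p φ) (b c : ℕ) (okr : LineOK ℓ b c) (h1 : Fac1 β η b c) :
    ev φ q (line q z β η) = ev φ x (sqr x q q' z (ℓ - 1) b c) := by
  have hq := (hT.sq_deg s).2.1
  have ho := s.oth_eq hT
  obtain ⟨r, hr⟩ := hT.exists_line_raw s.qz hq okr
  obtain ⟨e, he⟩ := hT.exists_line_raw s.qz hq ok
  obtain ⟨e', he'⟩ := hT.exists_sqr_raw s okr.sq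
  rw [ev_raw _ he, ev_raw _ he']
  refine hφ e e' r ?_ ?_ ?_ ?_
  · exact (hT.inc_line_iff h3 hodd s.qz hq ok he).2 (Or.inr ⟨x, s.xq, by rw [ho]; exact hp⟩)
  · exact (hT.inc_sqr_iff h3 hodd s okr.sq he').2 ⟨_, _, _, (Fac2.incl hodd).2 ⟨rfl, h1⟩, hp⟩
  · exact (hT.inc_line_iff h3 hodd s.qz hq okr hr).2 (Or.inl ⟨_, _, h1, he⟩)
  · exact (hT.inc_line_iff h3 hodd s.qz hq okr hr).2 (Or.inr ⟨x, s.xq, by rw [ho]; exact he'⟩)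

/-- All edges above a vertex in one square carry the same value. -/
theorem Nice.hub_sqr (hT : T.Nice) (h3 : 3 ≤ ℓ) (hodd : ℓ % 2 = 1) {x q q' z : T.V}
    (s : Sq T x q q' z) {α β η : ℕ} (ok : SqOK ℓ α β η) (hα : α % 2 = 0) (hβ : β % 2 = 0)
    (hη : η % 2 = 0) (h2 : 2 ≤ α) {p : (replace ℓ true T).V}
    (hp : raw p = (x, sqr x q q' z α β η)) {φ : (replace ℓ true T).V → ZMod 2}
    (hφ : UpInvariant p φ) (a b c : ℕ) (oka : SqOK ℓ a b c) (hf : Fac2 α β η a b c) :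
    ev φ x (sqr x q q' z a b c) = ev φ x (sqr x q q' z (α - 1) β η) := by
  have key := hT.upInvariant_sqr h3 hodd s hp hφ
  -- The edge `(α - 1, β)`, which points from `p` inwards, serves as a hub. An edge in the second
  -- direction shares with it the face `(α - 1, b)`.
  have hA : ∀ b, b < ℓ → b % 2 = 1 → (β + 1 = b ∨ β = b + 1) →
      ev φ x (sqr x q q' z α b η) = ev φ x (sqr x q q' z (α - 1) β η) := by
    intro b hb hbo hbb
    refine key _ _ _ _ _ _ (α - 1) b η ?_ ?_ ?_ ?_ ?_ <;> unfold Fac2 SqOK at * <;> omega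
  obtain ⟨β1, hb1, hb1o, hb11⟩ : ∃ b, b < ℓ ∧ b % 2 = 1 ∧ (β + 1 = b ∨ β = b + 1) := by
    unfold SqOK at ok
    by_cases h : β = 0
    · exact ⟨1, by omega⟩
    · exact ⟨β - 1, by omega⟩
  have hf0 := hf
  unfold Fac2 at hf
  rcases hf with ⟨h1, h4, rfl, rfl⟩ | ⟨h1, rfl, h4, rfl⟩ | ⟨h1, rfl, rfl, h4⟩
  · by_cases h5 : a = α - 1
    · rw [h5]
    · rw [← hA β1 hb1 hb1o hb11]
      refine key _ _ _ _ _ _ a β1 η ?_ ?_ ?_ ?_ ?_ <;> unfold Fac2 SqOK at * <;> omega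
  · exact hA b oka.2.1 h1 (by omega)
  · have hc : c = 1 := by unfold SqOK at oka; omega
    subst hc
    -- Over the side `α = ℓ - 1` the vertical edge shares a cylinder face with an edge in the second
    -- direction; over the side `β = ℓ - 1` it shares one with the hub itself.
    rcases oka.2.2.2 rfl with h6 | h6
    · rw [← hA β1 hb1 hb1o hb11]
      refine key _ _ _ _ _ _ α β1 1 ?_ ?_ ?_ ?_ ?_ <;> unfold Fac2 SqOK at * <;> omega
    · refine key _ _ _ _ _ _ (α - 1) β 1 ?_ ?_ ?_ ?_ ?_ <;> unfold Fac2 SqOK at * <;> omega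

/-- The copy in `Y_q` carries the same value as the edges. -/
theorem Nice.hub_line (hT : T.Nice) (h3 : 3 ≤ ℓ) (hodd : ℓ % 2 = 1) {x q q' z : T.V}
    (s : Sq T x q q' z) {β η : ℕ} (ok : LineOK ℓ β η) (hβ : β % 2 = 0)
    (hη : η % 2 = 0) {p : (replace ℓ true T).V}
    (hp : raw p = (x, sqr x q q' z (ℓ - 1) β η)) {φ : (replace ℓ true T).V → ZMod 2}
    (hφ : UpInvariant p φ) :
    ev φ q (line q z β η) = ev φ x (sqr x q q' z (ℓ - 1 - 1) β η) ∧
      (2 ≤ β → ev φ q (line q z β η) = ev φ x (sqr x q q' z (ℓ - 1) (β - 1) η)) := by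
  obtain ⟨β1, hb1, hb1o, hb11, hb12⟩ : ∃ b, b < ℓ ∧ b % 2 = 1 ∧ (β + 1 = b ∨ β = b + 1) ∧
      (2 ≤ β → b = β - 1) := by
    unfold LineOK at ok
    by_cases h : β = 0
    · exact ⟨1, by omega⟩
    · exact ⟨β - 1, by omega⟩
  have h := hT.upInvariant_line h3 hodd s hp ok hφ β1 η (by unfold LineOK at *; omega)
    (by unfold Fac1; omega)
  constructor
  · rw [h]
    refine hT.hub_sqr h3 hodd s ok.sq (by omega) hβ hη (by omega) hp hφ _ _ _ ?_ ?_
    · unfold LineOK at ok; unfold SqOK; omega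
    · unfold Fac2; omega
  · intro h2
    rw [h, hb12 h2]

theorem Nice.hub_sqr' (hT : T.Nice) (h3 : 3 ≤ ℓ) (hodd : ℓ % 2 = 1) {x q q' z : T.V}
    (s : Sq T x q q' z) {α β η : ℕ} (ok : SqOK ℓ α β η) (hα : α % 2 = 0) (hβ : β % 2 = 0)
    (hη : η % 2 = 0) (h2 : 2 ≤ β) {p : (replace ℓ true T).V}
    (hp : raw p = (x, sqr x q q' z α β η)) {φ : (replace ℓ true T).V → ZMod 2}
    (hφ : UpInvariant p φ) (a b c : ℕ) (oka : SqOK ℓ a b c) (hf : Fac2 α β η a b c) :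
    ev φ x (sqr x q q' z a b c) = ev φ x (sqr x q q' z α (β - 1) η) := by
  rw [sqr_swap s.ne, sqr_swap s.ne α]
  exact hT.hub_sqr h3 hodd s.symm ok.symm hβ hα hη h2 (by rw [hp, sqr_swap s.ne]) hφ _ _ _
    oka.symm hf.symm

/-- Every qubit above a vertex of `Y_x` lies in a square that contains this vertex. -/
theorem Nice.hub (hT : T.Nice) (h3 : 3 ≤ ℓ) (hodd : ℓ % 2 = 1) {x : T.V} {c : T.RawCell ℓ}
    {p : (replace ℓ true T).V} (hx : T.deg x = 0) (hp : raw p = (x, c))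
    (hp0 : (replace ℓ true T).deg p = 0) {φ : (replace ℓ true T).V → ZMod 2}
    (hφ : UpInvariant p φ) {e : (replace ℓ true T).V} (he : (replace ℓ true T).inc p e) :
    ∃ q q' z α β η, Sq T x q q' z ∧ SqOK ℓ α β η ∧ α % 2 = 0 ∧ β % 2 = 0 ∧
      c = sqr x q q' z α β η ∧
      (2 ≤ α → φ e = ev φ x (sqr x q q' z (α - 1) β η)) ∧
      (2 ≤ β → φ e = ev φ x (sqr x q q' z α (β - 1) η)) ∧
      (α = 0 → β = 0 → φ e = ev φ x (line x q 1 η) ∨ φ e = ev φ x (line x q' 1 η)) := by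
  have hde := hT.replace_inc_deg h3 hodd he
  rcases hT.raw_cases h3 e with ⟨x', q, q', z, α, β, η, s, ok, he', hd⟩ |
    ⟨q, z, α, η, hqz, hq, ok, he', hd⟩ | ⟨z, η, hz, hη, hne, he', hd⟩
  · obtain ⟨a, b, e0, hf, hp'⟩ := (hT.inc_sqr_iff h3 hodd s ok he').1 he
    rw [hp] at hp'
    obtain ⟨rfl, rfl⟩ := Prod.mk.inj hp'
    have ok' := hf.ok hodd ok
    have hd' := deg_sqr hT s ok' hp
    refine ⟨q, q', z, a, b, e0, s, ok', by omega, by omega, rfl, ?_, ?_, ?_⟩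
    · intro h2
      rw [← ev_raw φ he']
      exact hT.hub_sqr h3 hodd s ok' (by omega) (by omega) (by omega) h2 hp hφ _ _ _ ok hf
    · intro h2
      rw [← ev_raw φ he']
      exact hT.hub_sqr' h3 hodd s ok' (by omega) (by omega) (by omega) h2 hp hφ _ _ _ ok hf
    · rintro rfl rfl
      unfold Fac2 at hf
      unfold SqOK at ok
      rw [← ev_raw φ he']
      rcases hf with hf | hf | hf
      · obtain ⟨rfl, rfl, rfl⟩ : α = 1 ∧ β = 0 ∧ η = e0 := by omega
        rw [sqr_zero_right]
        exact Or.inl rfl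
      · obtain ⟨rfl, rfl, rfl⟩ : α = 0 ∧ β = 1 ∧ η = e0 := by omega
        rw [sqr_zero_left s.ne]
        exact Or.inr rfl
      · omega
  · rcases (hT.inc_line_iff h3 hodd hqz hq ok he').1 he with ⟨a, e0, hf, hp'⟩ | ⟨x', hx', hp'⟩
    · rw [hp] at hp'
      have : x = q := congrArg Prod.fst hp'
      rw [this] at hx
      omega
    · rw [hp] at hp'
      obtain ⟨rfl, rfl⟩ := Prod.mk.inj hp'
      have s := hT.sq_oth hx' hqz
      have hd' := deg_sqr hT s ok.sq hp
      have hh := hT.hub_line h3 hodd s ok (by omega) (by omega) hp hφ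
      refine ⟨q, _, z, ℓ - 1, α, η, s, ok.sq, by omega, by omega, rfl, ?_, ?_, ?_⟩
      · intro _
        rw [← ev_raw φ he']
        exact hh.1
      · intro h2
        rw [← ev_raw φ he']
        exact hh.2 h2
      · intro h; omega
  · omega

/-- Away from the centre of `Y_x` every edge above `p` is equivalent to the edge pointing inwards.
Over the centre the edges correspond to the qubits at `x`, and the link of `x` in `T` decides. -/
theorem Nice.replace_linkUp (hT : T.Nice) (h3 : 3 ≤ ℓ) (hodd : ℓ % 2 = 1)
    (p : (replace ℓ true T).V) (hp0 : (replace ℓ true T).deg p = 0)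
    (φ : (replace ℓ true T).V → ZMod 2) (hφ : UpInvariant p φ) (e e' : (replace ℓ true T).V)
    (he : (replace ℓ true T).inc p e) (he' : (replace ℓ true T).inc p e') : φ e = φ e' := by
  rcases hT.raw_cases h3 p with ⟨x, q, q', z, α, β, η, s, ok, hp, hd⟩ |
    ⟨q, z, α, η, hqz, hq, ok, hp, hd⟩ | ⟨z, η, hz, hη, hne, hp, hd⟩
  · have hx := (hT.sq_deg s).1
    by_cases h00 : α = 0 ∧ β = 0
    · obtain ⟨rfl, rfl⟩ := h00
      have hc : ∀ {e}, (replace ℓ true T).inc p e → ∃ q, T.inc x q ∧ φ e = ev φ x (line x q 1 η) := by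
        intro e he
        obtain ⟨q1, q1', z1, a, b, c, s1, ok1, -, -, hc, -, -, k⟩ :=
          hT.hub h3 hodd hx hp hp0 hφ he
        have hlab : (sqr x q1 q1' z1 a b c : T.RawCell ℓ).1 = x := by rw [← hc]; simp [sqr]
        have hη : c = η := by
          rw [← sqr_height (ℓ := ℓ) x q1 q1' z1 a b ok1.2.2.1, ← hc, sqr_height _ _ _ _ _ _ ok.2.2.1]
        have hd1 := hT.sq_deg s1
        rcases sqr_label_cases (ℓ := ℓ) x q1 q1' z1 a b c with h | h | h | h
        · rw [← hη]
          rcases k h.2.1 h.2.2 with k | k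
          · exact ⟨q1, s1.xq, k⟩
          · exact ⟨q1', s1.xq', k⟩
        · rw [hlab] at h; rw [h.1] at hd1; omega
        · rw [hlab] at h; rw [h.1] at hd1; omega
        · rw [hlab] at h; rw [h.1] at hd1; omega
      obtain ⟨q1, hq1, h1⟩ := hc he
      obtain ⟨q2, hq2, h2⟩ := hc he'
      rw [h1, h2]
      refine hT.linkUp x hx (fun q => ev φ x (line x q 1 η)) ?_ q1 q2 hq1 hq2
      intro a b z ha hb haz hbz
      by_cases hab : a = b
      · rw [hab]
      · obtain ⟨a', s1⟩ := hT.exists_sq ha haz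
        obtain rfl : b = a' := (s1.only b hb hbz).resolve_left (Ne.symm hab)
        have hp1 : raw p = (x, sqr x a b z 0 0 η) := by
          rw [hp]; simp [sqr_zero_right, line_zero]
        have := hT.upInvariant_sqr h3 hodd s1 hp1 hφ 1 0 η 0 1 η 1 1 η
          (by unfold SqOK at *; omega) (by unfold Fac2; omega) (by unfold Fac2; omega)
          (by unfold Fac2; omega) (by unfold Fac2; omega)
        rwa [sqr_zero_right, sqr_zero_left s1.ne] at this
    -- The hub must not depend on the square in which the edge `e` is seen. If `p` is on an axis,
    -- all squares containing it share this axis and the hub lies on it; otherwise the square is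
    -- unique up to exchanging its qubits.
    · have main : ∀ q q' z α β, Sq T x q q' z → SqOK ℓ α β η → 2 ≤ α → α % 2 = 0 → β % 2 = 0 →
          raw p = (x, sqr x q q' z α β η) → ∀ e, (replace ℓ true T).inc p e →
          φ e = ev φ x (sqr x q q' z (α - 1) β η) := by
        intro q q' z α β s ok h2 hα hβ hp e he
        obtain ⟨q1, q1', z1, a, b, c, s1, ok1, ha, hb, hc, k1, k2, -⟩ :=
          hT.hub h3 hodd hx hp hp0 hφ he
        have hη : c = η := by
          rw [← sqr_height (ℓ := ℓ) x q1 q1' z1 a b ok1.2.2.1, ← hc,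
            sqr_height _ _ _ _ _ _ ok.2.2.1]
        subst hη
        have hd := hT.sq_deg s
        have hd1 := hT.sq_deg s1
        have c1 := fun w => congrArg (fun r : T.RawCell ℓ => (r.2.1 w).val) hc
        rcases sqr_label_cases (ℓ := ℓ) x q q' z α β c with h | h | h | h
        · omega
        · omega
        · obtain ⟨h, -, rfl⟩ := h
          rw [sqr_zero_right]
          rcases sqr_label_cases (ℓ := ℓ) x q1 q1' z1 a b c with h' | h' | h' | h'
          · rw [← hc, h] at h'; rw [← h'.1] at hd1; omega
          · rw [← hc, h] at h'
            obtain ⟨rfl, rfl, h7⟩ := h'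
            have e1 := c1 q
            rw [sqr_coord_left _ _ _ _ _ _ ok.1, sqr_coord_right s1.ne _ _ ok1.2.1] at e1
            subst e1
            rw [k2 h2, sqr_zero_left s1.ne]
          · rw [← hc, h] at h'
            obtain ⟨rfl, h7, rfl⟩ := h'
            have e1 := c1 q
            rw [sqr_coord_left _ _ _ _ _ _ ok.1, sqr_coord_left _ _ _ _ _ _ ok1.1] at e1
            subst e1
            rw [k1 h2, sqr_zero_right]
          · rw [← hc, h] at h'; rw [← h'.1] at hd1; omega
        · obtain ⟨h, -, hb0⟩ := h
          rcases sqr_label_cases (ℓ := ℓ) x q1 q1' z1 a b c with h' | h' | h' | h'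
          · rw [← hc, h] at h'; rw [← h'.1] at hd1; omega
          · rw [← hc, h] at h'; rw [← h'.1] at hd1; omega
          · rw [← hc, h] at h'; rw [← h'.1] at hd1; omega
          · rw [← hc, h] at h'
            obtain ⟨rfl, h6, h7⟩ := h'
            have e1 := c1 q
            have e2 := c1 q'
            rw [sqr_coord_left _ _ _ _ _ _ ok.1] at e1
            rw [sqr_coord_right s.ne _ _ ok.2.1] at e2
            rcases s1.only q s.xq s.qz with rfl | rfl
            · obtain rfl : q' = q1' := (s.oth_eq hT).symm.trans (s1.oth_eq hT)
              rw [sqr_coord_left _ _ _ _ _ _ ok1.1] at e1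
              rw [sqr_coord_right s1.ne _ _ ok1.2.1] at e2
              subst e1 e2
              exact k1 h2
            · obtain rfl : q' = q1 := (s.oth_eq hT).symm.trans (s1.symm.oth_eq hT)
              rw [sqr_coord_right s1.ne _ _ ok1.2.1] at e1
              rw [sqr_coord_left _ _ _ _ _ _ ok1.1] at e2
              subst e1 e2
              rw [k2 h2, sqr_swap s1.ne]
      by_cases hα : 2 ≤ α
      · rw [main q q' z α β s ok hα (by omega) (by omega) hp e he,
          main q q' z α β s ok hα (by omega) (by omega) hp e' he']
      · have hp2 : raw p = (x, sqr x q' q z β α η) := by rw [hp, sqr_swap s.ne]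
        rw [main q' q z β α s.symm ok.symm (by omega) (by omega) (by omega) hp2 e he,
          main q' q z β α s.symm ok.symm (by omega) (by omega) (by omega) hp2 e' he']
  · omega
  · omega

/-- The facets of a face of `Y_x` form a connected boundary. Below a one-dimensional cell of `Y_q`,
every facet in `Y_q` is linked to every image in some `Y_x`. Below a point of `Y_z` one sees the
link of `z` in `T`. -/
theorem Nice.replace_linkDown (hT : T.Nice) (h3 : 3 ≤ ℓ) (hodd : ℓ % 2 = 1)
    (r : (replace ℓ true T).V) (hr2 : (replace ℓ true T).deg r = 2)
    (φ : (replace ℓ true T).V → ZMod 2)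
    (hφ : ∀ a b p, (replace ℓ true T).inc a r → (replace ℓ true T).inc b r →
      (replace ℓ true T).inc p a → (replace ℓ true T).inc p b → φ a = φ b)
    (e e' : (replace ℓ true T).V)
    (he : (replace ℓ true T).inc e r) (he' : (replace ℓ true T).inc e' r) : φ e = φ e' := by
  rcases hT.raw_cases h3 r with ⟨x, q, q', z, α, β, η, s, ok, hr, hd⟩ |
    ⟨q, z, α, η, hqz, hq, ok, hr, hd⟩ | ⟨z, η, hz, hη, hne, hr, hd⟩
  · have key : ∀ a b c a' b' c' i j k : ℕ, Fac2 a b c α β η → Fac2 a' b' c' α β η →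
        Fac2 i j k a b c → Fac2 i j k a' b' c' →
        ev φ x (sqr x q q' z a b c) = ev φ x (sqr x q q' z a' b' c') := by
      intro a b c a' b' c' i j k h1 h1' h2 h2'
      have ok1 := h1.ok hodd ok
      have ok1' := h1'.ok hodd ok
      obtain ⟨u, hu⟩ := hT.exists_sqr_raw s ok1
      obtain ⟨u', hu'⟩ := hT.exists_sqr_raw s ok1'
      obtain ⟨p, hp⟩ := hT.exists_sqr_raw s (h2.ok hodd ok1)
      rw [ev_raw _ hu, ev_raw _ hu']
      exact hφ u u' p ((hT.inc_sqr_iff h3 hodd s ok hr).2 ⟨_, _, _, h1, hu⟩)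
        ((hT.inc_sqr_iff h3 hodd s ok hr).2 ⟨_, _, _, h1', hu'⟩)
        ((hT.inc_sqr_iff h3 hodd s ok1 hu).2 ⟨_, _, _, h2, hp⟩)
        ((hT.inc_sqr_iff h3 hodd s ok1' hu').2 ⟨_, _, _, h2', hp⟩)
    obtain ⟨a, b, c, hf, hu⟩ := (hT.inc_sqr_iff h3 hodd s ok hr).1 he
    obtain ⟨a', b', c', hf', hu'⟩ := (hT.inc_sqr_iff h3 hodd s ok hr).1 he'
    rw [← ev_raw φ hu, ← ev_raw φ hu']
    have step : ∀ a b c a' b' c', Fac2 a b c α β η → Fac2 a' b' c' α β η →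
        Transversal a b c a' b' c' α β η →
        ev φ x (sqr x q q' z a b c) = ev φ x (sqr x q q' z a' b' c') := by
      intro a b c a' b' c' h1 h2 hh
      obtain ⟨i, j, k, g1, g2⟩ := h1.common_facet h2 hh
      exact key _ _ _ _ _ _ _ _ _ h1 h2 g1 g2
    rcases hf.exists_transversal hf' (by omega) with h | ⟨i, j, k, hg, h1, h2⟩
    · exact step _ _ _ _ _ _ hf hf' h
    · rw [step a b c i j k hf hg h1, step a' b' c' i j k hf' hg h2]
  · obtain ⟨x0, hx0⟩ := hT.below q (by omega)
    have hl : ∀ x a c, T.inc x q → Fac1 a c α η →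
        ev φ q (line q z a c) = ev φ x (sqr x q (oth T x q z) z (ℓ - 1) α η) := by
      intro x a c hx hf
      have s := hT.sq_oth hx hqz
      have okf := hf.ok hodd ok
      obtain ⟨u, hu⟩ := hT.exists_line_raw hqz hq okf
      obtain ⟨u', hu'⟩ := hT.exists_sqr_raw s ok.sq
      obtain ⟨p, hp⟩ := hT.exists_sqr_raw s okf.sq
      rw [ev_raw _ hu, ev_raw _ hu']
      exact hφ u u' p ((hT.inc_line_iff h3 hodd hqz hq ok hr).2 (Or.inl ⟨_, _, hf, hu⟩))
        ((hT.inc_line_iff h3 hodd hqz hq ok hr).2 (Or.inr ⟨_, hx, hu'⟩))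
        ((hT.inc_line_iff h3 hodd hqz hq okf hu).2 (Or.inr ⟨_, hx, hp⟩))
        ((hT.inc_sqr_iff h3 hodd s ok.sq hu').2 ⟨_, _, _, (Fac2.incl hodd).2 ⟨rfl, hf⟩, hp⟩)
    obtain ⟨a0, c0, hf0⟩ : ∃ a c, Fac1 a c α η := by
      by_cases h : α % 2 = 1
      · exact ⟨α - 1, η, by unfold Fac1; omega⟩
      · exact ⟨α, η - 1, by unfold Fac1; omega⟩
    have all : ∀ e, (replace ℓ true T).inc e r → φ e = ev φ q (line q z a0 c0) := by
      intro e he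
      rcases (hT.inc_line_iff h3 hodd hqz hq ok hr).1 he with ⟨a, c, hf, hu⟩ | ⟨x, hx, hu⟩
      · rw [← ev_raw φ hu, hl x0 a c hx0 hf, hl x0 a0 c0 hx0 hf0]
      · rw [← ev_raw φ hu, hl x a0 c0 hx hf0]
    rw [all e he, all e' he']
  · have ok : LineOK ℓ (ℓ - 1) η := by unfold LineOK; omega
    obtain ⟨q, hqz, hu⟩ := (hT.inc_pt_iff h3 hz hη hr).1 he
    obtain ⟨q', hqz', hu'⟩ := (hT.inc_pt_iff h3 hz hη hr).1 he'
    rw [← ev_raw φ hu, ← ev_raw φ hu']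
    refine hT.linkDown z hz (fun q => ev φ q (line q z (ℓ - 1) η)) ?_ q q' hqz hqz'
    intro a b x ha hb hxa hxb
    by_cases hab : a = b
    · rw [hab]
    · have s := hT.sq_oth hxa ha
      have hb' := (s.only b hxb hb).resolve_left (Ne.symm hab)
      rw [← hb'] at s
      have hdd := hT.sq_deg s
      obtain ⟨u, hu⟩ := hT.exists_line_raw ha hdd.2.1 ok
      obtain ⟨u', hu'⟩ := hT.exists_line_raw hb hdd.2.2.1 ok
      obtain ⟨p, hp⟩ := hT.exists_sqr_raw s ok.sq
      rw [ev_raw _ hu, ev_raw _ hu']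
      refine hφ u u' p ((hT.inc_pt_iff h3 hz hη hr).2 ⟨_, ha, hu⟩)
        ((hT.inc_pt_iff h3 hz hη hr).2 ⟨_, hb, hu'⟩)
        ((hT.inc_line_iff h3 hodd ha hdd.2.1 ok hu).2 (Or.inr ⟨x, hxa, ?_⟩))
        ((hT.inc_line_iff h3 hodd hb hdd.2.2.1 ok hu').2 (Or.inr ⟨x, hxb, ?_⟩))
      · rw [s.oth_eq hT, hp]
      · rw [s.symm.oth_eq hT, hp, sqr_swap s.ne]

theorem Nice.replace_true (hT : T.Nice) (h3 : 3 ≤ ℓ) (hodd : ℓ % 2 = 1) :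
    (replace ℓ true T).Nice where
  deg_le := hT.replace_deg_le h3 hodd
  inc_deg := hT.replace_inc_deg h3 hodd
  diamond := hT.replace_diamond h3 hodd
  above := hT.replace_above h3 hodd
  below := hT.replace_below h3 hodd
  linkUp := hT.replace_linkUp h3 hodd
  linkDown := hT.replace_linkDown h3 hodd

omit [NeZero ℓ] in
-- Everything but the degrees agrees by definition; for degrees at most two the truncated
-- subtractions `d - c` and `2 - ((2 - d) + c)` coincide.
theorem replace_false_eq (hT : T.Nice) :
    replace ℓ false T = (replace ℓ true T.dual).dual := by
  have h : ∀ p : (replace ℓ false T).V, (replace ℓ false T).deg p =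
      2 - ((2 - T.deg p.1) + cellDim p.2.1) := by
    intro p
    have := hT.deg_le p.1
    change T.deg p.1 - cellDim p.2.1 = _
    omega
  have hd : (replace ℓ false T).deg =
      fun p => 2 - ((2 - T.deg p.1) + cellDim p.2.1) := funext h
  change (⟨(replace ℓ false T).V, (replace ℓ false T).fin, (replace ℓ false T).deg,
    (replace ℓ false T).inc⟩ : Tanner) = _
  rw [hd]
  rfl

theorem Nice.replace (hT : T.Nice) (h3 : 3 ≤ ℓ) (hodd : ℓ % 2 = 1) (b : Bool) :
    (replace ℓ b T).Nice := by
  cases b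
  · rw [replace_false_eq hT]
    exact (hT.dual.replace_true h3 hodd).dual
  · exact hT.replace_true h3 hodd

end Tanner

namespace Tanner

variable {T : Tanner} {ℓ : ℕ}

/-! ### Local cohomology -/

/-- Even coordinates are the vertices of a subdivided edge, so equality across every small edge
propagates to the origin. -/
theorem even_chain {ℓ : ℕ} {f : ℕ → ZMod 2} (h : ∀ i, i % 2 = 0 → i + 2 < ℓ → f i = f (i + 2)) :
    ∀ α, α % 2 = 0 → α < ℓ → f α = f 0 := by
  intro α
  induction α using Nat.strong_induction_on with
  | _ α ih =>
    intro h1 h2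
    by_cases h0 : α = 0
    · rw [h0]
    · have h3 := h (α - 2) (by omega) (by omega)
      rw [show α - 2 + 2 = α by omega] at h3
      rw [← h3, ih (α - 2) (by omega) (by omega) (by omega)]

theorem sum_telescope (f : ℕ → ZMod 2) (n : ℕ) :
    ∑ k ∈ Finset.range n, (f k + f (k + 1)) = f 0 + f n := by
  induction n with
  | zero => simp [CharTwo.add_self_eq_zero]
  | succ n ih =>
    rw [Finset.sum_range_succ, ih]
    linear_combination CharTwo.add_self_eq_zero (f n)

variable [NeZero ℓ]

/-- An edge of `Y_x` runs inside one of the two layers, or it is vertical. -/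
theorem Nice.edge_cases (hT : T.Nice) (h3 : 3 ≤ ℓ) (hodd : ℓ % 2 = 1)
    {p : (Tanner.replace ℓ true T).V} (hx : T.deg p.1 = 0)
    (hp : (Tanner.replace ℓ true T).deg p = 1) :
    (∃ q q' z i β η, Sq T p.1 q q' z ∧ i + 2 < ℓ ∧ β < ℓ ∧ i % 2 = 0 ∧ β % 2 = 0 ∧
      (η = 0 ∨ η = 2) ∧ raw p = (p.1, sqr p.1 q q' z (i + 1) β η)) ∨
    (∃ q q' z β, Sq T p.1 q q' z ∧ β < ℓ ∧ β % 2 = 0 ∧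
      raw p = (p.1, sqr p.1 q q' z (ℓ - 1) β 1)) := by
  rcases hT.raw_cases h3 p with ⟨x, q, q', z, α, β, η, s, ok, hp', hd⟩ |
    ⟨q, z, α, η, hqz, hq, ok, hp', hd⟩ | ⟨z, η, hz, hη, hne, hp', hd⟩
  · obtain rfl := raw_fst hp'
    unfold SqOK at ok
    by_cases hη : η = 1
    · subst hη
      right
      rcases ok.2.2.2 rfl with h | h
      · obtain rfl : α = ℓ - 1 := by omega
        exact ⟨q, q', z, β, s, ok.2.1, by omega, hp'⟩
      · obtain rfl : β = ℓ - 1 := by omega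
        exact ⟨q', q, z, α, s.symm, ok.1, by omega, by rw [hp', sqr_swap s.ne]⟩
    · left
      by_cases hα : α % 2 = 1
      · obtain ⟨i, rfl⟩ : ∃ i, α = i + 1 := ⟨α - 1, by omega⟩
        exact ⟨q, q', z, i, β, η, s, by omega, ok.2.1, by omega, by omega, by omega, hp'⟩
      · obtain ⟨i, rfl⟩ : ∃ i, β = i + 1 := ⟨β - 1, by omega⟩
        exact ⟨q', q, z, i, α, η, s.symm, by omega, ok.1, by omega, by omega, by omega,
          by rw [hp', sqr_swap s.ne]⟩
  · rw [raw_fst hp'] at hx; omega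
  · rw [raw_fst hp'] at hx; omega

/-- One of the two qubits of a square, chosen for `x` and `z`. -/
noncomputable def fst (T : Tanner) (x z : T.V) : T.V :=
  if h : ∃ q, ∃ q', Sq T x q q' z then h.choose else x

theorem Sq.fst_cases {x q q' z : T.V} (s : Sq T x q q' z) : fst T x z = q ∨ fst T x z = q' := by
  have hex : ∃ q, ∃ q', Sq T x q q' z := ⟨q, q', s⟩
  rw [fst, dif_pos hex]
  obtain ⟨q'', hq⟩ := hex.choose_spec
  exact s.only _ hq.xq hq.qz

/-- The integral of a cochain along an edge of the star. -/
noncomputable def axisSum (g : (Tanner.replace ℓ true T).Cochain) (x q : T.V) (η n : ℕ) : ZMod 2 :=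
  ∑ k ∈ Finset.range n, ev g x (line x q (2 * k + 1) η)

/-- The integral of a cochain over paths in the star that start at its centre. -/
noncomputable def pathSum (g : (Tanner.replace ℓ true T).Cochain) (x : T.V) (η : ℕ)
    (c : T.RawCell ℓ) : ZMod 2 :=
  if c.1 = x then 0
  else if T.inc x c.1 then axisSum g x c.1 η ((c.2.1 c.1).val / 2)
  else axisSum g x (fst T x c.1) η ((c.2.1 (fst T x c.1)).val / 2) +
    ∑ k ∈ Finset.range ((c.2.1 (oth T x (fst T x c.1) c.1)).val / 2),
      ev g x (sqr x (fst T x c.1) (oth T x (fst T x c.1) c.1) c.1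
        (c.2.1 (fst T x c.1)).val (2 * k + 1) η)

/-- The path follows the axis of the chosen qubit and then turns towards the other one. On the two
axes one leg is empty, so the choice made in each square causes no conflict where squares meet. -/
theorem Nice.pathSum_sqr (hT : T.Nice) {x q q' z : T.V} (s : Sq T x q q' z)
    (hf : fst T x z = q) (g : (Tanner.replace ℓ true T).Cochain) (η : ℕ) {m n : ℕ}
    (hm : 2 * m < ℓ) (hn : 2 * n < ℓ) :
    pathSum g x η (sqr x q q' z (2 * m) (2 * n) η) = axisSum g x q η m +
      ∑ k ∈ Finset.range n, ev g x (sqr x q q' z (2 * m) (2 * k + 1) η) := by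
  obtain ⟨hx, hq, hq', hz⟩ := hT.sq_deg s
  have e1 := sqr_coord_left (ℓ := ℓ) x q q' z (2 * n) η hm
  have e2 := sqr_coord_right (ℓ := ℓ) (x := x) (z := z) s.ne (2 * m) η hn
  have n1 : q ≠ x := by rintro rfl; omega
  have n2 : q' ≠ x := by rintro rfl; omega
  have n3 : z ≠ x := by rintro rfl; omega
  have n4 : ¬ T.inc x z := fun h => by have := hT.inc_deg h; omega
  unfold pathSum
  rcases sqr_label_cases (ℓ := ℓ) x q q' z (2 * m) (2 * n) η with h | h | h | h
  · rw [if_pos h.1]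
    obtain rfl : m = 0 := by omega
    obtain rfl : n = 0 := by omega
    simp [axisSum]
  · obtain ⟨h, h1, h2⟩ := h
    rw [h, if_neg n2, if_pos s.xq', e2]
    obtain rfl : m = 0 := by omega
    simp only [axisSum, Finset.range_zero, Finset.sum_empty, zero_add, Nat.mul_zero,
      sqr_zero_left s.ne]
    rw [Nat.mul_div_cancel_left _ (by norm_num)]
  · obtain ⟨h, h1, h2⟩ := h
    rw [h, if_neg n1, if_pos s.xq, e1]
    obtain rfl : n = 0 := by omega
    simp
  · obtain ⟨h, h1, h2⟩ := h
    rw [h, if_neg n3, if_neg n4, hf, s.oth_eq hT, e1, e2]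
    rw [Nat.mul_div_cancel_left _ (by norm_num), Nat.mul_div_cancel_left _ (by norm_num)]

/-- One layer of `Y_x` is a subdivided star: a closed cochain on its edges is exact. -/
theorem Nice.layer_exact (hT : T.Nice) (h3 : 3 ≤ ℓ) (hodd : ℓ % 2 = 1) (x : T.V) {η : ℕ}
    (hη : η = 0 ∨ η = 2) (g : (Tanner.replace ℓ true T).Cochain)
    (hg : ∀ q q' z i j, Sq T x q q' z → i % 2 = 0 → j % 2 = 0 → i + 2 < ℓ → j + 2 < ℓ →
      ev ((Tanner.replace ℓ true T).cobdry g) x (sqr x q q' z (i + 1) (j + 1) η) = 0) :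
    ∃ φ : T.RawCell ℓ → ZMod 2, ∀ q q' z i β, Sq T x q q' z → i % 2 = 0 → β % 2 = 0 →
      i + 2 < ℓ → β < ℓ → φ (sqr x q q' z i β η) + φ (sqr x q q' z (i + 2) β η) =
        ev g x (sqr x q q' z (i + 1) β η) := by
  refine ⟨pathSum g x η, fun q q' z i β s hi hβ hil hβl => ?_⟩
  obtain ⟨m, rfl⟩ : ∃ m, i = 2 * m := ⟨i / 2, by omega⟩
  obtain ⟨n, rfl⟩ : ∃ n, β = 2 * n := ⟨β / 2, by omega⟩
  rcases s.fst_cases with hf | hf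
  -- The paths to two neighbours along the first axis bound a strip of faces. When the closedness
  -- relations of the strip are added, its inner rungs cancel in pairs.
  · have hsum : ∑ k ∈ Finset.range n, (ev g x (sqr x q q' z (2 * m) (2 * k + 1) η) +
        ev g x (sqr x q q' z (2 * m + 2) (2 * k + 1) η)) =
        ev g x (sqr x q q' z (2 * m + 1) 0 η) + ev g x (sqr x q q' z (2 * m + 1) (2 * n) η) := by
      rw [← sum_telescope (fun k => ev g x (sqr x q q' z (2 * m + 1) (2 * k) η)) n]
      refine Finset.sum_congr rfl fun k hk => ?_
      rw [Finset.mem_range] at hk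
      have h1 := hg q q' z (2 * m) (2 * k) s (by omega) (by omega) (by omega) (by omega)
      rw [hT.ev_cobdry_face h3 hodd s (by unfold SqOK; omega) (by omega) (by omega)
        (by omega)] at h1
      refine zmod_two_eq_of_add ?_
      rw [← h1, show 2 * (k + 1) = 2 * k + 2 by ring]
      ring
    rw [Finset.sum_add_distrib] at hsum
    have e1 := hT.pathSum_sqr s hf g η (m := m) (n := n) (by omega) hβl
    have e2 := hT.pathSum_sqr s hf g η (m := m + 1) (n := n) (by omega) hβl
    rw [show 2 * (m + 1) = 2 * m + 2 by ring] at e2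
    have e3 : axisSum g x q η (m + 1) = axisSum g x q η m +
        ev g x (sqr x q q' z (2 * m + 1) 0 η) := by
      rw [axisSum, Finset.sum_range_succ, sqr_zero_right]; rfl
    rw [e1, e2, e3]
    linear_combination hsum + CharTwo.add_self_eq_zero (axisSum g x q η m) +
      CharTwo.add_self_eq_zero (ev g x (sqr x q q' z (2 * m + 1) 0 η))
  -- In the second direction the longer path extends the shorter one by just the edge in question.
  · have e1 := hT.pathSum_sqr s.symm hf g η (m := n) (n := m) hβl (by omega)
    have e2 := hT.pathSum_sqr s.symm hf g η (m := n) (n := m + 1) hβl (by omega)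
    rw [show 2 * (m + 1) = 2 * m + 2 by ring] at e2
    rw [sqr_swap s.ne, sqr_swap s.ne (2 * m + 2), sqr_swap s.ne (2 * m + 1), e1, e2,
      Finset.sum_range_succ]
    linear_combination CharTwo.add_self_eq_zero (axisSum g x q' η n) +
      CharTwo.add_self_eq_zero (∑ k ∈ Finset.range m,
        ev g x (sqr x q' q z (2 * n) (2 * k + 1) η))

/-- The cochain with given values at the vertices of `Y_x`. -/
noncomputable def vertexCochain (ℓ : ℕ) (x : T.V) (φ : T.RawCell ℓ → ZMod 2) :
    (Tanner.replace ℓ true T).Cochain :=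
  fun p => if p.1 = x ∧ (Tanner.replace ℓ true T).deg p = 0 then φ p.2.1 else 0

theorem Nice.ev_vertexCochain (hT : T.Nice) {x q q' z : T.V} (s : Sq T x q q' z) {α β η : ℕ}
    (ok : SqOK ℓ α β η) (hα : α % 2 = 0) (hβ : β % 2 = 0) (hη : η % 2 = 0)
    (φ : T.RawCell ℓ → ZMod 2) :
    ev (vertexCochain ℓ x φ) x (sqr x q q' z α β η) = φ (sqr x q q' z α β η) := by
  obtain ⟨p, hp⟩ := hT.exists_sqr_raw s ok
  rw [ev_raw _ hp, vertexCochain, if_pos ⟨raw_fst hp, by rw [deg_sqr hT s ok hp]; omega⟩,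
    raw_snd hp]

/-- The cell at the same place at height `η`. -/
def setHeight (c : T.RawCell ℓ) (η : ℕ) : T.RawCell ℓ := (c.1, c.2.1, fc 3 η)

/-- The vertex cochain that is `φ` on layer `k`, is chosen on the boundary of the layer `2 - k` so as
to cancel `u` on the vertical edges, and vanishes elsewhere. -/
noncomputable def fillHeight (u : (Tanner.replace ℓ true T).Cochain) (x : T.V) (k : ℕ)
    (φ : T.RawCell ℓ → ZMod 2) (c : T.RawCell ℓ) : ZMod 2 :=
  if c.2.2.val = k then φ c
  else if ∃ w, (c.2.1 w).val + 1 = ℓ then ev u x (setHeight c 1) + φ (setHeight c k) else 0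

/-- The values on layer `k` are fixed by `φ`. Distinct vertical edges end at distinct boundary
vertices of the layer `2 - k`, where the values are still free and can cancel `u` edge by edge. -/
theorem Nice.add_fillHeight (hT : T.Nice) (h3 : 3 ≤ ℓ) (hodd : ℓ % 2 = 1) (x : T.V) {k : ℕ}
    (hk : k = 0 ∨ k = 2) (u v : (Tanner.replace ℓ true T).Cochain) (φ : T.RawCell ℓ → ZMod 2)
    (hφ : ∀ q q' z i β, Sq T x q q' z → i % 2 = 0 → β % 2 = 0 →
      i + 2 < ℓ → β < ℓ → φ (sqr x q q' z i β k) + φ (sqr x q q' z (i + 2) β k) =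
        ev (u + v) x (sqr x q q' z (i + 1) β k)) :
    (∀ q q' z i β, Sq T x q q' z → i % 2 = 0 → β % 2 = 0 → i + 2 < ℓ → β < ℓ →
      ev (u + (Tanner.replace ℓ true T).cobdry (vertexCochain ℓ x (fillHeight u x k φ))) x
        (sqr x q q' z (i + 1) β k) = ev v x (sqr x q q' z (i + 1) β k)) ∧
    (∀ q q' z β, Sq T x q q' z → β % 2 = 0 → β < ℓ →
      ev (u + (Tanner.replace ℓ true T).cobdry (vertexCochain ℓ x (fillHeight u x k φ))) x
        (sqr x q q' z (ℓ - 1) β 1) = 0) := by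
  constructor
  · intro q q' z i β s hi hβ hil hβl
    rw [ev_add, hT.ev_cobdry_edge h3 hodd s (by unfold SqOK; omega) hi hβ (by omega),
      hT.ev_vertexCochain s (by unfold SqOK; omega) hi hβ (by omega),
      hT.ev_vertexCochain s (by unfold SqOK; omega) (by omega) hβ (by omega)]
    have h1 : ∀ α, fillHeight u x k φ (sqr x q q' z α β k) = φ (sqr x q q' z α β k) := by
      intro α
      rw [fillHeight, if_pos (sqr_height _ _ _ _ _ _ (by omega))]
    rw [h1, h1, hφ q q' z i β s hi hβ hil hβl, ev_add]
    linear_combination CharTwo.add_self_eq_zero (ev u x (sqr x q q' z (i + 1) β k))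
  · intro q q' z β s hβ hβl
    rw [ev_add, hT.ev_cobdry_vert h3 hodd s (by unfold SqOK; omega) (by omega) hβ,
      hT.ev_vertexCochain s (by unfold SqOK; omega) (by omega) hβ (by omega),
      hT.ev_vertexCochain s (by unfold SqOK; omega) (by omega) hβ (by omega)]
    have h1 : fillHeight u x k φ (sqr x q q' z (ℓ - 1) β k) = φ (sqr x q q' z (ℓ - 1) β k) := by
      rw [fillHeight, if_pos (sqr_height _ _ _ _ _ _ (by omega))]
    have h2 : ∀ k', k' < 3 → k' ≠ k → fillHeight u x k φ (sqr x q q' z (ℓ - 1) β k') =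
        ev u x (sqr x q q' z (ℓ - 1) β 1) + φ (sqr x q q' z (ℓ - 1) β k) := by
      intro k' hk' hne
      rw [fillHeight, if_neg (by rw [sqr_height _ _ _ _ _ _ hk']; exact hne), if_pos]
      · rfl
      · exact ⟨q, by rw [sqr_coord_left _ _ _ _ _ _ (by omega)]; omega⟩
    rcases hk with rfl | rfl
    · rw [h1, h2 2 (by omega) (by omega)]
      linear_combination CharTwo.add_self_eq_zero (ev u x (sqr x q q' z (ℓ - 1) β 1)) +
        CharTwo.add_self_eq_zero (φ (sqr x q q' z (ℓ - 1) β 0))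
    · rw [h1, h2 0 (by omega) (by omega)]
      linear_combination CharTwo.add_self_eq_zero (ev u x (sqr x q q' z (ℓ - 1) β 1)) +
        CharTwo.add_self_eq_zero (φ (sqr x q q' z (ℓ - 1) β 2))

theorem Nice.ev_cobdry_cobdry (hT : T.Nice) (h3 : 3 ≤ ℓ) (hodd : ℓ % 2 = 1)
    (u h : (Tanner.replace ℓ true T).Cochain) (x : T.V) (c : T.RawCell ℓ) :
    ev ((Tanner.replace ℓ true T).cobdry (u + (Tanner.replace ℓ true T).cobdry h)) x c =
      ev ((Tanner.replace ℓ true T).cobdry u) x c := by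
  rw [map_add, (hT.replace_true h3 hodd).cobdry_cobdry, add_zero]

/-- The first cohomology of `Y_x` vanishes. -/
theorem Nice.star_exact (hT : T.Nice) (h3 : 3 ≤ ℓ) (hodd : ℓ % 2 = 1) {x : T.V}
    (hx : T.deg x = 0) (g : (Tanner.replace ℓ true T).Cochain)
    (hg : ∀ p : (Tanner.replace ℓ true T).V, p.1 = x → (Tanner.replace ℓ true T).deg p = 2 →
      (Tanner.replace ℓ true T).cobdry g p = 0) :
    ∃ h : (Tanner.replace ℓ true T).Cochain,
      (∀ p, h p ≠ 0 → p.1 = x ∧ (Tanner.replace ℓ true T).deg p = 0) ∧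
      ∀ p : (Tanner.replace ℓ true T).V, p.1 = x → (Tanner.replace ℓ true T).deg p = 1 →
        (Tanner.replace ℓ true T).cobdry h p = g p := by
  have hclosed : ∀ q q' z α β η, Sq T x q q' z → SqOK ℓ α β η → α % 2 + β % 2 + η % 2 = 2 →
      ev ((Tanner.replace ℓ true T).cobdry g) x (sqr x q q' z α β η) = 0 := by
    intro q q' z α β η s ok hd
    obtain ⟨p, hp⟩ := hT.exists_sqr_raw s ok
    rw [ev_raw _ hp]
    exact hg p (raw_fst hp) (by rw [deg_sqr hT s ok hp, hd])
  obtain ⟨φ, hφ⟩ := hT.layer_exact h3 hodd x (Or.inl rfl) g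
    (fun q q' z i j s hi hj hil hjl => hclosed _ _ _ _ _ _ s (by unfold SqOK; omega) (by omega))
  -- After the coboundary of `h0` is added, the cochain vanishes on layer `0` and on the vertical
  -- edges; only layer `2` remains.
  set h0 := vertexCochain ℓ x (fillHeight g x 0 φ) with hh0
  obtain ⟨hl0, hv⟩ := hT.add_fillHeight h3 hodd x (Or.inl rfl) g 0 φ (by simpa using hφ)
  rw [← hh0] at hl0 hv
  have hzero : ∀ c : T.RawCell ℓ, ev (0 : (Tanner.replace ℓ true T).Cochain) x c = 0 := by
    intro c; unfold ev; split_ifs <;> rfl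
  simp only [hzero] at hl0
  set g1 := g + (Tanner.replace ℓ true T).cobdry h0 with hg1
  have hclosed1 : ∀ q q' z α β η, Sq T x q q' z → SqOK ℓ α β η → α % 2 + β % 2 + η % 2 = 2 →
      ev ((Tanner.replace ℓ true T).cobdry g1) x (sqr x q q' z α β η) = 0 := by
    intro q q' z α β η s ok hd
    rw [hg1, hT.ev_cobdry_cobdry h3 hodd]
    exact hclosed _ _ _ _ _ _ s ok hd
  obtain ⟨ψ, hψ⟩ := hT.layer_exact h3 hodd x (Or.inr rfl) g1
    (fun q q' z i j s hi hj hil hjl => hclosed1 _ _ _ _ _ _ s (by unfold SqOK; omega) (by omega))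
  -- Three edges of a cylinder face now carry zero, so closedness kills the fourth, on the boundary
  -- of layer `2`.
  have hb : ∀ q q' z j, Sq T x q q' z → j % 2 = 0 → j + 2 < ℓ →
      ev g1 x (sqr x q q' z (ℓ - 1) (j + 1) 2) = 0 := by
    intro q q' z j s hj hjl
    have h1 := hclosed1 q q' z (ℓ - 1) (j + 1) 1 s (by unfold SqOK; omega) (by omega)
    rw [hT.ev_cobdry_cyl h3 hodd s (by unfold SqOK; omega) (by omega) hj,
      hv q q' z j s hj (by omega), hv q q' z (j + 2) s (by omega) (by omega),
      sqr_swap s.ne (ℓ - 1) (j + 1) 0, hl0 q' q z j (ℓ - 1) s.symm hj (by omega) hjl (by omega)]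
      at h1
    simpa using h1
  have hψb : ∀ q q' z β, Sq T x q q' z → β % 2 = 0 → β < ℓ →
      ψ (sqr x q q' z (ℓ - 1) β 2) = ψ (line x q (ℓ - 1) 2) := by
    intro q q' z β s hβ hβl
    rw [← sqr_zero_right x q q' z]
    refine even_chain (f := fun b => ψ (sqr x q q' z (ℓ - 1) b 2)) (fun j hj hjl => ?_) β hβ hβl
    refine zmod_two_eq_of_add ?_
    have h1 := hψ q' q z j (ℓ - 1) s.symm hj (by omega) hjl (by omega)
    simp only [← sqr_swap s.ne] at h1
    rw [h1, hb q q' z j s hj hjl]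
  -- The primitive `ψ` is constant on the side of the boundary belonging to each qubit, and the
  -- sides of two qubits of a square meet in the corner `(ℓ - 1, ℓ - 1)`. As the link of `x` is
  -- connected, there is one constant `κ` for the whole boundary.
  obtain ⟨q0, hq0⟩ := hT.above x (by omega)
  have hκ : ∀ q, T.inc x q → ψ (line x q (ℓ - 1) 2) = ψ (line x q0 (ℓ - 1) 2) := by
    intro q hq
    refine hT.linkUp x hx (fun q => ψ (line x q (ℓ - 1) 2)) ?_ q q0 hq hq0
    intro a b z ha hb haz hbz
    by_cases hab : a = b
    · rw [hab]
    · obtain ⟨a', s1⟩ := hT.exists_sq ha haz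
      obtain rfl : b = a' := (s1.only b hb hbz).resolve_left (Ne.symm hab)
      rw [← hψb a b z (ℓ - 1) s1 (by omega) (by omega),
        ← hψb b a z (ℓ - 1) s1.symm (by omega) (by omega), sqr_swap s1.ne]
  set κ := ψ (line x q0 (ℓ - 1) 2) with hκdef
  -- The shift by `κ` makes the primitive zero on the boundary, so that it extends by zero to layer
  -- `0` without touching the vertical edges.
  set h2 := vertexCochain ℓ x (fun c => if c.2.2.val = 2 then ψ c + κ else 0) with hh2
  have hsupp : ∀ φ p, vertexCochain ℓ x φ p ≠ 0 →
      p.1 = x ∧ (Tanner.replace ℓ true T).deg p = 0 := by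
    intro φ p hp
    by_contra hn
    exact hp (if_neg hn)
  refine ⟨h0 + h2, ?_, ?_⟩
  · intro p hp
    by_cases h : h0 p = 0
    · refine hsupp (fun c => if c.2.2.val = 2 then ψ c + κ else 0) p fun h' => ?_
      exact hp (by rw [Pi.add_apply, h, hh2, h', add_zero])
    · exact hsupp _ p h
  · intro p hpx hp1
    suffices hs : (Tanner.replace ℓ true T).cobdry h2 p = g1 p by
      rw [map_add, Pi.add_apply, hs, hg1, Pi.add_apply]
      linear_combination CharTwo.add_self_eq_zero ((Tanner.replace ℓ true T).cobdry h0 p)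
    subst hpx
    have hh2v : ∀ q q' z α β, Sq T p.1 q q' z → α < ℓ → β < ℓ → α % 2 = 0 → β % 2 = 0 →
        ev h2 p.1 (sqr p.1 q q' z α β 0) = 0 ∧
        ev h2 p.1 (sqr p.1 q q' z α β 2) = ψ (sqr p.1 q q' z α β 2) + κ := by
      intro q q' z α β s hα hβ hα' hβ'
      constructor
      · rw [hh2, hT.ev_vertexCochain s (by unfold SqOK; omega) hα' hβ' (by omega),
          if_neg (by rw [sqr_height _ _ _ _ _ _ (by omega)]; omega)]
      · rw [hh2, hT.ev_vertexCochain s (by unfold SqOK; omega) hα' hβ' (by omega),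
          if_pos (by rw [sqr_height _ _ _ _ _ _ (by omega)])]
    rcases hT.edge_cases h3 hodd hx hp1 with ⟨q, q', z, i, β, η, s, hil, hβl, hi, hβ, hη, hp⟩ |
      ⟨q, q', z, β, s, hβl, hβ, hp⟩
    · rw [← ev_raw ((Tanner.replace ℓ true T).cobdry h2) hp, ← ev_raw g1 hp,
        hT.ev_cobdry_edge h3 hodd s (by unfold SqOK; omega) hi hβ (by omega)]
      have a1 := hh2v q q' z i β s (by omega) hβl hi hβ
      have a2 := hh2v q q' z (i + 2) β s (by omega) hβl (by omega) hβ
      rcases hη with rfl | rfl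
      · rw [a1.1, a2.1, hl0 q q' z i β s hi hβ hil hβl, add_zero]
      · rw [a1.2, a2.2, ← hψ q q' z i β s hi hβ hil hβl]
        linear_combination CharTwo.add_self_eq_zero κ
    · rw [← ev_raw ((Tanner.replace ℓ true T).cobdry h2) hp, ← ev_raw g1 hp,
        hT.ev_cobdry_vert h3 hodd s (by unfold SqOK; omega) (by omega) hβ]
      have a1 := hh2v q q' z (ℓ - 1) β s (by omega) hβl (by omega) hβ
      rw [a1.1, a1.2, hv q q' z β s hβ hβl, hψb q q' z β s hβ hβl, hκ q s.xq, zero_add]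
      exact CharTwo.add_self_eq_zero κ

/-- Closed functions on the vertices of `Y_x` are constant. -/
theorem Nice.star_const (hT : T.Nice) (h3 : 3 ≤ ℓ) (hodd : ℓ % 2 = 1) {x : T.V}
    (ψ : (Tanner.replace ℓ true T).Cochain)
    (hψ : ∀ p : (Tanner.replace ℓ true T).V, p.1 = x → (Tanner.replace ℓ true T).deg p = 1 →
      (Tanner.replace ℓ true T).cobdry ψ p = 0) (hx : T.deg x = 0) :
    ∀ p : (Tanner.replace ℓ true T).V, p.1 = x → (Tanner.replace ℓ true T).deg p = 0 →
      ψ p = ev ψ x (pt x 0) := by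
  have hcl : ∀ q q' z α β η, Sq T x q q' z → SqOK ℓ α β η → α % 2 + β % 2 + η % 2 = 1 →
      ev ((Tanner.replace ℓ true T).cobdry ψ) x (sqr x q q' z α β η) = 0 := by
    intro q q' z α β η s ok hd
    obtain ⟨p, hp⟩ := hT.exists_sqr_raw s ok
    rw [ev_raw _ hp]
    exact hψ p (raw_fst hp) (by rw [deg_sqr hT s ok hp, hd])
  have h1 : ∀ q q' z α β η, Sq T x q q' z → α < ℓ → β < ℓ → α % 2 = 0 → β % 2 = 0 →
      (η = 0 ∨ η = 2) → ev ψ x (sqr x q q' z α β η) = ev ψ x (sqr x q q' z 0 β η) := by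
    intro q q' z α β η s hα hβ hα' hβ' hη
    refine even_chain (f := fun a => ev ψ x (sqr x q q' z a β η)) (fun i hi hil => ?_) α hα' hα
    refine zmod_two_eq_of_add ?_
    rw [← hT.ev_cobdry_edge h3 hodd s (by unfold SqOK; omega) hi hβ' (by omega)]
    exact hcl _ _ _ _ _ _ s (by unfold SqOK; omega) (by omega)
  have h2 : ∀ q q' z α β η, Sq T x q q' z → α < ℓ → β < ℓ → α % 2 = 0 → β % 2 = 0 →
      (η = 0 ∨ η = 2) → ev ψ x (sqr x q q' z α β η) = ev ψ x (pt x η) := by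
    intro q q' z α β η s hα hβ hα' hβ' hη
    rw [h1 q q' z α β η s hα hβ hα' hβ' hη, sqr_swap s.ne,
      h1 q' q z β 0 η s.symm hβ (by omega) hβ' (by omega) hη, sqr_zero_right, line_zero]
  intro p hpx hp0
  rcases hT.raw_cases h3 p with ⟨x', q, q', z, α, β, η, s, ok, hp, hd⟩ |
    ⟨q, z, α, η, hqz, hq, ok, hp, hd⟩ | ⟨z, η, hz, hη, hne, hp, hd⟩
  · obtain rfl : x' = x := (raw_fst hp).symm.trans hpx
    unfold SqOK at ok
    rw [← ev_raw ψ hp, h2 q q' z α β η s ok.1 ok.2.1 (by omega) (by omega) (by omega)]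
    have hη : η = 0 ∨ η = 2 := by omega
    rcases hη with rfl | rfl
    · rfl
    · have h5 := hcl q q' z (ℓ - 1) 0 1 s (by unfold SqOK; omega) (by omega)
      rw [hT.ev_cobdry_vert h3 hodd s (by unfold SqOK; omega) (by omega) (by omega)] at h5
      rw [← h2 q q' z (ℓ - 1) 0 2 s (by omega) (by omega) (by omega) (by omega) (Or.inr rfl),
        ← h2 q q' z (ℓ - 1) 0 0 s (by omega) (by omega) (by omega) (by omega) (Or.inl rfl)]
      exact (zmod_two_eq_of_add h5).symm
  · omega
  · omega

omit [NeZero ℓ] in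
theorem ev_eq_zero {g : (Tanner.replace ℓ true T).Cochain} {v : T.V} {c : T.RawCell ℓ}
    (h : ∀ p : (Tanner.replace ℓ true T).V, p.1 = v → g p = 0) : ev g v c = 0 := by
  unfold ev
  split_ifs with hc
  · exact h ⟨v, c, hc⟩ rfl
  · rfl

theorem inclSum_eq_zero {g : (Tanner.replace ℓ true T).Cochain} {q : T.V}
    (h : ∀ p : (Tanner.replace ℓ true T).V, T.inc p.1 q → g p = 0) (z : T.V) (α η : ℕ) :
    inclSum g q z α η = 0 := by
  refine Finset.sum_eq_zero fun x _ => ?_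
  split_ifs with hx
  · exact ev_eq_zero fun p hp => h p (by rw [hp]; exact hx)
  · rfl

/-- Closed functions on the vertices of `Y_q` are constant. -/
theorem Nice.qubit_const (hT : T.Nice) (h3 : 3 ≤ ℓ) (hodd : ℓ % 2 = 1) {q : T.V}
    (hq : T.deg q = 1) (ψ : (Tanner.replace ℓ true T).Cochain)
    (h0 : ∀ p : (Tanner.replace ℓ true T).V, T.inc p.1 q → ψ p = 0)
    (hψ : ∀ p : (Tanner.replace ℓ true T).V, p.1 = q → (Tanner.replace ℓ true T).deg p = 2 →
      (Tanner.replace ℓ true T).cobdry ψ p = 0) :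
    ∀ p : (Tanner.replace ℓ true T).V, p.1 = q → (Tanner.replace ℓ true T).deg p = 1 →
      ψ p = ev ψ q (pt q 0) := by
  have hcl : ∀ z α η, T.inc q z → LineOK ℓ α η → α % 2 + η % 2 = 1 →
      ev ((Tanner.replace ℓ true T).cobdry ψ) q (line q z α η) = 0 := by
    intro z α η hz ok hd
    obtain ⟨p, hp⟩ := hT.exists_line_raw hz hq ok
    rw [ev_raw _ hp]
    exact hψ p (raw_fst hp) (by rw [deg_line hq ok hp, hd])
  have h2 : ∀ z α η, T.inc q z → α < ℓ → α % 2 = 0 → (η = 0 ∨ η = 2) →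
      ev ψ q (line q z α η) = ev ψ q (pt q η) := by
    intro z α η hz hα hα' hη
    rw [← line_zero q z]
    refine even_chain (f := fun a => ev ψ q (line q z a η)) (fun i hi hil => ?_) α hα' hα
    refine zmod_two_eq_of_add ?_
    have h5 := hcl z (i + 1) η hz (by unfold LineOK; omega) (by omega)
    rwa [hT.ev_cobdry_line h3 hodd hz hq (by unfold LineOK; omega) hi (by omega),
      inclSum_eq_zero h0, add_zero] at h5
  intro p hpx hp0
  rcases hT.raw_cases h3 p with ⟨x', q', q'', z, α, β, η, s, ok, hp, hd⟩ |
    ⟨q', z, α, η, hqz, hq', ok, hp, hd⟩ | ⟨z, η, hz, hη, hne, hp, hd⟩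
  · have := (hT.sq_deg s).1
    rw [← (raw_fst hp).symm.trans hpx] at hq
    omega
  · obtain rfl : q' = q := (raw_fst hp).symm.trans hpx
    unfold LineOK at ok
    rw [← ev_raw ψ hp, h2 z α η hqz ok.1 (by omega) (by omega)]
    have hη : η = 0 ∨ η = 2 := by omega
    rcases hη with rfl | rfl
    · rfl
    · have h5 := hcl z (ℓ - 1) 1 hqz (by unfold LineOK; omega) (by omega)
      rw [hT.ev_cobdry_line_vert h3 hodd hqz hq (by unfold LineOK; omega) (by omega),
        inclSum_eq_zero h0, add_zero] at h5
      rw [← h2 z (ℓ - 1) 2 hqz (by omega) (by omega) (Or.inr rfl),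
        ← h2 z (ℓ - 1) 0 hqz (by omega) (by omega) (Or.inl rfl)]
      exact (zmod_two_eq_of_add h5).symm
  · omega

end Tanner

namespace Tanner

section Loc

variable {T : Tanner} {ℓ : ℕ} {b : Bool}

/-! ### Restriction to local complexes -/

theorem loc_apply (v : T.V) (σ : (Tanner.replace ℓ b T).Cochain) (p : (Tanner.replace ℓ b T).V) :
    loc v σ p = if p.1 = v then σ p else 0 := rfl

theorem loc_of_eq {v : T.V} (σ : (Tanner.replace ℓ b T).Cochain)
    {p : (Tanner.replace ℓ b T).V} (h : p.1 = v) : loc v σ p = σ p := if_pos h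

theorem loc_of_ne {v : T.V} (σ : (Tanner.replace ℓ b T).Cochain)
    {p : (Tanner.replace ℓ b T).V} (h : p.1 ≠ v) : loc v σ p = 0 := if_neg h

theorem loc_add (v : T.V) (σ τ : (Tanner.replace ℓ b T).Cochain) :
    loc v (σ + τ) = loc v σ + loc v τ := by
  funext p
  simp only [loc_apply, Pi.add_apply]
  split_ifs <;> simp

theorem loc_zero (v : T.V) : loc v (0 : (Tanner.replace ℓ b T).Cochain) = 0 := by
  funext p
  simp [loc_apply]

theorem loc_loc (v : T.V) (σ : (Tanner.replace ℓ b T).Cochain) : loc v (loc v σ) = loc v σ := by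
  funext p
  simp only [loc_apply]
  split_ifs <;> rfl

theorem loc_eq_zero_iff {v : T.V} {σ : (Tanner.replace ℓ b T).Cochain} :
    loc v σ = 0 ↔ ∀ p : (Tanner.replace ℓ b T).V, p.1 = v → σ p = 0 := by
  constructor
  · intro h p hp
    have := congrFun h p
    rwa [loc_of_eq _ hp] at this
  · intro h
    funext p
    by_cases hp : p.1 = v
    · rw [loc_of_eq _ hp, h p hp]; rfl
    · rw [loc_of_ne _ hp]; rfl

theorem loc_eq_self_iff {v : T.V} {σ : (Tanner.replace ℓ b T).Cochain} :
    loc v σ = σ ↔ ∀ p, σ p ≠ 0 → p.1 = v := by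
  constructor
  · intro h p hp
    by_contra hne
    rw [← h, loc_of_ne _ hne] at hp
    exact hp rfl
  · intro h
    funext p
    by_cases hp : p.1 = v
    · rw [loc_of_eq _ hp]
    · rw [loc_of_ne _ hp]
      by_contra hne
      exact hp (h p (Ne.symm hne))

theorem loc_mem_cochains {m : ℕ} {σ : (Tanner.replace ℓ b T).Cochain} (v : T.V)
    (h : σ ∈ (Tanner.replace ℓ b T).cochains m) :
    loc v σ ∈ (Tanner.replace ℓ b T).cochains m := restrict_mem_cochains _ h

theorem loc_sum {ι : Type} (s : Finset ι) (v : T.V) (f : ι → (Tanner.replace ℓ b T).Cochain) :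
    loc v (∑ i ∈ s, f i) = ∑ i ∈ s, loc v (f i) := by
  induction s using Finset.induction_on with
  | empty => simp [loc_zero]
  | insert a s ha ih => rw [Finset.sum_insert ha, Finset.sum_insert ha, loc_add, ih]

theorem sum_loc (σ : (Tanner.replace ℓ b T).Cochain) : ∑ v : T.V, loc v σ = σ := by
  funext p
  rw [Finset.sum_apply, Finset.sum_eq_single p.1]
  · rw [loc_of_eq _ rfl]
  · intro v _ hv
    rw [loc_of_ne _ (Ne.symm hv)]
  · intro h; exact absurd (Finset.mem_univ _) h

/-- Puts the cost of a correction into a form that can be bounded by assigning cells of the syndrome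
to outside cells. -/
theorem sum_weight_loc (x : T.V) (σ : (Tanner.replace ℓ b T).Cochain) :
    (∑ w : T.V, if w = x then 0 else weight (loc w σ)) =
      (Finset.univ.filter fun p : (Tanner.replace ℓ b T).V => p.1 ≠ x ∧ σ p ≠ 0).card := by
  rw [Finset.card_eq_sum_card_fiberwise (f := fun p => p.1) (t := Finset.univ)
    (fun p _ => Finset.mem_coe.2 (Finset.mem_univ _))]
  refine Finset.sum_congr rfl fun w _ => ?_
  split_ifs with h
  · subst h
    symm
    rw [Finset.card_eq_zero, Finset.filter_eq_empty_iff]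
    intro p hp hpw
    rw [Finset.mem_filter] at hp
    exact hp.2.1 hpw
  · unfold weight
    congr 1
    ext p
    constructor
    · intro hp
      have hp' := (Finset.mem_filter.1 hp).2
      by_cases hw : p.1 = w
      · rw [loc_of_eq _ hw] at hp'
        exact Finset.mem_filter.2 ⟨Finset.mem_filter.2
          ⟨Finset.mem_univ _, fun h' => h (hw.symm.trans h'), hp'⟩, hw⟩
      · exact absurd (loc_of_ne _ hw) hp'
    · intro hp
      obtain ⟨h1, h4⟩ := Finset.mem_filter.1 hp
      refine Finset.mem_filter.2 ⟨Finset.mem_univ _, ?_⟩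
      rw [loc_of_eq _ h4]
      exact (Finset.mem_filter.1 h1).2.2

end Loc

variable {T : Tanner} {ℓ : ℕ}

theorem replace_inc_fst {p p' : (Tanner.replace ℓ true T).V}
    (h : (Tanner.replace ℓ true T).inc p p') : p.1 = p'.1 ∨ T.inc p.1 p'.1 := by
  rcases (replace_inc p p').1 h with h | h
  · exact Or.inl h.1
  · exact Or.inr h.1

/-- The coboundary on `Y_v` depends only on the values on `Y_v` if nothing below contributes. -/
theorem cobdry_loc_apply {v : T.V} (g : (Tanner.replace ℓ true T).Cochain)
    {p : (Tanner.replace ℓ true T).V} (hp : p.1 = v)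
    (h : ∀ p' : (Tanner.replace ℓ true T).V, T.inc p'.1 v → g p' = 0) :
    (Tanner.replace ℓ true T).cobdry (loc v g) p = (Tanner.replace ℓ true T).cobdry g p := by
  rw [cobdry_apply, cobdry_apply]
  refine Finset.sum_congr rfl fun u _ => ?_
  split_ifs with hu
  · by_cases huv : u.1 = v
    · rw [loc_of_eq _ huv]
    · rw [loc_of_ne _ huv]
      rcases replace_inc_fst hu with h1 | h1
      · exact absurd (h1.trans hp) huv
      · rw [h u (by rw [← hp]; exact h1)]
  · rfl

theorem Nice.not_inc_of_deg_zero (hT : T.Nice) {x v : T.V} (hx : T.deg x = 0) : ¬ T.inc v x := by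
  intro h
  have := hT.inc_deg h
  omega

theorem Nice.loc_cobdry_loc (hT : T.Nice) {x : T.V} (hx : T.deg x = 0)
    (g : (Tanner.replace ℓ true T).Cochain) :
    loc x ((Tanner.replace ℓ true T).cobdry (loc x g)) =
      loc x ((Tanner.replace ℓ true T).cobdry g) := by
  funext p
  by_cases hp : p.1 = x
  · rw [loc_of_eq _ hp, loc_of_eq _ hp]
    exact cobdry_loc_apply g hp fun p' h => absurd h (hT.not_inc_of_deg_zero hx)
  · rw [loc_of_ne _ hp, loc_of_ne _ hp]

variable [NeZero ℓ]

/-! ### Local corrections on the `X`-checks -/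

/-- The strings that move the faces of layer `k` of `Y_x` in the direction of the first qubit. -/
noncomputable def pushSum (σ : (Tanner.replace ℓ true T).Cochain) (x : T.V) (k : ℕ)
    (c : T.RawCell ℓ) : ZMod 2 :=
  if c.1 ≠ x ∧ ¬ T.inc x c.1 ∧ (c.2.1 (fst T x c.1)).val % 2 = 0 then
    ∑ i ∈ Finset.range ((c.2.1 (fst T x c.1)).val / 2),
      ev σ x (sqr x (fst T x c.1) (oth T x (fst T x c.1) c.1) c.1 (2 * i + 1)
        (c.2.1 (oth T x (fst T x c.1) c.1)).val k)
  else 0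

/-- The cochain with given values at the edges of `Y_x`. -/
noncomputable def edgeCochain (ℓ : ℕ) (x : T.V) (φ : T.RawCell ℓ → ZMod 2) :
    (Tanner.replace ℓ true T).Cochain :=
  fun p => if p.1 = x ∧ (Tanner.replace ℓ true T).deg p = 1 then φ p.2.1 else 0

theorem Nice.ev_edgeCochain (hT : T.Nice) {x q q' z : T.V} (s : Sq T x q q' z) {α β η : ℕ}
    (ok : SqOK ℓ α β η) (hd : α % 2 + β % 2 + η % 2 = 1) (φ : T.RawCell ℓ → ZMod 2) :
    ev (edgeCochain ℓ x φ) x (sqr x q q' z α β η) = φ (sqr x q q' z α β η) := by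
  obtain ⟨p, hp⟩ := hT.exists_sqr_raw s ok
  rw [ev_raw _ hp, edgeCochain, if_pos ⟨raw_fst hp, by rw [deg_sqr hT s ok hp]; omega⟩,
    raw_snd hp]

/-- Each face of the syndrome emits a string outwards in the direction of the chosen qubit; the edge
at coordinate `2 * m` is crossed by the strings of those faces in its column that are nearer to the
centre. -/
theorem Nice.pushSum_sqr (hT : T.Nice) {x q q' z : T.V} (s : Sq T x q q' z)
    (hf : fst T x z = q) (σ : (Tanner.replace ℓ true T).Cochain) (k : ℕ) {m β : ℕ}
    (hm : 2 * m < ℓ) (hβ : β < ℓ) (hβ' : β % 2 = 1) :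
    pushSum σ x k (sqr x q q' z (2 * m) β k) =
      ∑ i ∈ Finset.range m, ev σ x (sqr x q q' z (2 * i + 1) β k) := by
  obtain ⟨hx, hq, hq', hz⟩ := hT.sq_deg s
  have e1 := sqr_coord_left (ℓ := ℓ) x q q' z β k hm
  have e2 := sqr_coord_right (ℓ := ℓ) (x := x) (z := z) s.ne (2 * m) k hβ
  have n3 : z ≠ x := by rintro rfl; omega
  have n4 : ¬ T.inc x z := fun h => by have := hT.inc_deg h; omega
  unfold pushSum
  rcases sqr_label_cases (ℓ := ℓ) x q q' z (2 * m) β k with h | h | h | h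
  · omega
  · obtain ⟨h, h1, h2⟩ := h
    obtain rfl : m = 0 := by omega
    rw [h, if_neg (fun h' => h'.2.1 s.xq')]
    simp
  · omega
  · obtain ⟨h, h1, h2⟩ := h
    rw [h, hf, s.oth_eq hT, e1, e2, if_pos ⟨n3, n4, by omega⟩,
      Nat.mul_div_cancel_left _ (by norm_num)]

theorem Nice.pushSum_sqr_odd (hT : T.Nice) {x q q' z : T.V} (s : Sq T x q q' z)
    (hf : fst T x z = q) (σ : (Tanner.replace ℓ true T).Cochain) (k : ℕ) {α β : ℕ}
    (hα : α < ℓ) (hα' : α % 2 = 1) :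
    pushSum σ x k (sqr x q q' z α β k) = 0 := by
  obtain ⟨hx, hq, hq', hz⟩ := hT.sq_deg s
  have e1 := sqr_coord_left (ℓ := ℓ) x q q' z β k hα
  unfold pushSum
  rw [if_neg]
  rintro ⟨h1, h2, h3⟩
  rcases sqr_label_cases (ℓ := ℓ) x q q' z α β k with h | h | h | h
  · exact h1 h.1
  · rw [h.1] at h2; exact h2 s.xq'
  · rw [h.1] at h2; exact h2 s.xq
  · rw [h.1, hf, e1] at h3; omega

/-- The strings have the prescribed boundary on layer `k`. -/
theorem Nice.cobdry_push (hT : T.Nice) (h3 : 3 ≤ ℓ) (hodd : ℓ % 2 = 1) {x q q' z : T.V}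
    (s : Sq T x q q' z) (σ : (Tanner.replace ℓ true T).Cochain) {k : ℕ} (hk : k = 0 ∨ k = 2)
    {i j : ℕ} (hi : i % 2 = 0) (hj : j % 2 = 0) (hil : i + 2 < ℓ) (hjl : j + 2 < ℓ) :
    ev ((Tanner.replace ℓ true T).cobdry (edgeCochain ℓ x (pushSum σ x k))) x
      (sqr x q q' z (i + 1) (j + 1) k) = ev σ x (sqr x q q' z (i + 1) (j + 1) k) := by
  have main : ∀ q q' z i j, Sq T x q q' z → fst T x z = q → i % 2 = 0 → j % 2 = 0 → i + 2 < ℓ →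
      j + 2 < ℓ → ev ((Tanner.replace ℓ true T).cobdry (edgeCochain ℓ x (pushSum σ x k))) x
      (sqr x q q' z (i + 1) (j + 1) k) = ev σ x (sqr x q q' z (i + 1) (j + 1) k) := by
    intro q q' z i j s hf hi hj hil hjl
    rw [hT.ev_cobdry_face h3 hodd s (by unfold SqOK; omega) hi hj (by omega),
      hT.ev_edgeCochain s (by unfold SqOK; omega) (by omega),
      hT.ev_edgeCochain s (by unfold SqOK; omega) (by omega),
      hT.ev_edgeCochain s (by unfold SqOK; omega) (by omega),
      hT.ev_edgeCochain s (by unfold SqOK; omega) (by omega),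
      hT.pushSum_sqr_odd s hf σ k (α := i + 1) (β := j) (by omega) (by omega),
      hT.pushSum_sqr_odd s hf σ k (α := i + 1) (β := j + 2) (by omega) (by omega)]
    obtain ⟨m, rfl⟩ : ∃ m, i = 2 * m := ⟨i / 2, by omega⟩
    rw [hT.pushSum_sqr s hf σ k (m := m) (β := j + 1) (by omega) (by omega) (by omega),
      show 2 * m + 2 = 2 * (m + 1) by ring,
      hT.pushSum_sqr s hf σ k (m := m + 1) (β := j + 1) (by omega) (by omega) (by omega), Finset.sum_range_succ]
    linear_combination CharTwo.add_self_eq_zero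
      (∑ i ∈ Finset.range m, ev σ x (sqr x q q' z (2 * i + 1) (j + 1) k))
  rcases s.fst_cases with hf | hf
  · exact main q q' z i j s hf hi hj hil hjl
  · rw [sqr_swap s.ne]
    exact main q' q z j i s.symm hf hj hi hjl hil

/-- A correction on `Y_x` that moves the faces on the layer `k` to the layer `2 - k`. -/
theorem Nice.exists_push (hT : T.Nice) (h3 : 3 ≤ ℓ) (hodd : ℓ % 2 = 1) {x : T.V}
    (u : (Tanner.replace ℓ true T).Cochain) (hu : u ∈ (Tanner.replace ℓ true T).cochains 1)
    {k : ℕ} (hk : k = 0 ∨ k = 2) :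
    ∃ f ∈ (Tanner.replace ℓ true T).cochains 1,
      (∀ c, ev ((Tanner.replace ℓ true T).cobdry f) x c =
        ev ((Tanner.replace ℓ true T).cobdry u) x c) ∧
      (∀ q q' z β, Sq T x q q' z → β % 2 = 0 → β < ℓ → ev f x (sqr x q q' z (ℓ - 1) β 1) = 0) ∧
      (∀ q q' z j, Sq T x q q' z → j % 2 = 0 → j + 2 < ℓ →
        ev f x (sqr x q q' z (ℓ - 1) (j + 1) k) ≠ 0 → fst T x z = q ∧
        ∃ i, i % 2 = 0 ∧ i + 2 < ℓ ∧ ev ((Tanner.replace ℓ true T).cobdry u) x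
          (sqr x q q' z (i + 1) (j + 1) k) ≠ 0) := by
  set σ := (Tanner.replace ℓ true T).cobdry u with hσ
  set v := edgeCochain ℓ x (pushSum σ x k) with hv
  -- On layer `k` the cochain `u` and the strings `v` have the same coboundary, hence differ by an
  -- exact cochain. A coboundary therefore turns `u` into `v` there, with the syndrome unchanged.
  obtain ⟨φ, hφ⟩ := hT.layer_exact h3 hodd x hk (u + v) (by
    intro q q' z i j s hi hj hil hjl
    rw [map_add, ev_add, hv, hT.cobdry_push h3 hodd s σ hk hi hj hil hjl]
    exact CharTwo.add_self_eq_zero _)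
  obtain ⟨h1, h2⟩ := hT.add_fillHeight h3 hodd x hk u v φ hφ
  have hvc : vertexCochain ℓ x (fillHeight u x k φ) ∈ (Tanner.replace ℓ true T).cochains 0 := by
    intro p hp
    by_contra hn
    exact hp (if_neg fun h => hn h.2)
  refine ⟨u + (Tanner.replace ℓ true T).cobdry (vertexCochain ℓ x (fillHeight u x k φ)),
    Submodule.add_mem _ hu ((hT.replace_true h3 hodd).cobdry_mem hvc), ?_, h2, ?_⟩
  · intro c
    exact hT.ev_cobdry_cobdry h3 hodd u _ x c
  · intro q q' z j s hj hjl hne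
    rw [sqr_swap s.ne, h1 q' q z j (ℓ - 1) s.symm hj (by omega) hjl (by omega), hv,
      hT.ev_edgeCochain s.symm (by unfold SqOK; omega) (by omega)] at hne
    -- Strings leave a square only through the side of its chosen qubit; none crosses the side of
    -- the other one.
    rcases s.fst_cases with hf | hf
    · refine ⟨hf, ?_⟩
      obtain ⟨m, hm⟩ : ∃ m, ℓ - 1 = 2 * m := ⟨(ℓ - 1) / 2, by omega⟩
      rw [← sqr_swap s.ne, hm, hT.pushSum_sqr s hf σ k (by omega) (by omega) (by omega)] at hne
      obtain ⟨i, hi, hi'⟩ := Finset.exists_ne_zero_of_sum_ne_zero hne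
      rw [Finset.mem_range] at hi
      exact ⟨2 * i, by omega, by omega, hi'⟩
    · exact absurd (hT.pushSum_sqr_odd s.symm hf σ k (by omega) (by omega)) hne

/-- The support of a local syndrome at height `η`. -/
noncomputable def heightSupport (x : T.V) (σ : (Tanner.replace ℓ true T).Cochain) (η : ℕ) :
    Finset (Tanner.replace ℓ true T).V :=
  Finset.univ.filter fun p => p.1 = x ∧ p.2.1.2.2.val = η ∧ σ p ≠ 0

omit [NeZero ℓ] in
theorem heightSupport_card_le (x : T.V) (σ : (Tanner.replace ℓ true T).Cochain) :
    (heightSupport x σ 0).card + (heightSupport x σ 1).card + (heightSupport x σ 2).card ≤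
      weight (loc x σ) := by
  have d01 : Disjoint (heightSupport x σ 0) (heightSupport x σ 1) := by
    rw [Finset.disjoint_left]
    intro p hp hp'
    have h1 := (Finset.mem_filter.1 hp).2.2.1
    have h2 := (Finset.mem_filter.1 hp').2.2.1
    omega
  have d2 : Disjoint (heightSupport x σ 0 ∪ heightSupport x σ 1) (heightSupport x σ 2) := by
    rw [Finset.disjoint_left]
    intro p hp hp'
    have h2 := (Finset.mem_filter.1 hp').2.2.1
    rcases Finset.mem_union.1 hp with hp | hp
    · have h1 := (Finset.mem_filter.1 hp).2.2.1
      omega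
    · have h1 := (Finset.mem_filter.1 hp).2.2.1
      omega
  rw [← Finset.card_union_of_disjoint d01, ← Finset.card_union_of_disjoint d2]
  refine Finset.card_le_card fun p hp => ?_
  have key : p.1 = x ∧ σ p ≠ 0 := by
    rcases Finset.mem_union.1 hp with hp | hp
    · rcases Finset.mem_union.1 hp with hp | hp
      · exact ⟨(Finset.mem_filter.1 hp).2.1, (Finset.mem_filter.1 hp).2.2.2⟩
      · exact ⟨(Finset.mem_filter.1 hp).2.1, (Finset.mem_filter.1 hp).2.2.2⟩
    · exact ⟨(Finset.mem_filter.1 hp).2.1, (Finset.mem_filter.1 hp).2.2.2⟩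
  refine Finset.mem_filter.2 ⟨Finset.mem_univ _, ?_⟩
  rw [loc_of_eq _ key.1]
  exact key.2

theorem sqr_label (x q q' z : T.V) {α β : ℕ} (η : ℕ) (hα : α ≠ 0) (hβ : β ≠ 0) :
    (sqr x q q' z α β η : T.RawCell ℓ).1 = z := by
  simp [sqr, hα, hβ]

/-- The layer `k` with fewer faces is cleaned by strings that run to the boundary. A face of this
layer costs at most two outside cells, one at each height, and a cylinder face costs at most one.
With `n_k` at most the count `n_k'` of the other layer, the cost `2 n_k + n_1` is at most the weight
of the syndrome. -/
theorem Nice.exists_correction_check (hT : T.Nice) (h3 : 3 ≤ ℓ) (hodd : ℓ % 2 = 1) {x : T.V}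
    (hx : T.deg x = 0) (u : (Tanner.replace ℓ true T).Cochain)
    (hu : u ∈ (Tanner.replace ℓ true T).cochains 1) :
    ∃ f, IsCorrectionX x (loc x ((Tanner.replace ℓ true T).cobdry u)) f := by
  set σ := (Tanner.replace ℓ true T).cobdry u with hσ
  obtain ⟨k, k', hk, hkk, hle⟩ : ∃ k k', (k = 0 ∨ k = 2) ∧ k' = 2 - k ∧
      (heightSupport x σ k).card ≤ (heightSupport x σ k').card := by
    rcases le_total (heightSupport x σ 0).card (heightSupport x σ 2).card with h | h
    · exact ⟨0, 2, Or.inl rfl, rfl, h⟩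
    · exact ⟨2, 0, Or.inr rfl, rfl, h⟩
  have hsum : (heightSupport x σ k).card + (heightSupport x σ 1).card +
      (heightSupport x σ k').card ≤ weight (loc x σ) := by
    refine _root_.le_trans (le_of_eq ?_) (heightSupport_card_le x σ)
    rcases hk with rfl | rfl
    · rw [hkk]
    · rw [hkk]; simp only [Nat.sub_self]; ring
  obtain ⟨f, hf, hfσ, hf1, hfk⟩ := hT.exists_push h3 hodd u hu (x := x) hk
  rw [← hσ] at hfσ hfk
  refine ⟨loc x f, loc_mem_cochains x hf, loc_loc x f, ?_, ?_⟩
  · rw [hT.loc_cobdry_loc hx]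
    funext p
    by_cases hp : p.1 = x
    · rw [loc_of_eq _ hp, loc_of_eq _ hp]
      have hr : raw p = (x, p.2.1) := Prod.ext hp rfl
      rw [← ev_raw ((Tanner.replace ℓ true T).cobdry f) hr, ← ev_raw σ hr, hfσ]
    · rw [loc_of_ne _ hp, loc_of_ne _ hp]
  · rw [sum_weight_loc]
    set F := (Tanner.replace ℓ true T).cobdry (loc x f) with hF
    -- the outside syndrome lies on edges parallel to the layers
    have hD : ∀ p : (Tanner.replace ℓ true T).V, p.1 ≠ x → F p ≠ 0 →
        ∃ q q' z j η, Sq T x q q' z ∧ j % 2 = 0 ∧ j + 2 < ℓ ∧ (η = 0 ∨ η = 2) ∧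
          raw p = (q, line q z (j + 1) η) ∧ ev f x (sqr x q q' z (ℓ - 1) (j + 1) η) ≠ 0 := by
      intro p hpx hp
      obtain ⟨e, he, hne⟩ := cobdry_ne_zero hp
      have hex : e.1 = x := by
        by_contra h
        exact hne (loc_of_ne _ h)
      rw [loc_of_eq _ hex] at hne
      have hde := hf e hne
      have hinc : T.inc x p.1 := by
        rcases replace_inc_fst he with h | h
        · exact absurd (h.symm.trans hex) hpx
        · rwa [hex] at h
      have hp1 : T.deg p.1 = 1 := by rw [hT.inc_deg hinc, hx]
      rcases hT.raw_cases h3 p with ⟨x', q, q', z, α, β, η, s, ok, hp', hd⟩ |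
        ⟨q, z, α, η, hqz, hq, ok, hp', hd⟩ | ⟨z, η, hz, hη, -, hp', hd⟩
      · rw [raw_fst hp', (hT.sq_deg s).1] at hp1
        omega
      · have hqp := raw_fst hp'
        rw [hqp] at hinc
        rcases (hT.inc_line_iff h3 hodd hqz hq ok hp').1 he with ⟨a, c, _, he'⟩ | ⟨y, hy, he'⟩
        · rw [raw_fst he'] at hex
          rw [hex] at hq
          omega
        · obtain rfl : y = x := (raw_fst he').symm.trans hex
          have s := hT.sq_oth hy hqz
          have hd' := deg_sqr hT s ok.sq he'
          rw [← ev_raw f he'] at hne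
          unfold LineOK at ok
          have hη1 : η ≠ 1 := by
            rintro rfl
            exact hne (hf1 _ _ _ _ s (by omega) ok.1)
          obtain ⟨j, rfl⟩ : ∃ j, α = j + 1 := ⟨α - 1, by omega⟩
          exact ⟨q, _, z, j, η, s, by omega, by omega, by omega, hp', hne⟩
      · rw [raw_fst hp'] at hp1
        omega
    -- edges above a face of layer `k`, seen at height `η`
    have hB : ∀ η, (Finset.univ.filter fun p : (Tanner.replace ℓ true T).V =>
        ∃ q q' z j, Sq T x q q' z ∧ j % 2 = 0 ∧ j + 2 < ℓ ∧ raw p = (q, line q z (j + 1) η) ∧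
          ev f x (sqr x q q' z (ℓ - 1) (j + 1) k) ≠ 0).card ≤ (heightSupport x σ k).card := by
      intro η
      -- Each outside cell is assigned a face in its column. As a square is swept in one direction
      -- only, the face determines `q`, `z` and `j`, hence the outside cell.
      refine Finset.card_le_card_of_forall_subsingleton
        (fun p e => ∃ q q' z i j, Sq T x q q' z ∧ fst T x z = q ∧ i + 2 < ℓ ∧ j + 2 < ℓ ∧
          raw p = (q, line q z (j + 1) η) ∧ raw e = (x, sqr x q q' z (i + 1) (j + 1) k)) ?_ ?_
      · intro p hp
        obtain ⟨q, q', z, j, s, hj, hjl, hp', hne⟩ := (Finset.mem_filter.1 hp).2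
        obtain ⟨hfst, i, hi, hil, hne'⟩ := hfk q q' z j s hj hjl hne
        obtain ⟨e, he⟩ := hT.exists_sqr_raw s
          (show SqOK ℓ (i + 1) (j + 1) k by unfold SqOK; omega)
        refine ⟨e, Finset.mem_filter.2 ⟨Finset.mem_univ _, raw_fst he, ?_, ?_⟩,
          q, q', z, i, j, s, hfst, hil, hjl, hp', he⟩
        · rw [raw_snd he, sqr_height _ _ _ _ _ _ (by omega)]
        · rwa [ev_raw σ he] at hne'
      · rintro e - p ⟨-, q, q', z, i, j, s, hfst, hil, hjl, hp, he⟩ p2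
          ⟨-, q2, q2', z2, i2, j2, s2, hfst2, hil2, hjl2, hp2, he2⟩
        have hc := congrArg Prod.snd (he.symm.trans he2)
        have hz : z = z2 := by
          have := congrArg Prod.fst hc
          rwa [sqr_label x q q' z k (by omega) (by omega),
            sqr_label x q2 q2' z2 k (by omega) (by omega)] at this
        subst hz
        obtain rfl : q = q2 := hfst.symm.trans hfst2
        obtain rfl : q' = q2' := (s.oth_eq hT).symm.trans (s2.oth_eq hT)
        obtain ⟨-, h4, -⟩ := sqr_inj s.ne (by unfold SqOK; omega) (by unfold SqOK; omega) hc
        rw [← h4] at hp2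
        exact raw_injective (hp.trans hp2.symm)
    -- A cylinder face belongs to one side of its square only, since its other star coordinate is
    -- odd and cannot be `ℓ - 1`; so it determines the outside cell.
    have hA : (Finset.univ.filter fun p : (Tanner.replace ℓ true T).V =>
        ∃ q q' z j, Sq T x q q' z ∧ j % 2 = 0 ∧ j + 2 < ℓ ∧ raw p = (q, line q z (j + 1) k') ∧
          ev σ x (sqr x q q' z (ℓ - 1) (j + 1) 1) ≠ 0).card ≤ (heightSupport x σ 1).card := by
      refine Finset.card_le_card_of_forall_subsingleton
        (fun p e => ∃ q q' z j, Sq T x q q' z ∧ j % 2 = 0 ∧ j + 2 < ℓ ∧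
          raw p = (q, line q z (j + 1) k') ∧ raw e = (x, sqr x q q' z (ℓ - 1) (j + 1) 1)) ?_ ?_
      · intro p hp
        obtain ⟨q, q', z, j, s, hj, hjl, hp', hne⟩ := (Finset.mem_filter.1 hp).2
        obtain ⟨e, he⟩ := hT.exists_sqr_raw s
          (show SqOK ℓ (ℓ - 1) (j + 1) 1 by unfold SqOK; omega)
        refine ⟨e, Finset.mem_filter.2 ⟨Finset.mem_univ _, raw_fst he, ?_, ?_⟩,
          q, q', z, j, s, hj, hjl, hp', he⟩
        · rw [raw_snd he, sqr_height _ _ _ _ _ _ (by omega)]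
        · rwa [ev_raw σ he] at hne
      · rintro e - p ⟨-, q, q', z, j, s, hj, hjl, hp, he⟩ p2
          ⟨-, q2, q2', z2, j2, s2, hj2, hjl2, hp2, he2⟩
        have hc := congrArg Prod.snd (he.symm.trans he2)
        have hz : z = z2 := by
          have := congrArg Prod.fst hc
          rwa [sqr_label x q q' z 1 (by omega) (by omega),
            sqr_label x q2 q2' z2 1 (by omega) (by omega)] at this
        subst hz
        rcases s.only q2 s2.xq s2.qz with rfl | rfl
        · obtain rfl : q' = q2' := (s.oth_eq hT).symm.trans (s2.oth_eq hT)
          obtain ⟨-, h4, -⟩ := sqr_inj s.ne (by unfold SqOK; omega) (by unfold SqOK; omega) hc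
          rw [← h4] at hp2
          exact raw_injective (hp.trans hp2.symm)
        · obtain rfl : q = q2' := (s.symm.oth_eq hT).symm.trans (s2.oth_eq hT)
          rw [sqr_swap s2.ne] at hc
          obtain ⟨h4, -, -⟩ := sqr_inj s.ne (by unfold SqOK; omega) (by unfold SqOK; omega) hc
          omega
    refine _root_.le_trans (Finset.card_le_card (t := ((Finset.univ.filter fun p =>
        ∃ q q' z j, Sq T x q q' z ∧ j % 2 = 0 ∧ j + 2 < ℓ ∧ raw p = (q, line q z (j + 1) k) ∧
          ev f x (sqr x q q' z (ℓ - 1) (j + 1) k) ≠ 0) ∪ (Finset.univ.filter fun p =>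
        ∃ q q' z j, Sq T x q q' z ∧ j % 2 = 0 ∧ j + 2 < ℓ ∧ raw p = (q, line q z (j + 1) k') ∧
          ev σ x (sqr x q q' z (ℓ - 1) (j + 1) 1) ≠ 0)) ∪ (Finset.univ.filter fun p =>
        ∃ q q' z j, Sq T x q q' z ∧ j % 2 = 0 ∧ j + 2 < ℓ ∧ raw p = (q, line q z (j + 1) k') ∧
          ev f x (sqr x q q' z (ℓ - 1) (j + 1) k) ≠ 0)) ?_) ?_
    · intro p hp
      obtain ⟨hpx, hpF⟩ := (Finset.mem_filter.1 hp).2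
      obtain ⟨q, q', z, j, η, s, hj, hjl, hη, hp', hne⟩ := hD p hpx hpF
      by_cases hηk : η = k
      · subst hηk
        refine Finset.mem_union_left _ (Finset.mem_union_left _ (Finset.mem_filter.2
          ⟨Finset.mem_univ _, q, q', z, j, s, hj, hjl, hp', hne⟩))
      · obtain rfl : η = k' := by omega
        by_cases hσ1 : ev σ x (sqr x q q' z (ℓ - 1) (j + 1) 1) = 0
        · refine Finset.mem_union_right _ (Finset.mem_filter.2
            ⟨Finset.mem_univ _, q, q', z, j, s, hj, hjl, hp', ?_⟩)
          -- As `f` vanishes on vertical edges, its coboundary on a cylinder face is the sum of the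
          -- values on the two horizontal edges. If the syndrome is zero there, the two values agree
          -- and the contribution at height `k'` is charged to layer `k`.
          have h5 := hfσ (sqr x q q' z (ℓ - 1) (j + 1) 1)
          rw [hT.ev_cobdry_cyl h3 hodd s (by unfold SqOK; omega) (by omega) hj,
            hf1 _ _ _ _ s hj (by omega), hf1 _ _ _ _ s (by omega) (by omega), hσ1, zero_add,
            zero_add] at h5
          have h6 := zmod_two_eq_of_add h5
          rcases hk with rfl | rfl
          · rw [h6]; rwa [hkk] at hne
          · rw [← h6]; rwa [hkk] at hne
        · exact Finset.mem_union_left _ (Finset.mem_union_right _ (Finset.mem_filter.2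
            ⟨Finset.mem_univ _, q, q', z, j, s, hj, hjl, hp', hσ1⟩))
    · refine _root_.le_trans (Finset.card_union_le _ _) ?_
      refine _root_.le_trans (Nat.add_le_add_right (Finset.card_union_le _ _) _) ?_
      have b1 := hB k
      have b2 := hB k'
      omega

end Tanner

namespace Tanner

variable {T : Tanner} {ℓ : ℕ} [NeZero ℓ]

/-! ### Local corrections on the qubits -/

/-- The sum of the points of `Y_q`. -/
noncomputable def pointSum (ℓ : ℕ) (q : T.V) : (Tanner.replace ℓ true T).Cochain :=
  fun p => if p.1 = q ∧ (Tanner.replace ℓ true T).deg p = 1 then 1 else 0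

theorem ev_pointSum (hT : T.Nice) {q z : T.V} (hqz : T.inc q z) (hq : T.deg q = 1) {α η : ℕ}
    (ok : LineOK ℓ α η) (hα : α % 2 = 0) (hη : η % 2 = 0) :
    ev (pointSum ℓ q) q (line q z α η) = 1 := by
  obtain ⟨p, hp⟩ := hT.exists_line_raw hqz hq ok
  rw [ev_raw _ hp, pointSum, if_pos ⟨raw_fst hp, by rw [deg_line hq ok hp]; omega⟩]

omit [NeZero ℓ] in
theorem pointSum_mem (q : T.V) : pointSum ℓ q ∈ (Tanner.replace ℓ true T).cochains 1 := by
  intro p hp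
  by_contra hn
  exact hp (if_neg fun h => hn h.2)

omit [NeZero ℓ] in
theorem loc_pointSum (q : T.V) : loc q (pointSum ℓ q) = pointSum ℓ q := by
  rw [loc_eq_self_iff]
  intro p hp
  by_contra hn
  exact hp (if_neg fun h => hn h.1)

omit [NeZero ℓ] in
theorem zero_below_of_loc (hT : T.Nice) {q : T.V} {f : (Tanner.replace ℓ true T).Cochain}
    (hf : loc q f = f) (p : (Tanner.replace ℓ true T).V) (hp : T.inc p.1 q) : f p = 0 := by
  rw [← hf, loc_of_ne]
  rintro rfl
  have := hT.inc_deg hp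
  omega

/-- The constant on the vertices of `Y_q` is closed. By `Nice.qubit_const` it is the only freedom in
a correction on `Y_q`. -/
theorem Nice.loc_cobdry_pointSum (hT : T.Nice) (h3 : 3 ≤ ℓ) (hodd : ℓ % 2 = 1) {q : T.V}
    (hq : T.deg q = 1) : loc q ((Tanner.replace ℓ true T).cobdry (pointSum ℓ q)) = 0 := by
  rw [loc_eq_zero_iff]
  intro p hpq
  by_contra hne
  have hd2 := (hT.replace_true h3 hodd).cobdry_mem (pointSum_mem q) p hne
  have h0 := zero_below_of_loc hT (loc_pointSum (ℓ := ℓ) q)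
  rcases hT.raw_cases h3 p with ⟨x', q', q'', z, α, β, η, s, ok, hp, hd⟩ |
    ⟨q', z, α, η, hqz, hq', ok, hp, hd⟩ | ⟨z, η, hz, hη, hne', hp, hd⟩
  · have := (hT.sq_deg s).1
    rw [(raw_fst hp).symm.trans hpq] at this
    omega
  · obtain rfl : q' = q := (raw_fst hp).symm.trans hpq
    refine hne ?_
    rw [← ev_raw ((Tanner.replace ℓ true T).cobdry (pointSum ℓ q')) hp]
    have ok2 := ok
    unfold LineOK at ok2
    by_cases hη : η = 1
    · subst hη
      rw [hT.ev_cobdry_line_vert h3 hodd hqz hq ok (by omega), inclSum_eq_zero h0, add_zero,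
        ev_pointSum hT hqz hq (by unfold LineOK; omega) (by omega) (by omega),
        ev_pointSum hT hqz hq (by unfold LineOK; omega) (by omega) (by omega)]
      decide
    · obtain ⟨i, rfl⟩ : ∃ i, α = i + 1 := ⟨α - 1, by omega⟩
      rw [hT.ev_cobdry_line h3 hodd hqz hq ok (by omega) (by omega), inclSum_eq_zero h0, add_zero,
        ev_pointSum hT hqz hq (by unfold LineOK; omega) (by omega) (by omega),
        ev_pointSum hT hqz hq (by unfold LineOK; omega) (by omega) (by omega)]
      decide
  · rw [(raw_fst hp).symm.trans hpq] at hz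
    omega

/-- A change of value along a leg of `Y_q` is detected by the coboundary. -/
theorem Nice.leg_break (hT : T.Nice) (h3 : 3 ≤ ℓ) (hodd : ℓ % 2 = 1) {q z : T.V}
    (hq : T.deg q = 1) (hqz : T.inc q z) {f : (Tanner.replace ℓ true T).Cochain}
    (hf : loc q f = f) {η : ℕ} (hη : η = 0 ∨ η = 2)
    (h : ev f q (line q z (ℓ - 1) η) ≠ ev f q (pt q η)) :
    ∃ i, i % 2 = 0 ∧ i + 2 < ℓ ∧
      ev ((Tanner.replace ℓ true T).cobdry f) q (line q z (i + 1) η) ≠ 0 := by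
  by_contra hcon
  push Not at hcon
  refine h ?_
  rw [← line_zero q z]
  refine even_chain (ℓ := ℓ) (f := fun a => ev f q (line q z a η)) (fun i hi hil => ?_) (ℓ - 1)
    (by omega) (by omega)
  refine zmod_two_eq_of_add ?_
  have h5 := hcon i hi hil
  rwa [hT.ev_cobdry_line h3 hodd hqz hq (i := i) (η := η) (by unfold LineOK; omega) hi (by omega),
    inclSum_eq_zero (zero_below_of_loc hT hf), add_zero] at h5

/-- The vertices of `Y_z`, for `z` above `q`, at height `η` with `ev f (line q z (ℓ-1) η) ≠ 0`. -/
noncomputable def endSupport (q : T.V) (f : (Tanner.replace ℓ true T).Cochain) (η : ℕ) :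
    Finset (Tanner.replace ℓ true T).V :=
  Finset.univ.filter fun p => ∃ z, T.inc q z ∧ raw p = (z, pt z η) ∧
    ev f q (line q z (ℓ - 1) η) ≠ 0

/-- Only the ends of the legs of `Y_q` are included from some `Y_z`, so only the values at these
ends are visible outside. -/
theorem Nice.outside_qubit (hT : T.Nice) (h3 : 3 ≤ ℓ) {q : T.V} (hq : T.deg q = 1)
    {f : (Tanner.replace ℓ true T).Cochain} (hf : loc q f = f)
    (p : (Tanner.replace ℓ true T).V) (hp : p.1 ≠ q)
    (hne : (Tanner.replace ℓ true T).cobdry f p ≠ 0) :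
    p ∈ endSupport q f 0 ∪ endSupport q f 2 := by
  obtain ⟨e, he, hfe⟩ := cobdry_ne_zero hne
  have heq : e.1 = q := loc_eq_self_iff.1 hf e hfe
  have hinc : T.inc q p.1 := by
    rcases replace_inc_fst he with h | h
    · exact absurd (h.symm.trans heq) hp
    · rwa [heq] at h
  have hd := hT.inc_deg hinc
  have hp2 : T.deg p.1 = 2 := by omega
  rcases hT.raw_cases h3 p with ⟨x', q', q'', z, α, β, η, s, ok, hp', -⟩ |
    ⟨q', z, α, η, hqz, hq', ok, hp', -⟩ | ⟨z, η, hz, hη, hne', hp', -⟩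
  · have := (hT.sq_deg s).1
    rw [raw_fst hp'] at hp2; omega
  · rw [raw_fst hp'] at hp2; omega
  · rw [raw_fst hp'] at hinc
    have key : ev f q (line q z (ℓ - 1) η) ≠ 0 := by
      rw [← ev_raw ((Tanner.replace ℓ true T).cobdry f) hp', hT.ev_cobdry_pt h3 hz hη hne',
        Finset.sum_eq_single q] at hne
      · rwa [if_pos hinc] at hne
      · intro q' _ hq'
        split_ifs
        · refine ev_eq_zero fun p' hp'' => ?_
          rw [← hf, loc_of_ne]
          rw [hp'']; exact hq'
        · rfl
      · intro h; exact absurd (Finset.mem_univ _) h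
    have hη' : η = 0 ∨ η = 2 := by omega
    rcases hη' with rfl | rfl
    · exact Finset.mem_union_left _ (Finset.mem_filter.2 ⟨Finset.mem_univ _, z, hinc, hp', key⟩)
    · exact Finset.mem_union_right _ (Finset.mem_filter.2 ⟨Finset.mem_univ _, z, hinc, hp', key⟩)

theorem line_label (q z : T.V) {α : ℕ} (η : ℕ) (hα : α ≠ 0) :
    (line q z α η : T.RawCell ℓ).1 = z := by
  simp [line, hα]

/-- Vertices above `q` are counted by cells of `Y_q` on distinct legs. -/
theorem card_le_of_legs (q : T.V) (η : ℕ)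
    (A S : Finset (Tanner.replace ℓ true T).V)
    (h : ∀ p ∈ A, ∃ z α η', raw p = (z, pt z η) ∧ α ≠ 0 ∧
      ∃ e ∈ S, raw e = (q, line q z α η')) : A.card ≤ S.card := by
  refine Finset.card_le_card_of_forall_subsingleton
    (fun p e => ∃ z α η', raw p = (z, pt z η) ∧ α ≠ 0 ∧ raw e = (q, line q z α η')) ?_ ?_
  · intro p hp
    obtain ⟨z, α, η', h1, h2, e, he, h4⟩ := h p hp
    exact ⟨e, he, z, α, η', h1, h2, h4⟩
  · rintro e - p ⟨-, z, α, η1, h1, h2, h4⟩ p' ⟨-, z', α', η2, h1', h2', h4'⟩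
    have h5 := congrArg (fun r => r.2.1) (h4.symm.trans h4')
    simp only [line_label q z η1 h2, line_label q z' η2 h2'] at h5
    subst h5
    exact raw_injective (h1.trans h1'.symm)

/-- Two solutions compete, `u` and `u + pointSum ℓ q`. If `u` agrees at the two centres, one of them
vanishes at both, and then a nonzero leg end forces a syndrome on the same leg and layer. If not,
every leg with its vertical edge joins the two centres by a path along which the value changes, so
there are at most as many legs as syndrome cells; the nonzero ends of the two solutions together
number twice the legs, and the cheaper solution costs at most one end per leg. -/
theorem Nice.exists_correction_qubit (hT : T.Nice) (h3 : 3 ≤ ℓ) (hodd : ℓ % 2 = 1) {q : T.V}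
    (hq : T.deg q = 1) (u : (Tanner.replace ℓ true T).Cochain)
    (hu : u ∈ (Tanner.replace ℓ true T).cochains 1) (hul : loc q u = u) :
    ∃ f, IsCorrectionX q (loc q ((Tanner.replace ℓ true T).cobdry u)) f := by
  have hone := hT.loc_cobdry_pointSum h3 hodd hq
  have hcard : ∀ f : (Tanner.replace ℓ true T).Cochain, loc q f = f →
      (Finset.univ.filter fun p : (Tanner.replace ℓ true T).V =>
        p.1 ≠ q ∧ (Tanner.replace ℓ true T).cobdry f p ≠ 0).card ≤
      (endSupport q f 0).card + (endSupport q f 2).card := by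
    intro f hf
    refine _root_.le_trans (Finset.card_le_card ?_) (Finset.card_union_le _ _)
    intro p hp
    obtain ⟨h1, h2⟩ := (Finset.mem_filter.1 hp).2
    exact hT.outside_qubit h3 hq hf p h1 h2
  -- it suffices to find a correction of small cost
  have hfin : ∀ f, f ∈ (Tanner.replace ℓ true T).cochains 1 → loc q f = f →
      loc q ((Tanner.replace ℓ true T).cobdry f) = loc q ((Tanner.replace ℓ true T).cobdry u) →
      (endSupport q f 0).card + (endSupport q f 2).card ≤
        weight (loc q ((Tanner.replace ℓ true T).cobdry u)) →
      IsCorrectionX q (loc q ((Tanner.replace ℓ true T).cobdry u)) f := by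
    intro f hf hfl hfs hc
    refine ⟨hf, hfl, hfs, ?_⟩
    rw [sum_weight_loc]
    exact (hcard f hfl).trans hc
  set σ := (Tanner.replace ℓ true T).cobdry u with hσ
  have hmem : ∀ z α η, T.inc q z → LineOK ℓ α η → ev σ q (line q z α η) ≠ 0 →
      ∃ e, raw e = (q, line q z α η) ∧ e ∈ heightSupport q σ η := by
    intro z α η hz ok hne
    obtain ⟨e, he⟩ := hT.exists_line_raw hz hq ok
    refine ⟨e, he, Finset.mem_filter.2 ⟨Finset.mem_univ _, raw_fst he, ?_, ?_⟩⟩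
    · rw [raw_snd he, line_height _ _ _ ok.2.1]
    · rwa [ev_raw σ he] at hne
  have hsum := heightSupport_card_le q σ
  have hu1 : u + pointSum ℓ q ∈ (Tanner.replace ℓ true T).cochains 1 :=
    Submodule.add_mem _ hu (pointSum_mem q)
  have hu2 : loc q (u + pointSum ℓ q) = u + pointSum ℓ q := by
    rw [loc_add, hul, loc_pointSum]
  have hu3 : loc q ((Tanner.replace ℓ true T).cobdry (u + pointSum ℓ q)) = loc q σ := by
    rw [map_add, loc_add, hone, add_zero]
  have hev : ∀ z η, T.inc q z → (η = 0 ∨ η = 2) → ∀ α, α % 2 = 0 → α < ℓ →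
      ev (u + pointSum ℓ q) q (line q z α η) = ev u q (line q z α η) + 1 := by
    intro z η hz hη α hα hαl
    rw [ev_add, ev_pointSum hT hz hq (by unfold LineOK; omega) hα (by omega)]
  have hev0 : ∀ η, (η = 0 ∨ η = 2) →
      ev (u + pointSum ℓ q) q (pt q η) = ev u q (pt q η) + 1 := by
    intro η hη
    obtain ⟨z, hz⟩ := hT.above q (by omega)
    rw [← line_zero q z]
    exact hev z η hz hη 0 (by omega) (by omega)
  by_cases hA : ev u q (pt q 0) = ev u q (pt q 2)
  · -- a cochain that vanishes at the centres of both layers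
    have main : ∀ f, loc q f = f → loc q ((Tanner.replace ℓ true T).cobdry f) = loc q σ →
        ev f q (pt q 0) = 0 → ev f q (pt q 2) = 0 →
        (endSupport q f 0).card + (endSupport q f 2).card ≤ weight (loc q σ) := by
      intro f hf hfs h0 h2
      have hle : ∀ η, (η = 0 ∨ η = 2) → (endSupport q f η).card ≤ (heightSupport q σ η).card := by
        intro η hη
        refine card_le_of_legs q η _ _ fun p hp => ?_
        obtain ⟨z, hz, hpz, hne⟩ := (Finset.mem_filter.1 hp).2
        have hne' : ev f q (line q z (ℓ - 1) η) ≠ ev f q (pt q η) := by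
          rcases hη with rfl | rfl
          · rwa [h0]
          · rwa [h2]
        obtain ⟨i, hi, hil, hne2⟩ := hT.leg_break h3 hodd hq hz hf hη hne'
        have ok : LineOK ℓ (i + 1) η := by unfold LineOK; omega
        have hσf : ev σ q (line q z (i + 1) η) ≠ 0 := by
          obtain ⟨e, he⟩ := hT.exists_line_raw hz hq ok
          rw [ev_raw _ he] at hne2 ⊢
          rwa [← loc_of_eq σ (raw_fst he), ← hfs, loc_of_eq _ (raw_fst he)]
        obtain ⟨e, he, hem⟩ := hmem z (i + 1) η hz ok hσf
        exact ⟨z, i + 1, η, hpz, by omega, e, hem, he⟩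
      have b0 := hle 0 (Or.inl rfl)
      have b2 := hle 2 (Or.inr rfl)
      omega
    rcases zmod_two_cases (ev u q (pt q 0)) with h0 | h0
    · exact ⟨u, hfin u hu hul rfl (main u hul rfl h0 (hA ▸ h0))⟩
    · refine ⟨_, hfin _ hu1 hu2 hu3 (main _ hu2 hu3 ?_ ?_)⟩
      · rw [hev0 0 (Or.inl rfl), h0]; decide
      · rw [hev0 2 (Or.inr rfl), ← hA, h0]; decide
  · -- every leg carries a syndrome
    have hleg : ∀ η, ((Finset.univ.filter fun p : (Tanner.replace ℓ true T).V =>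
        ∃ z, T.inc q z ∧ raw p = (z, pt z η)).card ≤ weight (loc q σ)) := by
      intro η
      refine _root_.le_trans (card_le_of_legs q η _
        ((heightSupport q σ 0 ∪ heightSupport q σ 1) ∪ heightSupport q σ 2) fun p hp => ?_) ?_
      · obtain ⟨z, hz, hpz⟩ := (Finset.mem_filter.1 hp).2
        by_cases b0 : ev u q (line q z (ℓ - 1) 0) = ev u q (pt q 0)
        · by_cases b2 : ev u q (line q z (ℓ - 1) 2) = ev u q (pt q 2)
          · have ok : LineOK ℓ (ℓ - 1) 1 := by unfold LineOK; omega
            obtain ⟨e, he, hem⟩ := hmem z (ℓ - 1) 1 hz ok (by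
              rw [hT.ev_cobdry_line_vert h3 hodd hz hq ok (by omega),
                inclSum_eq_zero (zero_below_of_loc hT hul), add_zero, b0, b2]
              exact fun h => hA (zmod_two_eq_of_add h))
            exact ⟨z, ℓ - 1, 1, hpz, by omega, e,
              Finset.mem_union_left _ (Finset.mem_union_right _ hem), he⟩
          · obtain ⟨i, hi, hil, hne2⟩ := hT.leg_break h3 hodd hq hz hul (Or.inr rfl) b2
            obtain ⟨e, he, hem⟩ := hmem z (i + 1) 2 hz (by unfold LineOK; omega) hne2
            exact ⟨z, i + 1, 2, hpz, by omega, e, Finset.mem_union_right _ hem, he⟩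
        · obtain ⟨i, hi, hil, hne2⟩ := hT.leg_break h3 hodd hq hz hul (Or.inl rfl) b0
          obtain ⟨e, he, hem⟩ := hmem z (i + 1) 0 hz (by unfold LineOK; omega) hne2
          exact ⟨z, i + 1, 0, hpz, by omega, e,
            Finset.mem_union_left _ (Finset.mem_union_left _ hem), he⟩
      · refine _root_.le_trans (Finset.card_union_le _ _) ?_
        refine _root_.le_trans (Nat.add_le_add_right (Finset.card_union_le _ _) _) hsum
    have hsplit : ∀ η, (η = 0 ∨ η = 2) →
        (endSupport q u η).card + (endSupport q (u + pointSum ℓ q) η).card ≤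
        weight (loc q σ) := by
      intro η hη
      rw [← Finset.card_union_of_disjoint]
      · refine _root_.le_trans (Finset.card_le_card fun p hp => ?_) (hleg η)
        rcases Finset.mem_union.1 hp with hp | hp
        · obtain ⟨z, hz, hpz, -⟩ := (Finset.mem_filter.1 hp).2
          exact Finset.mem_filter.2 ⟨Finset.mem_univ _, z, hz, hpz⟩
        · obtain ⟨z, hz, hpz, -⟩ := (Finset.mem_filter.1 hp).2
          exact Finset.mem_filter.2 ⟨Finset.mem_univ _, z, hz, hpz⟩
      · rw [Finset.disjoint_left]
        intro p hp hp'
        obtain ⟨z, hz, hpz, hne⟩ := (Finset.mem_filter.1 hp).2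
        obtain ⟨z', hz', hpz', hne'⟩ := (Finset.mem_filter.1 hp').2
        obtain rfl : z = z' := congrArg Prod.fst (hpz.symm.trans hpz')
        rw [hev z η hz hη _ (by omega) (by omega), zmod_two_ne_zero.1 hne] at hne'
        exact hne' (by decide)
    have c0 := hsplit 0 (Or.inl rfl)
    have c2 := hsplit 2 (Or.inr rfl)
    rcases le_total ((endSupport q u 0).card + (endSupport q u 2).card)
      (weight (loc q σ)) with h | h
    · exact ⟨u, hfin u hu hul rfl h⟩
    · exact ⟨_, hfin _ hu1 hu2 hu3 (by omega)⟩

end Tanner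

namespace Tanner

section Lift

variable {T : Tanner} {ℓ : ℕ} {b : Bool}

/-! ### The cochain map of a replacement step -/

theorem lift_add (c c' : T.Cochain) :
    lift (ℓ := ℓ) (b := b) (c + c') = lift (ℓ := ℓ) (b := b) c + lift (ℓ := ℓ) (b := b) c' := by
  funext p
  simp only [lift, Pi.add_apply]
  split_ifs <;> simp

theorem lift_zero : lift (ℓ := ℓ) (b := b) (0 : T.Cochain) = 0 := by
  funext p
  simp [lift]

theorem Nice.isCell_center [NeZero ℓ] (hT : T.Nice) (v : T.V) :
    T.IsCell ℓ true v (pt v 0) := by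
  have h0 : (pt v 0 : T.RawCell ℓ).1 = v := rfl
  refine ⟨le_refl v, fun w => ?_, fun h => ?_⟩
  · constructor
    · intro h
      exact absurd fc_zero_val h
    · rintro ⟨h1, h2⟩
      rw [up_true] at h1
      have h4 := hT.inc_deg h1
      have h5 := hT.le_trans_deg h2
      rw [h0] at h5
      omega
  · have := congrArg Fin.val h
    rw [pt_height v (by omega)] at this
    simp at this

end Lift

variable {T : Tanner} {ℓ : ℕ} [NeZero ℓ]

/-- The centre of layer `0` of `Y_v` reads off the value of a lift at `v`, in both kinds of steps.
It makes lifts injective and shows where a coarse syndrome leaves a trace. -/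
theorem Nice.exists_center (hT : T.Nice) (b : Bool) (v : T.V) :
    ∃ p : (Tanner.replace ℓ b T).V, p.1 = v ∧
      ∀ c : T.Cochain, lift (ℓ := ℓ) (b := b) c p = c v := by
  cases b
  · have hc : T.IsCell ℓ false v (pt v 0) := hT.dual.isCell_center v
    refine ⟨⟨v, pt v 0, hc⟩, rfl, fun c => ?_⟩
    have hd : (Tanner.replace ℓ false T).deg ⟨v, pt v 0, hc⟩ = T.deg v := by
      change T.deg v - cellDim (pt v 0) = T.deg v
      rw [cellDim_pt v (by omega)]
      simp
    have hh : (pt v 0 : T.RawCell ℓ).2.2 = 0 := by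
      apply Fin.ext
      rw [pt_height v (by omega)]
      rfl
    simp only [lift, Bool.false_eq_true, if_false]
    rw [if_pos ⟨hh, hd⟩]
    rfl
  · refine ⟨⟨v, pt v 0, hT.isCell_center v⟩, rfl, fun c => ?_⟩
    simp only [lift, if_true]
    rw [if_pos]
    rw [cellDim_pt v (by omega)]

theorem Nice.lift_injective (hT : T.Nice) (b : Bool) :
    Function.Injective (lift (ℓ := ℓ) (b := b) (T := T)) := by
  intro c c' h
  funext v
  obtain ⟨p, -, hp⟩ := hT.exists_center (ℓ := ℓ) b v
  rw [← hp c, ← hp c', h]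

omit [NeZero ℓ] in
theorem lift_raw (c : T.Cochain) {p : (Tanner.replace ℓ true T).V} {v : T.V} {r : T.RawCell ℓ}
    (h : raw p = (v, r)) :
    lift (ℓ := ℓ) (b := true) c p = if cellDim r = 0 then c v else 0 := by
  simp only [lift, if_true]
  rw [raw_snd h, raw_fst h]

theorem Nice.ev_lift_sqr (hT : T.Nice) (c : T.Cochain) {x q q' z : T.V} (s : Sq T x q q' z)
    {α β η : ℕ} (ok : SqOK ℓ α β η) :
    ev (lift (ℓ := ℓ) (b := true) c) x (sqr x q q' z α β η) =
      if α % 2 + β % 2 + η % 2 = 0 then c x else 0 := by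
  obtain ⟨p, hp⟩ := hT.exists_sqr_raw s ok
  rw [ev_raw _ hp, lift_raw c hp, cellDim_sqr s.ne ok]

theorem Nice.ev_lift_line (hT : T.Nice) (c : T.Cochain) {q z : T.V} (hqz : T.inc q z)
    (hq : T.deg q = 1) {α η : ℕ} (ok : LineOK ℓ α η) :
    ev (lift (ℓ := ℓ) (b := true) c) q (line q z α η) =
      if α % 2 + η % 2 = 0 then c q else 0 := by
  obtain ⟨p, hp⟩ := hT.exists_line_raw hqz hq ok
  rw [ev_raw _ hp, lift_raw c hp, cellDim_line q z ok]

theorem Nice.inclSum_lift (hT : T.Nice) (c : T.Cochain) {q z : T.V} (hqz : T.inc q z)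
    (hodd : ℓ % 2 = 1) {α η : ℕ} (ok : LineOK ℓ α η) :
    inclSum (lift (ℓ := ℓ) (b := true) c) q z α η =
      if α % 2 + η % 2 = 0 then T.cobdry c q else 0 := by
  unfold inclSum
  rw [cobdry_apply]
  split_ifs with h
  · refine Finset.sum_congr rfl fun x _ => ?_
    split_ifs with hx
    · rw [hT.ev_lift_sqr c (hT.sq_oth hx hqz) ok.sq, if_pos (by omega)]
    · rfl
  · refine Finset.sum_eq_zero fun x _ => ?_
    split_ifs with hx
    · rw [hT.ev_lift_sqr c (hT.sq_oth hx hqz) ok.sq, if_neg (by omega)]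
    · rfl

/-- A lift is constant on the vertices of each `Y_v`, so the local coboundaries cancel; the
inclusions that remain reproduce the coboundary of `T`. -/
theorem Nice.cobdry_lift_true (hT : T.Nice) (h3 : 3 ≤ ℓ) (hodd : ℓ % 2 = 1) (c : T.Cochain) :
    (Tanner.replace ℓ true T).cobdry (lift (ℓ := ℓ) (b := true) c) =
      lift (ℓ := ℓ) (b := true) (T.cobdry c) := by
  set δ := (Tanner.replace ℓ true T).cobdry with hδ
  funext p
  rcases hT.raw_cases h3 p with ⟨x, q, q', z, α, β, η, s, ok, hp, hd⟩ |
    ⟨q, z, α, η, hqz, hq, ok, hp, hd⟩ | ⟨z, η, hz, hη, hne', hp, hd⟩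
  · have hx : T.cobdry c x = 0 := by
      rw [cobdry_apply]
      exact Finset.sum_eq_zero fun u _ => if_neg (hT.not_inc_of_deg_zero (hT.sq_deg s).1)
    rw [lift_raw _ hp, hx, ite_self]
    by_cases h1 : α % 2 + β % 2 + η % 2 = 1
    · rw [← ev_raw (δ _) hp]
      have ok2 := ok
      unfold SqOK at ok2
      by_cases hα : α % 2 = 1
      · obtain ⟨i, rfl⟩ : ∃ i, α = i + 1 := ⟨α - 1, by omega⟩
        rw [hT.ev_cobdry_edge h3 hodd s ok (by omega) (by omega) (by omega),
          hT.ev_lift_sqr c s (by unfold SqOK; omega), hT.ev_lift_sqr c s (by unfold SqOK; omega),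
          if_pos (by omega), if_pos (by omega), CharTwo.add_self_eq_zero]
      · by_cases hβ : β % 2 = 1
        · obtain ⟨i, rfl⟩ : ∃ i, β = i + 1 := ⟨β - 1, by omega⟩
          rw [hT.ev_cobdry_edge' h3 hodd s ok (by omega) (by omega) (by omega),
            hT.ev_lift_sqr c s (by unfold SqOK; omega), hT.ev_lift_sqr c s (by unfold SqOK; omega),
            if_pos (by omega), if_pos (by omega), CharTwo.add_self_eq_zero]
        · obtain rfl : η = 1 := by omega
          rw [hT.ev_cobdry_vert h3 hodd s ok (by omega) (by omega),
            hT.ev_lift_sqr c s (by unfold SqOK; omega), hT.ev_lift_sqr c s (by unfold SqOK; omega),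
            if_pos (by omega), CharTwo.add_self_eq_zero]
    · by_contra hne
      obtain ⟨u, hu, hcu⟩ := cobdry_ne_zero hne
      obtain ⟨a, b, e, hf, hu'⟩ := (hT.inc_sqr_iff h3 hodd s ok hp).1 hu
      rw [lift_raw c hu', cellDim_sqr s.ne (hf.ok hodd ok)] at hcu
      have h5 : a % 2 + b % 2 + e % 2 = 0 := by
        by_contra h5
        exact hcu (if_neg h5)
      unfold Fac2 at hf
      omega
  · rw [lift_raw _ hp, cellDim_line _ _ ok, ← ev_raw (δ _) hp]
    have ok2 := ok
    unfold LineOK at ok2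
    by_cases hη : η = 1
    · subst hη
      rw [hT.ev_cobdry_line_vert h3 hodd hqz hq ok (by omega), hT.inclSum_lift c hqz hodd ok,
        hT.ev_lift_line c hqz hq (by unfold LineOK; omega),
        hT.ev_lift_line c hqz hq (by unfold LineOK; omega), if_pos (by omega),
        CharTwo.add_self_eq_zero, zero_add]
    · by_cases hα : α % 2 = 1
      · obtain ⟨i, rfl⟩ : ∃ i, α = i + 1 := ⟨α - 1, by omega⟩
        rw [hT.ev_cobdry_line h3 hodd hqz hq ok (by omega) (by omega),
          hT.inclSum_lift c hqz hodd ok,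
          hT.ev_lift_line c hqz hq (by unfold LineOK; omega),
          hT.ev_lift_line c hqz hq (by unfold LineOK; omega), if_pos (by omega), if_pos (by omega),
          CharTwo.add_self_eq_zero, zero_add]
      · rw [hT.ev_cobdry_line_pt h3 hodd hqz hq ok (by omega) (by omega),
          hT.inclSum_lift c hqz hodd ok]
  · rw [lift_raw _ hp, cellDim_pt _ hη, if_pos (by omega), ← ev_raw (δ _) hp,
      hT.ev_cobdry_pt h3 hz hη hne', cobdry_apply]
    refine Finset.sum_congr rfl fun q _ => ?_
    split_ifs with hq
    · have := hT.inc_deg hq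
      rw [hT.ev_lift_line c hq (by omega) (by unfold LineOK; omega), if_pos (by omega)]
    · rfl

omit [NeZero ℓ] in
theorem lift_true_mem {m : ℕ} {c : T.Cochain} (hc : c ∈ T.cochains m) :
    lift (ℓ := ℓ) (b := true) c ∈ (Tanner.replace ℓ true T).cochains m := by
  intro p hp
  simp only [lift, if_true] at hp
  have h0 : cellDim p.2.1 = 0 := by
    by_contra h
    exact hp (if_neg h)
  rw [if_pos h0] at hp
  change T.deg p.1 + cellDim p.2.1 = m
  rw [h0, hc _ hp]
  rfl

/-! ### Cocycles of an `X`-step -/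

/-- A one-cochain closed on the `Y_x` can be cleaned from the `Y_x` by a coboundary. -/
theorem Nice.exists_clean (hT : T.Nice) (h3 : 3 ≤ ℓ) (hodd : ℓ % 2 = 1)
    (u : (Tanner.replace ℓ true T).Cochain) (hu : u ∈ (Tanner.replace ℓ true T).cochains 1)
    (hx : ∀ x, T.deg x = 0 → loc x ((Tanner.replace ℓ true T).cobdry u) = 0) :
    ∃ H ∈ (Tanner.replace ℓ true T).cochains 0,
      (∀ x, T.deg x = 0 → loc x (u + (Tanner.replace ℓ true T).cobdry H) = 0) ∧
      ∀ x, loc x u = 0 → loc x H = 0 := by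
  have key : ∀ x, ∃ h : (Tanner.replace ℓ true T).Cochain,
      (∀ p, h p ≠ 0 → p.1 = x ∧ (Tanner.replace ℓ true T).deg p = 0) ∧
      (T.deg x = 0 → ∀ p : (Tanner.replace ℓ true T).V, p.1 = x →
        (Tanner.replace ℓ true T).deg p = 1 → (Tanner.replace ℓ true T).cobdry h p = u p) ∧
      (loc x u = 0 → h = 0) := by
    intro x
    by_cases hd : T.deg x = 0
    -- Where `u` already vanishes the primitive is chosen to be zero; this keeps `H` local.
    · by_cases h0 : loc x u = 0
      · refine ⟨0, fun p hp => absurd rfl hp, fun _ p hp _ => ?_, fun _ => rfl⟩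
        rw [map_zero, loc_eq_zero_iff.1 h0 p hp]
        rfl
      · obtain ⟨h, h1, h2⟩ := hT.star_exact h3 hodd hd u
          (fun p hp _ => loc_eq_zero_iff.1 (hx x hd) p hp)
        exact ⟨h, h1, fun _ => h2, fun h' => absurd h' h0⟩
    · exact ⟨0, fun p hp => absurd rfl hp, fun h => absurd h hd, fun _ => rfl⟩
  choose h h1 h2 h4 using key
  have hH : (∑ x, h x) ∈ (Tanner.replace ℓ true T).cochains 0 :=
    Submodule.sum_mem _ fun x _ p hp => (h1 x p hp).2
  have hloc : ∀ x, loc x (∑ y, h y) = h x := by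
    intro x
    rw [loc_sum, Finset.sum_eq_single x]
    · rw [loc_eq_self_iff]
      exact fun p hp => (h1 x p hp).1
    · intro y _ hy
      rw [loc_eq_zero_iff]
      intro p hp
      by_contra hne
      exact hy ((h1 y p hne).1.symm.trans hp)
    · intro hn; exact absurd (Finset.mem_univ _) hn
  refine ⟨∑ x, h x, hH, ?_, ?_⟩
  · intro x hd
    rw [loc_add, ← hT.loc_cobdry_loc hd, hloc]
    funext p
    rw [Pi.add_apply]
    by_cases hp : p.1 = x
    · rw [loc_of_eq _ hp, loc_of_eq _ hp]
      by_cases hpd : (Tanner.replace ℓ true T).deg p = 1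
      · rw [h2 x hd p hp hpd]
        exact CharTwo.add_self_eq_zero _
      · have e1 : u p = 0 := by
          by_contra hne
          exact hpd (hu p hne)
        have e2 : (Tanner.replace ℓ true T).cobdry (h x) p = 0 := by
          by_contra hne
          exact hpd ((hT.replace_true h3 hodd).cobdry_mem (m := 0)
            (fun p hp => (h1 x p hp).2) p hne)
        rw [e1, e2]; rfl
    · rw [loc_of_ne _ hp, loc_of_ne _ hp]; rfl
  · intro x h0
    rw [hloc, h4 x h0]

/-- A one-cochain supported on the `Y_q` and closed there is in the image of the cochain map. -/
theorem Nice.eq_lift (hT : T.Nice) (h3 : 3 ≤ ℓ) (hodd : ℓ % 2 = 1)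
    (g : (Tanner.replace ℓ true T).Cochain) (hg : g ∈ (Tanner.replace ℓ true T).cochains 1)
    (hx : ∀ x, T.deg x = 0 → loc x g = 0)
    (hq : ∀ q, T.deg q = 1 → loc q ((Tanner.replace ℓ true T).cobdry g) = 0) :
    ∃ e ∈ T.cochains 1, g = lift (ℓ := ℓ) (b := true) e ∧ ∀ q, loc q g = 0 → e q = 0 := by
  refine ⟨fun q => if T.deg q = 1 then ev g q (pt q 0) else 0, ?_, ?_, ?_⟩
  · intro q hne
    by_contra h
    exact hne (if_neg h)
  · funext p
    have hpd : (Tanner.replace ℓ true T).deg p = T.deg p.1 + cellDim p.2.1 := rfl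
    simp only [lift, if_true]
    have hle := hT.deg_le p.1
    have hcase : T.deg p.1 = 0 ∨ T.deg p.1 = 1 ∨ T.deg p.1 = 2 := by omega
    have hz : (Tanner.replace ℓ true T).deg p ≠ 1 → g p = 0 := by
      intro h
      by_contra hne
      exact h (hg p hne)
    rcases hcase with h | h | h
    · rw [loc_eq_zero_iff.1 (hx _ h) p rfl, if_neg (c := T.deg p.1 = 1) (by omega), ite_self]
    · rw [if_pos h]
      split_ifs with h0
      · refine hT.qubit_const h3 hodd h g (fun p' hp' => ?_) (fun p' hp' _ => ?_) p rfl (by omega)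
        · have := hT.inc_deg hp'
          exact loc_eq_zero_iff.1 (hx _ (by omega)) p' rfl
        · exact loc_eq_zero_iff.1 (hq _ h) p' hp'
      · exact hz (by omega)
    · rw [if_neg (c := T.deg p.1 = 1) (by omega), ite_self]
      exact hz (by omega)
  · intro q h0
    change (if _ then _ else _) = _
    split_ifs
    · exact ev_eq_zero fun p hp => loc_eq_zero_iff.1 h0 p hp
    · rfl

omit [NeZero ℓ] in
theorem loc_cobdry_of_below {q : T.V} (g : (Tanner.replace ℓ true T).Cochain) (h0 : ∀ x, T.inc x q → loc x g = 0) :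
    loc q ((Tanner.replace ℓ true T).cobdry (loc q g)) =
      loc q ((Tanner.replace ℓ true T).cobdry g) := by
  funext p
  by_cases hp : p.1 = q
  · rw [loc_of_eq _ hp, loc_of_eq _ hp]
    exact cobdry_loc_apply g hp fun p' h => loc_eq_zero_iff.1 (h0 _ h) p' rfl
  · rw [loc_of_ne _ hp, loc_of_ne _ hp]

omit [NeZero ℓ] in
theorem loc_lift_true {c : T.Cochain} {v : T.V} (h : c v = 0) :
    loc v (lift (ℓ := ℓ) (b := true) c) = 0 := by
  rw [loc_eq_zero_iff]
  intro p hp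
  subst hp
  simp only [lift, if_true]
  rw [h, ite_self]

omit [NeZero ℓ] in
theorem cochain_zero_of_deg {m : ℕ} {c : T.Cochain} (hc : c ∈ T.cochains m) {v : T.V}
    (h : T.deg v ≠ m) : c v = 0 := by
  by_contra hne
  exact h (hc v hne)

/-- One-cochains whose coboundary is a lift are cohomologous to lifts. -/
theorem Nice.exists_eq_lift_true (hT : T.Nice) (h3 : 3 ≤ ℓ) (hodd : ℓ % 2 = 1)
    (g : (Tanner.replace ℓ true T).Cochain) (hg : g ∈ (Tanner.replace ℓ true T).cochains 1)
    {c : T.Cochain} (hc : c ∈ T.cochains 2)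
    (hgc : (Tanner.replace ℓ true T).cobdry g = lift (ℓ := ℓ) (b := true) c) :
    ∃ H ∈ (Tanner.replace ℓ true T).cochains 0, ∃ e ∈ T.cochains 1,
      g + (Tanner.replace ℓ true T).cobdry H = lift (ℓ := ℓ) (b := true) e ∧ T.cobdry e = c ∧
      ∀ q, T.deg q = 1 → loc q g = 0 → (∀ x, T.inc x q → loc x g = 0) → e q = 0 := by
  have hN := hT.replace_true h3 hodd
  obtain ⟨H, hH, h1, h2⟩ := hT.exists_clean h3 hodd g hg (fun x hx => by
    rw [hgc]
    exact loc_lift_true (cochain_zero_of_deg hc (by omega)))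
  have hg' : g + (Tanner.replace ℓ true T).cobdry H ∈ (Tanner.replace ℓ true T).cochains 1 :=
    Submodule.add_mem _ hg (hN.cobdry_mem hH)
  have hδ : (Tanner.replace ℓ true T).cobdry (g + (Tanner.replace ℓ true T).cobdry H) =
      lift (ℓ := ℓ) (b := true) c := by
    rw [map_add, hN.cobdry_cobdry, add_zero, hgc]
  obtain ⟨e, he, hge, hloc⟩ := hT.eq_lift h3 hodd _ hg' h1 (fun q hq => by
    rw [hδ]
    exact loc_lift_true (cochain_zero_of_deg hc (by omega)))
  refine ⟨H, hH, e, he, hge, ?_, ?_⟩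
  · apply hT.lift_injective (ℓ := ℓ) true
    rw [← hT.cobdry_lift_true h3 hodd, ← hge, hδ]
  · intro q hq h0 hx
    refine hloc q ?_
    rw [loc_add, h0, zero_add, ← loc_cobdry_of_below H (fun x hxq => h2 x (hx x hxq))]
    -- `H` has degree zero, whereas the cells of `Y_q` have degree at least one.
    have h5 : loc q H = 0 := by
      rw [loc_eq_zero_iff]
      intro p hp
      refine cochain_zero_of_deg hH ?_
      change T.deg p.1 + cellDim p.2.1 ≠ 0
      have : T.deg p.1 = 1 := by rw [hp, hq]
      omega
    rw [h5, map_zero, loc_zero]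

end Tanner

namespace Tanner

section Local

variable {T : Tanner} {ℓ : ℕ} {b : Bool}

theorem loc_of_support {v w : T.V} (hvw : v ≠ w) {f : (Tanner.replace ℓ b T).Cochain}
    (hf : loc w f = f) : loc v f = 0 := by
  rw [loc_eq_zero_iff]
  intro p hp
  rw [← hf, loc_of_ne]
  rintro rfl
  exact hvw hp.symm

theorem loc_sum_local (F : T.V → (Tanner.replace ℓ b T).Cochain) (hF : ∀ w, loc w (F w) = F w)
    (v : T.V) : loc v (∑ w, F w) = F v := by
  rw [loc_sum, Finset.sum_eq_single v]
  · exact hF v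
  · intro w _ hw
    exact loc_of_support hw.symm (hF w)
  · intro h; exact absurd (Finset.mem_univ _) h

theorem cochain_ext_loc {c c' : (Tanner.replace ℓ b T).Cochain} (h : ∀ v, loc v c = loc v c') :
    c = c' := by
  rw [← sum_loc c, ← sum_loc c']
  exact Finset.sum_congr rfl fun v _ => h v

end Local

variable {T : Tanner} {ℓ : ℕ}

/-! ### The `X`-steps -/

section StepX

variable (corr : T.V → (Tanner.replace ℓ true T).Cochain → (Tanner.replace ℓ true T).Cochain)

/-- The part of the correction of an `X`-step that lives on the `Y_x`. -/
noncomputable def checkPart (σ : (Tanner.replace ℓ true T).Cochain) :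
    (Tanner.replace ℓ true T).Cochain :=
  ∑ x : T.V, if T.deg x = 0 then corr x (loc x σ) else 0

theorem stepLocal_check (σ : (Tanner.replace ℓ true T).Cochain) {x : T.V} (hx : T.deg x = 0) :
    stepLocal corr σ x = corr x (loc x σ) := by
  simp only [stepLocal, if_true, if_pos hx]

theorem stepLocal_qubit (σ : (Tanner.replace ℓ true T).Cochain) {q : T.V} (hq : T.deg q = 1) :
    stepLocal corr σ q =
      corr q (loc q (σ + (Tanner.replace ℓ true T).cobdry (checkPart corr σ))) := by
  have h : ¬ T.deg q = 0 := by omega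
  simp only [stepLocal, if_true, if_neg h, if_pos hq]
  rfl

theorem stepLocal_top (σ : (Tanner.replace ℓ true T).Cochain) {z : T.V} (hz : T.deg z = 2) :
    stepLocal corr σ z = 0 := by
  have h : ¬ T.deg z = 0 := by omega
  have h' : ¬ T.deg z = 1 := by omega
  simp only [stepLocal, if_true, if_neg h, if_neg h']

theorem stepCoarse_true (σ : (Tanner.replace ℓ true T).Cochain) :
    stepCoarse corr σ = Function.invFun (lift (ℓ := ℓ) (b := true) (T := T))
      (σ + (Tanner.replace ℓ true T).cobdry (∑ v : T.V, stepLocal corr σ v)) := by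
  simp only [stepCoarse, if_true]

variable [NeZero ℓ]

/-- The properties of the local corrections of an `X`-step. -/
structure StepX (σ : (Tanner.replace ℓ true T).Cochain) : Prop where
  check : ∀ x, T.deg x = 0 → IsCorrectionX x (loc x σ) (stepLocal corr σ x)
  qubit : ∀ q, T.deg q = 1 → IsCorrectionX q
    (loc q (σ + (Tanner.replace ℓ true T).cobdry (checkPart corr σ))) (stepLocal corr σ q)
  mem : ∀ v, stepLocal corr σ v ∈ (Tanner.replace ℓ true T).cochains 1
  local_eq : ∀ v, loc v (stepLocal corr σ v) = stepLocal corr σ v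
  mem_coarse : stepCoarse corr σ ∈ T.coboundaries 1
  lift_eq : σ + (Tanner.replace ℓ true T).cobdry (∑ v, stepLocal corr σ v) =
    lift (ℓ := ℓ) (b := true) (stepCoarse corr σ)

variable {corr}

/-- A decoder is constrained only where an admissible correction exists, so solvability has to come
from `σ` being a coboundary of some `u`. On the `Y_x` it comes from `u`. After these corrections `u
+ A` can be cleaned from the `Y_x`, and the result `w`, restricted to `Y_q`, solves the problem
there. Once the qubits are corrected as well, what is left of `w` vanishes on the `Y_x` and is
closed on the `Y_q`, hence is a lift. -/
theorem Nice.stepX (hT : T.Nice) (h3 : 3 ≤ ℓ) (hodd : ℓ % 2 = 1)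
    (hcorr : ∀ v s, (∃ f, IsCorrection v s f) → IsCorrection v s (corr v s))
    {σ : (Tanner.replace ℓ true T).Cochain} (hσ : σ ∈ (Tanner.replace ℓ true T).coboundaries 1) :
    StepX corr σ := by
  have hN := hT.replace_true h3 hodd
  have hcorr' : ∀ v s, (∃ f, IsCorrectionX v s f) → IsCorrectionX v s (corr v s) := by
    intro v s h
    have := hcorr v s (by simpa only [IsCorrection, if_true] using h)
    simpa only [IsCorrection, if_true] using this
  obtain ⟨u, hu, rfl⟩ := mem_coboundaries.1 hσ
  set δ := (Tanner.replace ℓ true T).cobdry with hδ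
  have hcheck : ∀ x, T.deg x = 0 → IsCorrectionX x (loc x (δ u)) (stepLocal corr (δ u) x) := by
    intro x hx
    rw [stepLocal_check _ _ hx]
    exact hcorr' _ _ (hT.exists_correction_check h3 hodd hx u hu)
  set A := checkPart corr (δ u) with hA
  have hAloc : ∀ v, loc v A = if T.deg v = 0 then corr v (loc v (δ u)) else 0 := by
    intro v
    refine loc_sum_local _ (fun w => ?_) v
    split_ifs with hw
    · rw [← stepLocal_check corr _ hw]
      exact (hcheck w hw).2.1
    · exact loc_zero w
  have hAmem : A ∈ (Tanner.replace ℓ true T).cochains 1 := by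
    refine Submodule.sum_mem _ fun x _ => ?_
    split_ifs with hx
    · rw [← stepLocal_check corr _ hx]
      exact (hcheck x hx).1
    · exact Submodule.zero_mem _
  have hAx : ∀ x, T.deg x = 0 → loc x (δ (u + A)) = 0 := by
    intro x hx
    rw [map_add, loc_add, ← hT.loc_cobdry_loc hx A, hAloc, if_pos hx, ← stepLocal_check corr _ hx,
      (hcheck x hx).2.2.1]
    exact cochain_add_self _
  have huA := Submodule.add_mem _ hu hAmem
  obtain ⟨H, hH, hH1, -⟩ := hT.exists_clean h3 hodd (u + A) huA hAx
  set w := u + A + δ H with hw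
  have hwmem : w ∈ (Tanner.replace ℓ true T).cochains 1 :=
    Submodule.add_mem _ huA (hN.cobdry_mem hH)
  have hδw : δ w = δ u + δ A := by
    rw [hw, map_add, hN.cobdry_cobdry, add_zero, map_add]
  have hqubit : ∀ q, T.deg q = 1 →
      IsCorrectionX q (loc q (δ u + δ A)) (stepLocal corr (δ u) q) := by
    intro q hq
    rw [stepLocal_qubit _ _ hq]
    refine hcorr' _ _ ?_
    rw [← hδw, ← loc_cobdry_of_below w (fun x hx => hH1 x (by
      have := hT.inc_deg hx; omega))]
    exact hT.exists_correction_qubit h3 hodd hq _ (loc_mem_cochains q hwmem) (loc_loc q w)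
  have hmem : ∀ v, stepLocal corr (δ u) v ∈ (Tanner.replace ℓ true T).cochains 1 ∧
      loc v (stepLocal corr (δ u) v) = stepLocal corr (δ u) v := by
    intro v
    have hle := hT.deg_le v
    have hcase : T.deg v = 0 ∨ T.deg v = 1 ∨ T.deg v = 2 := by omega
    rcases hcase with h | h | h
    · exact ⟨(hcheck v h).1, (hcheck v h).2.1⟩
    · exact ⟨(hqubit v h).1, (hqubit v h).2.1⟩
    · rw [stepLocal_top _ _ h]
      exact ⟨Submodule.zero_mem _, loc_zero v⟩
  set f := ∑ v, stepLocal corr (δ u) v with hf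
  have hfloc : ∀ v, loc v f = stepLocal corr (δ u) v := loc_sum_local _ fun v => (hmem v).2
  have hfmem : f ∈ (Tanner.replace ℓ true T).cochains 1 :=
    Submodule.sum_mem _ fun v _ => (hmem v).1
  -- the part of the correction on the qubits
  set B := f + A with hB
  have hBx : ∀ x, T.deg x = 0 → loc x B = 0 := by
    intro x hx
    rw [hB, loc_add, hfloc, hAloc, if_pos hx, stepLocal_check _ _ hx]
    exact cochain_add_self _
  have hBq : ∀ q, T.deg q = 1 → loc q B = stepLocal corr (δ u) q := by
    intro q hq
    rw [hB, loc_add, hfloc, hAloc, if_neg (by omega), add_zero]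
  have hfB : f = A + B := by
    rw [hB, ← add_assoc, add_comm A f, add_assoc, cochain_add_self, add_zero]
  obtain ⟨e, he, hwe, -⟩ := hT.eq_lift h3 hodd (w + B)
    (Submodule.add_mem _ hwmem (Submodule.add_mem _ hfmem hAmem))
    (fun x hx => by rw [loc_add, hH1 x hx, hBx x hx, add_zero])
    (fun q hq => by
      rw [map_add, loc_add, ← loc_cobdry_of_below B (fun x hx => hBx x (by
        have := hT.inc_deg hx; omega)), hBq q hq, (hqubit q hq).2.2.1, ← hδw]
      exact cochain_add_self _)
  have hfin : δ u + δ f = lift (ℓ := ℓ) (b := true) (T.cobdry e) := by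
    rw [← hT.cobdry_lift_true h3 hodd, ← hwe, ← hδ, map_add, hδw, hfB, map_add, add_assoc]
  have hco : stepCoarse corr (δ u) = T.cobdry e := by
    rw [stepCoarse_true, ← hf, ← hδ, hfin]
    exact Function.leftInverse_invFun (hT.lift_injective (ℓ := ℓ) true) _
  refine ⟨hcheck, hqubit, fun v => (hmem v).1, fun v => (hmem v).2, ?_, ?_⟩
  · rw [hco]; exact ⟨e, he, rfl⟩
  · rw [hco, hfin]

/-- A correction of an `X`-step responds locally to errors near one `X`-check. -/
theorem Nice.stepX_local (hT : T.Nice) (h3 : 3 ≤ ℓ) (hodd : ℓ % 2 = 1)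
    {σ e : (Tanner.replace ℓ true T).Cochain}
    (h1 : StepX corr σ) (h2 : StepX corr (σ + (Tanner.replace ℓ true T).cobdry e))
    {p : (Tanner.replace ℓ true T).V} (hp : (Tanner.replace ℓ true T).deg p = 0)
    (he : e ∈ (Tanner.replace ℓ true T).cochains 1)
    (hep : ∀ q, e q ≠ 0 → (Tanner.replace ℓ true T).inc p q) :
    ∃ x, T.deg x = 0 ∧ ∃ e' ∈ T.cochains 1, (∀ q, e' q ≠ 0 → T.inc x q) ∧
      T.cobdry e' = stepCoarse corr σ +
        stepCoarse corr (σ + (Tanner.replace ℓ true T).cobdry e) ∧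
      (∑ v, stepLocal corr σ v) +
        (∑ v, stepLocal corr (σ + (Tanner.replace ℓ true T).cobdry e) v) + e +
        lift (ℓ := ℓ) (b := true) e' ∈ (Tanner.replace ℓ true T).coboundaries 0 := by
  have hN := hT.replace_true h3 hodd
  set δ := (Tanner.replace ℓ true T).cobdry with hδ
  set σ' := σ + δ e with hσ'
  have hx : T.deg p.1 = 0 := by
    change T.deg p.1 + cellDim p.2.1 = 0 at hp
    omega
  have heloc : ∀ v, v ≠ p.1 → ¬ T.inc p.1 v → loc v e = 0 := by
    intro v h4 h5
    rw [loc_eq_zero_iff]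
    intro r hr
    by_contra hne
    rcases replace_inc_fst (hep r hne) with h | h
    · exact h4 (hr.symm.trans h.symm)
    · rw [hr] at h; exact h5 h
  have hxe : ∀ y, T.deg y = 0 → y ≠ p.1 → loc y e = 0 := fun y hy h =>
    heloc y h fun h5 => by have := hT.inc_deg h5; omega
  have hxσ : ∀ y, T.deg y = 0 → y ≠ p.1 → loc y σ' = loc y σ := by
    intro y hy h
    rw [hσ', loc_add, hδ, ← hT.loc_cobdry_loc hy, hxe y hy h, map_zero, loc_zero, add_zero]
  have hA : ∀ (τ : (Tanner.replace ℓ true T).Cochain), StepX corr τ → ∀ v,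
      loc v (checkPart corr τ) = if T.deg v = 0 then stepLocal corr τ v else 0 := by
    intro τ hτ v
    have h6 : checkPart corr τ = ∑ v, if T.deg v = 0 then stepLocal corr τ v else 0 :=
      Finset.sum_congr rfl fun v _ => by
        split_ifs with h
        · rw [stepLocal_check _ _ h]
        · rfl
    rw [h6]
    refine loc_sum_local _ (fun w => ?_) v
    split_ifs with hw
    · exact hτ.local_eq w
    · exact loc_zero w
  have hxf : ∀ y, T.deg y = 0 → y ≠ p.1 → stepLocal corr σ' y = stepLocal corr σ y := by
    intro y hy h
    rw [stepLocal_check _ _ hy, stepLocal_check _ _ hy, hxσ y hy h]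
  -- For a qubit not above `p.1`, neither `e` nor a changed correction on a check reaches `Y_q`. Its
  -- updated local syndrome is the same, and the correction is a function of that syndrome.
  have hqf : ∀ q, T.deg q = 1 → ¬ T.inc p.1 q → stepLocal corr σ' q = stepLocal corr σ q := by
    intro q hq h
    rw [stepLocal_qubit _ _ hq, stepLocal_qubit _ _ hq]
    congr 1
    rw [loc_add, loc_add, hσ', loc_add, ← hσ', add_assoc, ← loc_add, ← map_add]
    have key : loc q (δ (e + checkPart corr σ')) = loc q (δ (checkPart corr σ)) := by
      have hz : ∀ g : (Tanner.replace ℓ true T).Cochain, loc q g = 0 →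
          (∀ x, T.inc x q → loc x g = 0) → loc q (δ g) = 0 := by
        intro g hg hgx
        rw [hδ, ← loc_cobdry_of_below g hgx, hg, map_zero, loc_zero]
      apply cochain_eq_of_add
      rw [← loc_add, ← map_add]
      apply hz
      · rw [loc_add, loc_add, hA _ h2, hA _ h1, if_neg (by omega), if_neg (by omega),
          heloc q (by rintro rfl; omega) h, add_zero, add_zero]
      · intro y hy
        have hy0 : T.deg y = 0 := by have := hT.inc_deg hy; omega
        have hyp : y ≠ p.1 := by rintro rfl; exact h hy
        rw [loc_add, loc_add, hA _ h2, hA _ h1, if_pos hy0, if_pos hy0, hxf y hy0 hyp,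
          hxe y hy0 hyp, zero_add]
        exact cochain_add_self _
    rw [key]
  set f := ∑ v, stepLocal corr σ v with hf
  set f' := ∑ v, stepLocal corr σ' v with hf'
  have hfl : ∀ v, loc v f = stepLocal corr σ v := loc_sum_local _ h1.local_eq
  have hfl' : ∀ v, loc v f' = stepLocal corr σ' v := loc_sum_local _ h2.local_eq
  have hc1 := hT.coboundaries_le h1.mem_coarse
  have hc2 := hT.coboundaries_le h2.mem_coarse
  have hg : f + f' + e ∈ (Tanner.replace ℓ true T).cochains 1 :=
    Submodule.add_mem _ (Submodule.add_mem _ (Submodule.sum_mem _ fun v _ => h1.mem v)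
      (Submodule.sum_mem _ fun v _ => h2.mem v)) he
  have hδg : δ (f + f' + e) =
      lift (ℓ := ℓ) (b := true) (stepCoarse corr σ + stepCoarse corr σ') := by
    rw [lift_add, ← h1.lift_eq, ← h2.lift_eq, map_add, map_add, hσ', ← hf, ← hf', ← hδ]
    have := cochain_add_self σ
    linear_combination -this
  obtain ⟨H, hH, e', he', hge, hce, hloc⟩ := hT.exists_eq_lift_true h3 hodd _ hg
    (Submodule.add_mem _ hc1 hc2) hδg
  refine ⟨p.1, hx, e', he', ?_, hce, ?_⟩
  · intro q hne
    by_contra h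
    have hq := he' q hne
    refine hne (hloc q hq ?_ ?_)
    · rw [loc_add, loc_add, hfl, hfl', hqf q hq h, heloc q (by rintro rfl; omega) h, add_zero]
      exact cochain_add_self _
    · intro y hy
      have hy0 : T.deg y = 0 := by have := hT.inc_deg hy; omega
      have hyp : y ≠ p.1 := by rintro rfl; exact h hy
      rw [loc_add, loc_add, hfl, hfl', hxf y hy0 hyp, hxe y hy0 hyp, add_zero]
      exact cochain_add_self _
  · refine ⟨H, hH, ?_⟩
    rw [← hge, ← add_assoc, cochain_add_self, zero_add]

end StepX

end Tanner

namespace Tanner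

/-! ### Weights -/

section Weight

variable {T : Tanner}

theorem weight_zero : weight (0 : T.Cochain) = 0 := by
  simp [weight]

theorem weight_add_le (c c' : T.Cochain) : weight (c + c') ≤ weight c + weight c' := by
  refine (Finset.card_le_card fun v hv => ?_).trans (Finset.card_union_le _ _)
  have h := (Finset.mem_filter.1 hv).2
  by_cases h0 : c v = 0
  · refine Finset.mem_union_right _ (Finset.mem_filter.2 ⟨Finset.mem_univ _, fun h1 => h ?_⟩)
    rw [Pi.add_apply, h0, h1, add_zero]
  · exact Finset.mem_union_left _ (Finset.mem_filter.2 ⟨Finset.mem_univ _, h0⟩)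

theorem weight_sum_le {ι : Type} (s : Finset ι) (f : ι → T.Cochain) :
    weight (∑ i ∈ s, f i) ≤ ∑ i ∈ s, weight (f i) := by
  induction s using Finset.induction_on with
  | empty => simp [weight_zero]
  | insert a s ha ih =>
    rw [Finset.sum_insert ha, Finset.sum_insert ha]
    exact (weight_add_le _ _).trans (Nat.add_le_add_left ih _)

theorem weight_restrict (W : Set T.V) (c : T.Cochain) :
    weight (restrict W c) = (Finset.univ.filter fun v => v ∈ W ∧ c v ≠ 0).card := by
  unfold weight
  congr 1
  ext v
  rw [Finset.mem_filter, Finset.mem_filter, restrict_apply]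
  by_cases h : v ∈ W
  · simp [h]
  · simp [h]

theorem weight_restrict_eq_sum (W : Set T.V) (c : T.Cochain) :
    weight (restrict W c) =
      ∑ v ∈ Finset.univ.filter (fun v => v ∈ W), if c v ≠ 0 then 1 else 0 := by
  rw [weight_restrict, ← Finset.card_filter, Finset.filter_filter]

variable {ℓ : ℕ} {b : Bool}

theorem weight_restrict_loc (W : Set T.V) (σ : (Tanner.replace ℓ b T).Cochain) :
    weight (restrict {p : (Tanner.replace ℓ b T).V | p.1 ∈ W} σ) =
      ∑ v ∈ Finset.univ.filter (fun v => v ∈ W), weight (loc v σ) := by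
  rw [weight_restrict, Finset.card_eq_sum_card_fiberwise (f := fun p => p.1)
    (t := Finset.univ.filter (fun v => v ∈ W))]
  · refine Finset.sum_congr rfl fun v hv => ?_
    unfold weight
    congr 1
    ext p
    have hvW := (Finset.mem_filter.1 hv).2
    constructor
    · intro hp
      obtain ⟨h1, h2⟩ := Finset.mem_filter.1 hp
      refine Finset.mem_filter.2 ⟨Finset.mem_univ _, ?_⟩
      rw [loc_of_eq _ h2]
      exact (Finset.mem_filter.1 h1).2.2
    · intro hp
      have h1 := (Finset.mem_filter.1 hp).2
      by_cases hpv : p.1 = v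
      · rw [loc_of_eq _ hpv] at h1
        refine Finset.mem_filter.2 ⟨Finset.mem_filter.2 ⟨Finset.mem_univ _, ?_, h1⟩, hpv⟩
        change p.1 ∈ W
        rw [hpv]; exact hvW
      · exact absurd (loc_of_ne _ hpv) h1
  · intro p hp
    have hp' := (Finset.mem_filter.1 (Finset.mem_coe.1 hp)).2.1
    exact Finset.mem_coe.2 (Finset.mem_filter.2 ⟨Finset.mem_univ _, hp'⟩)

theorem loc_eq_zero_of_weight {v : T.V} {σ : (Tanner.replace ℓ b T).Cochain}
    (h : weight (loc v σ) ≠ 0) : loc v σ ≠ 0 := fun h0 => h (by rw [h0, weight_zero])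

/-- A double sum is controlled by the rows that contribute to it. -/
theorem sum_transfer {V : Type} [Fintype V] (m : V → V → ℕ) (S W W' : Finset V)
    (hd : Disjoint W W') (h : ∀ v ∈ S, ∀ w ∈ W', m v w ≠ 0 → v ∈ W) :
    ∑ w ∈ W', ∑ v ∈ S, m v w ≤ ∑ v ∈ W, ∑ w, if w = v then 0 else m v w := by
  have h1 : ∑ w ∈ W', ∑ v ∈ S, m v w ≤ ∑ w ∈ W', ∑ v ∈ W, m v w := by
    refine Finset.sum_le_sum fun w hw => ?_
    calc ∑ v ∈ S, m v w = ∑ v ∈ S.filter (fun v => v ∈ W), m v w := by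
          symm
          refine Finset.sum_filter_of_ne fun v hv hne => h v hv w hw hne
      _ ≤ ∑ v ∈ W, m v w := Finset.sum_le_sum_of_subset fun v hv => (Finset.mem_filter.1 hv).2
  refine h1.trans ?_
  rw [Finset.sum_comm]
  refine Finset.sum_le_sum fun v hv => ?_
  calc ∑ w ∈ W', m v w = ∑ w ∈ W', if w = v then 0 else m v w := by
        refine Finset.sum_congr rfl fun w hw => ?_
        rw [if_neg]
        rintro rfl
        exact Finset.disjoint_left.1 hd hv hw
    _ ≤ ∑ w, if w = v then 0 else m v w :=
        Finset.sum_le_sum_of_subset (Finset.subset_univ _)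

end Weight

variable {T : Tanner} {ℓ : ℕ} [NeZero ℓ]

/-- `Y_z` has two points and a lift takes the same value on both. This is the source of the factor
two gained in an `X`-step. -/
theorem Nice.two_le_weight_lift (hT : T.Nice) (c : T.Cochain) {z : T.V} (hz : T.deg z = 2) :
    (2 * if c z ≠ 0 then 1 else 0) ≤ weight (loc z (lift (ℓ := ℓ) (b := true) c)) := by
  split_ifs with h
  · obtain ⟨p, hp⟩ := hT.exists_pt_raw (ℓ := ℓ) hz (η := 0) (by omega) (by omega)
    obtain ⟨p', hp'⟩ := hT.exists_pt_raw (ℓ := ℓ) hz (η := 2) (by omega) (by omega)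
    have hne : p ≠ p' := by
      rintro rfl
      have h1 := congrArg (fun r => r.2.2.2.val) (hp.symm.trans hp')
      have h2 := pt_height (ℓ := ℓ) z (η := 0) (by omega)
      have h4 := pt_height (ℓ := ℓ) z (η := 2) (by omega)
      simp only [h2, h4] at h1
      omega
    refine Finset.one_lt_card.2 ⟨p, Finset.mem_filter.2 ⟨Finset.mem_univ _, ?_⟩, p',
      Finset.mem_filter.2 ⟨Finset.mem_univ _, ?_⟩, hne⟩
    · rwa [loc_of_eq _ (raw_fst hp), lift_raw c hp, cellDim_pt _ (by omega), if_pos rfl]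
    · rwa [loc_of_eq _ (raw_fst hp'), lift_raw c hp', cellDim_pt _ (by omega), if_pos rfl]
  · omega

variable {corr : T.V → (Tanner.replace ℓ true T).Cochain → (Tanner.replace ℓ true T).Cochain}

/-- Syndrome weight flows from the `Y_x` to the `Y_q` and on to the `Y_z`. By the cost clause each
`Y_x` passes on at most what it has, and each `Y_q` at most what it has together with what it
received; on `Y_z` twice the coarse weight must be paid from what is there and what arrives. By `hW`
no flow crosses the border of `W`. -/
theorem Nice.stepX_weight (hT : T.Nice) {σ : (Tanner.replace ℓ true T).Cochain}
    (h : StepX corr σ) (W : Set T.V)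
    (hW : ∀ v v', loc v ((Tanner.replace ℓ true T).cobdry (stepLocal corr σ v')) ≠ 0 →
      (v ∈ W ↔ v' ∈ W)) :
    2 * weight (restrict W (stepCoarse corr σ)) ≤
      weight (restrict {p : (Tanner.replace ℓ true T).V | p.1 ∈ W} σ) := by
  set δ := (Tanner.replace ℓ true T).cobdry with hδ
  set c := stepCoarse corr σ with hc
  set f := stepLocal corr σ with hf
  set a : T.V → ℕ := fun v => weight (loc v σ) with ha
  set m : T.V → T.V → ℕ := fun v w => weight (loc w (δ (f v))) with hm
  set S : ℕ → Finset T.V := fun d => Finset.univ.filter fun v => T.deg v = d with hS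
  set WW : ℕ → Finset T.V := fun d => Finset.univ.filter fun v => v ∈ W ∧ T.deg v = d with hWW
  have hdisj : ∀ d d', d ≠ d' → Disjoint (WW d) (WW d') := by
    intro d d' hne
    rw [Finset.disjoint_left]
    intro v hv hv'
    exact hne ((Finset.mem_filter.1 hv).2.2.symm.trans (Finset.mem_filter.1 hv').2.2)
  have htr : ∀ d d', ∀ v ∈ S d, ∀ w ∈ WW d', m v w ≠ 0 → v ∈ WW d := by
    intro d d' v hv w hw hne
    refine Finset.mem_filter.2 ⟨Finset.mem_univ _, ?_, (Finset.mem_filter.1 hv).2⟩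
    exact (hW w v (loc_eq_zero_of_weight hne)).1 (Finset.mem_filter.1 hw).2.1
  have hA : δ (checkPart corr σ) = ∑ x ∈ S 0, δ (f x) := by
    rw [hS, checkPart, map_sum, Finset.sum_filter]
    refine Finset.sum_congr rfl fun x _ => ?_
    split_ifs with hx
    · rw [hf, stepLocal_check _ _ hx]
    · exact map_zero _
  have hq : ∀ q ∈ WW 1, (∑ w, if w = q then 0 else m q w) ≤ a q + ∑ x ∈ S 0, m x q := by
    intro q hq
    refine (h.qubit q (Finset.mem_filter.1 hq).2.2).2.2.2.trans ?_
    rw [loc_add, ← hδ, hA, loc_sum]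
    exact (weight_add_le _ _).trans (Nat.add_le_add_left (weight_sum_le _ _) _)
  have hx : ∀ x ∈ WW 0, (∑ w, if w = x then 0 else m x w) ≤ a x := fun x hx =>
    (h.check x (Finset.mem_filter.1 hx).2.2).2.2.2
  have hz : ∀ z ∈ WW 2, (2 * if c z ≠ 0 then 1 else 0) ≤ a z + ∑ q ∈ S 1, m q z := by
    intro z hz
    have hz2 := (Finset.mem_filter.1 hz).2.2
    refine (hT.two_le_weight_lift (ℓ := ℓ) c hz2).trans ?_
    rw [hc, ← h.lift_eq, loc_add, ← hδ, map_sum, loc_sum]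
    refine (weight_add_le _ _).trans (Nat.add_le_add_left ?_ _)
    refine (weight_sum_le _ _).trans (le_of_eq ?_)
    symm
    refine Finset.sum_subset (Finset.subset_univ _) fun v _ hv => ?_
    have hv1 : T.deg v ≠ 1 := fun h' => hv (Finset.mem_filter.2 ⟨Finset.mem_univ _, h'⟩)
    have hle := hT.deg_le v
    by_cases hv2 : T.deg v = 2
    · change weight (loc z (δ (stepLocal corr σ v))) = 0
      rw [stepLocal_top _ _ hv2, map_zero, loc_zero, weight_zero]
    · change weight (loc z (δ (stepLocal corr σ v))) = 0
      have h0 : loc z (δ (stepLocal corr σ v)) = 0 := by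
        rw [loc_eq_zero_iff]
        intro p hp
        by_contra hne
        obtain ⟨u, hu, hfu⟩ := cobdry_ne_zero hne
        have huv := loc_eq_self_iff.1 (h.local_eq v) u hfu
        rcases replace_inc_fst hu with h5 | h5
        · rw [huv, hp] at h5
          rw [h5] at hv2
          exact hv2 hz2
        · have := hT.inc_deg h5
          rw [huv, hp] at this
          omega
      rw [h0, weight_zero]
  rw [weight_restrict_loc, weight_restrict_eq_sum, Finset.mul_sum]
  have hsplit : ∀ g : T.V → ℕ, ∑ v ∈ Finset.univ.filter (fun v => v ∈ W), g v =
      ∑ v ∈ WW 0, g v + ∑ v ∈ WW 1, g v + ∑ v ∈ WW 2, g v := by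
    intro g
    rw [← Finset.sum_union (hdisj 0 1 (by omega)), ← Finset.sum_union]
    · refine Finset.sum_congr ?_ fun _ _ => rfl
      ext v
      have hle := hT.deg_le v
      simp only [hWW, Finset.mem_union, Finset.mem_filter, Finset.mem_univ, true_and]
      constructor
      · intro hv
        have : T.deg v = 0 ∨ T.deg v = 1 ∨ T.deg v = 2 := by omega
        tauto
      · tauto
    · rw [Finset.disjoint_union_left]
      exact ⟨hdisj 0 2 (by omega), hdisj 1 2 (by omega)⟩
  have hcz : ∀ d, d ≠ 2 → ∑ v ∈ WW d, (2 * if c v ≠ 0 then 1 else 0) = 0 := by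
    intro d hd
    refine Finset.sum_eq_zero fun v hv => ?_
    rw [if_neg, mul_zero]
    intro hne
    have := hT.coboundaries_le h.mem_coarse v hne
    have := (Finset.mem_filter.1 hv).2.2
    omega
  rw [hsplit, hsplit, hcz 0 (by omega), hcz 1 (by omega)]
  have b1 := sum_transfer m (S 1) (WW 1) (WW 2) (hdisj 1 2 (by omega)) (htr 1 2)
  have b0 := sum_transfer m (S 0) (WW 0) (WW 1) (hdisj 0 1 (by omega)) (htr 0 1)
  have c0 := Finset.sum_le_sum hx
  have c1 := Finset.sum_le_sum hq
  have c2 := Finset.sum_le_sum hz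
  rw [Finset.sum_add_distrib] at c1 c2
  change 0 + 0 + _ ≤ ∑ v ∈ WW 0, a v + ∑ v ∈ WW 1, a v + ∑ v ∈ WW 2, a v
  omega

/-- The lift shows the value at `v` in the centre of `Y_v`, so the syndrome or a correction must be
visible there. This is what marks the node of `v` one level up. -/
theorem Nice.coarse_support (hT : T.Nice) {b : Bool} {σ : (Tanner.replace ℓ b T).Cochain}
    {f : T.V → (Tanner.replace ℓ b T).Cochain} {c : T.Cochain}
    (h : σ + (Tanner.replace ℓ b T).cobdry (∑ v, f v) = lift (ℓ := ℓ) (b := b) c) {v : T.V}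
    (hv : c v ≠ 0) :
    loc v σ ≠ 0 ∨ ∃ v', loc v ((Tanner.replace ℓ b T).cobdry (f v')) ≠ 0 := by
  by_contra hcon
  push Not at hcon
  obtain ⟨p, hp, hl⟩ := hT.exists_center (ℓ := ℓ) b v
  refine hv ?_
  rw [← hl c, ← h, ← loc_of_eq (σ + (Tanner.replace ℓ b T).cobdry (∑ v, f v)) hp, loc_add, map_sum, loc_sum, hcon.1, zero_add,
    Finset.sum_eq_zero fun v' _ => hcon.2 v']
  rfl

end Tanner

namespace Tanner

/-! ### Linear duality -/

/-- In finite dimension a subspace is its own double annihilator. Exactness in a `Z`-step thereby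
becomes a statement about cocycles of the dual `X`-step. -/
theorem mem_of_pairing {V : Type} [Fintype V] (B : Submodule (ZMod 2) (V → ZMod 2))
    (g : V → ZMod 2)
    (h : ∀ ψ : V → ZMod 2, (∀ b ∈ B, ∑ v, b v * ψ v = 0) → ∑ v, g v * ψ v = 0) : g ∈ B := by
  rw [← Subspace.forall_mem_dualAnnihilator_apply_eq_zero_iff]
  intro φ hφ
  have hrep : ∀ c : V → ZMod 2, φ c = ∑ v, c v * φ (fun w => if v = w then 1 else 0) := by
    intro c
    rw [LinearMap.pi_apply_eq_sum_univ φ c]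
    rfl
  rw [hrep]
  refine h _ fun b hb => ?_
  rw [← hrep]
  exact (Submodule.mem_dualAnnihilator φ).1 hφ b hb

theorem eq_of_pairing {V : Type} [Fintype V] {a b : V → ZMod 2}
    (h : ∀ c : V → ZMod 2, ∑ v, a v * c v = ∑ v, b v * c v) : a = b := by
  funext v
  have := h (fun w => if w = v then 1 else 0)
  simpa using this

/-- Passing to the dual complex transposes the incidence matrix. -/
theorem pair_cobdry (T : Tanner) (c g : T.V → ZMod 2) :
    ∑ v, T.cobdry c v * g v = ∑ u, c u * T.dual.cobdry g u := by
  have h1 : ∑ v, T.cobdry c v * g v = ∑ v : T.V, ∑ u : T.V, if T.inc u v then c u * g v else 0 := by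
    refine Finset.sum_congr rfl fun v _ => ?_
    rw [cobdry_apply, Finset.sum_mul]
    refine Finset.sum_congr rfl fun u _ => ?_
    rw [ite_mul, zero_mul]
  have h2 : ∑ u, c u * T.dual.cobdry g u =
      ∑ u : T.V, ∑ v : T.V, if T.inc u v then c u * g v else 0 := by
    refine Finset.sum_congr rfl fun u _ => ?_
    have h : T.dual.cobdry g u = ∑ v : T.V, if T.inc u v then g v else 0 := rfl
    rw [h, Finset.mul_sum]
    refine Finset.sum_congr rfl fun v _ => ?_
    rw [mul_ite, mul_zero]
  rw [h1, h2, Finset.sum_comm]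

variable {T : Tanner} {ℓ : ℕ}

theorem pair_replace (c : (Tanner.replace ℓ false T).Cochain)
    (g : (Tanner.replace ℓ true T.dual).Cochain) :
    ∑ p : (Tanner.replace ℓ false T).V, (Tanner.replace ℓ false T).cobdry c p * g p =
      ∑ p : (Tanner.replace ℓ false T).V, c p * (Tanner.replace ℓ true T.dual).cobdry g p :=
  pair_cobdry (Tanner.replace ℓ false T) c g

theorem replace_false_inc {p p' : (Tanner.replace ℓ false T).V} :
    (Tanner.replace ℓ false T).inc p p' ↔ (Tanner.replace ℓ true T.dual).inc p' p := Iff.rfl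

theorem replace_false_inc_fst {p p' : (Tanner.replace ℓ false T).V}
    (h : (Tanner.replace ℓ false T).inc p p') : p'.1 = p.1 ∨ T.inc p.1 p'.1 :=
  replace_inc_fst (T := T.dual) (p := p') (p' := p) (replace_false_inc.1 h)

/-- The part of a cochain of the replaced complex seen by the lowest cohomology of the `Y_v`. -/
noncomputable def fiberSum (g : (Tanner.replace ℓ false T).Cochain) : T.Cochain :=
  fun v => ∑ p : (Tanner.replace ℓ false T).V, if p.1 = v ∧ cellDim p.2.1 = 0 then g p else 0

theorem fiberSum_add (g g' : (Tanner.replace ℓ false T).Cochain) :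
    fiberSum (g + g') = fiberSum g + fiberSum g' := by
  funext v
  rw [Pi.add_apply]
  unfold fiberSum
  rw [← Finset.sum_add_distrib]
  refine Finset.sum_congr rfl fun p _ => ?_
  split_ifs
  · rfl
  · rw [add_zero]

/-- `fiberSum` is the transpose of the lift of the dual `X`-step and inherits its properties by
duality. -/
theorem pair_fiberSum (g : (Tanner.replace ℓ false T).Cochain) (c : T.V → ZMod 2) :
    ∑ v, fiberSum g v * c v = ∑ p : (Tanner.replace ℓ false T).V,
      g p * lift (ℓ := ℓ) (b := true) (T := T.dual) c p := by
  unfold fiberSum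
  simp_rw [Finset.sum_mul]
  rw [Finset.sum_comm]
  refine Finset.sum_congr rfl fun p _ => ?_
  rw [Finset.sum_eq_single p.1]
  · have : lift (ℓ := ℓ) (b := true) (T := T.dual) c p =
        if cellDim p.2.1 = 0 then c p.1 else 0 := by
      simp only [lift, if_true]
      rfl
    rw [this]
    by_cases h : cellDim p.2.1 = 0
    · rw [if_pos ⟨rfl, h⟩, if_pos h]
    · rw [if_neg (fun h' => h h'.2), if_neg h, zero_mul, mul_zero]
  · intro v _ hv
    rw [if_neg (fun h' => hv h'.1.symm), zero_mul]
  · intro h; exact absurd (Finset.mem_univ _) h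

theorem fiberSum_mem {m : ℕ} {g : (Tanner.replace ℓ false T).Cochain}
    (hg : g ∈ (Tanner.replace ℓ false T).cochains m) : fiberSum g ∈ T.cochains m := by
  intro v hv
  obtain ⟨p, -, hp⟩ := Finset.exists_ne_zero_of_sum_ne_zero hv
  by_cases h : p.1 = v ∧ cellDim p.2.1 = 0
  · rw [if_pos h] at hp
    have h1 : T.deg p.1 - cellDim p.2.1 = m := hg p hp
    rw [h.2] at h1
    rw [← h.1]
    exact h1
  · rw [if_neg h] at hp
    exact absurd rfl hp

theorem lift_false_apply (c : T.Cochain) (p : (Tanner.replace ℓ false T).V) :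
    lift (ℓ := ℓ) (b := false) c p = if p.2.1.2.2 = 0 ∧
      (Tanner.replace ℓ false T).deg p = T.deg p.2.1.1 then c p.2.1.1 else 0 := by
  simp only [lift, Bool.false_eq_true, if_false]

theorem lift_false_mem {m : ℕ} {c : T.Cochain} (hc : c ∈ T.cochains m) :
    lift (ℓ := ℓ) (b := false) c ∈ (Tanner.replace ℓ false T).cochains m := by
  intro p hp
  rw [lift_false_apply] at hp
  by_cases h : p.2.1.2.2 = 0 ∧ (Tanner.replace ℓ false T).deg p = T.deg p.2.1.1
  · rw [if_pos h] at hp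
    rw [h.2]
    exact hc _ hp
  · rw [if_neg h] at hp
    exact absurd rfl hp

variable [NeZero ℓ]

theorem Nice.deg_add_deg (hT : T.Nice) (h3 : 3 ≤ ℓ) (hodd : ℓ % 2 = 1)
    (p : (Tanner.replace ℓ false T).V) :
    (Tanner.replace ℓ false T).deg p + (Tanner.replace ℓ true T.dual).deg p = 2 := by
  have h1 : (2 - T.deg p.1) + cellDim p.2.1 ≤ 2 := hT.dual.replace_deg_le h3 hodd p
  have h2 := hT.deg_le p.1
  change T.deg p.1 - cellDim p.2.1 + ((2 - T.deg p.1) + cellDim p.2.1) = 2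
  omega

omit [NeZero ℓ] in
theorem Nice.deg_fst_of_deg_two (hT : T.Nice) {p : (Tanner.replace ℓ false T).V}
    (hp : (Tanner.replace ℓ false T).deg p = 2) : T.deg p.1 = 2 ∧ cellDim p.2.1 = 0 := by
  have h2 := hT.deg_le p.1
  have h1 : T.deg p.1 - cellDim p.2.1 = 2 := hp
  omega

omit [NeZero ℓ] in
-- In a `Z`-step the cells of degree two are exactly the 0-cells of the `Y_z`.
theorem Nice.parity_eq (hT : T.Nice) {σ : (Tanner.replace ℓ false T).Cochain}
    (hσ : σ ∈ (Tanner.replace ℓ false T).cochains 2) : parity σ = fiberSum σ := by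
  funext v
  unfold parity fiberSum
  have key : ∀ p : (Tanner.replace ℓ false T).V,
      (if p.1 = v ∧ cellDim p.2.1 = 0 then σ p else 0) =
        if T.deg v = 2 then loc v σ p else 0 := by
    intro p
    by_cases h0 : σ p = 0
    · rw [h0, ite_self, loc_apply, h0, ite_self, ite_self]
    · obtain ⟨h1, h2⟩ := hT.deg_fst_of_deg_two (hσ p h0)
      rw [loc_apply]
      by_cases hv : p.1 = v
      · rw [if_pos ⟨hv, h2⟩, if_pos hv, if_pos (by rw [← hv]; exact h1)]
      · rw [if_neg (fun h => hv h.1), if_neg hv, ite_self]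
  rw [Finset.sum_congr rfl fun p _ => key p]
  split_ifs
  · rfl
  · simp

/-- The transpose of `Nice.cobdry_lift_true` for the dual complex. -/
theorem Nice.fiberSum_cobdry (hT : T.Nice) (h3 : 3 ≤ ℓ) (hodd : ℓ % 2 = 1)
    (g : (Tanner.replace ℓ false T).Cochain) :
    fiberSum ((Tanner.replace ℓ false T).cobdry g) = T.cobdry (fiberSum g) := by
  apply eq_of_pairing
  intro c
  rw [pair_fiberSum, pair_replace, hT.dual.cobdry_lift_true h3 hodd c]
  exact (pair_fiberSum g (T.dual.cobdry c)).symm.trans (pair_cobdry T (fiberSum g) c).symm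

/-- The cells of dimension zero in `Y_v` on which lifts live. -/
theorem Nice.eq_center (hT : T.Nice) {v : T.V} {c : T.RawCell ℓ} (hc : T.IsCell ℓ true v c)
    (hd : T.deg c.1 = T.deg v) (hh : c.2.2 = 0) : c = pt v 0 := by
  have hl : c.1 = v := (hT.eq_of_le hc.1 (by omega)).symm
  refine Prod.ext hl (Prod.ext ?_ ?_)
  · funext w
    apply Fin.ext
    change (c.2.1 w).val = (fc ℓ 0).val
    rw [fc_zero_val]
    by_contra hne
    obtain ⟨h1, h2⟩ := (hc.2.1 w).1 hne
    rw [up_true] at h1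
    have h4 := hT.inc_deg h1
    have h5 := hT.le_trans_deg h2
    omega
  · rw [hh]
    rfl

/-- Where the lift of a cochain meets a cell of dimension zero. -/
theorem Nice.lift_false_of_dim (hT : T.Nice) (c : T.Cochain)
    (p : (Tanner.replace ℓ false T).V) (hd : cellDim p.2.1 = 0) :
    lift (ℓ := ℓ) (b := false) c p = if p.2.1 = pt p.1 0 then c p.1 else 0 := by
  rw [lift_false_apply]
  have hR : (Tanner.replace ℓ false T).deg p = T.deg p.1 := by
    change T.deg p.1 - cellDim p.2.1 = T.deg p.1
    omega
  rw [hR]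
  by_cases h : p.2.1 = pt p.1 0
  · rw [if_pos h, if_pos]
    · rw [h]; rfl
    · rw [h]; exact ⟨rfl, rfl⟩
  · rw [if_neg h, if_neg]
    rintro ⟨h1, h2⟩
    refine h (hT.dual.eq_center (v := p.1) (c := p.2.1) p.2.2 ?_ h1)
    change 2 - T.deg p.2.1.1 = 2 - T.deg p.1
    omega

/-- Among the 0-cells of `Y_v` the lift lives on the centre of layer `0` only. -/
theorem Nice.fiberSum_lift (hT : T.Nice) (c : T.Cochain) :
    fiberSum (lift (ℓ := ℓ) (b := false) c) = c := by
  funext v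
  have hcell : T.IsCell ℓ false v (pt v 0) := hT.dual.isCell_center v
  have hd0 : cellDim (pt v 0 : T.RawCell ℓ) = 0 := cellDim_pt v (by omega)
  refine (Finset.sum_eq_single (⟨v, pt v 0, hcell⟩ : (Tanner.replace ℓ false T).V) ?_ ?_).trans ?_
  rotate_left 2
  · exact (if_pos ⟨rfl, hd0⟩).trans ((hT.lift_false_of_dim c ⟨v, pt v 0, hcell⟩ hd0).trans
      (if_pos rfl))
  · intro p _ hp
    by_cases h : p.1 = v ∧ cellDim p.2.1 = 0
    · rw [if_pos h, hT.lift_false_of_dim c _ h.2, if_neg]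
      intro h5
      obtain ⟨v', c', hc'⟩ := p
      obtain rfl : v' = v := h.1
      have h5' : c' = pt v' 0 := h5
      subst h5'
      exact hp rfl
    · rw [if_neg h]
  · intro h; exact absurd (Finset.mem_univ _) h

end Tanner

namespace Tanner

variable {T : Tanner} {ℓ : ℕ} [NeZero ℓ]

/-! ### Strings and the cochain map of a `Z`-step -/

/-- The cells on which the lift of a qubit lives: the centre of `Y_q` and the straight strings. -/
theorem Nice.string_indicator (hT : T.Nice) (h3 : 3 ≤ ℓ) (hodd : ℓ % 2 = 1) {q : T.V} (hq : T.deg q = 1)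
    (p : (Tanner.replace ℓ true T).V) :
    ((if raw p = (q, pt q 0) then 1 else 0) + ∑ x : T.V, if T.inc x q then
      ∑ i ∈ Finset.range ((ℓ - 1) / 2), if raw p = (x, line x q (2 * i + 1) 0) then 1 else 0
      else 0 : ZMod 2) =
    if p.2.1.1 = q ∧ p.2.1.2.2 = 0 ∧ (Tanner.replace ℓ true T).deg p = 1 then 1 else 0 := by
  by_cases h : p.2.1.1 = q ∧ p.2.1.2.2 = 0 ∧ (Tanner.replace ℓ true T).deg p = 1
  · rw [if_pos h]
    obtain ⟨hl, hh, hd⟩ := h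
    have hd' : T.deg p.1 + cellDim p.2.1 = 1 := hd
    have hle : T.le true p.1 p.2.1.1 := p.2.2.1
    rw [hl] at hle
    -- A cell with label `q` lies over `q` itself, and is then the centre, or over an `X`-check
    -- below `q`, and is then an odd position on the axis.
    rcases hT.le_deg hle with h1 | ⟨h1, h2⟩ | ⟨-, h2⟩
    · have hc : p.2.1 = pt p.1 0 := hT.eq_center p.2.2 (by rw [hl, ← h1]) hh
      have hr : raw p = (q, pt q 0) := by
        rw [← h1]; exact Prod.ext rfl hc
      rw [if_pos hr, Finset.sum_eq_zero, add_zero]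
      intro x _
      split_ifs with hx
      · refine Finset.sum_eq_zero fun i _ => if_neg fun h4 => ?_
        have h5 : q = x := congrArg Prod.fst (hr.symm.trans h4)
        rw [h5] at hx
        have := hT.inc_deg hx
        omega
      · rfl
    · have hx0 : T.deg p.1 = 0 := by omega
      obtain ⟨q1, q1', z, α, β, η, s, ok, hc, hlab⟩ := hT.exists_sqr h3 hx0 p.2.2
      have hs := hT.sq_deg s
      have hq1 : q1 = q := by
        rcases hlab with h4 | h4 | h4
        · rw [hl] at h4; rw [h4] at hq; omega
        · rw [← h4, hl]
        · rw [hl] at h4; rw [h4] at hq; omega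
      subst hq1
      have hη : η = 0 := by
        have h5 := sqr_height (ℓ := ℓ) p.1 q1 q1' z α β ok.2.2.1
        rw [← hc, hh] at h5
        exact h5.symm
      subst hη
      have hβ : β = 0 := by
        rcases sqr_label_cases (ℓ := ℓ) p.1 q1 q1' z α β 0 with h4 | h4 | h4 | h4
        · exact h4.2.2
        · rw [← hc, hl] at h4; exact absurd h4.1 s.ne
        · exact h4.2.2
        · rw [← hc, hl] at h4; rw [h4.1] at hq; omega
      subst hβ
      rw [hc, cellDim_sqr s.ne ok] at hd'
      have hr : raw p = (p.1, line p.1 q1 α 0) := by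
        rw [← sqr_zero_right p.1 q1 q1' z]; exact Prod.ext rfl hc
      have okα : LineOK ℓ α 0 := by unfold SqOK at ok; unfold LineOK; omega
      rw [if_neg, zero_add, Finset.sum_eq_single p.1, if_pos h1, Finset.sum_eq_single (α / 2)]
      · rw [if_pos]
        rw [hr, show 2 * (α / 2) + 1 = α by omega]
      · intro i hi hne
        rw [Finset.mem_range] at hi
        rw [if_neg]
        rw [hr]
        intro h4
        have := (line_inj okα (show LineOK ℓ (2 * i + 1) 0 by unfold LineOK; omega)
          (congrArg Prod.snd h4)).1
        omega
      · intro h4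
        have := okα.1
        rw [Finset.mem_range] at h4
        omega
      · intro y _ hy
        split_ifs
        · refine Finset.sum_eq_zero fun i _ => if_neg fun h4 => ?_
          exact hy (congrArg Prod.fst (hr.symm.trans h4)).symm
        · rfl
      · intro h4; exact absurd (Finset.mem_univ _) h4
      · intro h4
        have h5 : p.1 = q1 := congrArg Prod.fst h4
        rw [h5] at hx0
        omega
    · omega
  · rw [if_neg h, if_neg, zero_add]
    · refine Finset.sum_eq_zero fun x _ => ?_
      split_ifs with hx
      · refine Finset.sum_eq_zero fun i hi => if_neg fun h4 => h ?_
        rw [Finset.mem_range] at hi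
        have ok : LineOK ℓ (2 * i + 1) 0 := by unfold LineOK; omega
        have hx0 := hT.inc_deg hx
        refine ⟨?_, ?_, ?_⟩
        · rw [raw_snd h4]; exact line_label _ _ _ (by omega)
        · rw [raw_snd h4]; rfl
        · rw [replace_deg h4, cellDim_line _ _ ok]
          omega
      · rfl
    · intro h4
      refine h ⟨?_, ?_, ?_⟩
      · rw [raw_snd h4]; rfl
      · rw [raw_snd h4]; rfl
      · rw [replace_deg h4, cellDim_pt _ (by omega), hq]

omit [NeZero ℓ] in
theorem sum_raw_mul (g : (Tanner.replace ℓ true T).Cochain) (v : T.V) (c : T.RawCell ℓ) :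
    ∑ p : (Tanner.replace ℓ true T).V, (if raw p = (v, c) then 1 else 0) * g p = ev g v c := by
  rw [← sum_raw g v c]
  refine Finset.sum_congr rfl fun p _ => ?_
  rw [ite_mul, one_mul, zero_mul]

/-- Pairing with a string. -/
theorem Nice.pair_string (hT : T.Nice) (h3 : 3 ≤ ℓ) (hodd : ℓ % 2 = 1) {q : T.V} (hq : T.deg q = 1)
    (g : (Tanner.replace ℓ true T).Cochain) :
    ∑ p : (Tanner.replace ℓ true T).V, (if p.2.1.1 = q ∧ p.2.1.2.2 = 0 ∧
      (Tanner.replace ℓ true T).deg p = 1 then 1 else 0) * g p =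
    ev g q (pt q 0) + ∑ x : T.V, if T.inc x q then
      ∑ i ∈ Finset.range ((ℓ - 1) / 2), ev g x (line x q (2 * i + 1) 0) else 0 := by
  simp_rw [← hT.string_indicator h3 hodd hq, add_mul, Finset.sum_add_distrib, sum_raw_mul]
  congr 1
  simp_rw [Finset.sum_mul]
  rw [Finset.sum_comm]
  refine Finset.sum_congr rfl fun x _ => ?_
  split_ifs
  · simp_rw [Finset.sum_mul]
    rw [Finset.sum_comm]
    refine Finset.sum_congr rfl fun i _ => sum_raw_mul g x _
  · simp

/-- Pairing the coboundary with a string. -/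
theorem Nice.pair_string_cobdry (hT : T.Nice) (h3 : 3 ≤ ℓ) (hodd : ℓ % 2 = 1) {q : T.V}
    (hq : T.deg q = 1) (g : (Tanner.replace ℓ true T).Cochain) :
    ∑ p : (Tanner.replace ℓ true T).V, (if p.2.1.1 = q ∧ p.2.1.2.2 = 0 ∧
      (Tanner.replace ℓ true T).deg p = 1 then 1 else 0) * (Tanner.replace ℓ true T).cobdry g p =
    ∑ x : T.V, if T.inc x q then ev g x (pt x 0) else 0 := by
  obtain ⟨z, hz⟩ := hT.above q (by omega)
  rw [hT.pair_string h3 hodd hq, ← line_zero q z,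
    hT.ev_cobdry_line_pt h3 hodd hz hq (by unfold LineOK; omega) (by omega) (by omega), inclSum,
    ← Finset.sum_add_distrib]
  refine Finset.sum_congr rfl fun x _ => ?_
  split_ifs with hx
  · have s := hT.sq_oth hx hz
    have e1 : ∀ α, (line x q α 0 : T.RawCell ℓ) = sqr x q (oth T x q z) z α 0 0 := fun α =>
      (sqr_zero_right _ _ _ _ _ _).symm
    have e2 : ∀ i ∈ Finset.range ((ℓ - 1) / 2),
        ev ((Tanner.replace ℓ true T).cobdry g) x (line x q (2 * i + 1) 0) =
        (fun i => ev g x (line x q (2 * i) 0)) i + (fun i => ev g x (line x q (2 * i) 0)) (i + 1) := by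
      intro i hi
      rw [Finset.mem_range] at hi
      rw [e1, hT.ev_cobdry_edge h3 hodd s (by unfold SqOK; omega) (by omega) (by omega) (by omega),
        ← e1, ← e1]
      rfl
    -- The sum over the axis telescopes to its ends. The outer end cancels against the inclusion of
    -- the centre of `Y_q`, and the centre of `Y_x` survives.
    rw [Finset.sum_congr rfl e2, sum_telescope, ← e1]
    rw [show 2 * ((ℓ - 1) / 2) = ℓ - 1 by omega, Nat.mul_zero, line_zero, add_comm, add_assoc,
      CharTwo.add_self_eq_zero, add_zero]
  · rw [add_zero]

/-- Degree one is self-dual, the two degrees of a cell adding up to two, so the lift of a qubit is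
the indicator of its string in the dual `X`-step. -/
theorem Nice.lift_false_one (hT : T.Nice) (h3 : 3 ≤ ℓ) (hodd : ℓ % 2 = 1) {e : T.Cochain}
    (he : e ∈ T.cochains 1) (p : (Tanner.replace ℓ false T).V) :
    lift (ℓ := ℓ) (b := false) e p = ∑ q : T.V, e q * (if p.2.1.1 = q ∧ p.2.1.2.2 = 0 ∧
      (Tanner.replace ℓ true T.dual).deg p = 1 then 1 else 0) := by
  rw [lift_false_apply, Finset.sum_eq_single p.2.1.1]
  · by_cases h0 : e p.2.1.1 = 0
    · rw [h0, zero_mul, ite_self]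
    · have h1 := he _ h0
      have h2 := hT.deg_add_deg h3 hodd p
      by_cases h : p.2.1.2.2 = 0 ∧ (Tanner.replace ℓ false T).deg p = T.deg p.2.1.1
      · rw [if_pos h, if_pos ⟨rfl, h.1, by omega⟩, mul_one]
      · rw [if_neg h, if_neg, mul_zero]
        rintro ⟨-, h4, h5⟩
        exact h ⟨h4, by omega⟩
  · intro q _ hq
    rw [if_neg (fun h => hq h.1.symm), mul_zero]
  · intro h; exact absurd (Finset.mem_univ _) h

theorem Nice.lift_false_two (hT : T.Nice) {c : T.Cochain} (hc : c ∈ T.cochains 2)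
    (p : (Tanner.replace ℓ false T).V) :
    lift (ℓ := ℓ) (b := false) c p = if p.2.1 = pt p.1 0 then c p.1 else 0 := by
  by_cases h : cellDim p.2.1 = 0
  · exact hT.lift_false_of_dim c p h
  · rw [if_neg]
    · refine cochain_zero_of_deg (lift_false_mem hc) ?_
      intro h2
      exact h (hT.deg_fst_of_deg_two h2).2
    · intro h2
      rw [h2, cellDim_pt _ (by omega)] at h
      exact h rfl

theorem pair_point (a : T.V → ZMod 2) (g : (Tanner.replace ℓ true T).Cochain) :
    ∑ p : (Tanner.replace ℓ true T).V, (if p.2.1 = pt p.1 0 then a p.1 else 0) * g p =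
      ∑ x : T.V, a x * ev g x (pt x 0) := by
  have h1 : ∀ x : T.V, a x * ev g x (pt x 0) =
      ∑ p : (Tanner.replace ℓ true T).V, if raw p = (x, pt x 0) then a x * g p else 0 := by
    intro x
    rw [← sum_raw_mul, Finset.mul_sum]
    refine Finset.sum_congr rfl fun p _ => ?_
    rw [ite_mul, one_mul, zero_mul, mul_ite, mul_zero]
  rw [Finset.sum_congr rfl fun x _ => h1 x, Finset.sum_comm]
  refine Finset.sum_congr rfl fun p _ => ?_
  rw [Finset.sum_eq_single p.1]
  · by_cases h : p.2.1 = pt p.1 0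
    · have h' : raw p = (p.1, pt p.1 0) := Prod.ext rfl h
      rw [if_pos h, if_pos h']
    · have h' : ¬ raw p = (p.1, pt p.1 0) := fun h' => h (congrArg Prod.snd h')
      rw [if_neg h, if_neg h', zero_mul]
  · intro x _ hx
    rw [if_neg]
    intro h
    exact hx (congrArg Prod.fst h).symm
  · intro h; exact absurd (Finset.mem_univ _) h

theorem Nice.pair_lift_two (hT : T.Nice) {c : T.Cochain} (hc : c ∈ T.cochains 2)
    (g : (Tanner.replace ℓ true T.dual).Cochain) :
    ∑ p : (Tanner.replace ℓ false T).V, lift (ℓ := ℓ) (b := false) c p * g p =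
      ∑ x : T.V, c x * ev (T := T.dual) g x (pt (T := T.dual) x 0) := by
  refine Eq.trans (Finset.sum_congr rfl fun p _ => ?_) (pair_point (T := T.dual) c g)
  rw [hT.lift_false_two hc]
  rfl

/-- Both sides are tested against an arbitrary `g`. Either way `g` is evaluated at the centres of
the `Y_z` for `z` above the support of `e`: on the left the strings telescope to these points, on
the right the lift consists of them. -/
theorem Nice.cobdry_lift_false (hT : T.Nice) (h3 : 3 ≤ ℓ) (hodd : ℓ % 2 = 1) {e : T.Cochain}
    (he : e ∈ T.cochains 1) :
    (Tanner.replace ℓ false T).cobdry (lift (ℓ := ℓ) (b := false) e) =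
      lift (ℓ := ℓ) (b := false) (T.cobdry e) := by
  apply eq_of_pairing
  intro g
  refine (pair_replace _ g).trans (Eq.trans ?_ (hT.pair_lift_two (hT.cobdry_mem he) g).symm)
  have h1 : ∀ p : (Tanner.replace ℓ false T).V, lift (ℓ := ℓ) (b := false) e p *
      (Tanner.replace ℓ true T.dual).cobdry g p = ∑ q : T.V, e q *
      ((if p.2.1.1 = q ∧ p.2.1.2.2 = 0 ∧ (Tanner.replace ℓ true T.dual).deg p = 1 then 1 else 0) *
        (Tanner.replace ℓ true T.dual).cobdry g p) := by
    intro p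
    rw [hT.lift_false_one h3 hodd he, Finset.sum_mul]
    exact Finset.sum_congr rfl fun q _ => mul_assoc _ _ _
  rw [Finset.sum_congr rfl fun p _ => h1 p, Finset.sum_comm]
  have h2 : ∀ q : T.V, (∑ p : (Tanner.replace ℓ false T).V, e q *
      ((if p.2.1.1 = q ∧ p.2.1.2.2 = 0 ∧ (Tanner.replace ℓ true T.dual).deg p = 1 then 1 else 0) *
        (Tanner.replace ℓ true T.dual).cobdry g p)) =
      ∑ x : T.V, if T.inc q x then e q * ev (T := T.dual) g x (pt (T := T.dual) x 0) else 0 := by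
    intro q
    rw [← Finset.mul_sum]
    by_cases h0 : e q = 0
    · simp [h0]
    · have hq : T.dual.deg q = 1 := by
        change 2 - T.deg q = 1
        rw [he q h0]
      have h4 := hT.dual.pair_string_cobdry h3 hodd hq g
      refine (congrArg (fun r => e q * r) h4).trans ?_
      refine (Finset.mul_sum _ _ _).trans (Finset.sum_congr rfl fun x _ => ?_)
      rw [mul_ite, mul_zero]
      rfl
  rw [Finset.sum_congr rfl fun q _ => h2 q, Finset.sum_comm]
  refine Finset.sum_congr rfl fun x _ => ?_
  rw [cobdry_apply, Finset.sum_mul]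
  refine Finset.sum_congr rfl fun q _ => ?_
  rw [ite_mul, zero_mul]

end Tanner

namespace Tanner

variable {T : Tanner} {ℓ : ℕ} [NeZero ℓ]

/-! ### The `Z`-steps -/

omit [NeZero ℓ] in
theorem cobdry_eq_zero_of_pairing {p : T.V} {ψ : T.V → ZMod 2}
    (h : ∑ v, T.cobdry (fun r => if r = p then 1 else 0) v * ψ v = 0) :
    T.dual.cobdry ψ p = 0 := by
  rw [pair_cobdry, Finset.sum_eq_single p] at h
  · rwa [if_pos rfl, one_mul] at h
  · intro r _ hr
    rw [if_neg hr, zero_mul]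
  · intro h; exact absurd (Finset.mem_univ _) h

omit [NeZero ℓ] in
theorem single_mem {p : T.V} {m : ℕ} (hp : T.deg p = m) :
    (fun r => if r = p then 1 else 0 : T.Cochain) ∈ T.cochains m := by
  intro r hr
  by_cases h : r = p
  · rw [h]; exact hp
  · exact absurd (if_neg h) hr

/-- `Nice.exists_eq_lift_true` with zero right-hand side, applied to the degree-one part of `ψ`. It
describes the functionals that annihilate the coboundaries of a `Z`-step. -/
theorem Nice.exists_decomposition (hT : T.Nice) (h3 : 3 ≤ ℓ) (hodd : ℓ % 2 = 1)
    (ψ : (Tanner.replace ℓ true T).Cochain)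
    (h : ∀ p : (Tanner.replace ℓ true T).V, (Tanner.replace ℓ true T).deg p = 2 →
      (Tanner.replace ℓ true T).cobdry ψ p = 0) :
    ∃ (H : (Tanner.replace ℓ true T).Cochain) (e : T.Cochain),
      ∀ p : (Tanner.replace ℓ true T).V, (Tanner.replace ℓ true T).deg p = 1 →
        ψ p = (Tanner.replace ℓ true T).cobdry H p + lift (ℓ := ℓ) (b := true) e p := by
  have hN := hT.replace_true h3 hodd
  set ψ1 : (Tanner.replace ℓ true T).Cochain :=
    fun p => if (Tanner.replace ℓ true T).deg p = 1 then ψ p else 0 with hψ1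
  have hψ1m : ψ1 ∈ (Tanner.replace ℓ true T).cochains 1 := by
    intro p hp
    by_contra h
    exact hp (if_neg h)
  have hψ1c : (Tanner.replace ℓ true T).cobdry ψ1 = lift (ℓ := ℓ) (b := true) 0 := by
    rw [lift_zero]
    funext p
    by_cases hp : (Tanner.replace ℓ true T).deg p = 2
    · rw [Pi.zero_apply, ← h p hp, cobdry_apply, cobdry_apply]
      refine Finset.sum_congr rfl fun r _ => ?_
      split_ifs with hr
      · have := hN.inc_deg hr
        exact if_pos (by omega)
      · rfl
    · exact cochain_zero_of_deg (hN.cobdry_mem hψ1m) hp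
  obtain ⟨H, -, e, -, hHe, -, -⟩ := hT.exists_eq_lift_true h3 hodd ψ1 hψ1m
    (Submodule.zero_mem _) hψ1c
  refine ⟨H, e, fun p hp => ?_⟩
  have h1 : ψ1 p = ψ p := if_pos hp
  rw [← hHe, Pi.add_apply, h1, add_comm (ψ p), ← add_assoc, CharTwo.add_self_eq_zero, zero_add]

/-- Cocycles that are invisible to the lowest cohomology of the `Y_v` are coboundaries. -/
theorem Nice.mem_coboundaries_of_fiberSum (hT : T.Nice) (h3 : 3 ≤ ℓ) (hodd : ℓ % 2 = 1)
    {g : (Tanner.replace ℓ false T).Cochain} (hg : g ∈ (Tanner.replace ℓ false T).cochains 1)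
    (hδ : (Tanner.replace ℓ false T).cobdry g = 0) (hP : fiberSum g = 0) :
    g ∈ (Tanner.replace ℓ false T).coboundaries 0 := by
  -- A functional `ψ` that kills the coboundaries is a cocycle of the dual complex, in degree one a
  -- coboundary of some `H` plus a lift of some `e`. Against `g` the first part gives zero since `g`
  -- is closed, the second since its fibre sums vanish.
  refine mem_of_pairing (V := (Tanner.replace ℓ false T).V) _ g fun ψ hψ => ?_
  have hdual := hT.deg_add_deg h3 hodd (ℓ := ℓ)
  obtain ⟨H, e, hHe⟩ := hT.dual.exists_decomposition h3 hodd ψ (by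
    intro p hp
    have hp0 : (Tanner.replace ℓ false T).deg p = 0 := by
      have := hdual p
      omega
    exact cobdry_eq_zero_of_pairing (T := Tanner.replace ℓ false T) (hψ _ ⟨_, single_mem hp0, rfl⟩))
  have e1 : ∀ p : (Tanner.replace ℓ false T).V, g p * ψ p =
      g p * (Tanner.replace ℓ true T.dual).cobdry H p +
        g p * lift (ℓ := ℓ) (b := true) e p := by
    intro p
    by_cases h0 : g p = 0
    · rw [h0, zero_mul, zero_mul, zero_mul, add_zero]
    · have hd := hdual p
      rw [hg p h0] at hd
      exact (congrArg (fun r => g p * r) (hHe p (by omega))).trans (mul_add _ _ _)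
  have e2 := (pair_replace g H).symm
  have e3 := (pair_fiberSum g e).symm
  rw [hδ] at e2
  rw [hP] at e3
  rw [Finset.sum_congr rfl fun p _ => e1 p, Finset.sum_add_distrib]
  refine (congrArg₂ (fun r s => r + s) e2 e3).trans ?_
  simp

/-- One-cochains whose coboundary is a lift are cohomologous to the lift of their fibre sums. -/
theorem Nice.add_lift_fiberSum_mem (hT : T.Nice) (h3 : 3 ≤ ℓ) (hodd : ℓ % 2 = 1)
    {g : (Tanner.replace ℓ false T).Cochain} (hg : g ∈ (Tanner.replace ℓ false T).cochains 1)
    {c : T.Cochain} (hgc : (Tanner.replace ℓ false T).cobdry g = lift (ℓ := ℓ) (b := false) c) :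
    T.cobdry (fiberSum g) = c ∧
      g + lift (ℓ := ℓ) (b := false) (fiberSum g) ∈ (Tanner.replace ℓ false T).coboundaries 0 := by
  have h1 : T.cobdry (fiberSum g) = c := by
    rw [← hT.fiberSum_cobdry h3 hodd, hgc, hT.fiberSum_lift]
  refine ⟨h1, hT.mem_coboundaries_of_fiberSum h3 hodd
    (Submodule.add_mem _ hg (lift_false_mem (fiberSum_mem hg))) ?_ ?_⟩
  · rw [map_add, hT.cobdry_lift_false h3 hodd (fiberSum_mem hg), h1, hgc]
    exact cochain_add_self _
  · rw [fiberSum_add, hT.fiberSum_lift]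
    exact cochain_add_self _

/-- Lifts of coboundaries are coboundaries. -/
theorem Nice.lift_mem_coboundaries (hT : T.Nice) (h3 : 3 ≤ ℓ) (hodd : ℓ % 2 = 1) (b : Bool)
    {c : T.Cochain} (hc : c ∈ T.coboundaries 0) :
    lift (ℓ := ℓ) (b := b) c ∈ (Tanner.replace ℓ b T).coboundaries 0 := by
  obtain ⟨h, hh, rfl⟩ := hc
  cases b
  · have hN := hT.replace h3 hodd false
    have hm : T.cobdry h ∈ T.cochains 1 := hT.cobdry_mem hh
    have hm' := hN.cobdry_mem (lift_false_mem (ℓ := ℓ) hh)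
    have key := hT.mem_coboundaries_of_fiberSum h3 hodd (g := lift (ℓ := ℓ) (b := false)
      (T.cobdry h) + (Tanner.replace ℓ false T).cobdry (lift (ℓ := ℓ) (b := false) h))
      (Submodule.add_mem _ (lift_false_mem hm) hm') (by
        rw [map_add, hT.cobdry_lift_false h3 hodd hm, hT.cobdry_cobdry, hN.cobdry_cobdry,
          lift_zero, add_zero]) (by
        rw [fiberSum_add, hT.fiberSum_lift, hT.fiberSum_cobdry h3 hodd, hT.fiberSum_lift]
        exact cochain_add_self _)
    have := Submodule.add_mem _ key (⟨_, lift_false_mem hh, rfl⟩ :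
      (Tanner.replace ℓ false T).cobdry (lift (ℓ := ℓ) (b := false) h) ∈
        (Tanner.replace ℓ false T).coboundaries 0)
    rwa [cochain_add_cancel] at this
  · exact ⟨_, lift_true_mem hh, hT.cobdry_lift_true h3 hodd h⟩

/-- Local syndromes of even parity on `Y_z` can be removed. -/
theorem Nice.exists_cobdry_eq (hT : T.Nice) (h3 : 3 ≤ ℓ) (hodd : ℓ % 2 = 1) {z : T.V}
    (hz : T.deg z = 2) {y : (Tanner.replace ℓ false T).Cochain}
    (hy : y ∈ (Tanner.replace ℓ false T).cochains 2) (hyl : loc z y = y)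
    (hsum : ∑ p, y p = 0) :
    ∃ f ∈ (Tanner.replace ℓ false T).cochains 1, loc z f = f ∧
      (Tanner.replace ℓ false T).cobdry f = y := by
  have hdual := hT.deg_add_deg h3 hodd (ℓ := ℓ)
  have hz0 : T.dual.deg z = 0 := by
    change 2 - T.deg z = 0
    omega
  let F : Submodule (ZMod 2) (Tanner.replace ℓ false T).Cochain :=
    { carrier := {f | f ∈ (Tanner.replace ℓ false T).cochains 1 ∧ ∀ p, f p ≠ 0 → p.1 = z}
      zero_mem' := ⟨Submodule.zero_mem _, fun p hp => absurd rfl hp⟩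
      add_mem' := by
        rintro a b ⟨ha, ha'⟩ ⟨hb, hb'⟩
        refine ⟨Submodule.add_mem _ ha hb, fun p hp => ?_⟩
        by_cases h : a p = 0
        · refine hb' p fun h' => hp ?_
          rw [Pi.add_apply, h, h', add_zero]
        · exact ha' p h
      smul_mem' := by
        rintro r a ⟨ha, ha'⟩
        refine ⟨Submodule.smul_mem _ r ha, fun p hp => ha' p fun h => hp ?_⟩
        rw [Pi.smul_apply, h, smul_zero] }
  have hmem : y ∈ F.map (Tanner.replace ℓ false T).cobdry := by
    -- `Y_z` is connected, so a functional that kills the coboundaries of the edges of `Y_z` is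
    -- constant on its points and sees only the parity of `y`.
    refine mem_of_pairing (V := (Tanner.replace ℓ false T).V) _ y fun ψ hψ => ?_
    have h1 : ∀ p : (Tanner.replace ℓ true T.dual).V, p.1 = z →
        (Tanner.replace ℓ true T.dual).deg p = 1 →
        (Tanner.replace ℓ true T.dual).cobdry ψ p = 0 := by
      intro p hpz hp
      have hp1 : (Tanner.replace ℓ false T).deg p = 1 := by
        have := hdual p
        omega
      exact cobdry_eq_zero_of_pairing (T := Tanner.replace ℓ false T)
        (hψ _ ⟨_, ⟨single_mem hp1, fun r hr => by
          by_cases h : r = p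
          · rw [h]; exact hpz
          · exact absurd (if_neg h) hr⟩, rfl⟩)
    have h2 := hT.dual.star_const h3 hodd (x := z) ψ h1 hz0
    have h4 : ∀ p : (Tanner.replace ℓ false T).V, y p * ψ p =
        y p * ev (T := T.dual) ψ z (pt (T := T.dual) z 0) := by
      intro p
      by_cases h0 : y p = 0
      · rw [h0, zero_mul, zero_mul]
      · have hpz : p.1 = z := loc_eq_self_iff.1 hyl p h0
        have hd := hdual p
        rw [hy p h0] at hd
        exact congrArg (fun r => y p * r) (h2 p hpz (by omega))
    rw [Finset.sum_congr rfl fun p _ => h4 p, ← Finset.sum_mul, hsum, zero_mul]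
  obtain ⟨f, ⟨hf, hf'⟩, hfy⟩ := hmem
  exact ⟨f, hf, loc_eq_self_iff.2 hf', hfy⟩

omit [NeZero ℓ] in
theorem parity_apply_two {z : T.V} (hz : T.deg z = 2) (σ : (Tanner.replace ℓ false T).Cochain) :
    parity σ z = ∑ p : (Tanner.replace ℓ false T).V, loc z σ p := by
  unfold parity
  rw [if_pos hz]

omit [NeZero ℓ] in
theorem parity_mem (σ : (Tanner.replace ℓ false T).Cochain) : parity σ ∈ T.cochains 2 := by
  intro v hv
  by_contra h
  exact hv (if_neg h)

theorem Nice.loc_lift_two (hT : T.Nice) {c c' : T.Cochain} (hc : c ∈ T.cochains 2)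
    (hc' : c' ∈ T.cochains 2) {z : T.V} (h : c z = c' z) :
    loc z (lift (ℓ := ℓ) (b := false) c) = loc z (lift (ℓ := ℓ) (b := false) c') := by
  funext p
  rw [loc_apply, loc_apply]
  split_ifs with hp
  · have h' : c p.1 = c' p.1 := by rw [hp, h]
    rw [hT.lift_false_two hc, hT.lift_false_two hc', h']
  · rfl

theorem Nice.exists_correction_parity (hT : T.Nice) (h3 : 3 ≤ ℓ) (hodd : ℓ % 2 = 1) {z : T.V}
    (hz : T.deg z = 2) {s : (Tanner.replace ℓ false T).Cochain}
    (hs : s ∈ (Tanner.replace ℓ false T).cochains 2) (hsl : loc z s = s) :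
    ∃ f, IsCorrectionZ z s f := by
  have hl := lift_false_mem (ℓ := ℓ) (parity_mem s)
  obtain ⟨f, hf, hfl, hfy⟩ := hT.exists_cobdry_eq h3 hodd hz
    (y := s + loc z (lift (ℓ := ℓ) (b := false) (parity s)))
    (Submodule.add_mem _ hs (loc_mem_cochains z hl))
    (by rw [loc_add, hsl, loc_loc]) (by
      have h1 : ∑ p : (Tanner.replace ℓ false T).V, s p = parity s z := by
        rw [parity_apply_two hz, hsl]
      have h2 : ∑ p : (Tanner.replace ℓ false T).V,
          loc z (lift (ℓ := ℓ) (b := false) (parity s)) p = parity s z := by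
        rw [← parity_apply_two hz, hT.parity_eq hl, hT.fiberSum_lift]
      simp only [Pi.add_apply]
      rw [Finset.sum_add_distrib, h1, h2]
      exact CharTwo.add_self_eq_zero _)
  refine ⟨f, hf, hfl, ?_⟩
  rw [hfy, loc_add, hsl, loc_loc]

section StepZ

variable (corr : T.V → (Tanner.replace ℓ false T).Cochain → (Tanner.replace ℓ false T).Cochain)

omit [NeZero ℓ] in
theorem stepLocal_two (σ : (Tanner.replace ℓ false T).Cochain) {z : T.V} (hz : T.deg z = 2) :
    stepLocal corr σ z = corr z (loc z σ) := by
  simp only [stepLocal, Bool.false_eq_true, if_false, if_pos hz]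

omit [NeZero ℓ] in
theorem stepLocal_not_two (σ : (Tanner.replace ℓ false T).Cochain) {v : T.V}
    (hv : T.deg v ≠ 2) : stepLocal corr σ v = 0 := by
  simp only [stepLocal, Bool.false_eq_true, if_false, if_neg hv]

omit [NeZero ℓ] in
theorem stepCoarse_false (σ : (Tanner.replace ℓ false T).Cochain) :
    stepCoarse corr σ = parity σ := by
  simp only [stepCoarse, Bool.false_eq_true, if_false]

/-- The properties of the local corrections of a `Z`-step. -/
structure StepZ (σ : (Tanner.replace ℓ false T).Cochain) : Prop where
  mem : ∀ v, stepLocal corr σ v ∈ (Tanner.replace ℓ false T).cochains 1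
  local_eq : ∀ v, loc v (stepLocal corr σ v) = stepLocal corr σ v
  mem_coarse : stepCoarse corr σ ∈ T.coboundaries 1
  lift_eq : σ + (Tanner.replace ℓ false T).cobdry (∑ v, stepLocal corr σ v) =
    lift (ℓ := ℓ) (b := false) (stepCoarse corr σ)

variable {corr}

omit [NeZero ℓ] in
theorem Nice.cobdry_local_two (hT : T.Nice) {z : T.V} (hz : T.deg z = 2)
    {f : (Tanner.replace ℓ false T).Cochain} (hf : loc z f = f) :
    loc z ((Tanner.replace ℓ false T).cobdry f) = (Tanner.replace ℓ false T).cobdry f := by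
  rw [loc_eq_self_iff]
  intro p hp
  obtain ⟨u, hu, hfu⟩ := cobdry_ne_zero hp
  have huz := loc_eq_self_iff.1 hf u hfu
  rcases replace_false_inc_fst hu with h | h
  · exact h.trans huz
  · have h1 := hT.inc_deg h
    have h2 := hT.deg_le p.1
    rw [huz] at h1
    omega

/-- Nothing lies above a `Z`-check, so a correction on `Y_z` creates no syndrome elsewhere and the
local problems are independent. Each is solvable because the syndrome and the lift of its parity
have the same parity on `Y_z`. -/
theorem Nice.stepZ (hT : T.Nice) (h3 : 3 ≤ ℓ) (hodd : ℓ % 2 = 1)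
    (hcorr : ∀ v s, (∃ f, IsCorrection v s f) → IsCorrection v s (corr v s))
    {σ : (Tanner.replace ℓ false T).Cochain}
    (hσ : σ ∈ (Tanner.replace ℓ false T).coboundaries 1) :
    StepZ corr σ := by
  have hN := hT.replace h3 hodd (ℓ := ℓ) false
  have hσ2 := hN.coboundaries_le hσ
  have hz : ∀ z, T.deg z = 2 → IsCorrectionZ z (loc z σ) (stepLocal corr σ z) := by
    intro z hz
    rw [stepLocal_two _ _ hz]
    have := hcorr z (loc z σ) (by
      simpa only [IsCorrection, Bool.false_eq_true, if_false] using
        hT.exists_correction_parity h3 hodd hz (loc_mem_cochains z hσ2) (loc_loc z σ))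
    simpa only [IsCorrection, Bool.false_eq_true, if_false] using this
  have hmem : ∀ v, stepLocal corr σ v ∈ (Tanner.replace ℓ false T).cochains 1 ∧
      loc v (stepLocal corr σ v) = stepLocal corr σ v := by
    intro v
    by_cases hv : T.deg v = 2
    · exact ⟨(hz v hv).1, (hz v hv).2.1⟩
    · rw [stepLocal_not_two _ _ hv]
      exact ⟨Submodule.zero_mem _, loc_zero v⟩
  have hfmem : (∑ v, stepLocal corr σ v) ∈ (Tanner.replace ℓ false T).cochains 1 :=
    Submodule.sum_mem _ fun v _ => (hmem v).1
  have hδloc : ∀ v, loc v ((Tanner.replace ℓ false T).cobdry (stepLocal corr σ v)) =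
      (Tanner.replace ℓ false T).cobdry (stepLocal corr σ v) := by
    intro v
    by_cases hv : T.deg v = 2
    · exact hT.cobdry_local_two hv (hmem v).2
    · rw [stepLocal_not_two _ _ hv, map_zero, loc_zero]
  refine ⟨fun v => (hmem v).1, fun v => (hmem v).2, ?_, ?_⟩
  · obtain ⟨u, hu, rfl⟩ := mem_coboundaries.1 hσ
    rw [stepCoarse_false, hT.parity_eq hσ2, hT.fiberSum_cobdry h3 hodd]
    exact ⟨_, fiberSum_mem hu, rfl⟩
  · rw [stepCoarse_false]
    have hlmem := lift_false_mem (ℓ := ℓ) (parity_mem σ)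
    apply cochain_ext_loc
    intro v
    by_cases hv : T.deg v = 2
    · rw [loc_add, map_sum, loc_sum_local _ hδloc, ← hδloc, (hz v hv).2.2, ← add_assoc,
        cochain_add_self, zero_add]
      refine hT.loc_lift_two (parity_mem _) (parity_mem _) ?_
      rw [parity_apply_two hv, parity_apply_two hv, loc_loc]
    · have h0 : ∀ c ∈ (Tanner.replace ℓ false T).cochains 2, loc v c = 0 := by
        intro c hc
        rw [loc_eq_zero_iff]
        intro p hp
        by_contra hne
        have := (hT.deg_fst_of_deg_two (hc p hne)).1
        rw [hp] at this
        exact hv this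
      rw [h0 _ (Submodule.add_mem _ hσ2 (hN.cobdry_mem hfmem)), h0 _ hlmem]

omit [NeZero ℓ] in
/-- Fibre sums of errors near one `X`-check are near one `X`-check. -/
theorem Nice.fiberSum_link (hT : T.Nice) {p : (Tanner.replace ℓ false T).V}
    {e : (Tanner.replace ℓ false T).Cochain} (he : e ∈ (Tanner.replace ℓ false T).cochains 1)
    (hep : ∀ q, e q ≠ 0 → (Tanner.replace ℓ false T).inc p q) :
    ∃ x, T.deg x = 0 ∧ ∀ q, fiberSum e q ≠ 0 → T.inc x q := by
  have hsupp : ∀ q, fiberSum e q ≠ 0 → q = p.1 ∨ T.inc p.1 q := by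
    intro q hq
    obtain ⟨r, -, hr⟩ := Finset.exists_ne_zero_of_sum_ne_zero hq
    by_cases h : r.1 = q ∧ cellDim r.2.1 = 0
    · rw [if_pos h] at hr
      rcases replace_false_inc_fst (hep r hr) with h6 | h6
      · left; rw [← h.1, h6]
      · right; rw [← h.1]; exact h6
    · rw [if_neg h] at hr
      exact absurd rfl hr
  have hfin : ∀ x, T.deg x = 0 → (∀ q, T.deg q = 1 → (q = p.1 ∨ T.inc p.1 q) → T.inc x q) →
      ∃ x, T.deg x = 0 ∧ ∀ q, fiberSum e q ≠ 0 → T.inc x q :=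
    fun x hx hxq => ⟨x, hx, fun q hq => hxq q (fiberSum_mem he q hq) (hsupp q hq)⟩
  have hle := hT.deg_le p.1
  -- A vertex `p` of degree zero may lie over a vertex of any degree. If `p.1` is not an `X`-check,
  -- at most the qubit `p.1` survives in the fibre sum, and any `X`-check below serves.
  have hcase : T.deg p.1 = 0 ∨ T.deg p.1 = 1 ∨ T.deg p.1 = 2 := by omega
  rcases hcase with h | h | h
  · refine hfin p.1 h fun q hq hqp => ?_
    rcases hqp with rfl | hqp
    · omega
    · exact hqp
  · obtain ⟨x, hx⟩ := hT.below p.1 (by omega)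
    refine hfin x (by have := hT.inc_deg hx; omega) fun q hq hqp => ?_
    rcases hqp with rfl | hqp
    · exact hx
    · have := hT.inc_deg hqp
      omega
  · obtain ⟨y, hy⟩ := hT.below p.1 (by omega)
    have hyd := hT.inc_deg hy
    obtain ⟨x, hx⟩ := hT.below y (by omega)
    refine hfin x (by have := hT.inc_deg hx; omega) fun q hq hqp => ?_
    rcases hqp with rfl | hqp
    · omega
    · have := hT.inc_deg hqp
      omega

/-- A correction of a `Z`-step responds locally to errors near one `X`-check. -/
theorem Nice.stepZ_local (hT : T.Nice) (h3 : 3 ≤ ℓ) (hodd : ℓ % 2 = 1)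
    {σ e : (Tanner.replace ℓ false T).Cochain}
    (h1 : StepZ corr σ) (h2 : StepZ corr (σ + (Tanner.replace ℓ false T).cobdry e))
    {p : (Tanner.replace ℓ false T).V}
    (he : e ∈ (Tanner.replace ℓ false T).cochains 1)
    (hep : ∀ q, e q ≠ 0 → (Tanner.replace ℓ false T).inc p q) :
    ∃ x, T.deg x = 0 ∧ ∃ e' ∈ T.cochains 1, (∀ q, e' q ≠ 0 → T.inc x q) ∧
      T.cobdry e' = stepCoarse corr σ +
        stepCoarse corr (σ + (Tanner.replace ℓ false T).cobdry e) ∧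
      (∑ v, stepLocal corr σ v) +
        (∑ v, stepLocal corr (σ + (Tanner.replace ℓ false T).cobdry e) v) + e +
        lift (ℓ := ℓ) (b := false) e' ∈ (Tanner.replace ℓ false T).coboundaries 0 := by
  set δ := (Tanner.replace ℓ false T).cobdry with hδ
  set σ' := σ + δ e with hσ'
  set f := ∑ v, stepLocal corr σ v with hf
  set f' := ∑ v, stepLocal corr σ' v with hf'
  have hg : f + f' + e ∈ (Tanner.replace ℓ false T).cochains 1 :=
    Submodule.add_mem _ (Submodule.add_mem _ (Submodule.sum_mem _ fun v _ => h1.mem v)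
      (Submodule.sum_mem _ fun v _ => h2.mem v)) he
  have hδg : δ (f + f' + e) =
      lift (ℓ := ℓ) (b := false) (stepCoarse corr σ + stepCoarse corr σ') := by
    rw [lift_add, ← h1.lift_eq, ← h2.lift_eq, map_add, map_add, hσ', ← hf, ← hf', ← hδ]
    have := cochain_add_self σ
    linear_combination -this
  obtain ⟨h4, h5⟩ := hT.add_lift_fiberSum_mem h3 hodd hg hδg
  -- Corrections live over `Z`-checks, where cells of degree one have dimension one and are not seen
  -- by fibre sums. So the error passed on is `fiberSum e`, whatever corrections were chosen.
  have hzero : ∀ τ : (Tanner.replace ℓ false T).Cochain, StepZ corr τ →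
      fiberSum (∑ v, stepLocal corr τ v) = 0 := by
    intro τ hτ
    funext q
    refine Finset.sum_eq_zero fun r _ => ?_
    split_ifs with h
    · have hmem : (∑ v, stepLocal corr τ v) ∈ (Tanner.replace ℓ false T).cochains 1 :=
        Submodule.sum_mem _ fun v _ => hτ.mem v
      by_contra hne
      have h6 : T.deg r.1 - cellDim r.2.1 = 1 := hmem r hne
      refine hne ?_
      rw [← loc_of_eq (∑ v, stepLocal corr τ v) (rfl : r.1 = r.1), loc_sum_local _ hτ.local_eq,
        stepLocal_not_two _ _ (by omega)]
      rfl
    · rfl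
  rw [fiberSum_add, fiberSum_add, hzero _ h1, hzero _ h2, zero_add, zero_add] at h4 h5
  obtain ⟨x, hx, hxe⟩ := hT.fiberSum_link he hep
  exact ⟨x, hx, _, fiberSum_mem he, hxe, h4, h5⟩

omit [NeZero ℓ] in
-- An odd parity needs at least one nonzero value. There is no gain in a `Z`-step.
theorem stepZ_weight (σ : (Tanner.replace ℓ false T).Cochain) (W : Set T.V) :
    weight (restrict W (stepCoarse corr σ)) ≤
      weight (restrict {p : (Tanner.replace ℓ false T).V | p.1 ∈ W} σ) := by
  rw [weight_restrict_loc, weight_restrict_eq_sum]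
  refine Finset.sum_le_sum fun v _ => ?_
  split_ifs with h
  · rw [stepCoarse_false] at h
    rw [Nat.one_le_iff_ne_zero]
    intro h0
    refine h ?_
    rw [parity_apply_two (parity_mem σ v h)]
    refine Finset.sum_eq_zero fun p _ => ?_
    by_contra hne
    have : p ∈ (Finset.univ.filter fun p => loc v σ p ≠ 0) :=
      Finset.mem_filter.2 ⟨Finset.mem_univ _, hne⟩
    rw [Finset.card_eq_zero.1 h0] at this
    exact absurd this (Finset.notMem_empty _)
  · exact Nat.zero_le _

end StepZ

end Tanner

namespace Tanner

/-! ### Steps of either kind -/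

section Step

variable {T : Tanner} {ℓ : ℕ} [NeZero ℓ] {b : Bool}
  (corr : T.V → (Tanner.replace ℓ b T).Cochain → (Tanner.replace ℓ b T).Cochain)

/-- The properties of the corrections of one step. -/
structure Step (σ : (Tanner.replace ℓ b T).Cochain) : Prop where
  local_eq : ∀ v, loc v (stepLocal corr σ v) = stepLocal corr σ v
  mem_coarse : stepCoarse corr σ ∈ T.coboundaries 1
  lift_eq : σ + (Tanner.replace ℓ b T).cobdry (∑ v, stepLocal corr σ v) =
    lift (ℓ := ℓ) (b := b) (stepCoarse corr σ)

variable {corr}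

theorem Nice.step (hT : T.Nice) (h3 : 3 ≤ ℓ) (hodd : ℓ % 2 = 1)
    (hcorr : ∀ v s, (∃ f, IsCorrection v s f) → IsCorrection v s (corr v s))
    {σ : (Tanner.replace ℓ b T).Cochain} (hσ : σ ∈ (Tanner.replace ℓ b T).coboundaries 1) :
    Step corr σ := by
  cases b
  · have h := hT.stepZ h3 hodd hcorr hσ
    exact ⟨h.local_eq, h.mem_coarse, h.lift_eq⟩
  · have h := hT.stepX h3 hodd hcorr hσ
    exact ⟨h.local_eq, h.mem_coarse, h.lift_eq⟩

theorem Nice.step_local (hT : T.Nice) (h3 : 3 ≤ ℓ) (hodd : ℓ % 2 = 1)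
    (hcorr : ∀ v s, (∃ f, IsCorrection v s f) → IsCorrection v s (corr v s))
    {σ e : (Tanner.replace ℓ b T).Cochain} (hσ : σ ∈ (Tanner.replace ℓ b T).coboundaries 1)
    {p : (Tanner.replace ℓ b T).V} (hp : (Tanner.replace ℓ b T).deg p = 0)
    (he : e ∈ (Tanner.replace ℓ b T).cochains 1)
    (hep : ∀ q, e q ≠ 0 → (Tanner.replace ℓ b T).inc p q) :
    ∃ x, T.deg x = 0 ∧ ∃ e' ∈ T.cochains 1, (∀ q, e' q ≠ 0 → T.inc x q) ∧
      T.cobdry e' = stepCoarse corr σ +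
        stepCoarse corr (σ + (Tanner.replace ℓ b T).cobdry e) ∧
      (∑ v, stepLocal corr σ v) +
        (∑ v, stepLocal corr (σ + (Tanner.replace ℓ b T).cobdry e) v) + e +
        lift (ℓ := ℓ) (b := b) e' ∈ (Tanner.replace ℓ b T).coboundaries 0 := by
  have hσ' : σ + (Tanner.replace ℓ b T).cobdry e ∈ (Tanner.replace ℓ b T).coboundaries 1 :=
    Submodule.add_mem _ hσ ⟨e, he, rfl⟩
  cases b
  · exact hT.stepZ_local h3 hodd (hT.stepZ h3 hodd hcorr hσ) (hT.stepZ h3 hodd hcorr hσ') he hep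
  · exact hT.stepX_local h3 hodd (hT.stepX h3 hodd hcorr hσ) (hT.stepX h3 hodd hcorr hσ') hp he hep

theorem Nice.step_weight (hT : T.Nice) (h3 : 3 ≤ ℓ) (hodd : ℓ % 2 = 1)
    (hcorr : ∀ v s, (∃ f, IsCorrection v s f) → IsCorrection v s (corr v s))
    {σ : (Tanner.replace ℓ b T).Cochain} (hσ : σ ∈ (Tanner.replace ℓ b T).coboundaries 1)
    (W : Set T.V)
    (hW : ∀ v v', loc v ((Tanner.replace ℓ b T).cobdry (stepLocal corr σ v')) ≠ 0 →
      (v ∈ W ↔ v' ∈ W)) :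
    (if b then 2 else 1) * weight (restrict W (stepCoarse corr σ)) ≤
      weight (restrict {p : (Tanner.replace ℓ b T).V | p.1 ∈ W} σ) := by
  cases b
  · rw [if_neg (by decide), one_mul]
    exact stepZ_weight σ W
  · rw [if_pos rfl]
    exact hT.stepX_weight (hT.stepX h3 hodd hcorr hσ) W hW

omit [NeZero ℓ] in
theorem replace_inc_fst_or {p p' : (Tanner.replace ℓ b T).V}
    (h : (Tanner.replace ℓ b T).inc p p') : p.1 = p'.1 ∨ T.inc p.1 p'.1 := by
  cases b
  · exact (replace_false_inc_fst h).imp_left Eq.symm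
  · exact replace_inc_fst h

end Step

/-! ### Small errors -/

/-- Closed qubit configurations of the seed code which agree on the ends of a row are
coboundaries. -/
theorem seed_mem_coboundaries {b : seed.Cochain} (hb : b ∈ seed.cochains 1)
    (hδ : seed.cobdry b = 0) {r : Fin 3} (hr : r = 0 ∨ r = 2)
    (h : b ((r, 0) : Fin 3 × Fin 3) = b ((r, 2) : Fin 3 × Fin 3)) :
    b ∈ seed.coboundaries 0 := by
  have hsum : ∀ (c : seed.Cochain) (v : Fin 3 × Fin 3), seed.cobdry c v =
      ∑ i : Fin 3, ∑ j : Fin 3, if seedInc (i, j) v then c ((i, j) : Fin 3 × Fin 3) else 0 := by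
    intro c v
    rw [← Fintype.sum_prod_type' (f := fun i j =>
      if seedInc (i, j) v then c ((i, j) : Fin 3 × Fin 3) else 0)]
    change (∑ u : Fin 3 × Fin 3, @ite _ (seedInc u v) (Classical.propDecidable _) (c u) 0) =
      ∑ u : Fin 3 × Fin 3, if seedInc u v then c u else 0
    refine Finset.sum_congr rfl fun u _ => ?_
    by_cases h : seedInc u v
    · exact (if_pos h).trans (if_pos h).symm
    · exact (if_neg h).trans (if_neg h).symm
  have hz : ∀ v : Fin 3 × Fin 3, seedDeg v ≠ 1 → b v = 0 := fun v hv => cochain_zero_of_deg hb hv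
  have z0 : _ = (0 : ZMod 2) := (hsum b (1, 0)).symm.trans (congrFun hδ _)
  have z2 : _ = (0 : ZMod 2) := (hsum b (1, 2)).symm.trans (congrFun hδ _)
  simp only [Fin.sum_univ_three, seedInc, seedDeg, Nat.dist] at z0 z2
  norm_num at z0 z2
  -- The primitive is read off at the corners of the first column. Closedness at the two `Z`-checks
  -- gives the central value and carries the agreement of the ends from row `r` to the other row.
  refine ⟨fun v : Fin 3 × Fin 3 => if v = (0, 1) then b ((0, 0) : Fin 3 × Fin 3) else
    if v = (2, 1) then b ((2, 0) : Fin 3 × Fin 3) else 0, ?_, ?_⟩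
  · intro v hv
    by_cases h1 : v = ((0, 1) : Fin 3 × Fin 3)
    · rw [h1]; rfl
    · by_cases h2 : v = ((2, 1) : Fin 3 × Fin 3)
      · rw [h2]; rfl
      · exact absurd ((if_neg h1).trans (if_neg h2)) hv
  · have two : (2 : ZMod 2) = 0 := rfl
    have h1 : b ((0, 0) : Fin 3 × Fin 3) + b ((2, 0) : Fin 3 × Fin 3) =
        b ((1, 1) : Fin 3 × Fin 3) := by
      linear_combination z0 - b ((1, 1) : Fin 3 × Fin 3) * two
    obtain ⟨h0, h2⟩ : b ((0, 0) : Fin 3 × Fin 3) = b ((0, 2) : Fin 3 × Fin 3) ∧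
        b ((2, 0) : Fin 3 × Fin 3) = b ((2, 2) : Fin 3 × Fin 3) := by
      rcases hr with rfl | rfl
      · exact ⟨h, by linear_combination z0 - z2 - h⟩
      · exact ⟨by linear_combination z0 - z2 - h, h⟩
    funext v
    refine (hsum _ v).trans ?_
    obtain ⟨i, j⟩ := v
    fin_cases i <;> fin_cases j <;>
      simp only [Fin.sum_univ_three, seedInc, seedDeg, Nat.dist] <;> norm_num <;>
      first
        | exact (hz _ (by decide)).symm
        | assumption
        | rfl

end Tanner

namespace Tanner

/-! ### Decoders exist -/

section Row

variable {T : Tanner} {ℓ : ℕ} [NeZero ℓ]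

/-- The value on a qubit `q` of a class on the old complex, read off along the segment from `q` to
the only `X`-check below it. -/
theorem Nice.apply_eq_of_row (hT : T.Nice) (h3 : 3 ≤ ℓ) (hodd : ℓ % 2 = 1) {x q q' z : T.V}
    (s : Sq T x q q' z) (honly : ∀ w, T.inc w q → w = x) {η : ℕ} (hη : η = 0 ∨ η = 2)
    {a H : (Tanner.replace ℓ true T).Cochain} {c : T.Cochain}
    (haH : a + (Tanner.replace ℓ true T).cobdry H = lift (ℓ := ℓ) (b := true) c)
    (ha : ∀ p : (Tanner.replace ℓ true T).V, p.1 = x ∨ p.1 = q → p.2.1.2.2.val = η → a p = 0) :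
    c q = ev H x (pt x η) := by
  have hδ : (Tanner.replace ℓ true T).cobdry H = a + lift (ℓ := ℓ) (b := true) c := by
    rw [← haH, ← add_assoc, cochain_add_self, zero_add]
  have hq := (hT.sq_deg s).2.1
  have ok : ∀ α, α < ℓ → SqOK ℓ α 0 η := fun α h => by unfold SqOK; omega
  -- Where `a` vanishes, the coboundary of `H` is the lift, and lifts are zero on edges of `Y_x`; so
  -- `H` is constant along the axis.
  have h1 : ∀ i, i % 2 = 0 → i + 2 < ℓ → ev H x (line x q i η) = ev H x (line x q (i + 2) η) := by
    intro i hi hil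
    have h2 := hT.ev_cobdry_edge h3 hodd s (ok (i + 1) (by omega)) hi (by omega) (by omega) H
    obtain ⟨p, hp⟩ := hT.exists_sqr_raw s (ok (i + 1) (by omega))
    rw [hδ, ev_add, hT.ev_lift_sqr c s (ok (i + 1) (by omega)), if_neg (by omega), ev_raw a hp,
      ha p (Or.inl (raw_fst hp)) (by rw [raw_snd hp, sqr_height _ _ _ _ _ _ (by omega)]),
      add_zero, sqr_zero_right, sqr_zero_right] at h2
    exact zmod_two_eq_of_add h2.symm
  have okl : LineOK ℓ 0 η := by unfold LineOK; omega
  -- At the centre of `Y_q` the lift equals `c q`, and only the outer end of the axis from `x`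
  -- contributes to the coboundary of `H`, as no other `X`-check lies below `q`.
  have h4 := hT.ev_cobdry_line_pt h3 hodd s.qz hq okl (by omega) (by omega) H
  obtain ⟨p, hp⟩ := hT.exists_line_raw s.qz hq okl
  rw [hδ, ev_add, hT.ev_lift_line c s.qz hq okl, if_pos (by omega), ev_raw a hp,
    ha p (Or.inr (raw_fst hp)) (by rw [raw_snd hp, line_height _ _ _ (by omega)]),
    zero_add, inclSum, Finset.sum_eq_single x, if_pos s.xq, s.oth_eq hT, sqr_zero_right] at h4
  · rw [h4]
    rw [← line_zero x q η]
    exact even_chain (f := fun i => ev H x (line x q i η)) h1 (ℓ - 1) (by omega) (by omega)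
  · exact fun w _ hw => if_neg fun h => hw (honly w h)
  · exact fun h => absurd (Finset.mem_univ _) h

end Row

section Small

variable {ℓ : ℕ} [NeZero ℓ]

omit [NeZero ℓ] in
/-- A link of an `X`-check of the first code meets a row at a given height only if the check lies
over the middle of the row, at that height. -/
theorem row_of_inc {y p : (Tanner.replace ℓ true seed).V}
    (hy : (Tanner.replace ℓ true seed).deg y = 0) (h : (Tanner.replace ℓ true seed).inc y p)
    {r j : Fin 3} (hr : r = 0 ∨ r = 2) (hj : j = 0 ∨ j = 2)
    (hp : p.1 = ((r, 1) : Fin 3 × Fin 3) ∨ p.1 = ((r, j) : Fin 3 × Fin 3))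
    {η : ℕ} (hη : η = 0 ∨ η = 2) (hpη : p.2.1.2.2.val = η) :
    y.1 = ((r, 1) : Fin 3 × Fin 3) ∧ y.2.1.2.2.val = η := by
  have hy0 : seed.deg y.1 = 0 := by
    have : seed.deg y.1 + cellDim y.2.1 = 0 := hy
    omega
  have h1 : ∀ r j : Fin 3, (r = 0 ∨ r = 2) → (j = 0 ∨ j = 2) → seedDeg (r, j) ≠ 0 := by
    intro r j hr hj
    rcases hr with rfl | rfl <;> rcases hj with rfl | rfl <;> decide
  rcases (replace_inc y p).1 h with ⟨h2, h3⟩ | ⟨h2, h3⟩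
  · have h2 : y.1 = p.1 := h2
    have h4 : y.2.1.2.2 = p.2.1.2.2 := by
      rcases h3.2.2.2 with h5 | h5
      · exact h5
      · have h5 : p.2.1.2.2 = 1 := h5
        rw [h5] at hpη
        have : (1 : ℕ) = η := hpη
        omega
    refine ⟨?_, by rw [h4, hpη]⟩
    rcases hp with hp | hp
    · rw [h2, hp]
    · rw [h2, hp] at hy0
      exact absurd hy0 (h1 r j hr hj)
  · have h2 : seed.inc y.1 p.1 := h2
    have h4 : y.2.1.2.2 = p.2.1.2.2 := h3.2.1
    refine ⟨?_, by rw [h4, hpη]⟩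
    have h5 := (seed_inc_iff _ _).1 h2
    rcases hp with hp | hp
    · rw [hp] at h5
      have h6 : ∀ r : Fin 3, (r = 0 ∨ r = 2) → seedDeg (r, 1) = 0 := by
        rintro r (rfl | rfl) <;> decide
      have h7 := h5.2
      rw [h6 r hr] at h7
      omega
    · rw [hp] at h5
      generalize hv : y.1 = v at h5 ⊢
      obtain ⟨v1, v2⟩ := v
      rcases hr with rfl | rfl <;> rcases hj with rfl | rfl <;> fin_cases v1 <;> fin_cases v2 <;>
        first | rfl | (exfalso; revert h5; simp [seedDeg, Nat.dist])

/-- Three distinct positions cannot all be taken by two pairs. -/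
theorem exists_avoiding {V : Type} {a b : V} (hne : a ≠ b) (v₁ v₂ : V) (n₁ n₂ : ℕ) :
    (¬ (v₁ = a ∧ n₁ = 0) ∧ ¬ (v₂ = a ∧ n₂ = 0)) ∨ (¬ (v₁ = a ∧ n₁ = 2) ∧ ¬ (v₂ = a ∧ n₂ = 2)) ∨
      (¬ (v₁ = b ∧ n₁ = 0) ∧ ¬ (v₂ = b ∧ n₂ = 0)) := by
  grind

/-- Rows `0` and `2` of the seed code appear at heights `0` and `2` of the level-one code, and by
`row_of_inc` a check meets at most one of these copies. Along a copy avoided by both errors the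
cochain `H` has the same value at the two ends, so the closed seed configuration `c` agrees at the
ends of that row and is trivial. -/
theorem small_pair (h3 : 3 ≤ ℓ) (hodd : ℓ % 2 = 1)
    {a₁ a₂ : (Tanner.replace ℓ true seed).Cochain} {y₁ y₂ : (Tanner.replace ℓ true seed).V}
    (hy₁ : (Tanner.replace ℓ true seed).deg y₁ = 0)
    (hy₂ : (Tanner.replace ℓ true seed).deg y₂ = 0)
    (ha₁ : a₁ ∈ (Tanner.replace ℓ true seed).cochains 1)
    (ha₂ : a₂ ∈ (Tanner.replace ℓ true seed).cochains 1)
    (hs₁ : ∀ q, a₁ q ≠ 0 → (Tanner.replace ℓ true seed).inc y₁ q)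
    (hs₂ : ∀ q, a₂ q ≠ 0 → (Tanner.replace ℓ true seed).inc y₂ q)
    (hδ : (Tanner.replace ℓ true seed).cobdry (a₁ + a₂) = 0) :
    a₁ + a₂ ∈ (Tanner.replace ℓ true seed).coboundaries 0 := by
  obtain ⟨H, hH, c, hc, haH, hcz, -⟩ := seed_nice.exists_eq_lift_true h3 hodd (a₁ + a₂)
    (Submodule.add_mem _ ha₁ ha₂) (c := 0) (Submodule.zero_mem _) (by rw [hδ, lift_zero])
  obtain ⟨r, η, hr, hη, hn₁, hn₂⟩ : ∃ (r : Fin 3) (η : ℕ), (r = 0 ∨ r = 2) ∧ (η = 0 ∨ η = 2) ∧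
      ¬ (y₁.1 = ((r, 1) : Fin 3 × Fin 3) ∧ y₁.2.1.2.2.val = η) ∧
      ¬ (y₂.1 = ((r, 1) : Fin 3 × Fin 3) ∧ y₂.2.1.2.2.val = η) := by
    have hne : ((0, 1) : Fin 3 × Fin 3) ≠ ((2, 1) : Fin 3 × Fin 3) := by decide
    rcases exists_avoiding hne y₁.1 y₂.1 y₁.2.1.2.2.val y₂.2.1.2.2.val with
      ⟨h1, h2⟩ | ⟨h1, h2⟩ | ⟨h1, h2⟩
    · exact ⟨0, 0, Or.inl rfl, Or.inl rfl, h1, h2⟩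
    · exact ⟨0, 2, Or.inl rfl, Or.inr rfl, h1, h2⟩
    · exact ⟨2, 0, Or.inr rfl, Or.inl rfl, h1, h2⟩
  have hrow : ∀ j : Fin 3, j = 0 ∨ j = 2 → ∀ p : (Tanner.replace ℓ true seed).V,
      p.1 = ((r, 1) : Fin 3 × Fin 3) ∨ p.1 = ((r, j) : Fin 3 × Fin 3) →
      p.2.1.2.2.val = η → (a₁ + a₂) p = 0 := by
    intro j hj p hp hpη
    have h1 : a₁ p = 0 := by
      by_contra h
      exact hn₁ (row_of_inc hy₁ (hs₁ p h) hr hj hp hη hpη)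
    have h2 : a₂ p = 0 := by
      by_contra h
      exact hn₂ (row_of_inc hy₂ (hs₂ p h) hr hj hp hη hpη)
    rw [Pi.add_apply, h1, h2, add_zero]
  have hval : ∀ j : Fin 3, j = 0 ∨ j = 2 → c ((r, j) : Fin 3 × Fin 3) =
      ev H ((r, 1) : Fin 3 × Fin 3) (pt (T := seed) ((r, 1) : Fin 3 × Fin 3) η) := by
    intro j hj
    have h1 : ∀ r j : Fin 3, (r = 0 ∨ r = 2) → (j = 0 ∨ j = 2) →
        seedInc (r, 1) (r, j) ∧ seedInc (r, 1) (1, 1) ∧ seedInc (r, j) (1, j) ∧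
        seedInc (1, 1) (1, j) ∧ (r, j) ≠ (1, 1) ∧ (∀ w, seedInc (r, 1) w → seedInc w (1, j) →
          w = (r, j) ∨ w = (1, 1)) ∧ ∀ w, seedInc w (r, j) → w = (r, 1) := by decide
    obtain ⟨e1, e2, e3, e4, e5, e6, e7⟩ := h1 r j hr hj
    exact seed_nice.apply_eq_of_row h3 hodd (q' := ((1, 1) : Fin 3 × Fin 3))
      (z := ((1, j) : Fin 3 × Fin 3)) ⟨e1, e2, e3, e4, e5, e6⟩ e7 hη haH (hrow j hj)
  have h : c ((r, 0) : Fin 3 × Fin 3) = c ((r, 2) : Fin 3 × Fin 3) :=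
    (hval 0 (Or.inl rfl)).trans (hval 2 (Or.inr rfl)).symm
  have h5 := seed_nice.lift_mem_coboundaries h3 hodd true (seed_mem_coboundaries hc hcz hr h)
  rw [← cochain_add_cancel (a₁ + a₂) ((Tanner.replace ℓ true seed).cobdry H), haH]
  exact Submodule.add_mem _ h5 ⟨H, hH, rfl⟩

end Small

end Tanner

namespace Tanner

section Unique

variable {ℓ : ℕ} [NeZero ℓ]

/-- Small errors of the level-two code with equal syndromes are equivalent. -/
theorem small_unique (h3 : 3 ≤ ℓ) (hodd : ℓ % 2 = 1)
    {e₁ e₂ : (Tanner.replace ℓ false (Tanner.replace ℓ true seed)).Cochain}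
    {x₁ x₂ : (Tanner.replace ℓ false (Tanner.replace ℓ true seed)).V}
    (he₁ : e₁ ∈ (Tanner.replace ℓ false (Tanner.replace ℓ true seed)).cochains 1)
    (he₂ : e₂ ∈ (Tanner.replace ℓ false (Tanner.replace ℓ true seed)).cochains 1)
    (hs₁ : ∀ q, e₁ q ≠ 0 → (Tanner.replace ℓ false (Tanner.replace ℓ true seed)).inc x₁ q)
    (hs₂ : ∀ q, e₂ q ≠ 0 → (Tanner.replace ℓ false (Tanner.replace ℓ true seed)).inc x₂ q)
    (hδ : (Tanner.replace ℓ false (Tanner.replace ℓ true seed)).cobdry e₁ =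
      (Tanner.replace ℓ false (Tanner.replace ℓ true seed)).cobdry e₂) :
    e₁ + e₂ ∈ (Tanner.replace ℓ false (Tanner.replace ℓ true seed)).coboundaries 0 := by
  have hN : (Tanner.replace ℓ true seed).Nice := seed_nice.replace h3 hodd true
  obtain ⟨h1, h2⟩ := hN.add_lift_fiberSum_mem h3 hodd (Submodule.add_mem _ he₁ he₂) (c := 0)
    (by rw [map_add, hδ, cochain_add_self, lift_zero])
  obtain ⟨y₁, hy₁, hl₁⟩ := hN.fiberSum_link he₁ hs₁
  obtain ⟨y₂, hy₂, hl₂⟩ := hN.fiberSum_link he₂ hs₂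
  rw [fiberSum_add] at h1 h2
  have h5 := hN.lift_mem_coboundaries h3 hodd false (small_pair h3 hodd hy₁ hy₂ (fiberSum_mem he₁)
    (fiberSum_mem he₂) hl₁ hl₂ h1)
  rw [← cochain_add_cancel (e₁ + e₂) (lift (ℓ := ℓ) (b := false) (fiberSum e₁ + fiberSum e₂))]
  exact Submodule.add_mem _ h2 h5

end Unique

end Tanner

open Tanner

/-! ### The tower of codes and a decoder for it. -/

section Levels

variable {ℓ : ℕ} [NeZero ℓ]

theorem level_nice (h3 : 3 ≤ ℓ) (hodd : ℓ % 2 = 1) : ∀ i, (tannerLevel ℓ i).Nice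
  | 0 => seed_nice
  | i + 1 => (level_nice h3 hodd i).replace h3 hodd (isX i)

/-- A small error, if there is one with the given syndrome; otherwise any error with it. -/
noncomputable def baseCorrection (T : Tanner) (σ : T.Cochain) : T.Cochain :=
  if h : ∃ e ∈ T.cochains 1, T.cobdry e = σ ∧ ∃ x, T.deg x = 0 ∧ ∀ q, e q ≠ 0 → T.inc x q then
    h.choose
  else if h : ∃ e ∈ T.cochains 1, T.cobdry e = σ then h.choose else 0

theorem baseCorrection_spec {T : Tanner} {σ : T.Cochain} (hσ : σ ∈ T.coboundaries 1) :
    baseCorrection T σ ∈ T.cochains 1 ∧ T.cobdry (baseCorrection T σ) = σ := by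
  unfold baseCorrection
  split_ifs with h h'
  · exact ⟨h.choose_spec.1, h.choose_spec.2.1⟩
  · exact h'.choose_spec
  · exact absurd hσ h'

theorem baseCorrection_small {T : Tanner} {x : T.V} (hx : T.deg x = 0) {e : T.Cochain}
    (he : e ∈ T.cochains 1) (hex : ∀ q, e q ≠ 0 → T.inc x q) :
    ∃ y, (∀ q, baseCorrection T (T.cobdry e) q ≠ 0 → T.inc y q) := by
  have h : ∃ e' ∈ T.cochains 1, T.cobdry e' = T.cobdry e ∧
      ∃ x, T.deg x = 0 ∧ ∀ q, e' q ≠ 0 → T.inc x q := ⟨e, he, rfl, x, hx, hex⟩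
  unfold baseCorrection
  rw [dif_pos h]
  obtain ⟨y, -, hy⟩ := h.choose_spec.2.2
  exact ⟨y, hy⟩

/-- The local choices are arbitrary. At level two a small error is returned whenever the syndrome
admits one; by `small_unique` it is equivalent to the error that occurred. -/
theorem nonempty_decoder (h3 : 3 ≤ ℓ) (hodd : ℓ % 2 = 1) : Nonempty (Decoder ℓ) := by
  refine ⟨{ corr := fun i v s => if h : ∃ f, IsCorrection v s f then h.choose else 0
            base := baseCorrection _
            corr_spec := ?_
            base_spec := fun σ hσ => baseCorrection_spec hσ
            base_small := ?_ }⟩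
  · intro i _ v s h
    rw [dif_pos h]
    exact h.choose_spec
  · intro x hx e he hex
    obtain ⟨y, hy⟩ := baseCorrection_small hx he hex
    obtain ⟨h1, h2⟩ := baseCorrection_spec (T := tannerLevel ℓ 2) ⟨e, he, rfl⟩
    exact small_unique h3 hodd h1 he hy hex h2

end Levels

theorem levelLift_zero (ℓ i : ℕ) : levelLift ℓ i 0 = 0 := lift_zero

theorem levelLift_add {ℓ i : ℕ} (c c' : (tannerLevel ℓ i).Cochain) :
    levelLift ℓ i (c + c') = levelLift ℓ i c + levelLift ℓ i c' := lift_add c c'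

namespace Decoder

variable {ℓ : ℕ} (D : Decoder ℓ)

/-! ### The history of a syndrome -/

theorem syndrome_self (n : ℕ) (σ : (tannerLevel ℓ n).Cochain) : D.syndrome n σ n = σ := by
  cases n with
  | zero => exact Function.update_self (β := fun j => (tannerLevel ℓ j).Cochain) 0 σ (fun _ => 0)
  | succ n => exact Function.update_self (β := fun j => (tannerLevel ℓ j).Cochain) (n + 1) σ _

theorem syndrome_succ {n j : ℕ} (hj : j ≤ n) (σ : (tannerLevel ℓ (n + 1)).Cochain) :
    D.syndrome (n + 1) σ j = D.syndrome n (D.coarse n σ) j :=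
  Function.update_of_ne (show j ≠ n + 1 by omega) _ _

theorem coarse_syndrome {n j : ℕ} (hj : j < n) (σ : (tannerLevel ℓ n).Cochain) :
    D.coarse j (D.syndrome n σ (j + 1)) = D.syndrome n σ j := by
  induction n with
  | zero => omega
  | succ n ih =>
    rcases Nat.lt_succ_iff_lt_or_eq.1 hj with h | rfl
    · rw [D.syndrome_succ (by omega), D.syndrome_succ (by omega)]
      exact ih h _
    · rw [D.syndrome_succ le_rfl, syndrome_self, syndrome_self]

theorem syndrome_one {n : ℕ} (hn : 2 ≤ n) (σ : (tannerLevel ℓ n).Cochain) :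
    D.syndrome n σ 1 = 0 :=
  (D.coarse_syndrome (by omega) σ).symm

theorem syndrome_zero {n : ℕ} (hn : 1 ≤ n) (σ : (tannerLevel ℓ n).Cochain) :
    D.syndrome n σ 0 = 0 :=
  (D.coarse_syndrome (by omega) σ).symm

variable [NeZero ℓ]

theorem step (h3 : 3 ≤ ℓ) (hodd : ℓ % 2 = 1) (i : ℕ) {σ : (tannerLevel ℓ (i + 3)).Cochain}
    (hσ : σ ∈ (tannerLevel ℓ (i + 3)).coboundaries 1) : Step (D.corr (i + 2)) σ :=
  (level_nice h3 hodd (i + 2)).step h3 hodd (D.corr_spec (i + 2) (by omega)) hσ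

omit [NeZero ℓ] in
theorem levelCorr_one (σ : (tannerLevel ℓ 2).Cochain) : D.levelCorr 1 σ = D.base σ :=
  sum_loc (D.base σ)

theorem coarse_mem (h3 : 3 ≤ ℓ) (hodd : ℓ % 2 = 1) {n : ℕ} {σ : (tannerLevel ℓ (n + 1)).Cochain}
    (hσ : σ ∈ (tannerLevel ℓ (n + 1)).coboundaries 1) :
    D.coarse n σ ∈ (tannerLevel ℓ n).coboundaries 1 := by
  match n with
  | 0 => exact Submodule.zero_mem _
  | 1 => exact Submodule.zero_mem _
  | i + 2 => exact (D.step h3 hodd i hσ).mem_coarse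

theorem syndrome_mem (h3 : 3 ≤ ℓ) (hodd : ℓ % 2 = 1) {n : ℕ} {σ : (tannerLevel ℓ n).Cochain}
    (hσ : σ ∈ (tannerLevel ℓ n).coboundaries 1) {j : ℕ} (hj : j ≤ n) :
    D.syndrome n σ j ∈ (tannerLevel ℓ j).coboundaries 1 := by
  induction n with
  | zero =>
    obtain rfl : j = 0 := by omega
    rwa [syndrome_self]
  | succ n ih =>
    rcases Nat.le_succ_iff.1 hj with h | rfl
    · rw [D.syndrome_succ h]
      exact ih (D.coarse_mem h3 hodd hσ) h
    · rwa [syndrome_self]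

omit [NeZero ℓ] in
theorem total_one (σ : (tannerLevel ℓ 1).Cochain) : D.total 1 σ = 0 := by
  have h : D.total 1 σ = ∑ v : (tannerLevel ℓ 0).V, (0 : (tannerLevel ℓ 1).Cochain) +
      levelLift ℓ 0 0 := rfl
  rw [h, levelLift_zero, add_zero, Finset.sum_const_zero]

omit [NeZero ℓ] in
theorem total_two (σ : (tannerLevel ℓ 2).Cochain) : D.total 2 σ = D.base σ := by
  have h : D.total 2 σ = D.levelCorr 1 σ +
      levelLift ℓ 1 (D.total 1 (D.coarse 1 σ)) := rfl
  rw [h, total_one, levelLift_zero, add_zero, levelCorr_one]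

/-- If the coarse-graining of `σ` ends with the trivial syndrome, a small error added to `σ` is
decoded correctly. -/
theorem total_small (h3 : 3 ≤ ℓ) (hodd : ℓ % 2 = 1) {n : ℕ} (hn : 2 ≤ n)
    {σ : (tannerLevel ℓ n).Cochain} (hσ : σ ∈ (tannerLevel ℓ n).coboundaries 1)
    (h0 : D.syndrome n σ 2 = 0) {x : (tannerLevel ℓ n).V} (hx : (tannerLevel ℓ n).deg x = 0)
    {e : (tannerLevel ℓ n).Cochain} (he : e ∈ (tannerLevel ℓ n).cochains 1)
    (hex : ∀ q, e q ≠ 0 → (tannerLevel ℓ n).inc x q) :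
    D.total n σ + D.total n (σ + (tannerLevel ℓ n).cobdry e) + e ∈
      (tannerLevel ℓ n).coboundaries 0 := by
  induction n, hn using Nat.le_induction with
  | base =>
    rw [syndrome_self] at h0
    subst h0
    rw [total_two, total_two, zero_add, add_assoc]
    -- The zero error is small as well, so the output for the zero syndrome is a coboundary.
    have h1 := D.base_small x hx 0 (Submodule.zero_mem _) fun q h => absurd rfl h
    rw [map_zero, add_zero] at h1
    exact Submodule.add_mem _ h1 (D.base_small x hx e he hex)
  | succ n hn ih =>
    obtain ⟨m, rfl⟩ : ∃ m, n = m + 2 := ⟨n - 2, by omega⟩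
    rw [D.syndrome_succ (by omega)] at h0
    -- The two histories remain related by a small error: the coarse syndromes differ by the
    -- coboundary of `e'`, which again lives near one `X`-check.
    obtain ⟨y, hy, e', he', hye', hδ, hmem⟩ := (level_nice h3 hodd (m + 2)).step_local h3 hodd
      (D.corr_spec (m + 2) (by omega)) hσ hx he hex
    have h1 := ih (D.coarse_mem h3 hodd hσ) h0 hy he' hye'
    set σ' := σ + (tannerLevel ℓ (m + 2 + 1)).cobdry e with hσ'
    have h2 : D.coarse (m + 2) σ + (tannerLevel ℓ (m + 2)).cobdry e' = D.coarse (m + 2) σ' := by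
      refine (congrArg (D.coarse (m + 2) σ + ·) hδ).trans ?_
      exact (add_assoc _ _ _).symm.trans ((congrArg (· + _) (cochain_add_self _)).trans
        (zero_add _))
    rw [h2] at h1
    have h4 := (level_nice h3 hodd (m + 2)).lift_mem_coboundaries (ℓ := ℓ) h3 hodd (isX (m + 2)) h1
    change levelLift ℓ (m + 2) _ ∈ _ at h4
    rw [levelLift_add, levelLift_add] at h4
    have h5 := Submodule.add_mem _ hmem h4
    have h6 : D.total (m + 2 + 1) σ + D.total (m + 2 + 1) σ' + e =
        D.levelCorr (m + 2) σ + D.levelCorr (m + 2) σ' + e +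
          levelLift ℓ (m + 2) e' +
        (levelLift ℓ (m + 2) (D.total (m + 2) (D.coarse (m + 2) σ)) +
          levelLift ℓ (m + 2) (D.total (m + 2) (D.coarse (m + 2) σ')) +
          levelLift ℓ (m + 2) e') := by
      have h7 : ∀ a b c d f g : (tannerLevel ℓ (m + 2 + 1)).Cochain,
          a + b + (c + d) + f = a + c + f + g + (b + d + g) := by
        intro a b c d f g
        have := cochain_add_self g
        linear_combination -this
      exact h7 _ _ _ _ _ _
    rw [h6]
    exact h5

/-- The history of an unstable syndrome reaches level two. -/
theorem Unstable.syndrome_two_ne_zero (h3 : 3 ≤ ℓ) (hodd : ℓ % 2 = 1) {n : ℕ} (hn : 2 ≤ n)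
    {σ : (tannerLevel ℓ n).Cochain} (hσ : σ ∈ (tannerLevel ℓ n).coboundaries 1)
    (h : D.Unstable n σ) : D.syndrome n σ 2 ≠ 0 := by
  intro h0
  obtain ⟨e, he, hw, -, hne⟩ := h
  obtain ⟨q, hq⟩ := Finset.card_eq_one.1 hw
  have hq' : ∀ r, e r ≠ 0 ↔ r = q := fun r => by
    rw [← Finset.mem_singleton, ← hq, Finset.mem_filter]
    simp
  have hdeg := he q ((hq' q).2 rfl)
  -- A single flipped qubit is a small error, near any `X`-check below it.
  obtain ⟨x, hx⟩ := (level_nice h3 hodd n).below q (by omega)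
  have hxd := (level_nice h3 hodd n).inc_deg hx
  exact hne (D.total_small h3 hodd hn hσ h0 (x := x) (by omega) he
    fun r hr => (hq' r).1 hr ▸ hx)

end Decoder

open Tanner

namespace Decoder

variable {ℓ : ℕ} (D : Decoder ℓ)

/-! ### Witness subgraphs -/

theorem mem_witness {n : ℕ} {σ : (tannerLevel ℓ n).Cochain} {u : DNode ℓ n} :
    u ∈ (D.witness n σ).verts ↔ D.Marked n σ none ∧
      (D.inducedSubgraph n σ).spanningCoe.Reachable none u := Iff.rfl

theorem inducedSubgraph_adj {n : ℕ} {σ : (tannerLevel ℓ n).Cochain} {u w : DNode ℓ n} :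
    (D.inducedSubgraph n σ).spanningCoe.Adj u w ↔
      D.Marked n σ u ∧ D.Marked n σ w ∧ (decodingGraph ℓ n).Adj u w := Iff.rfl

theorem marked_of_mem_witness {n : ℕ} {σ : (tannerLevel ℓ n).Cochain} {u : DNode ℓ n}
    (hu : u ∈ (D.witness n σ).verts) : D.Marked n σ u := by
  obtain ⟨h0, ⟨p⟩⟩ := D.mem_witness.1 hu
  clear hu
  generalize (none : DNode ℓ n) = w at p h0
  induction p with
  | nil => exact h0
  | cons h _ ih => exact ih ((D.inducedSubgraph_adj).1 h).2.1

theorem mem_witness_of_adj {n : ℕ} {σ : (tannerLevel ℓ n).Cochain} {u w : DNode ℓ n}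
    (hu : u ∈ (D.witness n σ).verts) (hw : D.Marked n σ w) (h : (decodingGraph ℓ n).Adj u w) :
    w ∈ (D.witness n σ).verts :=
  ⟨hu.1, hu.2.trans (SimpleGraph.Adj.reachable
    ((D.inducedSubgraph_adj).2 ⟨D.marked_of_mem_witness hu, hw, h⟩))⟩

theorem none_mem_witness {n : ℕ} {σ : (tannerLevel ℓ n).Cochain} (h : D.Marked n σ none) :
    none ∈ (D.witness n σ).verts := ⟨h, SimpleGraph.Reachable.refl _⟩

theorem mem_witness_congr {n : ℕ} {σ : (tannerLevel ℓ n).Cochain} {u w : DNode ℓ n}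
    (hu : D.Marked n σ u) (hw : D.Marked n σ w) (h : u = w ∨ DAdj u w ∨ DAdj w u) :
    u ∈ (D.witness n σ).verts ↔ w ∈ (D.witness n σ).verts := by
  by_cases hne : u = w
  · rw [hne]
  · have h' : (decodingGraph ℓ n).Adj u w :=
      (SimpleGraph.fromRel_adj _ _ _).2 ⟨hne, h.resolve_left hne⟩
    exact ⟨fun hu => D.mem_witness_of_adj hu hw h', fun hw => D.mem_witness_of_adj hw hu h'.symm⟩

/-- The vertices of `T_(i)` whose nodes belong to the witness subgraph. -/
def witnessSet (n : ℕ) (σ : (tannerLevel ℓ n).Cochain) (i : ℕ) : Set (tannerLevel ℓ i).V :=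
  {v | ∃ h : i < n, dnode i h v ∈ (D.witness n σ).verts}

theorem witnessSyndrome_succ {n : ℕ} (σ : (tannerLevel ℓ n).Cochain) (i : ℕ) :
    D.witnessSyndrome n σ (i + 1) =
      restrict {p : (tannerLevel ℓ (i + 1)).V | p.1 ∈ D.witnessSet n σ i}
        (D.syndrome n σ (i + 1)) := rfl

variable [NeZero ℓ]

omit [NeZero ℓ] in
-- A correction on `Y_v'` that is visible on `Y_v` marks both nodes, and these are equal or
-- adjacent. So the component of the root is closed under the interactions of a step, as
-- `Nice.step_weight` requires.
theorem mem_witnessSet_congr {n i : ℕ} (hi : 2 ≤ i) (hin : i < n)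
    {σ : (tannerLevel ℓ n).Cochain} {v v' : (tannerLevel ℓ i).V}
    (hloc : loc v' (D.localCorr i (D.syndrome n σ (i + 1)) v') =
      D.localCorr i (D.syndrome n σ (i + 1)) v')
    (h : levelLoc ℓ i v ((tannerLevel ℓ (i + 1)).cobdry
      (D.localCorr i (D.syndrome n σ (i + 1)) v')) ≠ 0) :
    v ∈ D.witnessSet n σ i ↔ v' ∈ D.witnessSet n σ i := by
  have hv : D.Marked n σ (dnode i hin v) := Marked.boundary i hin (by omega) v v' h
  have hv' : D.Marked n σ (dnode i hin v') := by
    refine Marked.correction i hin (by omega) v' fun h0 => h ?_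
    rw [h0, map_zero]
    exact loc_zero v
  obtain ⟨p, hp⟩ := Function.ne_iff.1 h
  have hp1 : p.1 = v ∧ (tannerLevel ℓ (i + 1)).cobdry
      (D.localCorr i (D.syndrome n σ (i + 1)) v') p ≠ 0 := by
    by_cases hpv : p.1 = v
    · exact ⟨hpv, fun h0 => hp ((loc_of_eq _ hpv).trans h0)⟩
    · exact absurd (loc_of_ne _ hpv) hp
  obtain ⟨p', hinc, hp'⟩ := cobdry_ne_zero hp1.2
  have hp1' : p'.1 = v' := by
    by_contra hne
    rw [← hloc] at hp'
    exact hp' (loc_of_ne _ hne)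
  have key := D.mem_witness_congr hv hv' (by
    rcases replace_inc_fst_or hinc with h1 | h1
    · left
      rw [← hp1.1, ← hp1', h1]
    · right; right
      rw [hp1.1, hp1'] at h1
      exact DAdj.level i hin v' v h1)
  exact ⟨fun ⟨_, h1⟩ => ⟨hin, key.1 h1⟩, fun ⟨_, h1⟩ => ⟨hin, key.2 h1⟩⟩

/-- By `Nice.coarse_support` a nonzero syndrome at `w` marks the node of `w` one level up, and this
node is joined to its parent `w.1`. Thus the support of a witness syndrome stays inside the
component. -/
theorem mem_witnessSet_of_fst (h3 : 3 ≤ ℓ) (hodd : ℓ % 2 = 1) {n i : ℕ} (hi : 1 ≤ i)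
    (hin : i + 1 < n) {σ : (tannerLevel ℓ n).Cochain} (hσ : σ ∈ (tannerLevel ℓ n).coboundaries 1)
    {w : (tannerLevel ℓ (i + 1)).V} (hw : D.syndrome n σ (i + 1) w ≠ 0)
    (h : w.1 ∈ D.witnessSet n σ i) : w ∈ D.witnessSet n σ (i + 1) := by
  obtain ⟨j, rfl⟩ : ∃ j, i = j + 1 := ⟨i - 1, by omega⟩
  obtain ⟨_, h⟩ := h
  have hst := D.step h3 hodd j (D.syndrome_mem h3 hodd hσ (show j + 3 ≤ n by omega))
  have hm : D.Marked n σ (dnode (j + 1 + 1) hin w) := by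
    rw [← D.coarse_syndrome hin] at hw
    rcases (level_nice h3 hodd (j + 2)).coarse_support hst.lift_eq hw with h1 | ⟨v', h1⟩
    · exact Marked.syndrome _ hin (by omega) w h1
    · exact Marked.boundary _ hin (by omega) w v' h1
  exact ⟨hin, (D.mem_witness_congr (D.marked_of_mem_witness h) hm
    (Or.inr (Or.inl (DAdj.child (j + 1) hin w)))).1 h⟩

/-- The weight estimate of one step, restricted to the witness component. Both closure properties of
the component enter: sideways for the flow of weight, upwards for the support of the coarse
syndrome. -/
theorem weight_witnessSyndrome_succ (h3 : 3 ≤ ℓ) (hodd : ℓ % 2 = 1) {n i : ℕ} (hi : 2 ≤ i)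
    (hin : i < n) {σ : (tannerLevel ℓ n).Cochain} (hσ : σ ∈ (tannerLevel ℓ n).coboundaries 1) :
    (if isX i then 2 else 1) * weight (D.witnessSyndrome n σ i) ≤
      weight (D.witnessSyndrome n σ (i + 1)) := by
  obtain ⟨j, rfl⟩ : ∃ j, i = j + 2 := ⟨i - 2, by omega⟩
  have hmem := D.syndrome_mem h3 hodd hσ (show j + 3 ≤ n by omega)
  have h1 := (level_nice h3 hodd (j + 2)).step_weight h3 hodd (D.corr_spec (j + 2) (by omega)) hmem
    (D.witnessSet n σ (j + 2)) (fun v v' h => D.mem_witnessSet_congr hi hin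
      ((D.step h3 hodd j hmem).local_eq v') h)
  have h2 : weight (D.witnessSyndrome n σ (j + 2)) ≤
      weight (restrict (D.witnessSet n σ (j + 2)) (D.syndrome n σ (j + 2))) := by
    refine Finset.card_le_card fun p hp => ?_
    rw [Finset.mem_filter] at hp ⊢
    have hp2 := hp.2
    rw [witnessSyndrome_succ, restrict_apply] at hp2
    refine ⟨hp.1, ?_⟩
    split_ifs at hp2 with h
    · rw [restrict_apply, if_pos (D.mem_witnessSet_of_fst h3 hodd (by omega) hin hσ hp2 h)]
      exact hp2
    · exact absurd rfl hp2
  rw [← D.coarse_syndrome hin] at h2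
  exact (Nat.mul_le_mul le_rfl h2).trans h1

theorem two_mul_weight_le (h3 : 3 ≤ ℓ) (hodd : ℓ % 2 = 1) {n j : ℕ} (hj : 1 ≤ j)
    (hjn : 2 * j < n) {σ : (tannerLevel ℓ n).Cochain}
    (hσ : σ ∈ (tannerLevel ℓ n).coboundaries 1) :
    2 * weight (D.witnessSyndrome n σ (2 * j)) ≤ weight (D.witnessSyndrome n σ (2 * j + 1)) := by
  have h := D.weight_witnessSyndrome_succ h3 hodd (i := 2 * j) (by omega) hjn hσ
  rwa [if_pos (by simp [isX])] at h

theorem weight_le (h3 : 3 ≤ ℓ) (hodd : ℓ % 2 = 1) {n j : ℕ} (hj : 1 ≤ j)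
    (hjn : 2 * j + 1 < n) {σ : (tannerLevel ℓ n).Cochain}
    (hσ : σ ∈ (tannerLevel ℓ n).coboundaries 1) :
    weight (D.witnessSyndrome n σ (2 * j + 1)) ≤
      weight (D.witnessSyndrome n σ (2 * (j + 1))) := by
  have h := D.weight_witnessSyndrome_succ h3 hodd (i := 2 * j + 1) (by omega) hjn hσ
  rwa [if_neg (by simp [isX]), one_mul] at h

omit [NeZero ℓ] in
theorem weight_witnessSyndrome_eq_zero {n j : ℕ} (hn : 2 ≤ n) (hj : j ≤ 1)
    (σ : (tannerLevel ℓ n).Cochain) : weight (D.witnessSyndrome n σ j) = 0 := by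
  have h : D.witnessSyndrome n σ j = 0 := by
    funext p
    match j with
    | 0 =>
      have : D.witnessSyndrome n σ 0 p = if none ∈ (D.witness n σ).verts then
        D.syndrome n σ 0 p else 0 := rfl
      rw [this, D.syndrome_zero (by omega)]
      exact ite_self _
    | 1 =>
      rw [witnessSyndrome_succ, D.syndrome_one hn, restrict_apply]
      exact ite_self _
  rw [h, weight_zero]

/-- The weights of the witness syndromes are controlled by the last one. -/
theorem sum_weight_witnessSyndrome_le (h3 : 3 ≤ ℓ) (hodd : ℓ % 2 = 1) {n : ℕ}
    {σ : (tannerLevel ℓ n).Cochain} (hσ : σ ∈ (tannerLevel ℓ n).coboundaries 1) {j : ℕ}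
    (hj : 1 ≤ j) (hjn : 2 * j ≤ n) :
    ∑ i ∈ Finset.range (2 * j + 1), weight (D.witnessSyndrome n σ i) ≤
      4 * weight (D.witnessSyndrome n σ (2 * j)) := by
  induction j, hj using Nat.le_induction with
  | base =>
    rw [Finset.sum_range_succ, Finset.sum_eq_zero fun i hi =>
      D.weight_witnessSyndrome_eq_zero (by omega) (by simp at hi; omega) σ]
    omega
  | succ j hj ih =>
    -- The constant four reproduces itself: four times the weight at level `2j` is at most twice
    -- that at level `2j + 1`, so the sum is at most three times the weight at level `2j + 1` plus
    -- the weight at level `2j + 2`.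
    have h1 := ih (by omega)
    have h2 := D.two_mul_weight_le h3 hodd hj (by omega) hσ
    have h4 := D.weight_le h3 hodd hj (by omega) hσ
    rw [show 2 * (j + 1) + 1 = (2 * j + 1) + 1 + 1 by ring, Finset.sum_range_succ,
      Finset.sum_range_succ, show 2 * j + 1 + 1 = 2 * (j + 1) by ring]
    omega

theorem pow_le_weight (h3 : 3 ≤ ℓ) (hodd : ℓ % 2 = 1) {n : ℕ}
    {σ : (tannerLevel ℓ n).Cochain} (hσ : σ ∈ (tannerLevel ℓ n).coboundaries 1)
    (h2 : 1 ≤ weight (D.witnessSyndrome n σ 2)) {j : ℕ} (hj : 1 ≤ j) (hjn : 2 * j ≤ n) :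
    2 ^ (j - 1) ≤ weight (D.witnessSyndrome n σ (2 * j)) := by
  induction j, hj using Nat.le_induction with
  | base => exact h2
  | succ j hj ih =>
    have h1 := ih (by omega)
    have h2 := D.two_mul_weight_le h3 hodd hj (by omega) hσ
    have h4 := D.weight_le h3 hodd hj (by omega) hσ
    rw [show j + 1 - 1 = (j - 1) + 1 by omega, pow_succ]
    omega

omit [NeZero ℓ] in
/-- A witness subgraph is not empty if the history of the syndrome reaches level two. -/
theorem one_le_weight {n : ℕ} (hn : 2 ≤ n) {σ : (tannerLevel ℓ n).Cochain}
    (h : D.syndrome n σ 2 ≠ 0) :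
    none ∈ (D.witness n σ).verts ∧ 1 ≤ weight (D.witnessSyndrome n σ 2) := by
  obtain ⟨p, hp⟩ := Function.ne_iff.1 h
  have hp : D.syndrome n σ 2 p ≠ 0 := hp
  have m1 : D.Marked n σ (dnode 1 hn p.1) := Marked.syndrome 1 hn le_rfl p.1 fun h0 =>
    hp (loc_eq_zero_iff.1 h0 p rfl)
  have m0 : D.Marked n σ (dnode 0 (by omega) p.1.1) := Marked.parent hn p.1 m1
  have m : D.Marked n σ none := Marked.root (by omega) p.1.1 m0
  have w := D.none_mem_witness m
  have w0 := (D.mem_witness_congr m m0 (Or.inr (Or.inl (DAdj.root (by omega) p.1.1)))).1 w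
  have w1 := (D.mem_witness_congr m0 m1 (Or.inr (Or.inl (DAdj.child 0 hn p.1)))).1 w0
  refine ⟨w, Finset.card_pos.2 ⟨p, Finset.mem_filter.2 ⟨Finset.mem_univ _, ?_⟩⟩⟩
  rw [witnessSyndrome_succ, restrict_apply, if_pos ⟨hn, w1⟩]
  exact hp

/-- The witness subgraph of an unstable syndrome is large. -/
theorem pow_le_ncard (h3 : 3 ≤ ℓ) (hodd : ℓ % 2 = 1) {k : ℕ} (hk : 1 ≤ k)
    {σ : (tannerLevel ℓ (2 * k)).Cochain} (hσ : σ ∈ (tannerLevel ℓ (2 * k)).coboundaries 1)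
    (h : D.Unstable (2 * k) σ) : 2 ^ (k - 1) ≤ (D.witness (2 * k) σ).verts.ncard := by
  obtain ⟨h0, h1⟩ := D.one_le_weight (by omega)
    (h.syndrome_two_ne_zero D h3 hodd (by omega) hσ)
  -- For `k = 1` the root alone suffices.
  obtain rfl | hk2 : k = 1 ∨ 2 ≤ k := by omega
  · exact (Set.ncard_pos (Set.toFinite _)).2 ⟨_, h0⟩
  · obtain ⟨j, rfl⟩ : ∃ j, k = j + 1 := ⟨k - 1, by omega⟩
    have h4 := D.pow_le_weight h3 hodd hσ h1 (j := j) (by omega) (by omega)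
    -- Nodes of the top level are labelled by vertices one level lower, so it is the support of the
    -- witness syndrome at level `2k - 1` that is counted. Its weight already includes the last
    -- doubling.
    have h5 := D.two_mul_weight_le h3 hodd (j := j) (by omega) (by omega) hσ
    have h6 : 2 ^ (j + 1 - 1) = 2 * 2 ^ (j - 1) := by
      rw [← pow_succ']
      congr 1
      omega
    rw [h6]
    refine (Nat.mul_le_mul le_rfl h4).trans (h5.trans ?_)
    unfold weight
    rw [← Set.ncard_coe_finset]
    refine Set.ncard_le_ncard_of_injOn
      (fun p => dnode (2 * j + 1) (show 2 * j + 1 < 2 * (j + 1) by omega) p) (fun p hp => ?_)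
      (fun p _ q _ hpq => ?_) (Set.toFinite _)
    · have hp := (Finset.mem_filter.1 (Finset.mem_coe.1 hp)).2
      rw [witnessSyndrome_succ, restrict_apply] at hp
      split_ifs at hp with hm
      · exact (D.mem_witnessSet_of_fst h3 hodd (by omega) (by omega) hσ hp hm).2
      · exact absurd rfl hp
    · have h7 := Option.some.inj hpq
      exact eq_of_heq (Sigma.mk.inj h7).2

end Decoder

/-! ### Counting connected vertex sets -/

namespace SimpleGraph

variable {V : Type*} (G : SimpleGraph V)

/-- A vertex set that is connected (from `r`, edges lead out of each proper part containing `r`) is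
the support of a closed walk. -/
theorem exists_closed_walk {r : V} {S : Finset V} (hr : r ∈ S)
    (hS : ∀ A ⊆ S, r ∈ A → A ≠ S → ∃ a ∈ A, ∃ b ∈ S, b ∉ A ∧ G.Adj a b) {j : ℕ} (hj : 1 ≤ j)
    (hjS : j ≤ S.card) : ∃ p : G.Walk r r, p.support.toFinset ⊆ S ∧ p.support.toFinset.card = j ∧
      p.length = 2 * (j - 1) := by
  induction j, hj using Nat.le_induction with
  | base => exact ⟨Walk.nil, by simpa using hr, by simp, rfl⟩
  | succ j hj ih =>
    obtain ⟨p, hpS, hpc, hpl⟩ := ih (by omega)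
    -- A detour from `a` to `b` and back is inserted where the walk visits `a`: one new vertex for
    -- two steps.
    obtain ⟨a, ha, b, hb, hba, hab⟩ := hS _ hpS (by simp) (fun h => by rw [h] at hpc; omega)
    have ha' : a ∈ p.support := List.mem_toFinset.1 ha
    have hsupp : ((p.takeUntil a ha').append
        (Walk.cons hab (Walk.cons hab.symm (p.dropUntil a ha')))).support.toFinset =
        insert b p.support.toFinset := by
      ext v
      have h1 : v ∈ p.support ↔ v ∈ (p.takeUntil a ha').support ∨
          v ∈ (p.dropUntil a ha').support := by
        rw [← Walk.mem_support_append_iff, Walk.take_spec]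
      have h2 := (p.takeUntil a ha').end_mem_support
      simp only [List.mem_toFinset, Walk.mem_support_append_iff, Walk.support_cons, List.mem_cons,
        Finset.mem_insert, h1]
      constructor
      · rintro (h | rfl | rfl | h)
        · exact Or.inr (Or.inl h)
        · exact Or.inr (Or.inl h2)
        · exact Or.inl rfl
        · exact Or.inr (Or.inr h)
      · rintro (rfl | h | h)
        · exact Or.inr (Or.inr (Or.inl rfl))
        · exact Or.inl h
        · exact Or.inr (Or.inr (Or.inr h))
    refine ⟨_, hsupp ▸ Finset.insert_subset hb hpS, ?_, ?_⟩
    · rw [hsupp, Finset.card_insert_of_notMem hba, hpc]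
    · have h := congrArg Walk.length (p.take_spec ha')
      rw [Walk.length_append] at h
      rw [Walk.length_append, Walk.length_cons, Walk.length_cons]
      omega

variable [Fintype V] [DecidableRel G.Adj]

/-- The supports of the walks of a given length from a given vertex. -/
noncomputable def walkSupports : ℕ → V → Finset (Finset V)
  | 0, u => {{u}}
  | L + 1, u => (G.neighborFinset u).biUnion fun v => (walkSupports L v).image (insert u)

theorem support_mem_walkSupports {u v : V} (p : G.Walk u v) :
    p.support.toFinset ∈ G.walkSupports p.length u := by
  induction p with
  | nil => simp [walkSupports]
  | cons h p ih =>
    rw [Walk.length_cons, walkSupports, Finset.mem_biUnion]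
    exact ⟨_, (G.mem_neighborFinset _ _).2 h, Finset.mem_image.2 ⟨_, ih, by simp⟩⟩

theorem card_walkSupports_le (L : ℕ) (u : V) : (G.walkSupports L u).card ≤ G.maxDegree ^ L := by
  induction L generalizing u with
  | zero => simp [walkSupports]
  | succ L ih =>
    rw [walkSupports, pow_succ']
    refine (Finset.card_biUnion_le_card_mul _ _ (G.maxDegree ^ L) fun v _ =>
      Finset.card_image_le.trans (ih v)).trans (Nat.mul_le_mul ?_ le_rfl)
    rw [card_neighborFinset_eq_degree]
    exact G.degree_le_maxDegree u

end SimpleGraph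

open Tanner

/-! ### The number of witness subgraphs. -/

namespace Decoder

variable {ℓ : ℕ} (D : Decoder ℓ)

theorem witness_adj {n : ℕ} {σ : (tannerLevel ℓ n).Cochain} {u w : DNode ℓ n} :
    (D.witness n σ).Adj u w ↔ u ∈ (D.witness n σ).verts ∧ w ∈ (D.witness n σ).verts ∧
      (decodingGraph ℓ n).Adj u w := by
  constructor
  · rintro ⟨hu, hw, h⟩
    exact ⟨hu, hw, ((D.inducedSubgraph_adj).1 h).2.2⟩
  · rintro ⟨hu, hw, h⟩
    exact ⟨hu, hw, D.inducedSubgraph_adj.2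
      ⟨D.marked_of_mem_witness hu, D.marked_of_mem_witness hw, h⟩⟩

/-- Witness subgraphs are induced, so it is enough to count vertex sets. -/
theorem witness_ext {n : ℕ} {σ σ' : (tannerLevel ℓ n).Cochain}
    (h : (D.witness n σ).verts = (D.witness n σ').verts) : D.witness n σ = D.witness n σ' := by
  refine SimpleGraph.Subgraph.ext h ?_
  funext u w
  rw [eq_iff_iff, witness_adj, witness_adj, h]

theorem witness_boundary {n : ℕ} {σ : (tannerLevel ℓ n).Cochain} {A : Finset (DNode ℓ n)}
    (hA : (A : Set (DNode ℓ n)) ⊆ (D.witness n σ).verts) (h0 : none ∈ A)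
    (hne : (A : Set (DNode ℓ n)) ≠ (D.witness n σ).verts) :
    ∃ a ∈ A, ∃ b ∈ (D.witness n σ).verts, b ∉ A ∧ (decodingGraph ℓ n).Adj a b := by
  obtain ⟨u, hu, huA⟩ := Set.exists_of_ssubset (hA.ssubset_of_ne hne)
  obtain ⟨-, ⟨p⟩⟩ := D.mem_witness.1 hu
  obtain ⟨d, -, h1, h2⟩ := p.exists_boundary_dart A h0 huA
  obtain ⟨-, h4, h5⟩ := D.inducedSubgraph_adj.1 d.adj
  exact ⟨d.fst, h1, d.snd, D.mem_witness_of_adj (hA h1) h4 h5, h2, h5⟩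

/-- A nonempty witness subgraph is connected and contains the root, hence is the support of a closed
walk of length `2 * (m - 1)` from the root. The fixed starting point makes a factor for the choice
of a node unnecessary. -/
theorem ncard_witness_le (n m : ℕ) :
    {K : (decodingGraph ℓ n).Subgraph | K.verts.ncard = m ∧
      ∃ σ ∈ (tannerLevel ℓ n).coboundaries 1, D.witness n σ = K}.ncard ≤
    ((decodingGraph ℓ n).maxDegree + 1) ^ (2 * m) := by
  have hcard : ∀ K : (decodingGraph ℓ n).Subgraph, K.verts.toFinset.card = K.verts.ncard :=
    fun K => (Set.ncard_eq_toFinset_card' _).symm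
  -- The case `m = 0` is listed apart: with truncated subtraction the walk of length zero would
  -- yield the root instead of the empty subgraph.
  refine le_trans (Set.ncard_le_ncard_of_injOn
    (t := (if m = 0 then {∅} else (decodingGraph ℓ n).walkSupports (2 * (m - 1)) none :
      Finset (Finset (DNode ℓ n))))
    (fun K => K.verts.toFinset) ?_ ?_ (Finset.finite_toSet _)) ?_
  · rintro _ ⟨hm, σ, -, rfl⟩
    rw [← hcard] at hm
    rw [Finset.mem_coe]
    split_ifs with h
    · rw [h] at hm
      exact Finset.mem_singleton.2 (Finset.card_eq_zero.1 hm)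
    · obtain ⟨u, hu⟩ := Finset.card_pos.1 (show 0 < (D.witness n σ).verts.toFinset.card by omega)
      have hr := D.none_mem_witness (D.mem_witness.1 (Set.mem_toFinset.1 hu)).1
      obtain ⟨p, hpS, hpc, hpl⟩ := (decodingGraph ℓ n).exists_closed_walk
        (S := (D.witness n σ).verts.toFinset) (Set.mem_toFinset.2 hr)
        (fun A hA h0 hne => by
          obtain ⟨a, ha, b, hb, hbA, hab⟩ := D.witness_boundary (A := A)
            (fun a ha => Set.mem_toFinset.1 (hA ha)) h0
            (fun h => hne (by ext a; rw [Set.mem_toFinset, ← h, Finset.mem_coe]))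
          exact ⟨a, ha, b, Set.mem_toFinset.2 hb, hbA, hab⟩)
        (j := m) (by omega) hm.ge
      have hS := Finset.eq_of_subset_of_card_le hpS (by omega)
      have := (decodingGraph ℓ n).support_mem_walkSupports p
      rwa [hpl, hS] at this
  · rintro _ ⟨-, σ, -, rfl⟩ _ ⟨-, σ', -, rfl⟩ h
    exact D.witness_ext (Set.toFinset_inj.1 h)
  · rw [Set.ncard_coe_finset]
    split_ifs with h
    · rw [h]
      simp
    · refine ((decodingGraph ℓ n).card_walkSupports_le _ _).trans ?_
      exact (Nat.pow_le_pow_left (Nat.le_succ _) _).trans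
        (Nat.pow_le_pow_right (Nat.succ_pos _) (by omega))

end Decoder

/-- Decoders exist for every large enough odd `ℓ`; and for every odd `ℓ ≥ 3`, every decoder and every
`k ≥ 1`: the witness subgraph of an unstable level-`2k` syndrome has at least `2^(k-1)` nodes; at
most `|V_2| (Δ+1)^(2m)` subgraphs with `m` nodes are witness subgraphs, `V_2` being the node set of
`G_2` (labelled by the vertices of `T_(1)`) and `Δ` the maximum degree of the decoding graph; and
`∑_{i=0}^{2k} |τ_i| ≤ 4 |τ_{2k}|`. -/
theorem mainTheorem10 :
    (∃ ℓ₀ : ℕ, ∀ ℓ : ℕ, Odd ℓ → ℓ₀ ≤ ℓ → Nonempty (Decoder ℓ)) ∧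
    ∀ ℓ : ℕ, Odd ℓ → 3 ≤ ℓ → ∀ (D : Decoder ℓ) (k : ℕ), 1 ≤ k →
      (∀ σ ∈ (tannerLevel ℓ (2 * k)).coboundaries 1, D.Unstable (2 * k) σ →
        2 ^ (k - 1) ≤ (D.witness (2 * k) σ).verts.ncard) ∧
      (∀ m : ℕ,
        {K : (decodingGraph ℓ (2 * k)).Subgraph | K.verts.ncard = m ∧
          ∃ σ ∈ (tannerLevel ℓ (2 * k)).coboundaries 1, D.witness (2 * k) σ = K}.ncard ≤
        Fintype.card (tannerLevel ℓ 1).V * ((decodingGraph ℓ (2 * k)).maxDegree + 1) ^ (2 * m)) ∧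
      (∀ σ ∈ (tannerLevel ℓ (2 * k)).coboundaries 1,
        ∑ i ∈ Finset.range (2 * k + 1), Tanner.weight (D.witnessSyndrome (2 * k) σ i) ≤
          4 * Tanner.weight (D.witnessSyndrome (2 * k) σ (2 * k))) := by
  refine ⟨⟨3, fun ℓ hodd h3 => ?_⟩, fun ℓ hodd h3 D k hk => ?_⟩
  · have : NeZero ℓ := ⟨by omega⟩
    exact nonempty_decoder h3 (Nat.odd_iff.1 hodd)
  · have : NeZero ℓ := ⟨by omega⟩
    have hodd := Nat.odd_iff.1 hodd
    refine ⟨fun σ hσ h => D.pow_le_ncard h3 hodd hk hσ h, fun m => ?_, fun σ hσ =>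
      D.sum_weight_witnessSyndrome_le h3 hodd hσ hk le_rfl⟩
    -- The factor counting the level-one vertices only weakens the bound; it has to be positive, and
    -- the centre over a corner of the seed shows that it is.
    refine (D.ncard_witness_le (2 * k) m).trans (Nat.le_mul_of_pos_left _ (Fintype.card_pos_iff.2 ?_))
    obtain ⟨p, -⟩ := Tanner.seed_nice.exists_center (ℓ := ℓ) true ((0, 0) : Fin 3 × Fin 3)
    exact ⟨p⟩
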